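/- Let $k$ be a field of characteristic $p>0$ and let $G=\prod_{i=1}^r \mathbb Z/m_i\mathbb Z$ with $m_i=p^{p_i}$ and $p_i\ge 1$. Let $\hat P$ be a complete projective resolution of the trivial $kG$-module $k$ (such resolutions exist), let $A=\mathrm{Hom}^*_{kG}(\hat P,\hat P)$ be its endomorphism dg-algebra, and let $\hat H^*(G,k)=H^*(A)$ be the Tate cohomology algebra. For a $kG$-module $M$ the Tate cohomology $\hat H^*(G,M)=H^*(\mathrm{Hom}_{kG}(\hat P,M))$ is a graded right $\hat H^*(G,k)$-module; graded modules isomorphic to one of this form are called realisable. The canonical class $\gamma_G\in HH^{3,-1}\hat H^*(G,k)$ is the Hochschild cohomology class of the cocycle $m$ obtained as follows: choose a $k$-linear map $f_1:H^*A\to A$ of degree $0$ selecting a representing cocycle of every class, and a $k$-bilinear map $f_2:H^*A\otimes H^*A\to A$ of degree $-1$ with $df_2(x,y)=f_1(xy)-f_1(x)f_1(y)$, and let $m(a,b,c)$ be the class of $$f_2(a,b)f_1(c)-f_2(a,bc)+f_2(ab,c)-(-1)^{|a|}f_1(a)f_2(b,c).$$ Then the following hold, for every choice of $\hat P$, $f_1$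 and $f_2$. (a) If $r=1$ or $r\ge 3$, and $m_i\neq 3$ for all $i$, then $\gamma_G=0$, and every graded $\hat H^*(G,k)$-module is a direct summand of a realisable one. (b) If $r=2$ or $m_i=3$ for some $i$, then $\gamma_G\neq 0$, and there is a graded $\hat H^*(G,k)$-module which is not a direct summand of a realisable one. Explicitly: if $r=2$, then for each $i$ the module $\hat H^*(G,k)/v_i\hat H^*(G,k)$ is not a direct summand of a realisable module, where $v_i\in\hat H^2(G,k)$ is the inflation along $G\to\mathbb Z/m_i$ of the class of the extension of $\mathbb Z/m_i$ by $k$ which is pushed out from $0\to\mathbb Z\to\mathbb Z\to\mathbb Z/m_i\to 0$; and if $m_i=3$, then $\hat H^*(G,k)/u_i\hat H^*(G,k)$ is not a direct summand of a realisable module, where $u_i\in\hat H^1(G,k)$ is the class of the homomorphism $G\to\mathbb Z/m_i\to k$. -/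

import Mathlib

open CategoryTheory CochainComplex.HomComplex

universe u v w

/-! ### Graded algebras, graded modules, Hochschild cohomology -/

/-- A `ℤ`-graded associative unital algebra over `k`. Products are indexed by a proof of
`i + j = l`, so that no transport between degrees is needed. -/
structure GradedAlg (k : Type u) [Field k] where
  carrier : ℤ → Type v
  [addCommGroup : ∀ n, AddCommGroup (carrier n)]
  [module : ∀ n, Module k (carrier n)]
  mul : ∀ {i j l : ℤ}, i + j = l → (carrier i →ₗ[k] carrier j →ₗ[k] carrier l)
  one : carrier 0
  one_mul : ∀ {i : ℤ} (a : carrier i), mul (zero_add i) one a = a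
  mul_one : ∀ {i : ℤ} (a : carrier i), mul (add_zero i) a one = a
  mul_assoc : ∀ {i j l ij jl n : ℤ} (hij : i + j = ij) (hjl : j + l = jl) (h : ij + l = n)
    (h' : i + jl = n) (a : carrier i) (b : carrier j) (c : carrier l),
    mul h (mul hij a b) c = mul h' a (mul hjl b c)

attribute [instance] GradedAlg.addCommGroup GradedAlg.module

/-- A `ℤ`-graded right module over a graded algebra. -/
structure GradedMod {k : Type u} [Field k] (Λ : GradedAlg.{u, v} k) where
  carrier : ℤ → Type v
  [addCommGroup : ∀ n, AddCommGroup (carrier n)]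
  [module : ∀ n, Module k (carrier n)]
  act : ∀ {i j l : ℤ}, i + j = l → (carrier i →ₗ[k] Λ.carrier j →ₗ[k] carrier l)
  act_one : ∀ {i : ℤ} (x : carrier i), act (add_zero i) x Λ.one = x
  act_mul : ∀ {i j l ij jl n : ℤ} (hij : i + j = ij) (hjl : j + l = jl) (h : ij + l = n)
    (h' : i + jl = n) (x : carrier i) (b : Λ.carrier j) (c : Λ.carrier l),
    act h (act hij x b) c = act h' x (Λ.mul hjl b c)

attribute [instance] GradedMod.addCommGroup GradedMod.module

namespace GradedMod

variable {k : Type u} [Field k] {Λ : GradedAlg.{u, v} k}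

/-- A morphism (of degree `0`) of graded modules. -/
structure Hom (X Y : GradedMod Λ) where
  map : ∀ n : ℤ, X.carrier n →ₗ[k] Y.carrier n
  map_act : ∀ {i j l : ℤ} (h : i + j = l) (x : X.carrier i) (a : Λ.carrier j),
    map l (X.act h x a) = Y.act h (map i x) a

/-- `X` is isomorphic to a direct summand of `Y`. -/
def IsDirectSummand (X Y : GradedMod Λ) : Prop :=
  ∃ (ι : Hom X Y) (π : Hom Y X), ∀ (n : ℤ) (x : X.carrier n), π.map n (ι.map n x) = x

/-- The graded right module `Λ / ζ Λ`, for a homogeneous element `ζ`. -/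
def cyclicQuotient (Λ : GradedAlg.{u, v} k) {d : ℤ} (ζ : Λ.carrier d) : GradedMod Λ where
  carrier n := Λ.carrier n ⧸ LinearMap.range (Λ.mul (add_sub_cancel d n) ζ)
  act {i j l} h := Submodule.liftQ _
    ((LinearMap.llcomp k _ _ _ (Submodule.mkQ _)).comp (Λ.mul h)) (by
      rintro _ ⟨a, rfl⟩
      rw [LinearMap.mem_ker]
      ext b
      simp only [LinearMap.comp_apply, LinearMap.llcomp_apply, Submodule.mkQ_apply,
        LinearMap.zero_apply, Submodule.Quotient.mk_eq_zero]
      exact ⟨Λ.mul (by omega) a b,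
        (Λ.mul_assoc (add_sub_cancel d i) (by omega) h (add_sub_cancel d l) ζ a b).symm⟩)
  act_one {i} x := by
    obtain ⟨x, rfl⟩ := Submodule.mkQ_surjective _ x
    simp [Λ.mul_one]
  act_mul {i j l ij jl n} hij hjl h h' x b c := by
    obtain ⟨x, rfl⟩ := Submodule.mkQ_surjective _ x
    simp [Λ.mul_assoc hij hjl h h']

end GradedMod

namespace Hochschild

variable {k : Type u} [Field k] (Λ : GradedAlg.{u, v} k) (t : ℤ)

/-- Source degrees `i`, `j` and target degree `n = i + j + t` of a `2`-cochain. -/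
structure Degrees2 (t : ℤ) where
  i : ℤ
  j : ℤ
  n : ℤ
  h : i + j + t = n

/-- Source degrees `i`, `j`, `l` and target degree `n = i + j + l + t` of a `3`-cochain. -/
structure Degrees3 (t : ℤ) where
  i : ℤ
  j : ℤ
  l : ℤ
  n : ℤ
  h : i + j + l + t = n

/-- `C^{2,t}(Λ, Λ)`: the `k`-linear maps `Λ ⊗ Λ → Λ` of degree `t`. -/
def Cochain2 : Type v :=
  ∀ T : Degrees2 t, Λ.carrier T.i →ₗ[k] Λ.carrier T.j →ₗ[k] Λ.carrier T.n

/-- `C^{3,t}(Λ, Λ)`: the `k`-linear maps `Λ ⊗ Λ ⊗ Λ → Λ` of degree `t`. -/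
def Cochain3 : Type v :=
  ∀ T : Degrees3 t,
    Λ.carrier T.i →ₗ[k] Λ.carrier T.j →ₗ[k] Λ.carrier T.l →ₗ[k] Λ.carrier T.n

instance : AddCommGroup (Cochain2 Λ t) :=
  inferInstanceAs (AddCommGroup (∀ T : Degrees2 t,
    Λ.carrier T.i →ₗ[k] Λ.carrier T.j →ₗ[k] Λ.carrier T.n))

instance : Module k (Cochain2 Λ t) :=
  inferInstanceAs (Module k (∀ T : Degrees2 t,
    Λ.carrier T.i →ₗ[k] Λ.carrier T.j →ₗ[k] Λ.carrier T.n))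

instance : AddCommGroup (Cochain3 Λ t) :=
  inferInstanceAs (AddCommGroup (∀ T : Degrees3 t,
    Λ.carrier T.i →ₗ[k] Λ.carrier T.j →ₗ[k] Λ.carrier T.l →ₗ[k] Λ.carrier T.n))

instance : Module k (Cochain3 Λ t) :=
  inferInstanceAs (Module k (∀ T : Degrees3 t,
    Λ.carrier T.i →ₗ[k] Λ.carrier T.j →ₗ[k] Λ.carrier T.l →ₗ[k] Λ.carrier T.n))

variable {Λ t}

theorem Cochain2.zero_apply (T : Degrees2 t) : (0 : Cochain2 Λ t) T = 0 := rfl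
theorem Cochain2.add_apply (φ ψ : Cochain2 Λ t) (T : Degrees2 t) : (φ + ψ) T = φ T + ψ T := rfl
theorem Cochain2.smul_apply (r : k) (φ : Cochain2 Λ t) (T : Degrees2 t) :
    (r • φ) T = r • φ T := rfl
theorem Cochain3.zero_apply (T : Degrees3 t) : (0 : Cochain3 Λ t) T = 0 := rfl
theorem Cochain3.add_apply (φ ψ : Cochain3 Λ t) (T : Degrees3 t) : (φ + ψ) T = φ T + ψ T := rfl
theorem Cochain3.smul_apply (r : k) (φ : Cochain3 Λ t) (T : Degrees3 t) :
    (r • φ) T = r • φ T := rfl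

/-- The value `(δψ)(a, b, c)` of the Hochschild differential of a `2`-cochain `ψ`. -/
def d2 (ψ : Cochain2 Λ t) {i j l n : ℤ} (h : i + j + l + t = n)
    (a : Λ.carrier i) (b : Λ.carrier j) (c : Λ.carrier l) : Λ.carrier n :=
  (t * i).negOnePow • Λ.mul (show i + (j + l + t) = n by omega) a (ψ ⟨j, l, j + l + t, rfl⟩ b c)
    - ψ ⟨i + j, l, n, h⟩ (Λ.mul rfl a b) c
    + ψ ⟨i, j + l, n, by omega⟩ a (Λ.mul rfl b c)
    - Λ.mul (show i + j + t + l = n by omega) (ψ ⟨i, j, i + j + t, rfl⟩ a b) c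

/-- The value `(δφ)(a, b, c, d)` of the Hochschild differential of a `3`-cochain `φ`. -/
def d3 (φ : Cochain3 Λ t) {i j l p n : ℤ} (h : i + j + l + p + t = n)
    (a : Λ.carrier i) (b : Λ.carrier j) (c : Λ.carrier l) (d : Λ.carrier p) : Λ.carrier n :=
  (t * i).negOnePow • Λ.mul (show i + (j + l + p + t) = n by omega) a (φ ⟨j, l, p, j + l + p + t, rfl⟩ b c d)
    - φ ⟨i + j, l, p, n, h⟩ (Λ.mul rfl a b) c d
    + φ ⟨i, j + l, p, n, by omega⟩ a (Λ.mul rfl b c) d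
    - φ ⟨i, j, l + p, n, by omega⟩ a b (Λ.mul rfl c d)
    + Λ.mul (show i + j + l + t + p = n by omega) (φ ⟨i, j, l, i + j + l + t, rfl⟩ a b c) d

variable (Λ t)

/-- The Hochschild `3`-cocycles of internal degree `t`. -/
def cocycles : Submodule k (Cochain3 Λ t) where
  carrier := {φ | ∀ {i j l p n : ℤ} (h : i + j + l + p + t = n) (a : Λ.carrier i)
    (b : Λ.carrier j) (c : Λ.carrier l) (d : Λ.carrier p), d3 φ h a b c d = 0}
  zero_mem' := by intros i j l p n h a b c d; simp [d3, Cochain3.zero_apply]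
  add_mem' := by
    intro φ ψ hφ hψ i j l p n h a b c d
    have h1 := hφ h a b c d
    have h2 := hψ h a b c d
    have : d3 (φ + ψ) h a b c d = d3 φ h a b c d + d3 ψ h a b c d := by
      simp only [d3, Cochain3.add_apply, LinearMap.add_apply, map_add, smul_add]
      abel
    rw [this, h1, h2, add_zero]
  smul_mem' := by
    intro r φ hφ i j l p n h a b c d
    have h1 := hφ h a b c d
    have : d3 (r • φ) h a b c d = r • d3 φ h a b c d := by
      simp only [d3, Cochain3.smul_apply, LinearMap.smul_apply, map_smul, smul_add, smul_sub]
      rw [smul_comm r]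
    rw [this, h1, smul_zero]

/-- The Hochschild `3`-cochains of internal degree `t` that are of the form `δψ`. -/
def coboundaries : Submodule k (Cochain3 Λ t) where
  carrier := {φ | ∃ ψ : Cochain2 Λ t, ∀ {i j l n : ℤ} (h : i + j + l + t = n) (a : Λ.carrier i)
    (b : Λ.carrier j) (c : Λ.carrier l), φ ⟨i, j, l, n, h⟩ a b c = d2 ψ h a b c}
  zero_mem' := ⟨0, by intros; simp [d2, Cochain2.zero_apply, Cochain3.zero_apply]⟩
  add_mem' := by
    rintro φ φ' ⟨ψ, hψ⟩ ⟨ψ', hψ'⟩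
    refine ⟨ψ + ψ', fun {i j l n} h a b c => ?_⟩
    simp only [Cochain2.add_apply, Cochain3.add_apply, LinearMap.add_apply, hψ, hψ', d2, map_add, smul_add]
    abel
  smul_mem' := by
    rintro r φ ⟨ψ, hψ⟩
    refine ⟨r • ψ, fun {i j l n} h a b c => ?_⟩
    simp only [Cochain2.smul_apply, Cochain3.smul_apply, LinearMap.smul_apply, hψ, d2, map_smul, smul_add, smul_sub]
    rw [smul_comm r]

/-- The Hochschild cohomology group `HH^{3,t}(Λ)`. -/
abbrev HH3 : Type v := cocycles Λ t ⧸ (coboundaries Λ t).comap (cocycles Λ t).subtype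

end Hochschild

/-! ### The endomorphism dg-algebra of a complex and its cohomology -/

namespace HomCohomology

variable (k : Type u) [Field k] {C : Type w} [Category.{v} C] [Preadditive C] [Linear k C]

section

variable (K L M N : CochainComplex C ℤ)

/-- The coboundaries of degree `n` in the complex of homomorphisms from `K` to `L`. -/
def boundaries (n : ℤ) : Submodule k (Cocycle K L n) where
  carrier := {z | ∃ y : Cochain K L (n - 1), δ (n - 1) n y = (z : Cochain K L n)}
  zero_mem' := ⟨0, by simp⟩
  add_mem' := by
    rintro z z' ⟨y, hy⟩ ⟨y', hy'⟩
    exact ⟨y + y', by simp [hy, hy']⟩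
  smul_mem' := by
    rintro r z ⟨y, hy⟩
    exact ⟨r • y, by simp [hy]⟩

/-- `H^n` of the complex of homomorphisms from `K` to `L`. -/
abbrev H (n : ℤ) : Type v := Cocycle K L n ⧸ boundaries k K L n

variable {K L M N}

/-- The composition product `f · g` of homogeneous maps `f : L → M` and `g : K → L`
(first `g`, then `f`). -/
def prod {m n l : ℤ} (h : m + n = l) : Cochain L M m →ₗ[k] Cochain K L n →ₗ[k] Cochain K M l :=
  LinearMap.mk₂ k (fun f g => g.comp f (by omega))
    (fun _ _ _ => Cochain.comp_add _ _ _ _) (fun _ _ _ => Cochain.comp_smul _ _ _ _)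
    (fun _ _ _ => Cochain.add_comp _ _ _ _) (fun _ _ _ => Cochain.smul_comp _ _ _ _)

theorem prod_apply {m n l : ℤ} (h : m + n = l) (f : Cochain L M m) (g : Cochain K L n) :
    prod k h f g = g.comp f (by omega) := rfl

/-- The Leibniz rule. -/
theorem δ_prod {m n l m' n' l' : ℤ} (h : m + n = l) (hm : m + 1 = m') (hn : n + 1 = n')
    (hl : l + 1 = l') (f : Cochain L M m) (g : Cochain K L n) :
    δ l l' (prod k h f g) = prod k (by omega) (δ m m' f) g
      + m.negOnePow • prod k (by omega) f (δ n n' g) :=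
  δ_comp g f (by omega) n' m' l' hl hn hm

theorem prod_assoc {m n p mn np q : ℤ} (hmn : m + n = mn) (hnp : n + p = np) (h : mn + p = q)
    (h' : m + np = q) (f : Cochain M N m) (g : Cochain L M n) (e : Cochain K L p) :
    prod k h (prod k hmn f g) e = prod k h' f (prod k hnp g e) := by
  simp only [prod_apply]
  exact (Cochain.comp_assoc _ _ _ _ _ (by omega)).symm

/-- The product of cocycles. -/
def cocycleProd {m n l : ℤ} (h : m + n = l) :
    Cocycle L M m →ₗ[k] Cocycle K L n →ₗ[k] Cocycle K M l :=
  LinearMap.mk₂ k (fun f g => Cocycle.mk (prod k h (f : Cochain L M m) (g : Cochain K L n))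
      (l + 1) rfl (by rw [δ_prod k h rfl rfl rfl]; simp))
    (fun _ _ _ => by ext1; simp) (fun _ _ _ => by ext1; simp)
    (fun _ _ _ => by ext1; simp) (fun _ _ _ => by ext1; simp)

theorem coe_cocycleProd {m n l : ℤ} (h : m + n = l) (f : Cocycle L M m) (g : Cocycle K L n) :
    (cocycleProd k h f g : Cochain K M l) = prod k h (f : Cochain L M m) (g : Cochain K L n) := rfl

theorem mk_eq_mk_iff {n : ℤ} (x y : Cocycle K L n) :
    (Submodule.Quotient.mk x : H k K L n) = Submodule.Quotient.mk y ↔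
      ∃ z : Cochain K L (n - 1), δ (n - 1) n z = (x : Cochain K L n) - (y : Cochain K L n) := by
  rw [Submodule.Quotient.eq]
  exact Iff.rfl

/-- The product on cohomology, induced by composition of homogeneous maps. -/
def cohProd {m n l : ℤ} (h : m + n = l) : H k L M m →ₗ[k] H k K L n →ₗ[k] H k K M l :=
  LinearMap.flip <| Submodule.liftQ _ (LinearMap.flip <| Submodule.liftQ _
    ((LinearMap.llcomp k _ _ _ (Submodule.mkQ _)).comp (cocycleProd k h)) (by
      rintro f ⟨y, hy⟩
      rw [LinearMap.mem_ker]
      ext1 g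
      simp only [LinearMap.comp_apply, LinearMap.llcomp_apply, Submodule.mkQ_apply,
        LinearMap.zero_apply, Submodule.Quotient.mk_eq_zero]
      refine ⟨prod k (show m - 1 + n = l - 1 by omega) y (g : Cochain K L n), ?_⟩
      rw [δ_prod k _ (sub_add_cancel m 1) rfl (sub_add_cancel l 1), hy, coe_cocycleProd]
      simp)) (by
      rintro g ⟨y, hy⟩
      rw [LinearMap.mem_ker]
      ext f
      simp only [LinearMap.comp_apply, LinearMap.flip_apply, Submodule.mkQ_apply,
        Submodule.liftQ_apply, LinearMap.llcomp_apply,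
        LinearMap.zero_apply, Submodule.Quotient.mk_eq_zero]
      refine ⟨m.negOnePow • prod k (show m + (n - 1) = l - 1 by omega) (f : Cochain L M m) y, ?_⟩
      rw [δ_units_smul, δ_prod k _ rfl (sub_add_cancel n 1) (sub_add_cancel l 1), hy,
        coe_cocycleProd]
      simp [smul_smul])

@[simp] theorem cohProd_mk {m n l : ℤ} (h : m + n = l) (f : Cocycle L M m) (g : Cocycle K L n) :
    cohProd k h (Submodule.Quotient.mk f) (Submodule.Quotient.mk g)
      = Submodule.Quotient.mk (cocycleProd k h f g) := rfl

theorem cohProd_assoc {m n p mn np q : ℤ} (hmn : m + n = mn) (hnp : n + p = np) (h : mn + p = q)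
    (h' : m + np = q) (f : H k M N m) (g : H k L M n) (e : H k K L p) :
    cohProd k h (cohProd k hmn f g) e = cohProd k h' f (cohProd k hnp g e) := by
  obtain ⟨f, rfl⟩ := Submodule.Quotient.mk_surjective _ f
  obtain ⟨g, rfl⟩ := Submodule.Quotient.mk_surjective _ g
  obtain ⟨e, rfl⟩ := Submodule.Quotient.mk_surjective _ e
  simp only [cohProd_mk]
  congr 1
  ext1
  simp only [coe_cocycleProd]
  exact prod_assoc k hmn hnp h h' _ _ _

theorem cohProd_id {m : ℤ} (f : H k L M m) :
    cohProd k (add_zero m) f (Submodule.Quotient.mk (Cocycle.ofHom (𝟙 L))) = f := by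
  obtain ⟨f, rfl⟩ := Submodule.Quotient.mk_surjective _ f
  rw [cohProd_mk]
  congr 1
  ext1
  rw [coe_cocycleProd, prod_apply]
  simp

theorem id_cohProd {m : ℤ} (f : H k L M m) :
    cohProd k (zero_add m) (Submodule.Quotient.mk (Cocycle.ofHom (𝟙 M))) f = f := by
  obtain ⟨f, rfl⟩ := Submodule.Quotient.mk_surjective _ f
  rw [cohProd_mk]
  congr 1
  ext1
  rw [coe_cocycleProd, prod_apply]
  simp

end

/-- The graded algebra `H^*(A)`, where `A = Hom^*(K, K)` is the endomorphism dg-algebra of `K`. -/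
def endAlg (K : CochainComplex C ℤ) : GradedAlg.{u, v} k where
  carrier n := H k K K n
  mul h := cohProd k h
  one := Submodule.Quotient.mk (Cocycle.ofHom (𝟙 K))
  one_mul := id_cohProd k
  mul_one := cohProd_id k
  mul_assoc := cohProd_assoc k

/-- The graded right `H^*(Hom^*(K, K))`-module `H^*(Hom^*(K, L))`. -/
def homMod (K L : CochainComplex C ℤ) : GradedMod (endAlg k K) where
  carrier n := H k K L n
  act h := cohProd k h
  act_one := cohProd_id k
  act_mul := cohProd_assoc k

/-- The choices entering the construction of the canonical class of the endomorphism dg-algebra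
`A` of `K`: a `k`-linear choice `f₁` of representing cocycles of the classes in `H^*(A)`, and
a bilinear choice `f₂`, of degree `-1`, of cochains with
`d f₂(x, y) = f₁(x y) - f₁(x) f₁(y)`. -/
structure Choice (K : CochainComplex C ℤ) where
  f₁ : ∀ n : ℤ, (endAlg k K).carrier n →ₗ[k] Cocycle K K n
  mk_f₁ : ∀ (n : ℤ) (x : (endAlg k K).carrier n),
    (Submodule.Quotient.mk (f₁ n x) : H k K K n) = x
  f₂ : ∀ i j l : ℤ, i + j + (-1) = l →
    ((endAlg k K).carrier i →ₗ[k] (endAlg k K).carrier j →ₗ[k] Cochain K K l)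
  δ_f₂ : ∀ (i j l n : ℤ) (h : i + j + (-1) = l) (hn : i + j = n)
    (x : (endAlg k K).carrier i) (y : (endAlg k K).carrier j),
    δ l n (f₂ i j l h x y) = (f₁ n ((endAlg k K).mul hn x y) : Cochain K K n)
      - prod k hn (f₁ i x : Cochain K K i) (f₁ j y : Cochain K K j)

namespace Choice

variable {k} {K : CochainComplex C ℤ} (s : Choice k K)

/-- The cochain
`f₂(a, b) f₁(c) - f₂(a, b c) + f₂(a b, c) - (-1)^|a| f₁(a) f₂(b, c)`. -/
def masseyCochain {i j l n : ℤ} (h : i + j + l + (-1) = n) (a : (endAlg k K).carrier i)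
    (b : (endAlg k K).carrier j) (c : (endAlg k K).carrier l) : Cochain K K n :=
  prod k (show i + j + (-1) + l = n by omega) (s.f₂ i j (i + j + (-1)) rfl a b)
      (s.f₁ l c : Cochain K K l)
    - s.f₂ i (j + l) n (by omega) a ((endAlg k K).mul rfl b c)
    + s.f₂ (i + j) l n h ((endAlg k K).mul rfl a b) c
    - i.negOnePow • prod k (show i + (j + l + (-1)) = n by omega) (s.f₁ i a : Cochain K K i)
      (s.f₂ j l (j + l + (-1)) rfl b c)

theorem δ_masseyCochain {i j l n : ℤ} (h : i + j + l + (-1) = n) (a : (endAlg k K).carrier i)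
    (b : (endAlg k K).carrier j) (c : (endAlg k K).carrier l) :
    δ n (n + 1) (s.masseyCochain h a b c) = 0 := by
  have hassoc : (endAlg k K).mul (show i + (j + l) = n + 1 by omega) a
      ((endAlg k K).mul rfl b c) =
      (endAlg k K).mul (show i + j + l = n + 1 by omega) ((endAlg k K).mul rfl a b) c :=
    ((endAlg k K).mul_assoc _ _ _ _ a b c).symm
  simp only [masseyCochain, δ_add, δ_sub, δ_units_smul]
  rw [δ_prod k _ (show i + j + (-1) + 1 = i + j by omega) rfl rfl,
    δ_prod k _ rfl (show j + l + (-1) + 1 = j + l by omega) rfl,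
    s.δ_f₂ _ _ _ _ _ rfl, s.δ_f₂ _ _ _ _ _ (show i + (j + l) = n + 1 by omega),
    s.δ_f₂ _ _ _ _ _ (show i + j + l = n + 1 by omega), s.δ_f₂ _ _ _ _ _ rfl, hassoc]
  simp only [Cocycle.δ_eq_zero, map_zero, smul_zero, LinearMap.zero_apply, zero_add, add_zero,
    map_sub, LinearMap.sub_apply, smul_smul, Int.units_mul_self, one_smul, smul_sub]
  rw [prod_assoc k rfl rfl (show i + j + l = n + 1 by omega) (show i + (j + l) = n + 1 by omega)]
  abel

/-- The trilinear map sending `a, b, c` to the cocycle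
`f₂(a, b) f₁(c) - f₂(a, b c) + f₂(a b, c) - (-1)^|a| f₁(a) f₂(b, c)`. -/
def masseyCocycle {i j l n : ℤ} (h : i + j + l + (-1) = n) :
    (endAlg k K).carrier i →ₗ[k] (endAlg k K).carrier j →ₗ[k] (endAlg k K).carrier l →ₗ[k]
      Cocycle K K n :=
  LinearMap.mk₂ k
    (fun a b =>
      { toFun := fun c => Cocycle.mk (s.masseyCochain h a b c) (n + 1) rfl
          (s.δ_masseyCochain h a b c)
        map_add' := fun _ _ => by
          ext1
          simp only [masseyCochain, Cocycle.mk_coe, Cocycle.coe_add, map_add, smul_add]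
          abel
        map_smul' := fun r _ => by
          ext1
          simp only [masseyCochain, Cocycle.mk_coe, Cocycle.coe_smul, map_smul, RingHom.id_apply, smul_sub, smul_add]
          rw [smul_comm r] })
    (fun _ _ _ => by
      refine LinearMap.ext fun c => ?_
      ext1
      simp only [masseyCochain, LinearMap.coe_mk, AddHom.coe_mk, Cocycle.mk_coe, Cocycle.coe_add,
        map_add, LinearMap.add_apply, smul_add]
      abel)
    (fun r _ _ => by
      refine LinearMap.ext fun c => ?_
      ext1
      simp only [masseyCochain, LinearMap.coe_mk, AddHom.coe_mk, Cocycle.mk_coe, Cocycle.coe_smul,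
        map_smul, LinearMap.smul_apply, smul_sub, smul_add]
      rw [smul_comm r])
    (fun _ _ _ => by
      refine LinearMap.ext fun c => ?_
      ext1
      simp only [masseyCochain, LinearMap.coe_mk, AddHom.coe_mk, Cocycle.mk_coe, Cocycle.coe_add,
        map_add, LinearMap.add_apply, smul_add]
      abel)
    (fun r _ _ => by
      refine LinearMap.ext fun c => ?_
      ext1
      simp only [masseyCochain, LinearMap.coe_mk, AddHom.coe_mk, Cocycle.mk_coe, Cocycle.coe_smul,
        map_smul, LinearMap.smul_apply, smul_sub, smul_add]
      rw [smul_comm r])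

theorem coe_masseyCocycle {i j l n : ℤ} (h : i + j + l + (-1) = n) (a : (endAlg k K).carrier i)
    (b : (endAlg k K).carrier j) (c : (endAlg k K).carrier l) :
    (s.masseyCocycle h a b c : Cochain K K n) = s.masseyCochain h a b c := rfl

/-- The map `m : H^*(A) ⊗ H^*(A) ⊗ H^*(A) → H^*(A)` of degree `-1` sending `a, b, c` to the
cohomology class of `f₂(a, b) f₁(c) - f₂(a, b c) + f₂(a b, c) - (-1)^|a| f₁(a) f₂(b, c)`. -/
def m : Hochschild.Cochain3 (endAlg k K) (-1) := fun T =>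
  (LinearMap.llcomp k _ _ _ (LinearMap.llcomp k _ _ _ (Submodule.mkQ _))).comp
    (s.masseyCocycle T.h)

theorem m_apply {i j l n : ℤ} (h : i + j + l + (-1) = n) (a : (endAlg k K).carrier i)
    (b : (endAlg k K).carrier j) (c : (endAlg k K).carrier l) :
    s.m ⟨i, j, l, n, h⟩ a b c = (Submodule.Quotient.mk (s.masseyCocycle h a b c) : H k K K n) :=
  rfl

theorem prod_units_smul {L M : CochainComplex C ℤ} {m n l : ℤ} (h : m + n = l) (ε : ℤˣ)
    (f : Cochain L M m) (g : Cochain K L n) : prod k h f (ε • g) = ε • prod k h f g := by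
  rcases Int.units_eq_one_or ε with rfl | rfl <;> simp

theorem units_smul_prod {L M : CochainComplex C ℤ} {m n l : ℤ} (h : m + n = l) (ε : ℤˣ)
    (f : Cochain L M m) (g : Cochain K L n) : prod k h (ε • f) g = ε • prod k h f g := by
  rcases Int.units_eq_one_or ε with rfl | rfl <;> simp

theorem mul_mk {i j n : ℤ} (h : i + j = n) (a : (endAlg k K).carrier i) (z : Cocycle K K j) :
    (endAlg k K).mul h a (Submodule.Quotient.mk z : H k K K j) =
      (Submodule.Quotient.mk (cocycleProd k h (s.f₁ i a) z) : H k K K n) := by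
  conv_lhs => rw [← s.mk_f₁ i a]
  rfl

theorem mk_mul {i j n : ℤ} (h : i + j = n) (z : Cocycle K K i) (a : (endAlg k K).carrier j) :
    (endAlg k K).mul h (Submodule.Quotient.mk z : H k K K i) a =
      (Submodule.Quotient.mk (cocycleProd k h z (s.f₁ j a)) : H k K K n) := by
  conv_lhs => rw [← s.mk_f₁ j a]
  rfl

/-- The map `m` is a Hochschild cocycle. -/
theorem m_mem_cocycles : s.m ∈ Hochschild.cocycles (endAlg k K) (-1) := by
  intro i j l p n h a b c d
  have key : Hochschild.d3 s.m h a b c d = (Submodule.Quotient.mk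
      ((-1 * i).negOnePow • cocycleProd k (show i + (j + l + p + (-1)) = n by omega) (s.f₁ i a)
          (s.masseyCocycle rfl b c d)
        - s.masseyCocycle h ((endAlg k K).mul rfl a b) c d
        + s.masseyCocycle (show i + (j + l) + p + (-1) = n by omega) a
          ((endAlg k K).mul rfl b c) d
        - s.masseyCocycle (show i + j + (l + p) + (-1) = n by omega) a b
          ((endAlg k K).mul rfl c d)
        + cocycleProd k (show i + j + l + (-1) + p = n by omega) (s.masseyCocycle rfl a b c)
          (s.f₁ p d)) : H k K K n) := by
    rw [Hochschild.d3, m_apply, m_apply, m_apply, m_apply, m_apply, mul_mk, mk_mul]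
    rfl
  refine key.trans ((Submodule.Quotient.mk_eq_zero _).2 ⟨(i + j).negOnePow • prod k (show i + j + (-1) + (l + p + (-1)) = n - 1 by omega)
    (s.f₂ i j _ rfl a b) (s.f₂ l p _ rfl c d), ?_⟩)
  have h1 : (-1 * i).negOnePow = i.negOnePow := by
    rw [neg_one_mul, Int.negOnePow_neg]
  rw [δ_units_smul, δ_prod k _ (show i + j + (-1) + 1 = i + j by omega)
    (show l + p + (-1) + 1 = l + p by omega) (sub_add_cancel n 1), s.δ_f₂ _ _ _ _ _ rfl,
    s.δ_f₂ _ _ _ _ _ rfl, h1]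
  have e1 : ∀ (q : ℤ) (hq : i + (j + l) = q) (h' : q + p + (-1) = n),
      s.f₂ q p n h' ((endAlg k K).mul hq a ((endAlg k K).mul rfl b c)) d =
        s.f₂ (i + j + l) p n h ((endAlg k K).mul rfl ((endAlg k K).mul rfl a b) c) d := by
    intro q hq h'
    obtain rfl : q = i + j + l := by omega
    rw [(endAlg k K).mul_assoc rfl rfl rfl hq]
  have e2 : ∀ (q : ℤ) (hq : j + (l + p) = q) (h' : i + q + (-1) = n),
      s.f₂ i q n h' a ((endAlg k K).mul hq b ((endAlg k K).mul rfl c d)) =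
        s.f₂ i (j + l + p) n (by omega) a
          ((endAlg k K).mul rfl ((endAlg k K).mul rfl b c) d) := by
    intro q hq h'
    obtain rfl : q = j + l + p := by omega
    rw [(endAlg k K).mul_assoc rfl rfl rfl hq]
  have e3 : ∀ (q : ℤ) (hq : j + (l + p) + (-1) = q) (h' : i + q = n),
      prod k h' (s.f₁ i a : Cochain K K i) (s.f₂ j (l + p) q hq b ((endAlg k K).mul rfl c d)) =
        prod k (show i + (j + l + p + (-1)) = n by omega) (s.f₁ i a : Cochain K K i)
          (s.f₂ j (l + p) (j + l + p + (-1)) (by omega) b ((endAlg k K).mul rfl c d)) := by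
    intro q hq h'
    obtain rfl : q = j + l + p + (-1) := by omega
    rfl
  have e4 : ∀ (q : ℤ) (hq : i + (j + l) + (-1) = q) (h' : q + p = n),
      prod k h' (s.f₂ i (j + l) q hq a ((endAlg k K).mul rfl b c)) (s.f₁ p d : Cochain K K p) =
        prod k (show i + j + l + (-1) + p = n by omega)
          (s.f₂ i (j + l) (i + j + l + (-1)) (by omega) a ((endAlg k K).mul rfl b c))
          (s.f₁ p d : Cochain K K p) := by
    intro q hq h'
    obtain rfl : q = i + j + l + (-1) := by omega
    rfl
  have u1 : (i + j).negOnePow * (i + j + (-1)).negOnePow = -1 := by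
    rw [← sub_eq_add_neg, Int.negOnePow_sub, Int.negOnePow_one, ← mul_assoc,
      Int.units_mul_self, one_mul]
  simp only [Cocycle.coe_add, Cocycle.coe_sub, Cocycle.coe_units_smul, coe_cocycleProd,
    coe_masseyCocycle, masseyCochain, map_sub, map_add, LinearMap.sub_apply, LinearMap.add_apply,
    smul_sub, smul_add, prod_units_smul, units_smul_prod, smul_smul, u1, e1, e2, e3, e4,
    ← Int.negOnePow_add]
  rw [prod_assoc k rfl (show j + (l + p + (-1)) = j + l + p + (-1) by omega)
      (show i + j + (l + p + (-1)) = n by omega) (show i + (j + l + p + (-1)) = n by omega),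
    ← prod_assoc k (show i + j + (-1) + l = i + j + l + (-1) by omega) rfl
      (show i + j + l + (-1) + p = n by omega) (show i + j + (-1) + (l + p) = n by omega),
    ← prod_assoc k (show i + (j + l + (-1)) = i + j + l + (-1) by omega)
      (show j + l + (-1) + p = j + l + p + (-1) by omega)
      (show i + j + l + (-1) + p = n by omega) (show i + (j + l + p + (-1)) = n by omega)]
  simp only [Units.neg_smul, one_smul]
  abel

/-- The class in `HH^{3,-1}(H^*(A))` of the Hochschild cocycle `m`: the canonical class of `A`,
computed with the choices `s`. -/
def canonicalClass : Hochschild.HH3 (endAlg k K) (-1) :=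
  Submodule.Quotient.mk ⟨s.m, s.m_mem_cocycles⟩

/-- The choices `f₁` and `f₂` exist. -/
theorem nonempty (k : Type u) [Field k] [Linear k C] (K : CochainComplex C ℤ) :
    Nonempty (Choice k K) := by
  have hex : ∀ n : ℤ, ∃ g : (endAlg k K).carrier n →ₗ[k] Cocycle K K n,
      ((boundaries k K K n).mkQ).comp g = LinearMap.id := fun n =>
    LinearMap.exists_rightInverse_of_surjective _ (Submodule.range_mkQ _)
  choose f₁ hf₁ using hex
  have mk_f₁ : ∀ (n : ℤ) (x : (endAlg k K).carrier n),
      (Submodule.Quotient.mk (f₁ n x) : H k K K n) = x := fun n x =>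
    LinearMap.congr_fun (hf₁ n) x
  have hsec : ∀ l n : ℤ, ∃ g : LinearMap.range (δ_hom k K K l n) →ₗ[k] Cochain K K l,
      (δ_hom k K K l n).rangeRestrict.comp g = LinearMap.id := fun l n =>
    LinearMap.exists_rightInverse_of_surjective _ (LinearMap.range_rangeRestrict _)
  choose sec hsec using hsec
  let F : ∀ i j n : ℤ, i + j = n → ((endAlg k K).carrier i →ₗ[k] (endAlg k K).carrier j →ₗ[k]
      Cocycle K K n) := fun i j n hn =>
    (LinearMap.llcomp k _ _ _ (f₁ n)).comp ((endAlg k K).mul hn)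
      - (cocycleProd k hn).compl₁₂ (f₁ i) (f₁ j)
  have hF : ∀ (i j l n : ℤ) (hn : i + j = n) (hl : l = n - 1) (x : (endAlg k K).carrier i)
      (y : (endAlg k K).carrier j),
      (F i j n hn x y : Cochain K K n) ∈ LinearMap.range (δ_hom k K K l n) := by
    rintro i j l n hn rfl x y
    have : (Submodule.Quotient.mk (F i j n hn x y) : H k K K n) = 0 := by
      have h1 : F i j n hn x y =
        f₁ n ((endAlg k K).mul hn x y) - cocycleProd k hn (f₁ i x) (f₁ j y) := rfl
      rw [h1, Submodule.Quotient.mk_sub]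
      refine sub_eq_zero.2 ((mk_f₁ _ _).trans ?_)
      conv_lhs => rw [← mk_f₁ i x, ← mk_f₁ j y]
      rfl
    exact (Submodule.Quotient.mk_eq_zero (boundaries k K K n)).1 this
  let G : ∀ i j l n : ℤ, (hn : i + j = n) → l = n - 1 →
      ((endAlg k K).carrier i →ₗ[k] (endAlg k K).carrier j →ₗ[k]
        LinearMap.range (δ_hom k K K l n)) := fun i j l n hn hl =>
    LinearMap.mk₂ k (fun x y => ⟨F i j n hn x y, hF i j l n hn hl x y⟩)
      (fun _ _ _ => by ext1; simp) (fun _ _ _ => by ext1; simp)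
      (fun _ _ _ => by ext1; simp) (fun _ _ _ => by ext1; simp)
  refine ⟨⟨f₁, mk_f₁, fun i j l h =>
    (LinearMap.llcomp k _ _ _ (sec l (i + j))).comp (G i j l (i + j) rfl (by omega)), ?_⟩⟩
  rintro i j l n h rfl x y
  have := LinearMap.congr_fun (hsec l (i + j)) (G i j l (i + j) rfl (by omega) x y)
  exact congrArg Subtype.val this

end Choice

end HomCohomology

/-! ### Complete resolutions and Tate cohomology -/

/-- A complete projective resolution of the trivial module `k` over `kG`: an acyclic complex
`⋯ → P₁ → P₀ → P₋₁ → ⋯` of projective modules with an augmentation `ε : P₀ → k` such that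
`P₁ → P₀ → k → 0` is exact. In cohomological indexing, `complex.X (-n)` is `Pₙ`. -/
structure CompleteResolution (k : Type u) [Field k] (G : Type) [Group G] where
  complex : CochainComplex (Rep.{u} k G) ℤ
  projective : ∀ n : ℤ, Projective (complex.X n)
  acyclic : complex.Acyclic
  ε : complex.X 0 ⟶ Rep.trivial k G k
  epi_ε : Epi ε
  d_comp_ε : complex.d (-1) 0 ≫ ε = 0
  exact : (ShortComplex.mk _ _ d_comp_ε).Exact

namespace CompleteResolution

open HomCohomology

variable {k : Type u} [Field k] {G : Type} [Group G] (P : CompleteResolution k G)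

/-- The Tate cohomology algebra `Ĥ^*(G, k)`, as the cohomology algebra of the endomorphism
dg-algebra of a complete resolution. -/
abbrev tateAlg : GradedAlg.{u, u} k := endAlg k P.complex

/-- The Tate cohomology `Ĥ^*(G, M)`, i.e. the cohomology of `Hom_{kG}(P, M)`, as a graded right
`Ĥ^*(G, k)`-module. -/
noncomputable def tateMod (M : Rep.{u} k G) : GradedMod P.tateAlg :=
  homMod k P.complex ((CochainComplex.singleFunctor (Rep.{u} k G) 0).obj M)

/-- `X` is a direct summand of a realisable module, i.e. of `Ĥ^*(G, M)` for some `kG`-module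
`M`. -/
def IsSummandOfRealisable (X : GradedMod P.tateAlg) : Prop :=
  ∃ M : Rep.{u} k G, X.IsDirectSummand (P.tateMod M)

/-- The class `ζ ∈ Ĥ^1(G, k)` is the one represented by the inhomogeneous group `1`-cocycle
`χ : G → k`: there are lifts `e` of `1 ∈ k` to `P₀` and `s g` of `g e - e` to `P₁`
such that the cocycle `P₁ → k` given by `ζ` takes the value `χ g` on `s g`. -/
def RepresentsOne (ζ : P.tateAlg.carrier 1) (χ : G → k) : Prop :=
  ∃ f : Cocycle P.complex P.complex 1,
    (Submodule.Quotient.mk f : H k P.complex P.complex 1) = ζ ∧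
    ∃ (e : P.complex.X 0) (s : G → P.complex.X (-1)),
      P.ε.hom e = (1 : k) ∧
      (∀ g, (P.complex.d (-1) 0).hom (s g) = (P.complex.X 0).ρ g e - e) ∧
      ∀ g, P.ε.hom (((f : Cochain P.complex P.complex 1).v (-1) 0 (by omega)).hom (s g)) = χ g

/-- The class `ζ ∈ Ĥ^2(G, k)` is the one represented by the inhomogeneous group `2`-cocycle
`c : G × G → k`: there are lifts `e` of `1 ∈ k` to `P₀`, `s g` of `g e - e` to `P₁` and
`t g h` of `g s(h) - s(g h) + s(g)` to `P₂` such that the cocycle `P₂ → k` given by `ζ`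
takes the value `c g h` on `t g h`. -/
def RepresentsTwo (ζ : P.tateAlg.carrier 2) (c : G → G → k) : Prop :=
  ∃ f : Cocycle P.complex P.complex 2,
    (Submodule.Quotient.mk f : H k P.complex P.complex 2) = ζ ∧
    ∃ (e : P.complex.X 0) (s : G → P.complex.X (-1)) (t : G → G → P.complex.X (-2)),
      P.ε.hom e = (1 : k) ∧
      (∀ g, (P.complex.d (-1) 0).hom (s g) = (P.complex.X 0).ρ g e - e) ∧
      (∀ g h, (P.complex.d (-2) (-1)).hom (t g h) =
        (P.complex.X (-1)).ρ g (s h) - s (g * h) + s g) ∧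
      ∀ g h,
        P.ε.hom (((f : Cochain P.complex P.complex 2).v (-2) 0 (by omega)).hom (t g h)) = c g h

end CompleteResolution

/-- The group `∏ i, ℤ/m_i`, written multiplicatively. -/
abbrev ProdCyclic {r : ℕ} (m : Fin r → ℕ) : Type := ∀ i : Fin r, Multiplicative (ZMod (m i))

namespace ProdCyclic

variable {r : ℕ} {m : Fin r → ℕ}

/-- The representative in `{0, …, m_i - 1}` of the `i`-th coordinate of `g`. -/
def coord (i : Fin r) (g : ProdCyclic m) : ℕ := (Multiplicative.toAdd (g i)).val

/-- The homomorphism `∏ i, ℤ/m_i → ℤ/m_i → k`, for `m_i = 0` in `k`. -/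
def proj (k : Type u) [Field k] (i : Fin r) (g : ProdCyclic m) : k := (coord i g : k)

/-- The inflation along the `i`-th projection of the `2`-cocycle of `ℤ/m_i` which classifies the
extension of `ℤ/m_i` by `k` obtained from `0 → ℤ → ℤ → ℤ/m_i → 0`: the carry in the addition of
the representatives in `{0, …, m_i - 1}`. -/
def carry (k : Type u) [Field k] (i : Fin r) (g h : ProdCyclic m) : k :=
  if m i ≤ coord i g + coord i h then 1 else 0

end ProdCyclic

/-! ### Extension of cochains between acyclic complexes -/

/-! Tate cohomology of an abelian `p`-group carries a `ℤ^r`-valued weight besides its degree, and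
weights decide whether triple Massey products can be non-zero.

The explicit resolution. With `t_i = g_i - 1` for the standard generators `g_i`, the group algebra
is `k[t_1, …, t_r] / (t_i ^ m_i)`, because `(1 + t) ^ m_i = 1 + t ^ m_i` in characteristic `p`. The
tensor product of the `r` periodic resolutions has the basis `t^a e_n` with all `n_i ≥ 0`; the same
formulas with all `n_i < 0` give a coresolution, and sending `e_0` to its socle element splices the
two into a complete resolution (`TateSpan.resolution`). Let `t_i` have weight `1` in coordinate `i`,
and let `e_n` have weight `m_i q` there if `n_i = 2 q` and `m_i q + 1` if `n_i = 2 q + 1`. The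
differential preserves weights. Wherever a coordinate of the weight is non-zero, that coordinate has
an explicit contraction; only `e_0` and the socle element have weight zero, and the splice matches
them, which gives exactness. For `r > 0` the resolution is minimal, so cohomology has a homogeneous
basis dual to the `e_n`.

Independence of the resolution. Projective representations of a finite group are injective, so
cochains between complete resolutions extend from one degree to all degrees
(`exists_δ_eq_of_δ_v_eq`). Hence complete resolutions are homotopy equivalent; the vanishing of the
canonical class and the property of being a summand of a realisable module are transported by
`Choice.canonicalClass_eq_zero_of_trivial` and `HEquiv.isDirectSummand_of_pull`.

Vanishing. `exists_homogeneous_choice` makes `f₁` and `f₂` compatible with weights. Then `m(a, b,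
c)`, for basis classes, can be non-zero only if some generator in degree `|a| + |b| + |c| - 1` has
the sum of the three weights. If no `m_i` is `3`, equality of weights forces `n` to be additive
(`eq_add_add_of_weight`). The degree of a generator is `∑ n_i` up to a multiple of `r - 1`, so the
defect `1` would be a multiple of `r - 1`; this is impossible for `r = 1` and for `r ≥ 3`
(`wt_ne_add`).

Realisation. If all Massey cochains are coboundaries, a module `X` is presented by a map `φ` between
sums of shifts of the resolution, which realises the bar differential `x ⊗ h ⊗ b ↦ x h ⊗ b - x ⊗ h
b`. In the cohomology of the cone, `X` is the image of the cokernel of `φ`, and the quotient is the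
kernel of `φ`. Correcting by `x ⊗ f₂(h, b)` lifts this kernel to the cone, and the vanishing of
Massey products makes the lift linear over the algebra, so `X` splits off
(`isDirectSummand_mappingCone`). The cone is then replaced by a cokernel of its differential, which
is a module.

Obstruction. If `Λ / ζ Λ` is a summand of some `Ĥ(G, M)` and `x` is the image of `1`, then `x ζ = 0`
and `x ⟨ζ, a, b⟩ = ± ⟨x, ζ, a⟩ b`; the retraction gives `⟨ζ, a, b⟩ ⊆ Λ b + ζ Λ`
(`exists_massey_eq_of_isDirectSummand`). For `m_i = 3` this is violated by `⟨u_i, u_i, u_i⟩`, which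
has coefficient `-1` at the generator `e_2` of the factor. For `r = 2` it is violated by `⟨v_i, a,
v_j⟩` with `a` dual to `e_{-2,-2}`, which is a non-zero multiple of `1`. In both cases weights
exclude the indeterminacy. Combined with realisation, such a module forces the canonical class to be
non-zero. -/

namespace CochainComplex.HomComplex

variable {C : Type w} [Category.{v} C] [Abelian C]

theorem exists_lift_of_exactAt {K L : CochainComplex C ℤ} {p a b c : ℤ} (hab : a + 1 = b)
    (hbc : b + 1 = c) (hL : L.ExactAt b) [Projective (K.X p)] (u : K.X p ⟶ L.X b)
    (hu : u ≫ L.d b c = 0) : ∃ f : K.X p ⟶ L.X a, f ≫ L.d a b = u := by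
  rw [L.exactAt_iff' a b c (by simp; omega) (by simp; omega)] at hL
  exact ⟨hL.liftFromProjective u hu, hL.liftFromProjective_comp u hu⟩

theorem exists_desc_of_exactAt {K L : CochainComplex C ℤ} {q a b c : ℤ} (hab : a + 1 = b)
    (hbc : b + 1 = c) (hK : K.ExactAt b) [Injective (L.X q)] (u : K.X b ⟶ L.X q)
    (hu : K.d a b ≫ u = 0) : ∃ f : K.X c ⟶ L.X q, K.d b c ≫ f = u := by
  rw [K.exactAt_iff' a b c (by simp; omega) (by simp; omega)] at hK
  exact ⟨hK.descToInjective u hu, hK.comp_descToInjective u hu⟩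

variable {K L : CochainComplex C ℤ} {n m : ℤ}

/-- Two cochains agree in source degrees between `a` and `b`. -/
def EqOnIcc (x y : Cochain K L m) (a b : ℤ) : Prop :=
  ∀ (p q : ℤ) (hpq : p + m = q), a ≤ p → p ≤ b → x.v p q hpq = y.v p q hpq

/-- The error `z - δ y` is closed and vanishes at `a`, so its component at `a - 1` composes to zero
with the differential of `L` and lifts by projectivity. The correction lives in source degree `a -
1`, so its coboundary only affects `a - 1` and `a - 2`. -/
theorem exists_extend_left (hnm : n + 1 = m) (hL : L.Acyclic) [∀ i, Projective (K.X i)]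
    (z : Cochain K L m) (hz : δ m (m + 1) z = 0) (y : Cochain K L n) (a b : ℤ) (hab : a ≤ b)
    (hy : EqOnIcc (δ n m y) z a b) :
    ∃ y' : Cochain K L n, EqOnIcc (δ n m y') z (a - 1) b ∧ EqOnIcc y' y a (b + 1) := by
  set x := z - δ n m y with hx
  have hδx : δ m (m + 1) x = 0 := by rw [hx, δ_sub, hz, δ_δ, sub_zero]
  have hxa : x.v a (a + m) rfl = 0 := by
    rw [hx, Cochain.sub_v, hy a _ rfl le_rfl hab, sub_self]
  have h0 := Cochain.congr_v hδx (a - 1) (a + m) (by omega)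
  rw [δ_v m (m + 1) rfl x (a - 1) (a + m) (by omega) (a - 1 + m) a (by omega) (by omega), hxa,
    Limits.comp_zero, smul_zero, add_zero, Cochain.zero_v] at h0
  obtain ⟨f, hf⟩ := exists_lift_of_exactAt (a := a - 1 + n) (by omega) (by omega) (hL _)
    (x.v (a - 1) (a - 1 + m) rfl) h0
  refine ⟨y + Cochain.single f n, ?_, ?_⟩
  · intro p q hpq h1 h2
    rw [δ_add, Cochain.δ_single f n m hnm (a - 2) (a - 1 + m) (by omega) (by omega), Cochain.add_v,
      Cochain.add_v, Cochain.units_smul_v, Cochain.single_v_eq_zero (K.d (a - 2) (a - 1) ≫ f) m p q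
      hpq (by omega), smul_zero, add_zero]
    obtain rfl | h3 := eq_or_ne p (a - 1)
    · obtain rfl : q = a - 1 + m := by omega
      rw [Cochain.single_v, hf, hx, Cochain.sub_v]
      abel
    · rw [Cochain.single_v_eq_zero _ _ _ _ _ h3, add_zero, hy p q hpq (by omega) h2]
  · intro p q hpq h1 h2
    rw [Cochain.add_v, Cochain.single_v_eq_zero _ _ _ _ _ (by omega), add_zero]

/-- Dual to the extension on the left, with exactness of `K` and injectivity of the terms of `L`.
The correction lives in source degree `b + 2`, so that its coboundary only affects `b + 1` and `b +
2`. -/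
theorem exists_extend_right (hnm : n + 1 = m) (hK : K.Acyclic) [∀ i, Injective (L.X i)]
    (z : Cochain K L m) (hz : δ m (m + 1) z = 0) (y : Cochain K L n) (a b : ℤ) (hab : a ≤ b)
    (hy : EqOnIcc (δ n m y) z a b) :
    ∃ y' : Cochain K L n, EqOnIcc (δ n m y') z a (b + 1) ∧ EqOnIcc y' y a (b + 1) := by
  set x := z - δ n m y with hx
  have hδx : δ m (m + 1) x = 0 := by rw [hx, δ_sub, hz, δ_δ, sub_zero]
  have hxb : x.v b (b + m) rfl = 0 := by
    rw [hx, Cochain.sub_v, hy b _ rfl hab le_rfl, sub_self]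
  have h0 := Cochain.congr_v hδx b (b + 1 + m) (by omega)
  rw [δ_v m (m + 1) rfl x b (b + 1 + m) (by omega) (b + m) (b + 1) (by omega) (by omega), hxb,
    Limits.zero_comp, zero_add, Cochain.zero_v, smul_eq_zero_iff_eq] at h0
  obtain ⟨f, hf⟩ := exists_desc_of_exactAt (c := b + 1 + 1) rfl rfl (hK (b + 1))
    (m.negOnePow • x.v (b + 1) (b + 1 + m) rfl) (by rw [Linear.comp_units_smul, h0, smul_zero])
  refine ⟨y + Cochain.single f n, ?_, ?_⟩
  · intro p q hpq h1 h2
    rw [δ_add, Cochain.δ_single f n m hnm (b + 1) (b + 2 + m) (by omega) (by omega), Cochain.add_v,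
      Cochain.add_v, Cochain.units_smul_v, Cochain.single_v_eq_zero (f ≫ _) m p q
      hpq (by omega), zero_add]
    obtain rfl | h3 := eq_or_ne p (b + 1)
    · obtain rfl : q = b + 1 + m := by omega
      rw [Cochain.single_v, hf, hx, Cochain.sub_v, smul_smul, Int.units_mul_self, one_smul]
      abel
    · rw [Cochain.single_v_eq_zero _ _ _ _ _ h3, smul_zero, add_zero, hy p q hpq h1 (by omega)]
  · intro p q hpq h1 h2
    rw [Cochain.add_v, Cochain.single_v_eq_zero _ _ _ _ _ (by omega), add_zero]

/-- A cochain `y` whose coboundary agrees with the cocycle `z` in one degree can be modified away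
from that degree so that its coboundary is `z`. -/
theorem exists_δ_eq_of_δ_v_eq (hnm : n + 1 = m) (hK : K.Acyclic) (hL : L.Acyclic)
    [∀ i, Projective (K.X i)] [∀ i, Injective (L.X i)]
    (z : Cochain K L m) (hz : δ m (m + 1) z = 0) (y : Cochain K L n) (p₀ q₀ : ℤ)
    (hpq₀ : p₀ + m = q₀) (hy : (δ n m y).v p₀ q₀ hpq₀ = z.v p₀ q₀ hpq₀) :
    ∃ y' : Cochain K L n, δ n m y' = z ∧ EqOnIcc y' y p₀ (p₀ + 1) := by
  subst hpq₀
  -- The invariant is placed inside the existential, so that `choose` yields a total successor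
  -- function.
  have step : ∀ (N : ℕ) (x : Cochain K L n), ∃ x' : Cochain K L n,
      EqOnIcc (δ n m x) z (p₀ - N) (p₀ + N) →
        EqOnIcc (δ n m x') z (p₀ - (N + 1 : ℕ)) (p₀ + (N + 1 : ℕ)) ∧
        EqOnIcc x' x (p₀ - N) (p₀ + N + 1) := by
    intro N x
    by_cases hx : EqOnIcc (δ n m x) z (p₀ - N) (p₀ + N)
    · obtain ⟨x₁, h1, h2⟩ := exists_extend_left hnm hL z hz x _ _ (by omega) hx
      obtain ⟨x₂, h3, h4⟩ := exists_extend_right hnm hK z hz x₁ _ _ (by omega) h1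
      refine ⟨x₂, fun _ => ⟨fun p q hpq hp hp' => h3 p q hpq (by push_cast at hp; omega)
        (by push_cast at hp'; omega), fun p q hpq hp hp' => ?_⟩⟩
      rw [h4 p q hpq (by omega) hp', h2 p q hpq hp hp']
    · exact ⟨x, fun h => absurd h hx⟩
  choose next hnext using step
  let s : ℕ → Cochain K L n := fun N => Nat.rec y next N
  have hs : ∀ N : ℕ, EqOnIcc (δ n m (s N)) z (p₀ - N) (p₀ + N) := by
    intro N
    induction N with
    | zero =>
      intro p q hpq hp hp'
      obtain rfl : p₀ = p := by push_cast at hp hp'; omega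
      subst hpq
      exact hy
    | succ N ih => exact (hnext N (s N) ih).1
  have hs' : ∀ (N N' : ℕ), N ≤ N' → EqOnIcc (s N') (s N) (p₀ - N) (p₀ + N + 1) := by
    intro N N' h
    induction N', h using Nat.le_induction with
    | base => intro p q hpq _ _; rfl
    | succ N' h ih =>
      intro p q hpq hp hp'
      rw [← ih p q hpq hp hp']
      exact (hnext N' (s N') (hs N')).2 p q hpq (by omega) (by omega)
  -- The component in source degree `p` is constant from stage `|p - p₀|` on, and the limit is read
  -- off there.
  let y' : Cochain K L n := Cochain.mk fun p q hpq => (s (p - p₀).natAbs).v p q hpq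
  have hy' : ∀ (N : ℕ), EqOnIcc y' (s N) (p₀ - N) (p₀ + N + 1) := by
    intro N p q hpq hp hp'
    rcases le_total N (p - p₀).natAbs with h | h
    · exact hs' _ _ h p q hpq hp hp'
    · exact (hs' _ _ h p q hpq (by omega) (by omega)).symm
  refine ⟨y', ?_, fun p q hpq hp hp' => hy' 0 p q hpq (by simpa using hp) (by simpa using hp')⟩
  ext p q hpq
  rw [← hs (p - p₀).natAbs p q hpq (by omega) (by omega),
    δ_v n m hnm _ p q hpq (q - 1) (p + 1) rfl rfl, δ_v n m hnm _ p q hpq (q - 1) (p + 1) rfl rfl,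
    hy' (p - p₀).natAbs p (q - 1) _ (by omega) (by omega),
    hy' (p - p₀).natAbs (p + 1) q _ (by omega) (by omega)]

/-- A cocycle vanishing in one degree is a coboundary. -/
theorem exists_δ_eq_of_v_eq_zero (hnm : n + 1 = m) (hK : K.Acyclic) (hL : L.Acyclic)
    [∀ i, Projective (K.X i)] [∀ i, Injective (L.X i)]
    (z : Cocycle K L m) (p q : ℤ) (hpq : p + m = q) (hz : (z : Cochain K L m).v p q hpq = 0) :
    ∃ y : Cochain K L n, δ n m y = z := by
  obtain ⟨y, hy, -⟩ := exists_δ_eq_of_δ_v_eq hnm hK hL (z : Cochain K L m)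
    (z.δ_eq_zero _) 0 p q hpq (by rw [δ_zero, hz]; rfl)
  exact ⟨y, hy⟩

variable {M : C} (ε : L.X 0 ⟶ M)

/-- A cocycle which becomes zero on composition with the cokernel of `L.X (-1) ⟶ L.X 0` is a
coboundary. -/
theorem exists_δ_eq_of_v_comp_eq_zero (hnm : n + 1 = m) (hK : K.Acyclic) (hL : L.Acyclic)
    [∀ i, Projective (K.X i)] [∀ i, Injective (L.X i)]
    (hε : L.d (-1) 0 ≫ ε = 0) (hex : (ShortComplex.mk _ _ hε).Exact)
    (z : Cocycle K L m) (p : ℤ) (hp : p + m = 0)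
    (hz : (z : Cochain K L m).v p 0 hp ≫ ε = 0) :
    ∃ y : Cochain K L n, δ n m y = z := by
  obtain ⟨h, hh⟩ : ∃ h : K.X p ⟶ L.X (-1), h ≫ L.d (-1) 0 = (z : Cochain K L m).v p 0 hp :=
    ⟨hex.liftFromProjective _ hz, hex.liftFromProjective_comp _ hz⟩
  obtain ⟨y, hy, -⟩ := exists_δ_eq_of_δ_v_eq hnm hK hL (z : Cochain K L m)
    (z.δ_eq_zero _) (Cochain.single h n) p 0 hp (by
      rw [Cochain.δ_single h n m hnm (p - 1) 0 (by omega) (by omega), Cochain.add_v,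
        Cochain.units_smul_v, Cochain.single_v_eq_zero (_ ≫ h) _ _ _ _ (by omega), smul_zero,
        add_zero, hh, Cochain.single_v])
  exact ⟨y, hy⟩

/-- A map `K.X (-n) ⟶ M` vanishing on boundaries lifts to a cocycle of degree `n`, for `M` the
cokernel of `L.X (-1) ⟶ L.X 0`. -/
theorem exists_cocycle_v_comp_eq (hK : K.Acyclic) (hL : L.Acyclic)
    [∀ i, Projective (K.X i)] [∀ i, Injective (L.X i)] [Epi ε]
    (hε : L.d (-1) 0 ≫ ε = 0) (hex : (ShortComplex.mk _ _ hε).Exact)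
    (p : ℤ) (hp : p + n = 0) (f : K.X p ⟶ M) (hf : K.d (p - 1) p ≫ f = 0) :
    ∃ z : Cocycle K L n, (z : Cochain K L n).v p 0 hp ≫ ε = f := by
  let g : K.X p ⟶ L.X 0 := Projective.factorThru f ε
  have hg : g ≫ ε = f := Projective.factorThru_comp f ε
  obtain ⟨h, hh⟩ : ∃ h : K.X (p - 1) ⟶ L.X (-1), h ≫ L.d (-1) 0 = K.d (p - 1) p ≫ g :=
    ⟨hex.liftFromProjective _ (by simp [hg, hf]), hex.liftFromProjective_comp _ _⟩
  obtain ⟨y, hy, hy'⟩ := exists_δ_eq_of_δ_v_eq (m := n + 1) rfl hK hL (0 : Cochain K L (n + 1))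
    (by simp) (Cochain.single g n + n.negOnePow • Cochain.single h n) (p - 1) 0
    (by omega) (by
      rw [δ_add, δ_units_smul, Cochain.δ_single g n (n + 1) rfl (p - 1) 1 (by omega) (by omega),
        Cochain.δ_single h n (n + 1) rfl (p - 2) 0 (by omega) (by omega)]
      simp only [Cochain.add_v, Cochain.units_smul_v, Cochain.zero_v, smul_add]
      rw [Cochain.single_v_eq_zero (g ≫ _) _ _ _ _ (by omega),
        Cochain.single_v_eq_zero (_ ≫ h) _ _ _ _ (by omega), hh, Cochain.single_v,
        Int.negOnePow_succ]
      simp)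
  refine ⟨Cocycle.mk y (n + 1) rfl hy, ?_⟩
  rw [Cocycle.mk_coe, hy' p 0 hp (by omega) (by omega), Cochain.add_v, Cochain.units_smul_v,
    Cochain.single_v_eq_zero h _ _ _ _ (by omega), smul_zero, add_zero, Cochain.single_v, hg]

end CochainComplex.HomComplex

/-! ### Homotopy invariance of the canonical class and of realisability -/

namespace HomCohomology

variable {k : Type u} [Field k] {C : Type w} [Category.{v} C] [Preadditive C] [Linear k C]

section

variable {K L : CochainComplex C ℤ}

/-- The inclusion of the cocycles into the cochains. -/
def coeLinear (n : ℤ) : Cocycle K L n →ₗ[k] Cochain K L n where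
  toFun z := z
  map_add' _ _ := rfl
  map_smul' _ _ := rfl

@[simp] theorem coeLinear_apply {n : ℤ} (z : Cocycle K L n) :
    coeLinear (k := k) n z = (z : Cochain K L n) := rfl

/-- Over a field, `δ` has a linear section on its range, so primitives existing pointwise can be
chosen linearly. -/
theorem exists_linear_primitive {V : Type*} [AddCommGroup V] [Module k V] (l n : ℤ)
    (F : V →ₗ[k] Cochain K L n) (hF : ∀ x, ∃ y : Cochain K L l, δ l n y = F x) :
    ∃ g : V →ₗ[k] Cochain K L l, ∀ x, δ l n (g x) = F x := by
  obtain ⟨sec, hsec⟩ := LinearMap.exists_rightInverse_of_surjective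
    (δ_hom k K L l n).rangeRestrict (LinearMap.range_rangeRestrict _)
  let F' : V →ₗ[k] LinearMap.range (δ_hom k K L l n) := F.codRestrict _ (fun x => hF x)
  refine ⟨sec.comp F', fun x => ?_⟩
  exact congrArg Subtype.val (LinearMap.congr_fun hsec (F' x))

theorem exists_δ_eq_sub {m n : ℤ} (hmn : m + 1 = n) {x y : Cocycle K L n}
    (h : (Submodule.Quotient.mk x : H k K L n) = Submodule.Quotient.mk y) :
    ∃ z : Cochain K L m, δ m n z = (x : Cochain K L n) - (y : Cochain K L n) := by
  obtain rfl : m = n - 1 := by omega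
  exact (mk_eq_mk_iff k x y).1 h

theorem mk_eq_mk_of_δ_eq {m n : ℤ} {x y : Cocycle K L n} (z : Cochain K L m)
    (h : δ m n z = (x : Cochain K L n) - (y : Cochain K L n)) :
    (Submodule.Quotient.mk x : H k K L n) = Submodule.Quotient.mk y := by
  rw [mk_eq_mk_iff]
  by_cases hmn : m + 1 = n
  · obtain rfl : m = n - 1 := by omega
    exact ⟨z, h⟩
  -- In non-consecutive degrees `δ` is zero by convention, so the two cocycles agree.
  · exact ⟨0, by rw [← h, δ_shape _ _ hmn, δ_zero]⟩

theorem mk_eq_zero_of_δ_eq {m n : ℤ} {x : Cocycle K L n} (z : Cochain K L m)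
    (h : δ m n z = (x : Cochain K L n)) : (Submodule.Quotient.mk x : H k K L n) = 0 :=
  mk_eq_mk_of_δ_eq z (by simpa using h)

theorem exists_δ_eq_of_mk_eq_zero {m n : ℤ} (hmn : m + 1 = n) {x : Cocycle K L n}
    (h : (Submodule.Quotient.mk x : H k K L n) = 0) :
    ∃ z : Cochain K L m, δ m n z = (x : Cochain K L n) := by
  obtain ⟨z, hz⟩ := exists_δ_eq_sub hmn (x := x) (y := 0) h
  exact ⟨z, by simpa using hz⟩

theorem mk_units_smul {n : ℤ} (e : ℤˣ) (x : Cocycle K L n) :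
    (Submodule.Quotient.mk (e • x) : H k K L n) = e • Submodule.Quotient.mk x := by
  rcases Int.units_eq_one_or e with rfl | rfl <;> simp

end

variable (k) in
/-- A homotopy equivalence between `K` and `L`, up to homotopy. -/
structure HEquiv (K L : CochainComplex C ℤ) where
  a : H k K L 0
  b : H k L K 0
  ba : cohProd k (add_zero 0) b a = Submodule.Quotient.mk (Cocycle.ofHom (𝟙 K))
  ab : cohProd k (add_zero 0) a b = Submodule.Quotient.mk (Cocycle.ofHom (𝟙 L))

namespace HEquiv

variable {K L M : CochainComplex C ℤ} (E : HEquiv k K L)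

/-- The inverse equivalence. -/
def symm : HEquiv k L K := ⟨E.b, E.a, E.ab, E.ba⟩

theorem mul_ab {n : ℤ} (x : H k L M n) :
    cohProd k (add_zero n) (cohProd k (add_zero n) x E.a) E.b = x := by
  rw [cohProd_assoc k _ (add_zero 0) _ (add_zero n), E.ab, cohProd_id]

theorem ba_mul {n : ℤ} (x : H k M K n) :
    cohProd k (zero_add n) E.b (cohProd k (zero_add n) E.a x) = x := by
  rw [← cohProd_assoc k (add_zero 0) _ (zero_add n), E.ba, id_cohProd]

theorem ab_mul {n : ℤ} (x : H k M L n) :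
    cohProd k (zero_add n) E.a (cohProd k (zero_add n) E.b x) = x :=
  E.symm.ba_mul x

/-- Conjugation `f ↦ b f a`. -/
def conj (n : ℤ) : H k L L n →ₗ[k] H k K K n :=
  (cohProd k (zero_add n) E.b).comp ((cohProd k (add_zero n)).flip E.a)

theorem conj_apply {n : ℤ} (f : H k L L n) :
    E.conj n f = cohProd k (zero_add n) E.b (cohProd k (add_zero n) f E.a) := rfl

theorem conj_symm_conj {n : ℤ} (f : H k L L n) : E.symm.conj n (E.conj n f) = f := by
  rw [conj_apply, conj_apply]
  change cohProd k _ E.a (cohProd k _ (cohProd k _ E.b _) E.b) = f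
  rw [cohProd_assoc k (zero_add n) (add_zero n) _ (zero_add n), E.mul_ab, E.ab_mul]

theorem conj_conj_symm {n : ℤ} (f : H k K K n) : E.conj n (E.symm.conj n f) = f :=
  E.symm.conj_symm_conj f

theorem a_conj {n : ℤ} (f : H k L L n) :
    cohProd k (zero_add n) E.a (E.conj n f) = cohProd k (add_zero n) f E.a := by
  rw [conj_apply, E.ab_mul]

theorem conj_b {n : ℤ} (f : H k L L n) :
    cohProd k (add_zero n) (E.conj n f) E.b = cohProd k (zero_add n) E.b f := by
  rw [conj_apply, cohProd_assoc k (zero_add n) (add_zero n) _ (zero_add n), E.mul_ab]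

theorem conj_mul {i j l : ℤ} (h : i + j = l) (f : H k L L i) (g : H k L L j) :
    E.conj l (cohProd k h f g) = cohProd k h (E.conj i f) (E.conj j g) := by
  conv_rhs => rw [conj_apply]
  rw [cohProd_assoc k (zero_add i) h h (zero_add l), cohProd_assoc k (add_zero i) (zero_add j) h h,
    a_conj, ← cohProd_assoc k h _ (add_zero l), conj_apply]

theorem conj_one :
    E.conj 0 (Submodule.Quotient.mk (Cocycle.ofHom (𝟙 L))) =
      Submodule.Quotient.mk (Cocycle.ofHom (𝟙 K)) := by
  rw [conj_apply, id_cohProd, E.ba]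

theorem act_conj_mul {X : GradedMod (endAlg k K)} {i j l ij jl n : ℤ} (hij : i + j = ij)
    (hjl : j + l = jl) (h : ij + l = n) (h' : i + jl = n) (x : X.carrier i) (b : H k L L j)
    (c : H k L L l) : X.act h (X.act hij x (E.conj j b)) (E.conj l c) =
      X.act h' x (E.conj jl (cohProd k hjl b c)) := by
  rw [conj_mul]
  exact X.act_mul hij hjl h h' x _ _

/-- Restriction of a graded module along conjugation. -/
def pull (X : GradedMod (endAlg k K)) : GradedMod (endAlg k L) where
  carrier := X.carrier
  addCommGroup := X.addCommGroup
  module := X.module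
  act {_ j _} h := (X.act h).compl₂ (E.conj j)
  act_one {i} x :=
    (congrArg (X.act (add_zero i) x) E.conj_one).trans (X.act_one x)
  act_mul hij hjl h h' x b c := E.act_conj_mul hij hjl h h' x b c

/-- Precomposition with `a` identifies the maps out of `L` with the maps out of `K` and turns the
action of a class into that of its conjugate; inclusion and retraction are composed with it and its
inverse. -/
theorem isDirectSummand_of_pull {X : GradedMod (endAlg k K)}
    (h : (E.pull X).IsDirectSummand (homMod k L M)) : X.IsDirectSummand (homMod k K M) := by
  obtain ⟨⟨ι, hι⟩, ⟨π, hπ⟩, hπι⟩ := h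
  change ∀ n : ℤ, X.carrier n →ₗ[k] H k L M n at ι
  change ∀ n : ℤ, H k L M n →ₗ[k] X.carrier n at π
  have hι' : ∀ {i j l : ℤ} (h : i + j = l) (x : X.carrier i) (f : H k K K j),
      ι l (X.act h x f) = cohProd k h (ι i x) (E.symm.conj j f) := by
    intro i j l h x f
    refine Eq.trans ?_ (hι h x (E.symm.conj j f))
    exact congrArg (fun t => ι l (X.act h x t)) (E.conj_conj_symm f).symm
  have hπ' : ∀ {i j l : ℤ} (h : i + j = l) (y : H k L M i) (f : H k K K j),
      π l (cohProd k h y (E.symm.conj j f)) = X.act h (π i y) f := by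
    intro i j l h y f
    refine (hπ h y (E.symm.conj j f)).trans ?_
    exact congrArg (fun t => X.act h (π i y) t) (E.conj_conj_symm f)
  have hπι' : ∀ (n : ℤ) (x : X.carrier n), π n (ι n x) = x := hπι
  refine ⟨⟨fun n => ((cohProd k (add_zero n)).flip E.a).comp (ι n), ?_⟩,
    ⟨fun n => (π n).comp ((cohProd k (add_zero n)).flip E.b), ?_⟩, ?_⟩
  · intro i j l h x f
    change H k K K j at f
    change cohProd k _ (ι l (X.act h x f)) E.a = cohProd k h (cohProd k _ (ι i x) E.a) f
    rw [hι', cohProd_assoc k h (add_zero j) _ h, cohProd_assoc k _ (zero_add j) _ h]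
    congr 1
    exact E.symm.conj_b f
  · intro i j l h y f
    change H k K K j at f
    change H k K M i at y
    change π l (cohProd k _ (cohProd k h y f) E.b) = X.act h (π i (cohProd k _ y E.b)) f
    rw [← hπ', cohProd_assoc k h (add_zero j) _ h, cohProd_assoc k _ (zero_add j) _ h]
    congr 2
    exact (E.symm.a_conj f).symm
  · intro n x
    change π n (cohProd k _ (cohProd k _ (ι n x) E.a) E.b) = x
    rw [E.mul_ab, hπι']

end HEquiv

namespace Choice

variable {K L : CochainComplex C ℤ}

/-- The representing cocycles of a choice, as a map on `H`. -/
def rep (s : Choice k K) (n : ℤ) : H k K K n →ₗ[k] Cocycle K K n := s.f₁ n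

/-- The primitives of a choice, as a map on `H`. -/
def htpy (s : Choice k K) {i j l : ℤ} (h : i + j + (-1) = l) :
    H k K K i →ₗ[k] H k K K j →ₗ[k] Cochain K K l := s.f₂ i j l h

theorem mk_rep (s : Choice k K) {n : ℤ} (x : H k K K n) :
    (Submodule.Quotient.mk (s.rep n x) : H k K K n) = x := s.mk_f₁ n x

theorem δ_htpy (s : Choice k K) {i j l n : ℤ} (h : i + j + (-1) = l) (hn : i + j = n)
    (x : H k K K i) (y : H k K K j) :
    δ l n (s.htpy h x y) = (s.rep n (cohProd k hn x y) : Cochain K K n)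
      - prod k hn (s.rep i x : Cochain K K i) (s.rep j y : Cochain K K j) :=
  s.δ_f₂ i j l n h hn x y

/-- Construction of a choice from maps defined on `H`. -/
def ofH (f₁ : ∀ n : ℤ, H k K K n →ₗ[k] Cocycle K K n)
    (mk_f₁ : ∀ (n : ℤ) (x : H k K K n), (Submodule.Quotient.mk (f₁ n x) : H k K K n) = x)
    (f₂ : ∀ i j l : ℤ, i + j + (-1) = l → (H k K K i →ₗ[k] H k K K j →ₗ[k] Cochain K K l))
    (δ_f₂ : ∀ (i j l n : ℤ) (h : i + j + (-1) = l) (hn : i + j = n) (x : H k K K i)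
      (y : H k K K j), δ l n (f₂ i j l h x y) = (f₁ n (cohProd k hn x y) : Cochain K K n)
        - prod k hn (f₁ i x : Cochain K K i) (f₁ j y : Cochain K K j)) : Choice k K :=
  ⟨f₁, mk_f₁, f₂, δ_f₂⟩

/-- The Massey cocycle of a choice, for elements of `H`. -/
def massey (s : Choice k K) {i j l n : ℤ} (h : i + j + l + (-1) = n) (a : H k K K i)
    (b : H k K K j) (c : H k K K l) : Cocycle K K n := s.masseyCocycle h a b c

theorem coe_massey (s : Choice k K) {i j l n : ℤ} (h : i + j + l + (-1) = n) (a : H k K K i)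
    (b : H k K K j) (c : H k K K l) : (s.massey h a b c : Cochain K K n) =
      prod k (show i + j + (-1) + l = n by omega) (s.htpy rfl a b) (s.rep l c : Cochain K K l)
      - s.htpy (show i + (j + l) + (-1) = n by omega) a (cohProd k rfl b c)
      + s.htpy h (cohProd k rfl a b) c
      - i.negOnePow • prod k (show i + (j + l + (-1)) = n by omega) (s.rep i a : Cochain K K i)
        (s.htpy rfl b c) := rfl

/-- Massey cochains are coboundaries. -/
def Trivial (s : Choice k K) : Prop :=
  ∀ {i j l ij jl ij' jl' n n' : ℤ} (hij : i + j = ij) (hjl : j + l = jl)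
    (hij' : i + j + (-1) = ij') (hjl' : j + l + (-1) = jl') (h : ij + l + (-1) = n)
    (_ : n' + 1 = n)
    (a : H k K K i) (b : H k K K j) (c : H k K K l),
    ∃ z : Cochain K K n', δ n' n z =
      prod k (show ij' + l = n by omega) (s.htpy hij' a b) (s.rep l c : Cochain K K l)
      - s.htpy (show i + jl + (-1) = n by omega) a (cohProd k hjl b c)
      + s.htpy (show ij + l + (-1) = n by omega) (cohProd k hij a b) c
      - i.negOnePow • prod k (show i + jl' = n by omega) (s.rep i a : Cochain K K i)
        (s.htpy hjl' b c)

theorem m_eq_zero_iff (s : Choice k K) : s.m = 0 ↔ s.Trivial := by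
  constructor
  · intro hs i j l ij jl ij' jl' n n' hij hjl hij' hjl' h hn' a b c
    subst hij hjl hij' hjl' h
    have : s.m ⟨i, j, l, _, rfl⟩ a b c = 0 := by rw [hs]; rfl
    exact exists_δ_eq_of_mk_eq_zero hn' this
  · intro hs
    funext ⟨i, j, l, n, h⟩
    refine LinearMap.ext fun a => LinearMap.ext fun b => LinearMap.ext fun c => ?_
    obtain ⟨z, hz⟩ := hs rfl rfl rfl rfl h (sub_add_cancel n 1) a b c
    exact mk_eq_zero_of_δ_eq z hz

/-- If the canonical class vanishes, then `f₂` can be chosen such that all Massey cochains are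
coboundaries. -/
theorem exists_trivial (s : Choice k K) (hs : s.canonicalClass = 0) :
    ∃ s' : Choice k K, s'.Trivial := by
  obtain ⟨ψ, hψ⟩ := (Submodule.Quotient.mk_eq_zero _).1 hs
  let Ψ : ∀ {i j l : ℤ} (_ : i + j + (-1) = l), H k K K i →ₗ[k] H k K K j →ₗ[k] H k K K l :=
    fun {i j l} h => ψ ⟨i, j, l, h⟩
  -- Adding representatives of `ψ` to `f₂` leaves `δ f₂` unchanged, and subtracts the Hochschild
  -- coboundary of `ψ` from the Massey class.
  let s' : Choice k K := ofH s.rep (fun _ => s.mk_rep) (fun i j l h => s.htpy h +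
    (LinearMap.llcomp k _ _ _ ((coeLinear l).comp (s.rep l))).comp (Ψ h)) fun i j l n h hn x y => by
      rw [LinearMap.add_apply, LinearMap.add_apply, δ_add, LinearMap.comp_apply,
        LinearMap.llcomp_apply, LinearMap.comp_apply, coeLinear_apply, Cocycle.δ_eq_zero,
        add_zero, s.δ_htpy h hn x y]
  have hs' : ∀ {i j l : ℤ} (h : i + j + (-1) = l) (x : H k K K i) (y : H k K K j),
    s'.htpy h x y = s.htpy h x y + s.rep l (Ψ h x y) := fun _ _ _ => rfl
  refine ⟨s', ?_⟩
  intro i j l ij jl ij' jl' n n' hij hjl hij' hjl' h hn' a b c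
  subst hij hjl hij' hjl'
  have h1 : (Submodule.Quotient.mk (s.masseyCocycle h a b c) : H k K K n) =
      (-1 * i).negOnePow • cohProd k (by omega) a (Ψ rfl b c) - Ψ h (cohProd k rfl a b) c +
      Ψ (by omega) a (cohProd k rfl b c) - cohProd k (by omega) (Ψ rfl a b) c := hψ h a b c
  have h2 : (Submodule.Quotient.mk (s.masseyCocycle h a b c -
      ((-1 * i).negOnePow • cocycleProd k (by omega) (s.rep i a) (s.rep _ (Ψ rfl b c))
      - s.rep n (Ψ h (cohProd k rfl a b) c) + s.rep n (Ψ (by omega) a (cohProd k rfl b c))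
      - cocycleProd k (by omega) (s.rep _ (Ψ rfl a b)) (s.rep l c))) : H k K K n) = 0 := by
    rw [Submodule.Quotient.mk_sub, h1, Submodule.Quotient.mk_sub, Submodule.Quotient.mk_add,
      Submodule.Quotient.mk_sub, mk_units_smul, ← cohProd_mk, ← cohProd_mk]
    simp only [mk_rep, sub_self]
  obtain ⟨z, hz⟩ := exists_δ_eq_of_mk_eq_zero hn' h2
  refine ⟨z, hz.trans ?_⟩
  have h3 : (s.masseyCocycle h a b c : Cochain K K n) =
    prod k (by omega) (s.htpy rfl a b) (s.rep l c : Cochain K K l)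
      - s.htpy (show i + (j + l) + (-1) = n by omega) a (cohProd k rfl b c)
      + s.htpy (show i + j + l + (-1) = n by omega) (cohProd k rfl a b) c
      - i.negOnePow • prod k (by omega) (s.rep i a : Cochain K K i) (s.htpy rfl b c) := rfl
  have h4 : (-1 * i).negOnePow = i.negOnePow := by rw [neg_one_mul, Int.negOnePow_neg]
  have h5 : s'.rep = s.rep := rfl
  simp only [Cocycle.coe_sub, Cocycle.coe_add, Cocycle.coe_units_smul, coe_cocycleProd, h3, hs', h4,
    h5, map_add, LinearMap.add_apply, smul_add]
  abel

/-- If some choice on `L` has trivial Massey cochains, then the canonical class of every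
complex `K` homotopy equivalent to `L` vanishes. -/
theorem canonicalClass_eq_zero_of_trivial (E : HEquiv k K L) (s : Choice k K) (t : Choice k L)
    (ht : t.Trivial) : s.canonicalClass = 0 := by
  obtain ⟨α, hα⟩ := Submodule.Quotient.mk_surjective _ E.a
  let θ : ∀ n, H k K K n →ₗ[k] H k L L n := fun n => E.symm.conj n
  have hθ : ∀ {n : ℤ} (x : H k K K n), cohProd k (add_zero n) (θ n x) E.a =
      cohProd k (zero_add n) E.a x := fun x => E.symm.conj_b x
  have hθm : ∀ {i j l : ℤ} (h : i + j = l) (x : H k K K i) (y : H k K K j),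
      cohProd k h (θ i x) (θ j y) = θ l (cohProd k h x y) := fun h x y =>
    (E.symm.conj_mul h x y).symm
  -- The representatives on the two sides are intertwined by `α` only up to homotopy; `g` is a
  -- linear choice of such homotopies.
  have hg : ∀ (l n : ℤ) (h : l + 1 = n), ∃ g : H k K K n →ₗ[k] Cochain K L l, ∀ x,
      δ l n (g x) = prod k (zero_add n) (α : Cochain K L 0) (s.rep n x : Cochain K K n)
        - prod k (add_zero n) (t.rep n (θ n x) : Cochain L L n) (α : Cochain K L 0) := by
    intro l n h
    refine exists_linear_primitive l n ((coeLinear n).comp (((cocycleProd k (zero_add n) α).comp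
      (s.rep n)) - ((cocycleProd k (add_zero n)).flip α).comp ((t.rep n).comp (θ n)))) fun x => ?_
    refine exists_δ_eq_sub (k := k) h ?_
    change Submodule.Quotient.mk (cocycleProd k _ α (s.rep n x)) =
      Submodule.Quotient.mk (cocycleProd k _ (t.rep n (θ n x)) α)
    rw [← cohProd_mk, ← cohProd_mk, hα, mk_rep, mk_rep, hθ]
  choose g hg using hg
  -- The comparison of `f₂` on `K` with `f₂` on `L`, corrected by `g` so as to be closed. Its class
  -- measures the discrepancy of the two choices.
  let ωc : ∀ {i j l : ℤ} (_ : i + j + (-1) = l), H k K K i → H k K K j → Cochain K L l :=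
    fun {i j l} h x y => prod k (zero_add l) (α : Cochain K L 0) (s.htpy h x y)
      - prod k (add_zero l) (t.htpy h (θ i x) (θ j y)) (α : Cochain K L 0)
      - g l (i + j) (by omega) (cohProd k rfl x y)
      + prod k (by omega) (g (i - 1) i (by omega) x) (s.rep j y : Cochain K K j)
      + i.negOnePow • prod k (by omega) (t.rep i (θ i x) : Cochain L L i)
        (g (j - 1) j (by omega) y)
  have δω : ∀ {i j l : ℤ} (h : i + j + (-1) = l) (x : H k K K i) (y : H k K K j),
      δ l (l + 1) (ωc h x y) = 0 := by
    intro i j l h x y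
    obtain ⟨ij, hij⟩ : ∃ ij, ij = l + 1 := ⟨_, rfl⟩
    have e1 : ∀ (q : ℤ) (hq : i + j = q) (hq' : l + 1 = q),
        δ l ij (g l q hq' (cohProd k hq x y)) = prod k (zero_add ij) (α : Cochain K L 0)
          (s.rep ij (cohProd k (by omega) x y) : Cochain K K ij)
        - prod k (add_zero ij) (t.rep ij (θ ij (cohProd k (by omega) x y)) : Cochain L L ij)
          (α : Cochain K L 0) := by
      intro q hq hq'
      obtain rfl : q = ij := by omega
      exact hg _ _ _ _
    rw [← hij]
    simp only [ωc, δ_add, δ_sub, δ_units_smul]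
    rw [e1, δ_prod k (zero_add l) (zero_add 1) hij.symm hij.symm,
      δ_prod k (add_zero l) hij.symm (zero_add 1) hij.symm,
      δ_prod k _ (sub_add_cancel i 1) rfl hij.symm, δ_prod k _ rfl (sub_add_cancel j 1) hij.symm,
      s.δ_htpy h (show i + j = ij by omega), t.δ_htpy h (show i + j = ij by omega), hg, hg, hθm]
    simp only [Cocycle.δ_eq_zero, map_zero, LinearMap.zero_apply, smul_zero, add_zero, zero_add,
      Int.negOnePow_zero, one_smul, map_sub, LinearMap.sub_apply, smul_sub, smul_smul,
      Int.units_mul_self]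
    rw [prod_assoc k (zero_add i) (by omega) (by omega) (zero_add ij),
      prod_assoc k (add_zero i) (zero_add j) (by omega) (by omega),
      prod_assoc k (by omega) (add_zero j) (add_zero ij) (by omega)]
    abel
  let ω : ∀ {i j l : ℤ} (_ : i + j + (-1) = l), H k K K i →ₗ[k] H k K K j →ₗ[k] Cocycle K L l :=
    fun {i j l} h => LinearMap.mk₂ k (fun x y => Cocycle.mk (ωc h x y) (l + 1) rfl (δω h x y))
      (fun _ _ _ => by
        ext1
        simp only [ωc, Cocycle.mk_coe, Cocycle.coe_add, map_add, LinearMap.add_apply, smul_add]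
        abel)
      (fun r _ _ => by
        ext1
        simp only [ωc, Cocycle.mk_coe, Cocycle.coe_smul, map_smul, LinearMap.smul_apply, smul_sub,
          smul_add]
        rw [smul_comm r])
      (fun _ _ _ => by
        ext1
        simp only [ωc, Cocycle.mk_coe, Cocycle.coe_add, map_add, LinearMap.add_apply, smul_add]
        abel)
      (fun r _ _ => by
        ext1
        simp only [ωc, Cocycle.mk_coe, Cocycle.coe_smul, map_smul, LinearMap.smul_apply, smul_sub,
          smul_add]
        rw [smul_comm r])
  -- The discrepancy carried back to `K` by `b`; the sign is the one for which the Massey class of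
  -- `s` becomes the coboundary of `ψ`.
  let ψ : ∀ {i j l : ℤ} (_ : i + j + (-1) = l), H k K K i →ₗ[k] H k K K j →ₗ[k] H k K K l :=
    fun {i j l} h => -(LinearMap.llcomp k _ _ _ ((cohProd k (zero_add l) E.b).comp
      (Submodule.mkQ _))).comp (ω h)
  have hψ : ∀ {i j l : ℤ} (h : i + j + (-1) = l) (x : H k K K i) (y : H k K K j),
      cohProd k (zero_add l) E.a (ψ h x y) = - Submodule.Quotient.mk (ω h x y) := by
    intro i j l h x y
    change cohProd k _ E.a (-(cohProd k _ E.b (Submodule.Quotient.mk (ω h x y)))) = _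
    rw [map_neg, E.ab_mul]
  refine (Submodule.Quotient.mk_eq_zero _).2 ⟨fun T => ψ T.h, ?_⟩
  intro i j l n h a b c
  change H k K K i at a
  change H k K K j at b
  change H k K K l at c
  suffices hsuff : (Submodule.Quotient.mk (s.massey h a b c) : H k K K n) =
      (-1 * i).negOnePow • cohProd k (by omega) a (ψ rfl b c) - ψ h (cohProd k rfl a b) c +
      ψ (by omega) a (cohProd k rfl b c) - cohProd k (by omega) (ψ rfl a b) c from hsuff
  -- Multiplication by `a` is injective, and after it every term is represented by a cochain from
  -- `K` to `L`.
  have hinj : ∀ x y : H k K K n,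
      cohProd k (zero_add n) E.a x = cohProd k (zero_add n) E.a y → x = y := by
    intro x y hxy
    rw [← E.ba_mul x, hxy, E.ba_mul]
  apply hinj
  have ha : ∀ {q q' : ℤ} (h : i + q = q') (z : H k K K q), cohProd k (zero_add q') E.a
      (cohProd k h a z) = cohProd k h (θ i a) (cohProd k (zero_add q) E.a z) := by
    intro q q' h z
    rw [← cohProd_assoc k (zero_add i) h h, ← hθ, cohProd_assoc k _ (zero_add q) h h]
  have h4 : (-1 * i).negOnePow = i.negOnePow := by rw [neg_one_mul, Int.negOnePow_neg]
  have hc : ∀ {q : ℤ} (h : q + l = n) (z : Cocycle K L q), cohProd k h (Submodule.Quotient.mk z) c =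
      (Submodule.Quotient.mk (cocycleProd k h z (s.rep l c)) : H k K L n) := by
    intro q h z
    rw [← cohProd_mk, s.mk_rep]
  have ha' : ∀ {q : ℤ} (h : i + q = n) (z : Cocycle K L q),
      cohProd k h (θ i a) (Submodule.Quotient.mk z) =
      (Submodule.Quotient.mk (cocycleProd k h (t.rep i (θ i a)) z) : H k K L n) := by
    intro q h z
    rw [← cohProd_mk, t.mk_rep]
  rw [map_sub, map_add, map_sub, ← smul_one_smul ℤ, map_zsmul, smul_one_smul, ha,
    ← cohProd_assoc k (zero_add _) _ (by omega) (zero_add n), hψ, hψ, hψ, hψ, h4, map_neg, map_neg,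
    LinearMap.neg_apply, ha', hc, ← hα, cohProd_mk]
  obtain ⟨z₀, hz₀⟩ := ht rfl rfl rfl rfl h (sub_add_cancel n 1) (θ i a) (θ j b) (θ l c)
  rw [smul_neg, ← mk_units_smul, ← Submodule.Quotient.mk_neg, ← Submodule.Quotient.mk_neg,
    ← Submodule.Quotient.mk_neg, ← Submodule.Quotient.mk_neg, ← Submodule.Quotient.mk_sub,
    ← Submodule.Quotient.mk_add, ← Submodule.Quotient.mk_sub]
  -- The primitive consists of the null-homotopy of the Massey cochain on `L` and of the two mixed
  -- products of `g` with a primitive `f₂`.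
  refine mk_eq_mk_of_δ_eq (prod k (add_zero (n - 1)) z₀ (α : Cochain K L 0)
    - i.negOnePow • prod k (show i - 1 + (j + l + (-1)) = n - 1 by omega)
      (g (i - 1) i (by omega) a) (s.htpy rfl b c)
    - (i + j).negOnePow • prod k (show i + j + (-1) + (l - 1) = n - 1 by omega)
      (t.htpy rfl (θ i a) (θ j b)) (g (l - 1) l (by omega) c)) ?_
  have hω : ∀ {i j l : ℤ} (h : i + j + (-1) = l) (x : H k K K i) (y : H k K K j),
    (ω h x y : Cochain K L l) = ωc h x y := fun _ _ _ => rfl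
  rw [δ_sub, δ_sub, δ_units_smul, δ_units_smul, δ_prod k _ (sub_add_cancel n 1) (zero_add 1)
      (sub_add_cancel n 1), δ_prod k _ (sub_add_cancel i 1) (show j + l + (-1) + 1 = j + l by omega)
      (sub_add_cancel n 1), δ_prod k _ (show i + j + (-1) + 1 = i + j by omega)
      (sub_add_cancel l 1) (sub_add_cancel n 1), hz₀, hg, hg, s.δ_htpy rfl rfl, t.δ_htpy rfl rfl]
  have hassoc : ∀ {m n p mn q : ℤ} {A B C' D : CochainComplex C ℤ} (hmn : m + n = mn)
      (h : mn + p = q) (f : Cochain C' D m) (g : Cochain B C' n) (e : Cochain A B p),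
      prod k h (prod k hmn f g) e = prod k (show m + (n + p) = q by omega) f (prod k rfl g e) :=
    fun hmn h f g e => prod_assoc k hmn rfl h (by omega) f g e
  have hassoc' : ∀ {m n p np q : ℤ} {A B C' D : CochainComplex C ℤ} (hnp : n + p = np)
      (h : m + np = q) (f : Cochain C' D m) (g : Cochain B C' n) (e : Cochain A B p),
      prod k h f (prod k hnp g e) = prod k (show m + n + p = q by omega) (prod k rfl f g) e :=
    fun hmn h f g e => (prod_assoc k rfl hmn (by omega) h f g e).symm
  simp only [Cocycle.coe_add, Cocycle.coe_neg, Cocycle.coe_units_smul,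
    coe_cocycleProd, coe_massey, hω, ωc, map_sub, map_add, LinearMap.sub_apply,
    LinearMap.add_apply, smul_sub, smul_add, prod_units_smul, units_smul_prod, smul_smul, hθm,
    Cocycle.δ_eq_zero, map_zero, smul_zero, add_zero, sub_neg_eq_add]
  simp only [hassoc']
  simp only [hassoc]
  have eg1 : prod k (show i + (j + l + (-1)) = n by omega) (t.rep i (θ i a) : Cochain L L i)
        (g (j + l + (-1)) (j + l) (by omega) (cohProd k rfl b c)) =
      prod k (show i + (j + l - 1) = n by omega) (t.rep i (θ i a) : Cochain L L i)
        (g (j + l - 1) (j + l) (by omega) (cohProd k rfl b c)) := rfl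
  have eg2 : prod k (show i + j + (-1) + l = n by omega) (g (i + j + (-1)) (i + j) (by omega)
        (cohProd k rfl a b)) (s.rep l c : Cochain K K l) =
      prod k (show i + j - 1 + l = n by omega) (g (i + j - 1) (i + j) (by omega)
        (cohProd k rfl a b)) (s.rep l c : Cochain K K l) := rfl
  have eg3 : ∀ (q : ℤ) (hq : i + (j + l) = q) (h' : n + 1 = q),
      g n q h' (cohProd k hq a (cohProd k rfl b c)) =
        g n (i + j + l) (by omega) (cohProd k rfl (cohProd k rfl a b) c) := by
    intro q hq h'
    obtain rfl : q = i + j + l := by omega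
    rw [cohProd_assoc k rfl rfl rfl hq]
  have u1 : i.negOnePow * (i - 1).negOnePow = -1 := by
    rw [Int.negOnePow_sub, Int.negOnePow_one, ← mul_assoc, Int.units_mul_self, one_mul]
  have u2 : (i + j).negOnePow * (i + j + (-1)).negOnePow = -1 := by
    rw [← sub_eq_add_neg, Int.negOnePow_sub, Int.negOnePow_one, ← mul_assoc,
      Int.units_mul_self, one_mul]
  rw [eg1, eg2, eg3, u1, u2, ← Int.negOnePow_add]
  simp only [Units.neg_smul, one_smul]
  abel

end Choice

end HomCohomology

/-! ### Projective representations of a finite group -/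

namespace Rep

variable {k : Type u} [Field k] {G : Type} [Group G]

theorem exact_iff_forall (S : ShortComplex (Rep.{u} k G)) :
    S.Exact ↔ ∀ x : S.X₂, S.g.hom x = 0 → ∃ y : S.X₁, S.f.hom y = x := by
  rw [← S.exact_map_iff_of_faithful (forget₂ (Rep.{u} k G) (ModuleCat.{u} k)),
    ShortComplex.moduleCat_exact_iff]
  rfl

/-- An intertwining map out of a linear map commuting with the action. -/
def homMk {A B : Rep.{u} k G} (f : A →ₗ[k] B) (hf : ∀ (g : G) (x : A), f (A.ρ g x) = B.ρ g (f x)) :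
    A ⟶ B :=
  Rep.ofHom ⟨f, fun g => LinearMap.ext fun x => hf g x⟩

@[simp] theorem homMk_apply {A B : Rep.{u} k G} (f : A →ₗ[k] B)
    (hf : ∀ (g : G) (x : A), f (A.ρ g x) = B.ρ g (f x)) (x : A) : (homMk f hf).hom x = f x := rfl

theorem hom_ext_apply {A B : Rep.{u} k G} {f g : A ⟶ B} (h : ∀ x : A, f.hom x = g.hom x) :
    f = g := by
  ext x
  exact h x

/-- The representation on the functions from `G` to a `k`-module by left translation. -/
def funRep (Q : Type u) [AddCommGroup Q] [Module k Q] : Representation k G (G → Q) where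
  toFun g := LinearMap.funLeft k Q (fun x => g⁻¹ * x)
  map_one' := by ext; simp [LinearMap.funLeft]
  map_mul' g h := by ext; simp [LinearMap.funLeft, mul_assoc]

theorem funRep_apply (Q : Type u) [AddCommGroup Q] [Module k Q] (g : G) (f : G → Q) (x : G) :
    funRep (k := k) Q g f x = f (g⁻¹ * x) := rfl

variable [Fintype G]

/-- The sum of the conjugates of a linear map. -/
def trace {A B : Rep.{u} k G} (f : A →ₗ[k] B) : A ⟶ B :=
  homMk (∑ h : G, (B.ρ h) ∘ₗ f ∘ₗ (A.ρ h⁻¹)) (by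
    intro g x
    simp only [LinearMap.sum_apply, LinearMap.comp_apply, map_sum]
    refine Fintype.sum_equiv (Equiv.mulLeft g⁻¹) _ _ fun h => ?_
    simp only [Equiv.coe_mulLeft, mul_inv_rev, inv_inv, ← Module.End.mul_apply, ← map_mul]
    simp)

theorem trace_apply {A B : Rep.{u} k G} (f : A →ₗ[k] B) (x : A) :
    (trace f).hom x = ∑ h : G, B.ρ h (f (A.ρ h⁻¹ x)) := by
  simp [trace]

/-- Higman's criterion. `Q` is a retract of the functions from `G` to `Q`, where the projection onto
functions supported at `1` has trace the identity; this projection is transported along the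
retraction. -/
theorem exists_trace_eq_id (Q : Rep.{u} k G) [Projective Q] :
    ∃ θ : Q →ₗ[k] Q, trace θ = 𝟙 Q := by
  classical
  let F : Rep.{u} k G := Rep.of (funRep (k := k) Q.V)
  let π : F ⟶ Q := homMk (A := F) (∑ x : G, Q.ρ x ∘ₗ LinearMap.proj x) (by
    intro g f
    simp only [LinearMap.sum_apply, LinearMap.comp_apply, map_sum]
    refine Fintype.sum_equiv (Equiv.mulLeft g⁻¹) _ _ fun x => ?_
    simp only [Equiv.coe_mulLeft, ← Module.End.mul_apply, ← map_mul, mul_inv_cancel_left]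
    rfl)
  have hπ : Epi π := by
    rw [Rep.epi_iff_surjective]
    intro x
    refine ⟨Pi.single 1 x, ?_⟩
    simp only [π, homMk_apply, LinearMap.sum_apply, LinearMap.comp_apply]
    change ∑ y : G, Q.ρ y ((Pi.single 1 x : G → Q.V) y) = x
    rw [Finset.sum_eq_single 1 (fun y _ hy => by simp [hy]) (by simp)]
    simp
  let s : Q ⟶ F := Projective.factorThru (𝟙 Q) π
  have hs : s ≫ π = 𝟙 Q := Projective.factorThru_comp _ _
  let θ : F →ₗ[k] F := LinearMap.single k (fun _ => Q.V) (1 : G) ∘ₗ LinearMap.proj (1 : G)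
  have hθ : ∀ x : F, ∑ h : G, F.ρ h (θ (F.ρ h⁻¹ x)) = x := by
    intro f
    funext y
    change (∑ h : G, funRep (k := k) Q.V h (Pi.single 1 (f (h⁻¹⁻¹ * 1))) : G → Q.V) y = f y
    rw [Finset.sum_apply, Finset.sum_eq_single y]
    · simp [funRep_apply]
    · intro h _ hh
      rw [funRep_apply, Pi.single_eq_of_ne]
      rwa [ne_eq, inv_mul_eq_one]
    · simp
  refine ⟨π.hom.toLinearMap ∘ₗ θ ∘ₗ s.hom.toLinearMap, hom_ext_apply fun x => ?_⟩
  have h1 := congrArg π.hom (hθ (s.hom x))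
  rw [map_sum] at h1
  have h2 : π.hom (s.hom x) = x := congrArg (fun t => t.hom x) hs
  rw [h2] at h1
  rw [trace_apply]
  refine Eq.trans (Finset.sum_congr rfl fun h _ => ?_) h1
  rw [Rep.hom_comm_apply]
  exact congrArg (fun t => Q.ρ h (π.hom (θ t))) (Rep.hom_comm_apply s h⁻¹ x)

/-- With `r` a linear retraction of the monomorphism and `θ` of trace the identity, the trace of `θ
g r` is an equivariant extension of `g`. -/
theorem injective_of_projective (Q : Rep.{u} k G) [Projective Q] : Injective Q := by
  obtain ⟨θ, hθ⟩ := exists_trace_eq_id Q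
  refine ⟨fun {A B} g f hf => ?_⟩
  rw [Rep.mono_iff_injective] at hf
  obtain ⟨r, hr⟩ := LinearMap.exists_leftInverse_of_injective f.hom.toLinearMap
    (LinearMap.ker_eq_bot.2 hf)
  refine ⟨trace (θ ∘ₗ g.hom.toLinearMap ∘ₗ r), hom_ext_apply fun x => ?_⟩
  have hr' : ∀ x, r (f.hom x) = x := fun x => LinearMap.congr_fun hr x
  rw [Rep.hom_comp]
  change (trace _).hom (f.hom x) = _
  rw [trace_apply]
  simp only [LinearMap.comp_apply, ← Rep.hom_comm_apply]
  have := congrArg (fun t => t.hom (g.hom x)) hθ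
  simp only [trace_apply, Rep.hom_id] at this
  refine Eq.trans (Finset.sum_congr rfl fun h _ => ?_) this
  rw [hr']
  exact congrArg (fun t => Q.ρ h (θ t)) (Rep.hom_comm_apply _ _ _)

end Rep

/-! ### Comparison of complete resolutions -/

namespace HomCohomology

variable {k : Type u} [Field k] {C : Type w} [Category.{v} C] [Abelian C] [Linear k C]

/-- Composition with the map from `L` to the cokernel of `L.X (-1) ⟶ L.X 0` is bijective on
cohomology. -/
theorem cohProd_bijective {K L S : CochainComplex C ℤ} (hK : K.Acyclic) (hL : L.Acyclic)
    [∀ i, Projective (K.X i)] [∀ i, Injective (L.X i)] (η : L ⟶ S)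
    (hS : ∀ i, i ≠ 0 → Limits.IsZero (S.X i)) [Epi (η.f 0)] (hε : L.d (-1) 0 ≫ η.f 0 = 0)
    (hex : (ShortComplex.mk _ _ hε).Exact) (n : ℤ) :
    Function.Bijective (cohProd k (K := K) (zero_add n)
      (Submodule.Quotient.mk (Cocycle.ofHom η) : H k L S 0)) := by
  have hv : ∀ (z : Cocycle K L n) (p q : ℤ) (hpq : p + n = q),
      (cocycleProd k (zero_add n) (Cocycle.ofHom η) z : Cochain K S n).v p q hpq =
        (z : Cochain K L n).v p q hpq ≫ η.f q := by
    intro z p q hpq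
    rw [coe_cocycleProd, prod_apply]
    simp
  constructor
  · rw [← LinearMap.ker_eq_bot, LinearMap.ker_eq_bot']
    intro z hz
    obtain ⟨z, rfl⟩ := Submodule.Quotient.mk_surjective _ z
    rw [cohProd_mk] at hz
    obtain ⟨y, hy⟩ := exists_δ_eq_of_mk_eq_zero (sub_add_cancel n 1) hz
    -- Since `S` is concentrated in degree `0`, only this component of `y` contributes. Its lift
    -- along `η` provides the boundary to be subtracted from `z`, after which the composite with `η`
    -- vanishes.
    let g : K.X (-n + 1) ⟶ L.X 0 := Projective.factorThru (y.v (-n + 1) 0 (by omega)) (η.f 0)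
    have hg : g ≫ η.f 0 = y.v (-n + 1) 0 (by omega) := Projective.factorThru_comp _ _
    let z' : Cocycle K L n := z - Cocycle.mk (δ (n - 1) n (Cochain.single g (n - 1))) (n + 1) rfl
      (δ_δ _ _ _ _)
    have hz' : (z' : Cochain K L n).v (-n) 0 (by omega) ≫ η.f 0 = 0 := by
      have h1 := Cochain.congr_v hy (-n) 0 (by omega)
      rw [hv, δ_v (n - 1) n (by omega) y (-n) 0 (by omega) (-1) (-n + 1) (by omega) (by omega),
        (hS (-1) (by omega)).eq_zero_of_tgt (y.v (-n) (-1) (by omega)), Limits.zero_comp,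
        zero_add] at h1
      change ((z : Cochain K L n) - δ (n - 1) n (Cochain.single g (n - 1))).v (-n) 0 (by omega) ≫
        η.f 0 = 0
      rw [Cochain.sub_v, Cochain.δ_single g (n - 1) n (by omega) (-n) 1 (by omega) (by omega),
        Cochain.add_v, Cochain.units_smul_v, Cochain.single_v, Preadditive.sub_comp,
        Cochain.single_v_eq_zero (g ≫ _) _ _ _ _ (by omega), zero_add, ← h1,
        Linear.units_smul_comp, Category.assoc, hg, sub_self]
    obtain ⟨w, hw⟩ := exists_δ_eq_of_v_comp_eq_zero (n := n - 1) (η.f 0) (by omega) hK hL hε hex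
      z' (-n) (by omega) hz'
    refine mk_eq_zero_of_δ_eq (w + Cochain.single g (n - 1)) ?_
    rw [δ_add, hw]
    change (z : Cochain K L n) - δ (n - 1) n (Cochain.single g (n - 1)) + _ = _
    abel
  · intro z
    obtain ⟨z, rfl⟩ := Submodule.Quotient.mk_surjective _ z
    obtain ⟨x, hx⟩ := exists_cocycle_v_comp_eq (n := n) (η.f 0) hK hL hε hex (-n) (by omega)
      ((z : Cochain K S n).v (-n) 0 (by omega)) (by
        have h1 := Cochain.congr_v (z.δ_eq_zero (n + 1)) (-n - 1) 0 (by omega)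
        rw [δ_v n (n + 1) rfl _ (-n - 1) 0 (by omega) (-1) (-n) (by omega) (by omega),
          (hS (-1) (by omega)).eq_zero_of_tgt ((z : Cochain K S n).v (-n - 1) (-1) (by omega)),
          Limits.zero_comp, zero_add, Cochain.zero_v, smul_eq_zero_iff_eq] at h1
        exact h1)
    refine ⟨Submodule.Quotient.mk x, ?_⟩
    rw [cohProd_mk]
    congr 1
    ext p q hpq
    rw [hv]
    by_cases hq : q = 0
    · subst hq
      obtain rfl : p = -n := by omega
      exact hx
    · exact (hS q hq).eq_of_tgt _ _

theorem isDirectSummand_of_bijective {K L S : CochainComplex C ℤ} (η : H k L S 0)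
    (hη : ∀ n, Function.Bijective (cohProd k (K := K) (zero_add n) η))
    {X : GradedMod (endAlg k K)} (hX : X.IsDirectSummand (homMod k K L)) :
    X.IsDirectSummand (homMod k K S) := by
  obtain ⟨⟨ι, hι⟩, ⟨π, hπ⟩, hπι⟩ := hX
  change ∀ n : ℤ, X.carrier n →ₗ[k] H k K L n at ι
  change ∀ n : ℤ, H k K L n →ₗ[k] X.carrier n at π
  have hι' : ∀ {i j l : ℤ} (h : i + j = l) (x : X.carrier i) (f : H k K K j),
    ι l (X.act h x f) = cohProd k h (ι i x) f := hι
  have hπ' : ∀ {i j l : ℤ} (h : i + j = l) (y : H k K L i) (f : H k K K j),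
    π l (cohProd k h y f) = X.act h (π i y) f := hπ
  have hπι' : ∀ (n : ℤ) (x : X.carrier n), π n (ι n x) = x := hπι
  let e : ∀ n, H k K L n ≃ₗ[k] H k K S n := fun n => LinearEquiv.ofBijective _ (hη n)
  have he : ∀ {i j l : ℤ} (h : i + j = l) (x : H k K L i) (f : H k K K j),
      e l (cohProd k h x f) = cohProd k h (e i x) f := by
    intro i j l h x f
    change cohProd k _ η (cohProd k h x f) = cohProd k h (cohProd k _ η x) f
    rw [cohProd_assoc]
  refine ⟨⟨fun n => (e n).toLinearMap.comp (ι n), ?_⟩,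
    ⟨fun n => (π n).comp (e n).symm.toLinearMap, ?_⟩, ?_⟩
  · intro i j l h x f
    change H k K K j at f
    change e l (ι l (X.act h x f)) = cohProd k h (e i (ι i x)) f
    rw [hι', he]
  · intro i j l h y f
    change H k K S i at y
    change H k K K j at f
    change π l ((e l).symm (cohProd k h y f)) = X.act h (π i ((e i).symm y)) f
    rw [← hπ']
    congr 1
    rw [LinearEquiv.symm_apply_eq, he, LinearEquiv.apply_symm_apply]
  · intro n x
    change π n ((e n).symm (e n (ι n x))) = x
    rw [LinearEquiv.symm_apply_apply, hπι']

/-- For totally acyclic complexes, summands of `H(K, L)` are summands of `H(K, M)` for an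
object `M`. -/
theorem exists_isDirectSummand_single {K L : CochainComplex C ℤ} (hK : K.Acyclic) (hL : L.Acyclic)
    [∀ i, Projective (K.X i)] [∀ i, Injective (L.X i)] {X : GradedMod (endAlg k K)}
    (hX : X.IsDirectSummand (homMod k K L)) :
    ∃ M : C, X.IsDirectSummand (homMod k K ((CochainComplex.singleFunctor C 0).obj M)) := by
  let M := Limits.cokernel (L.d (-1) 0)
  let π : L.X 0 ⟶ M := Limits.cokernel.π _
  let η : L ⟶ (HomologicalComplex.single C (ComplexShape.up ℤ) 0).obj M :=
    HomologicalComplex.mkHomToSingle π (by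
      intro i hi
      obtain rfl : i = -1 := by simp at hi; omega
      exact Limits.cokernel.condition _)
  let e := HomologicalComplex.singleObjXSelf (ComplexShape.up ℤ) (0 : ℤ) M
  have hη : η.f 0 = π ≫ e.inv := HomologicalComplex.mkHomToSingle_f _ _
  have hε : L.d (-1) 0 ≫ η.f 0 = 0 := by
    rw [hη, Limits.cokernel.condition_assoc, Limits.zero_comp]
  have hepi : Epi (η.f 0) := by
    rw [hη]
    exact epi_comp _ _
  refine ⟨M, isDirectSummand_of_bijective _ (fun n => cohProd_bijective hK hL η ?_ hε ?_ n) hX⟩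
  · intro i hi
    exact HomologicalComplex.isZero_single_obj_X _ _ _ _ hi
  · refine ShortComplex.exact_of_iso ?_ (ShortComplex.exact_cokernel (L.d (-1) 0))
    exact ShortComplex.isoMk (Iso.refl _) (Iso.refl _) e.symm (by simp) (by simp [hη, π])

end HomCohomology

namespace CompleteResolution

open HomCohomology

variable {k : Type u} [Field k] {G : Type} [Group G] [Finite G]

theorem injective (P : CompleteResolution k G) (n : ℤ) : Injective (P.complex.X n) := by
  have := Fintype.ofFinite G
  have := P.projective n
  exact Rep.injective_of_projective _

theorem exists_cocycle (P Q : CompleteResolution k G) : ∃ α : Cocycle P.complex Q.complex 0,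
    (α : Cochain P.complex Q.complex 0).v 0 0 (add_zero 0) ≫ Q.ε = P.ε := by
  have := P.projective
  have := Q.injective
  have := Q.epi_ε
  exact exists_cocycle_v_comp_eq Q.ε P.acyclic Q.acyclic Q.d_comp_ε Q.exact 0 (add_zero 0) P.ε
    P.d_comp_ε

/-- A class is determined by the composite of a representative with the augmentation. Applied in
degree zero, this makes comparison maps mutually inverse up to homotopy. -/
theorem mk_eq_of_v_comp_eq (P Q : CompleteResolution k G) {n : ℤ} (p : ℤ) (hp : p + n = 0)
    (x y : Cocycle P.complex Q.complex n)
    (h : (x : Cochain P.complex Q.complex n).v p 0 hp ≫ Q.ε =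
      (y : Cochain P.complex Q.complex n).v p 0 hp ≫ Q.ε) :
    (Submodule.Quotient.mk x : H k P.complex Q.complex n) = Submodule.Quotient.mk y := by
  have := P.projective
  have := Q.injective
  obtain ⟨w, hw⟩ := exists_δ_eq_of_v_comp_eq_zero (n := n - 1) Q.ε (by omega) P.acyclic Q.acyclic
    Q.d_comp_ε Q.exact (x - y) p hp (by
      rw [Cocycle.coe_sub, Cochain.sub_v, Preadditive.sub_comp, h, sub_self])
  exact mk_eq_mk_of_δ_eq w hw

/-- Complete resolutions are homotopy equivalent. -/
theorem exists_hEquiv (P Q : CompleteResolution k G) : ∃ (α : Cocycle P.complex Q.complex 0)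
    (β : Cocycle Q.complex P.complex 0) (E : HEquiv k P.complex Q.complex),
    E.a = Submodule.Quotient.mk α ∧ E.b = Submodule.Quotient.mk β ∧
    (α : Cochain P.complex Q.complex 0).v 0 0 (add_zero 0) ≫ Q.ε = P.ε ∧
    (β : Cochain Q.complex P.complex 0).v 0 0 (add_zero 0) ≫ P.ε = Q.ε := by
  obtain ⟨α, hα⟩ := exists_cocycle P Q
  obtain ⟨β, hβ⟩ := exists_cocycle Q P
  refine ⟨α, β, ⟨Submodule.Quotient.mk α, Submodule.Quotient.mk β, ?_, ?_⟩, rfl, rfl, hα, hβ⟩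
  · rw [cohProd_mk]
    refine mk_eq_of_v_comp_eq P P 0 (add_zero 0) _ _ ?_
    rw [coe_cocycleProd, prod_apply, Cochain.comp_v _ _ _ 0 0 0 (by simp) (by simp)]
    simp [hα, hβ]
  · rw [cohProd_mk]
    refine mk_eq_of_v_comp_eq Q Q 0 (add_zero 0) _ _ ?_
    rw [coe_cocycleProd, prod_apply, Cochain.comp_v _ _ _ 0 0 0 (by simp) (by simp)]
    simp [hα, hβ]

end CompleteResolution

/-! ### The monomials of an explicit complete resolution -/

/-- The monomials `t^a e_n` in the resolution (`pos = true`) and in the coresolution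
(`pos = false`) of the trivial module. -/
@[ext] structure TateMonomial (r : ℕ) where
  pos : Bool
  n : Fin r → ℤ
  a : Fin r → ℕ

namespace TateMonomial

variable {r : ℕ}

/-- The monomial with prescribed exponents in the coordinate `i`. -/
def set (b : TateMonomial r) (i : Fin r) (x : ℤ) (c : ℕ) : TateMonomial r :=
  ⟨b.pos, Function.update b.n i x, Function.update b.a i c⟩

@[simp] theorem set_pos (b : TateMonomial r) (i : Fin r) (x : ℤ) (c : ℕ) :
    (b.set i x c).pos = b.pos := rfl
@[simp] theorem set_n (b : TateMonomial r) (i : Fin r) (x : ℤ) (c : ℕ) :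
    (b.set i x c).n i = x := by simp [set]
@[simp] theorem set_a (b : TateMonomial r) (i : Fin r) (x : ℤ) (c : ℕ) :
    (b.set i x c).a i = c := by simp [set]
theorem set_n_ne (b : TateMonomial r) {i j : Fin r} (h : j ≠ i) (x : ℤ) (c : ℕ) :
    (b.set i x c).n j = b.n j := by simp [set, h]
theorem set_a_ne (b : TateMonomial r) {i j : Fin r} (h : j ≠ i) (x : ℤ) (c : ℕ) :
    (b.set i x c).a j = b.a j := by simp [set, h]
@[simp] theorem set_set (b : TateMonomial r) (i : Fin r) (x x' : ℤ) (c c' : ℕ) :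
    (b.set i x c).set i x' c' = b.set i x' c' := by simp [set]
@[simp] theorem set_self (b : TateMonomial r) (i : Fin r) : b.set i (b.n i) (b.a i) = b := by
  simp [set]
theorem set_comm (b : TateMonomial r) {i j : Fin r} (h : i ≠ j) (x x' : ℤ) (c c' : ℕ) :
    (b.set i x c).set j x' c' = (b.set j x' c').set i x c := by
  simp [set, Function.update_comm h]

/-- The cohomological degree of a monomial. -/
def deg (b : TateMonomial r) : ℤ := -(∑ i, b.n i) - if b.pos then 0 else (r : ℤ) - 1

theorem sum_set_n (b : TateMonomial r) (i : Fin r) (x : ℤ) (c : ℕ) :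
    ∑ j, (b.set i x c).n j = ∑ j, b.n j + (x - b.n i) := by
  rw [show (b.set i x c).n = Function.update b.n i x from rfl,
    Finset.sum_update_of_mem (Finset.mem_univ i), ← Finset.add_sum_erase _ b.n (Finset.mem_univ i),
    Finset.sdiff_singleton_eq_erase]
  ring

theorem deg_set (b : TateMonomial r) (i : Fin r) (x : ℤ) (c : ℕ) :
    (b.set i x c).deg = b.deg - (x - b.n i) := by
  rw [deg, deg, sum_set_n, set_pos]
  ring

variable (m : Fin r → ℕ)

/-- The weight of a monomial. -/
def wt (b : TateMonomial r) : Fin r → ℤ := fun i => b.a i + m i * (b.n i / 2) + b.n i % 2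

theorem wt_set (b : TateMonomial r) (i : Fin r) (x : ℤ) (c : ℕ) :
    (b.set i x c).wt m = Function.update (b.wt m) i (c + m i * (x / 2) + x % 2) := by
  funext j
  by_cases h : j = i
  · subst h; simp [wt]
  · simp [wt, h, set_n_ne, set_a_ne]

/-- The monomials which occur in the complete resolution. -/
def Valid (b : TateMonomial r) : Prop :=
  (∀ i, b.a i < m i) ∧ (b.pos = true → ∀ i, 0 ≤ b.n i) ∧ (b.pos = false → ∀ i, b.n i < 0)

variable {m} in
theorem Valid.set {b : TateMonomial r} (hb : b.Valid m) (i : Fin r) (x : ℤ) (c : ℕ) (hc : c < m i)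
    (hx : b.pos = true → 0 ≤ x) (hx' : b.pos = false → x < 0) : (b.set i x c).Valid m := by
  refine ⟨fun j => ?_, fun h j => ?_, fun h j => ?_⟩ <;> by_cases hj : j = i
  · subst hj; simpa
  · rw [set_a_ne _ hj]; exact hb.1 j
  · subst hj; simpa using hx h
  · rw [set_n_ne _ hj]; exact hb.2.1 h j
  · subst hj; simpa using hx' h
  · rw [set_n_ne _ hj]; exact hb.2.2 h j

/-- The generator of the resolution in degree `0`. -/
def bot (r : ℕ) : TateMonomial r := ⟨true, 0, 0⟩

/-- The socle element of the coresolution in degree `1`. -/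
def top : TateMonomial r := ⟨false, fun _ => -1, fun i => m i - 1⟩

theorem bot_ne_top : bot r ≠ top m := fun h => by simpa [bot, top] using congrArg pos h

theorem deg_bot : (bot r).deg = 0 := by simp [bot, deg]
theorem deg_top : (top m).deg = 1 := by simp [top, deg]
theorem wt_bot : (bot r).wt m = 0 := by funext i; simp [wt, bot]
theorem wt_top (hm : ∀ i, 2 ≤ m i) : (top m).wt m = 0 := by
  funext i
  have := hm i
  simp only [wt, top, Pi.zero_apply]
  push_cast [show 1 ≤ m i by omega]
  norm_num
  ring

theorem valid_bot (hm : ∀ i, 2 ≤ m i) : (bot r).Valid m :=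
  ⟨fun i => by have := hm i; simp [bot]; omega, fun _ i => by simp [bot], fun h => by simp [bot] at h⟩

theorem valid_top (hm : ∀ i, 2 ≤ m i) : (top m).Valid m :=
  ⟨fun i => by have := hm i; simp [top]; omega, fun h => by simp [top] at h, fun _ i => by simp [top]⟩

variable {m} in
-- In the resolution every summand of the weight is non-negative. In the coresolution `a_i < m_i`
-- makes the weight negative unless `n_i = -1` and `a_i = m_i - 1`. These two monomials are the ones
-- on which no coordinate can be contracted.
theorem Valid.wt_eq_zero {b : TateMonomial r} (hb : b.Valid m) (hw : b.wt m = 0) :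
    b = bot r ∨ b = top m := by
  have hw' : ∀ i, (b.a i : ℤ) + m i * (b.n i / 2) + b.n i % 2 = 0 := fun i => congrFun hw i
  rcases hp : b.pos with _ | _
  · right
    have : ∀ i, b.n i = -1 ∧ b.a i = m i - 1 := by
      intro i
      have h1 := hb.1 i
      have h2 := hb.2.2 hp i
      have h3 := hw' i
      have h4 : b.n i / 2 = -1 := by
        by_contra h
        have : b.n i / 2 ≤ -2 := by omega
        nlinarith [Int.emod_lt_of_pos (b.n i) (show (0:ℤ) < 2 by norm_num)]
      rw [h4] at h3
      omega
    ext i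
    · simp [hp, top]
    · exact (this i).1
    · exact (this i).2
  · left
    have : ∀ i, b.n i = 0 ∧ b.a i = 0 := by
      intro i
      have h1 := hb.1 i
      have h2 := hb.2.1 hp i
      have h3 := hw' i
      have h4 : 0 ≤ b.n i / 2 := by omega
      have h6 : 0 ≤ (m i : ℤ) * (b.n i / 2) := by positivity
      have h7 : (m i : ℤ) * (b.n i / 2) = 0 := by omega
      rcases mul_eq_zero.1 h7 with h | h <;> omega
    ext i
    · simp [hp, bot]
    · exact (this i).1
    · exact (this i).2

end TateMonomial

/-! ### Operators on the span of the monomials -/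

open TateMonomial

/-- The span of all monomials. -/
abbrev TateSpan (k : Type u) [Field k] (r : ℕ) : Type u := TateMonomial r →₀ k

namespace TateSpan

variable {k : Type u} [Field k] {r : ℕ}

/-- The linear map with prescribed values on the monomials. -/
noncomputable def lift {V : Type*} [AddCommGroup V] [Module k V] (f : TateMonomial r → V) :
    TateSpan k r →ₗ[k] V := Finsupp.linearCombination k f

@[simp] theorem lift_single {V : Type*} [AddCommGroup V] [Module k V] (f : TateMonomial r → V)
    (b : TateMonomial r) : lift f (Finsupp.single b (1 : k)) = f b := by
  simp [lift]

theorem hom_ext {V : Type*} [AddCommGroup V] [Module k V] {f g : TateSpan k r →ₗ[k] V}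
    (h : ∀ b, f (Finsupp.single b 1) = g (Finsupp.single b 1)) : f = g :=
  Finsupp.lhom_ext' fun b => LinearMap.ext_ring (h b)

/-- The value on a monomial of the operator given by a partial map on the exponents of the
coordinate `i`, with sign. -/
noncomputable def locFun (k : Type u) [Field k] (ε : ℤˣ) (φ : Bool → ℤ → ℕ → Option (ℤ × ℕ))
    (i : Fin r) (b : TateMonomial r) : TateSpan k r :=
  match φ b.pos (b.n i) (b.a i) with
  | none => 0
  | some y => (ε ^ (∑ j ∈ Finset.Iio i, b.n j)) • Finsupp.single (b.set i y.1 y.2) 1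

/-- The operator given by a partial map on the exponents of the coordinate `i`. -/
noncomputable def loc (k : Type u) [Field k] (ε : ℤˣ) (φ : Bool → ℤ → ℕ → Option (ℤ × ℕ))
    (i : Fin r) : TateSpan k r →ₗ[k] TateSpan k r := lift (locFun k ε φ i)

variable {ε : ℤˣ} {φ ψ : Bool → ℤ → ℕ → Option (ℤ × ℕ)} {i j : Fin r} {b : TateMonomial r}

theorem loc_none (h : φ b.pos (b.n i) (b.a i) = none) :
    loc k ε φ i (Finsupp.single b 1) = 0 := by
  rw [loc, lift_single, locFun, h]

theorem loc_some {x : ℤ} {c : ℕ} (h : φ b.pos (b.n i) (b.a i) = some (x, c)) :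
    loc k ε φ i (Finsupp.single b 1) =
      (ε ^ (∑ j ∈ Finset.Iio i, b.n j)) • Finsupp.single (b.set i x c) 1 := by
  rw [loc, lift_single, locFun, h]

theorem map_units_smul {V W : Type*} [AddCommGroup V] [Module k V] [AddCommGroup W] [Module k W]
    (f : V →ₗ[k] W) (e : ℤˣ) (x : V) : f (e • x) = e • f x := by
  rcases Int.units_eq_one_or e with rfl | rfl <;> simp

theorem sum_Iio_set_of_le (h : i ≤ j) (x : ℤ) (c : ℕ) :
    ∑ l ∈ Finset.Iio i, (b.set j x c).n l = ∑ l ∈ Finset.Iio i, b.n l :=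
  Finset.sum_congr rfl fun l hl => set_n_ne _ (by
    rintro rfl
    exact absurd (Finset.mem_Iio.1 hl) (not_lt.2 h)) _ _

theorem sum_Iio_set_of_lt (h : j < i) (x : ℤ) (c : ℕ) :
    ∑ l ∈ Finset.Iio i, (b.set j x c).n l = ∑ l ∈ Finset.Iio i, b.n l + (x - b.n j) := by
  have hj : j ∈ Finset.Iio i := Finset.mem_Iio.2 h
  rw [show (b.set j x c).n = Function.update b.n j x from rfl,
    Finset.sum_update_of_mem hj, ← Finset.add_sum_erase _ b.n hj,
    Finset.sdiff_singleton_eq_erase]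
  ring

/-- Composition of operators in the same coordinate. -/
theorem loc_loc_same (b : TateMonomial r) (i : Fin r) :
    loc k ε φ i (loc k ε ψ i (Finsupp.single b 1)) =
      loc k 1 (fun s x c => (ψ s x c).bind fun y => φ s y.1 y.2) i (Finsupp.single b 1) := by
  rcases h : ψ b.pos (b.n i) (b.a i) with _ | ⟨x, c⟩
  · rw [loc_none h, loc_none (by rw [h]; rfl), map_zero]
  · rw [loc_some h, map_units_smul]
    rcases h' : φ b.pos x c with _ | ⟨x', c'⟩
    · rw [loc_none (by simpa using h'), loc_none (by rw [h]; simpa using h'), smul_zero]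
    · rw [loc_some (x := x') (c := c') (by simpa using h'),
        loc_some (x := x') (c := c') (by rw [h]; simpa using h'),
        sum_Iio_set_of_le le_rfl, smul_smul, Int.units_mul_self, set_set, one_zpow]

theorem zpow_odd_add (a b : ℤ) (h : Odd b) : (-1 : ℤˣ) ^ (a + b) = -(-1) ^ a := by
  rw [zpow_add, h.neg_one_zpow]
  simp

/-- Signed operators of odd degree in different coordinates anticommute. -/
theorem loc_anticomm (hφ : ∀ s x c y, φ s x c = some y → Odd (y.1 - x))
    (hψ : ∀ s x c y, ψ s x c = some y → Odd (y.1 - x)) (hij : i ≠ j) (b : TateMonomial r) :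
    loc k (-1) φ i (loc k (-1) ψ j (Finsupp.single b 1)) =
      - loc k (-1) ψ j (loc k (-1) φ i (Finsupp.single b 1)) := by
  rcases h : ψ b.pos (b.n j) (b.a j) with _ | ⟨x, c⟩ <;>
  rcases h' : φ b.pos (b.n i) (b.a i) with _ | ⟨x', c'⟩
  · rw [loc_none h, loc_none h', map_zero, map_zero, neg_zero]
  · rw [loc_none h, loc_some h', map_zero, map_units_smul,
      loc_none (by simpa [set_n_ne _ hij.symm, set_a_ne _ hij.symm] using h), smul_zero, neg_zero]
  · rw [loc_none h', loc_some h, map_zero, map_units_smul,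
      loc_none (by simpa [set_n_ne _ hij, set_a_ne _ hij] using h'), smul_zero, neg_zero]
  · rw [loc_some h, loc_some h', map_units_smul, map_units_smul,
      loc_some (x := x') (c := c') (by simpa [set_n_ne _ hij, set_a_ne _ hij] using h'),
      loc_some (x := x) (c := c) (by simpa [set_n_ne _ hij.symm, set_a_ne _ hij.symm] using h),
      set_comm _ hij, smul_smul, smul_smul, ← Units.neg_smul]
    congr 1
    rcases lt_or_gt_of_ne hij with hlt | hlt
    · rw [sum_Iio_set_of_le hlt.le, sum_Iio_set_of_lt hlt, zpow_odd_add _ _ (hφ _ _ _ _ h')]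
      rw [mul_neg, neg_neg, mul_comm]
    · rw [sum_Iio_set_of_le hlt.le, sum_Iio_set_of_lt hlt, zpow_odd_add _ _ (hψ _ _ _ _ h)]
      rw [mul_neg, mul_comm]

/-- Unsigned operators of degree zero commute with operators in different coordinates. -/
theorem loc_comm (hφ : ∀ s x c y, φ s x c = some y → y.1 = x) (hij : i ≠ j) (b : TateMonomial r) :
    loc k 1 φ i (loc k ε ψ j (Finsupp.single b 1)) =
      loc k ε ψ j (loc k 1 φ i (Finsupp.single b 1)) := by
  rcases h : ψ b.pos (b.n j) (b.a j) with _ | ⟨x, c⟩ <;>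
  rcases h' : φ b.pos (b.n i) (b.a i) with _ | ⟨x', c'⟩
  · rw [loc_none h, loc_none h', map_zero, map_zero]
  · rw [loc_none h, loc_some h', map_zero, map_units_smul,
      loc_none (by simpa [set_n_ne _ hij.symm, set_a_ne _ hij.symm] using h), smul_zero]
  · rw [loc_none h', loc_some h, map_zero, map_units_smul,
      loc_none (by simpa [set_n_ne _ hij, set_a_ne _ hij] using h'), smul_zero]
  · have hx := hφ _ _ _ _ h'
    dsimp only at hx
    rw [loc_some h, loc_some h', map_units_smul, map_units_smul,
      loc_some (x := x') (c := c') (by simpa [set_n_ne _ hij, set_a_ne _ hij] using h'),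
      loc_some (x := x) (c := c) (by simpa [set_n_ne _ hij.symm, set_a_ne _ hij.symm] using h),
      set_comm _ hij, smul_smul, smul_smul]
    congr 1
    rcases lt_or_gt_of_ne hij with hlt | hlt
    · rw [sum_Iio_set_of_lt hlt, hx]
      simp
    · rw [sum_Iio_set_of_le hlt.le]
      simp

end TateSpan

/-! ### The differential and the contracting homotopies of the coordinates -/

namespace TateSpan

open TateMonomial

variable {k : Type u} [Field k] {r : ℕ} {m : Fin r → ℕ}

/-- Multiplication by `t`, in one coordinate. -/
def tFun (m : ℕ) (_ : Bool) (x : ℤ) (c : ℕ) : Option (ℤ × ℕ) :=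
  if c + 1 < m then some (x, c + 1) else none

/-- The exponent of `t` in the differential. -/
def dExp (m : ℕ) (x : ℤ) : ℕ := if x % 2 = 1 then 1 else m - 1

/-- The differential in one coordinate. -/
def dFun (m : ℕ) (s : Bool) (x : ℤ) (c : ℕ) : Option (ℤ × ℕ) :=
  if (s = true ∧ x = 0) ∨ m ≤ c + dExp m x then none else some (x - 1, c + dExp m x)

/-- The contracting homotopy in one coordinate. -/
def hFun (m : ℕ) (s : Bool) (x : ℤ) (c : ℕ) : Option (ℤ × ℕ) :=
  if x % 2 = 0 ∧ 1 ≤ c then some (x + 1, c - 1)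
  -- The exception is the element `t^(m-1) e_{-1}`, whose image would have exponent `0` and leave
  -- the coresolution.
  else if x % 2 = 1 ∧ c + 1 = m ∧ ¬ (s = false ∧ x = -1) then some (x + 1, 0) else none

theorem tFun_eq {m : ℕ} (s : Bool) (x : ℤ) (c : ℕ) (y : ℤ × ℕ) (h : tFun m s x c = some y) :
    y.1 = x := by
  unfold tFun at h
  split_ifs at h
  simp only [Option.some.injEq] at h
  rw [← h]

theorem dFun_odd {m : ℕ} (s : Bool) (x : ℤ) (c : ℕ) (y : ℤ × ℕ) (h : dFun m s x c = some y) :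
    Odd (y.1 - x) := by
  unfold dFun at h
  split_ifs at h
  simp only [Option.some.injEq] at h
  rw [← h]
  exact ⟨-1, by ring⟩

theorem hFun_odd {m : ℕ} (s : Bool) (x : ℤ) (c : ℕ) (y : ℤ × ℕ) (h : hFun m s x c = some y) :
    Odd (y.1 - x) := by
  unfold hFun at h
  split_ifs at h <;>
  · simp only [Option.some.injEq] at h
    rw [← h]
    exact ⟨0, by ring⟩

variable (k m) in
/-- Multiplication by `t_i`. -/
noncomputable def t (i : Fin r) : TateSpan k r →ₗ[k] TateSpan k r := loc k 1 (tFun (m i)) i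

variable (k m) in
/-- The component of the differential in the coordinate `i`. -/
noncomputable def dCoord (i : Fin r) : TateSpan k r →ₗ[k] TateSpan k r :=
  loc k (-1) (dFun (m i)) i

variable (k m) in
/-- The contracting homotopy in the coordinate `i`. -/
noncomputable def hCoord (i : Fin r) : TateSpan k r →ₗ[k] TateSpan k r :=
  loc k (-1) (hFun (m i)) i

open Classical in
variable (k m) in
/-- The splicing map from the resolution to the coresolution. -/
noncomputable def splice : TateSpan k r →ₗ[k] TateSpan k r :=
  lift fun b => if b = bot r then Finsupp.single (top m) 1 else 0

variable (k m) in
/-- The differential. -/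
noncomputable def d : TateSpan k r →ₗ[k] TateSpan k r := ∑ i, dCoord k m i + splice k m

theorem d_apply (x : TateSpan k r) : d k m x = ∑ i, dCoord k m i x + splice k m x := by
  simp [d]

theorem splice_bot : splice k m (Finsupp.single (bot r) 1) = Finsupp.single (top m) 1 := by
  simp [splice]

theorem splice_of_ne {b : TateMonomial r} (h : b ≠ bot r) :
    splice k m (Finsupp.single b 1) = 0 := by
  simp [splice, h]

theorem t_of_lt {i : Fin r} {b : TateMonomial r} (h : b.a i + 1 < m i) :
    t k m i (Finsupp.single b 1) = Finsupp.single (b.set i (b.n i) (b.a i + 1)) 1 := by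
  rw [t, loc_some (x := b.n i) (c := b.a i + 1) (by simp [tFun, h]), one_zpow, one_smul]

theorem t_of_le {i : Fin r} {b : TateMonomial r} (h : m i ≤ b.a i + 1) :
    t k m i (Finsupp.single b 1) = 0 := by
  rw [t, loc_none (by simp [tFun, h])]

theorem dCoord_of_lt {i : Fin r} {b : TateMonomial r} (h : b.a i + dExp (m i) (b.n i) < m i)
    (h' : b.pos = true → b.n i ≠ 0) : dCoord k m i (Finsupp.single b 1) =
      ((-1) ^ (∑ j ∈ Finset.Iio i, b.n j) : ℤˣ) •
        Finsupp.single (b.set i (b.n i - 1) (b.a i + dExp (m i) (b.n i))) 1 := by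
  rw [dCoord, loc_some (x := b.n i - 1) (c := b.a i + dExp (m i) (b.n i))]
  rw [dFun, if_neg]
  rintro (⟨h1, h2⟩ | h1)
  · exact h' h1 h2
  · omega

theorem dCoord_of_le {i : Fin r} {b : TateMonomial r} (h : m i ≤ b.a i + dExp (m i) (b.n i)) :
    dCoord k m i (Finsupp.single b 1) = 0 := by
  rw [dCoord, loc_none]
  rw [dFun, if_pos (Or.inr h)]

theorem dCoord_of_eq_zero {i : Fin r} {b : TateMonomial r} (h : b.pos = true) (h' : b.n i = 0) :
    dCoord k m i (Finsupp.single b 1) = 0 := by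
  rw [dCoord, loc_none]
  rw [dFun, if_pos (Or.inl ⟨h, h'⟩)]

theorem dCoord_dCoord (i : Fin r) (x : TateSpan k r) : dCoord k m i (dCoord k m i x) = 0 := by
  suffices h : dCoord k m i ∘ₗ dCoord k m i = 0 from LinearMap.congr_fun h x
  refine hom_ext fun b => ?_
  rw [LinearMap.comp_apply, dCoord, loc_loc_same, loc_none]
  · rfl
  -- Two consecutive exponents are `1` and `m i - 1` in some order, and their sum exceeds every
  -- admissible exponent of `t_i`.
  · have : dExp (m i) (b.n i) + dExp (m i) (b.n i - 1) ≥ m i := by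
      unfold dExp; split_ifs <;> omega
    unfold dFun
    split_ifs with h
    · rfl
    · rw [Option.bind_some, if_pos (Or.inr _)]
      dsimp only
      omega

theorem dCoord_anticomm {i j : Fin r} (h : i ≠ j) (x : TateSpan k r) :
    dCoord k m i (dCoord k m j x) = - dCoord k m j (dCoord k m i x) := by
  suffices h : dCoord k m i ∘ₗ dCoord k m j = -(dCoord k m j ∘ₗ dCoord k m i) from
    LinearMap.congr_fun h x
  exact hom_ext fun b => loc_anticomm dFun_odd dFun_odd h b

theorem dCoord_hCoord_anticomm {i j : Fin r} (h : i ≠ j) (x : TateSpan k r) :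
    dCoord k m i (hCoord k m j x) = - hCoord k m j (dCoord k m i x) := by
  suffices h : dCoord k m i ∘ₗ hCoord k m j = -(hCoord k m j ∘ₗ dCoord k m i) from
    LinearMap.congr_fun h x
  exact hom_ext fun b => loc_anticomm dFun_odd hFun_odd h b

theorem t_comm (i j : Fin r) (x : TateSpan k r) : t k m i (t k m j x) = t k m j (t k m i x) := by
  suffices h : t k m i ∘ₗ t k m j = t k m j ∘ₗ t k m i from LinearMap.congr_fun h x
  by_cases h : i = j
  · rw [h]
  · exact hom_ext fun b => loc_comm tFun_eq h b

theorem t_dCoord (i j : Fin r) (x : TateSpan k r) :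
    t k m i (dCoord k m j x) = dCoord k m j (t k m i x) := by
  suffices h : t k m i ∘ₗ dCoord k m j = dCoord k m j ∘ₗ t k m i from LinearMap.congr_fun h x
  by_cases h : i = j
  · subst h
    refine hom_ext fun b => ?_
    rw [LinearMap.comp_apply, LinearMap.comp_apply]
    by_cases h0 : b.pos = true ∧ b.n i = 0
    · rw [dCoord_of_eq_zero h0.1 h0.2, map_zero]
      rcases lt_or_ge (b.a i + 1) (m i) with h1 | h1
      · rw [t_of_lt h1, dCoord_of_eq_zero (by simpa using h0.1) (by simpa using h0.2)]
      · rw [t_of_le h1, map_zero]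
    · have h0' : b.pos = true → b.n i ≠ 0 := fun h1 h2 => h0 ⟨h1, h2⟩
      rcases lt_or_ge (b.a i + dExp (m i) (b.n i) + 1) (m i) with h1 | h1
      · rw [dCoord_of_lt (by omega) h0', map_units_smul, t_of_lt (by simpa using h1),
          t_of_lt (by omega), dCoord_of_lt (by simp; omega) (by simpa using h0'),
          sum_Iio_set_of_le le_rfl]
        simp [add_right_comm]
      · have h2 : t k m i (dCoord k m i (Finsupp.single b 1)) = 0 := by
          rcases lt_or_ge (b.a i + dExp (m i) (b.n i)) (m i) with h2 | h2
          · rw [dCoord_of_lt h2 h0', map_units_smul, t_of_le (by simpa using h1), smul_zero]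
          · rw [dCoord_of_le h2, map_zero]
        rw [h2]
        rcases lt_or_ge (b.a i + 1) (m i) with h3 | h3
        · rw [t_of_lt h3, dCoord_of_le (by simp; omega)]
        · rw [t_of_le h3, map_zero]
  · exact hom_ext fun b => loc_comm tFun_eq h b

theorem dExp_pos {m : ℕ} (hm : 2 ≤ m) (x : ℤ) : 1 ≤ dExp m x := by
  unfold dExp; split_ifs <;> omega

variable (hm : ∀ i, 2 ≤ m i)
include hm

omit hm in
theorem splice_t (i : Fin r) (x : TateSpan k r) : splice k m (t k m i x) = 0 := by
  suffices h : splice k m ∘ₗ t k m i = 0 from LinearMap.congr_fun h x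
  refine hom_ext fun b => ?_
  rw [LinearMap.comp_apply]
  rcases lt_or_ge (b.a i + 1) (m i) with h1 | h1
  · rw [t_of_lt h1, splice_of_ne]
    · rfl
    · intro h
      simpa [bot] using congrArg (fun b => b.a i) h
  · rw [t_of_le h1, map_zero]; rfl

theorem t_splice (i : Fin r) (x : TateSpan k r) : t k m i (splice k m x) = 0 := by
  suffices h : t k m i ∘ₗ splice k m = 0 from LinearMap.congr_fun h x
  refine hom_ext fun b => ?_
  rw [LinearMap.comp_apply]
  by_cases h : b = bot r
  · rw [h, splice_bot, t_of_le (by have := hm i; simp [top]; omega)]; rfl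
  · rw [splice_of_ne h, map_zero]; rfl

theorem splice_dCoord (i : Fin r) (x : TateSpan k r) : splice k m (dCoord k m i x) = 0 := by
  suffices h : splice k m ∘ₗ dCoord k m i = 0 from LinearMap.congr_fun h x
  refine hom_ext fun b => ?_
  rw [LinearMap.comp_apply]
  by_cases h0 : b.pos = true ∧ b.n i = 0
  · rw [dCoord_of_eq_zero h0.1 h0.2, map_zero]; rfl
  rcases lt_or_ge (b.a i + dExp (m i) (b.n i)) (m i) with h1 | h1
  · rw [dCoord_of_lt h1 (fun h1 h2 => h0 ⟨h1, h2⟩), map_units_smul, splice_of_ne, smul_zero]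
    · rfl
    · intro h
      have h2 := congrArg (fun b => b.a i) h
      have := dExp_pos (hm i) (b.n i)
      simp only [set_a, bot, Pi.zero_apply] at h2
      omega
  · rw [dCoord_of_le h1, map_zero]; rfl

theorem dCoord_splice (i : Fin r) (x : TateSpan k r) : dCoord k m i (splice k m x) = 0 := by
  suffices h : dCoord k m i ∘ₗ splice k m = 0 from LinearMap.congr_fun h x
  refine hom_ext fun b => ?_
  rw [LinearMap.comp_apply]
  by_cases h : b = bot r
  · rw [h, splice_bot, dCoord_of_le]
    · rfl
    · have := hm i
      simp [top, dExp]
      omega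
  · rw [splice_of_ne h, map_zero]; rfl

omit hm in
theorem splice_splice (x : TateSpan k r) : splice k m (splice k m x) = 0 := by
  suffices h : splice k m ∘ₗ splice k m = 0 from LinearMap.congr_fun h x
  refine hom_ext fun b => ?_
  rw [LinearMap.comp_apply]
  by_cases h : b = bot r
  · rw [h, splice_bot, splice_of_ne (bot_ne_top m).symm]; rfl
  · rw [splice_of_ne h, map_zero]; rfl

theorem d_d (x : TateSpan k r) : d k m (d k m x) = 0 := by
  have h1 : ∑ i, ∑ j, dCoord k m i (dCoord k m j x) = 0 := by
    rw [← Finset.sum_product']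
    -- Interchanging the indices pairs the mixed terms, which cancel by anticommutation; the fixed
    -- terms are squares and vanish.
    refine Finset.sum_involution (fun p _ => (p.2, p.1)) ?_ ?_ (by simp) (by simp)
    · rintro ⟨i, j⟩ -
      by_cases h : i = j
      · subst h; simp [dCoord_dCoord]
      · simp [dCoord_anticomm h]
    · rintro ⟨i, j⟩ - h h'
      obtain rfl : j = i := by simpa using congrArg Prod.fst h'
      exact h (dCoord_dCoord _ _)
  rw [d_apply, d_apply]
  simp [splice_dCoord hm, dCoord_splice hm, splice_splice, h1]

theorem t_d (i : Fin r) (x : TateSpan k r) : t k m i (d k m x) = d k m (t k m i x) := by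
  rw [d_apply, d_apply]
  simp [splice_t, t_splice hm, t_dCoord]

omit hm in
theorem hCoord_of_even {i : Fin r} {b : TateMonomial r} (h : b.n i % 2 = 0) (h' : 1 ≤ b.a i) :
    hCoord k m i (Finsupp.single b 1) = ((-1) ^ (∑ j ∈ Finset.Iio i, b.n j) : ℤˣ) •
        Finsupp.single (b.set i (b.n i + 1) (b.a i - 1)) 1 := by
  rw [hCoord, loc_some (x := b.n i + 1) (c := b.a i - 1) (by simp [hFun, h, h'])]

omit hm in
theorem hCoord_of_odd {i : Fin r} {b : TateMonomial r} (h : b.n i % 2 = 1) (h' : b.a i + 1 = m i)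
    (h'' : ¬ (b.pos = false ∧ b.n i = -1)) :
    hCoord k m i (Finsupp.single b 1) = ((-1) ^ (∑ j ∈ Finset.Iio i, b.n j) : ℤˣ) •
        Finsupp.single (b.set i (b.n i + 1) 0) 1 := by
  rw [hCoord, loc_some (x := b.n i + 1) (c := 0)]
  rw [hFun, if_neg (by omega), if_pos ⟨h, h', h''⟩]

omit hm in
theorem hCoord_eq_zero {i : Fin r} {b : TateMonomial r} (h1 : b.n i % 2 = 0 → b.a i = 0)
    (h2 : b.n i % 2 = 1 → b.a i + 1 = m i → b.pos = false ∧ b.n i = -1) :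
    hCoord k m i (Finsupp.single b 1) = 0 := by
  rw [hCoord, loc_none]
  rw [hFun, if_neg (fun h => by have := h1 h.1; omega),
    if_neg (fun h => h.2.2 (h2 h.1 h.2.1))]

/-- Multiplication by `t` and by `t^(m-1)` alternate, so in one coordinate the differential matches
monomials in pairs and the homotopy is the inverse matching. Exactly one of the two summands is
non-zero. Only weight zero contains unmatched monomials, created by truncation at `n_i = 0` and at
`n_i = -1`. -/
theorem dCoord_hCoord_add {i : Fin r} {b : TateMonomial r} (hb : b.Valid m) (hw : b.wt m i ≠ 0) :
    dCoord k m i (hCoord k m i (Finsupp.single b 1)) +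
      hCoord k m i (dCoord k m i (Finsupp.single b 1)) = Finsupp.single b 1 := by
  have hmi := hm i
  have ha := hb.1 i
  have hn := hb.2.1
  have hn' := hb.2.2
  have hw' : ¬ ((b.a i : ℤ) + m i * (b.n i / 2) + b.n i % 2 = 0) := hw
  rcases Int.emod_two_eq_zero_or_one (b.n i) with he | he
  · have hexp : dExp (m i) (b.n i) = m i - 1 := by rw [dExp, if_neg (by omega)]
    rcases Nat.eq_zero_or_pos (b.a i) with h0 | h0
    · rw [hCoord_eq_zero (fun _ => h0) (by omega), map_zero, zero_add]
      have hn0 : b.n i ≠ 0 := by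
        intro h
        apply hw'
        rw [h0, h]
        simp
      rw [dCoord_of_lt (by omega) (fun _ => hn0), map_units_smul, hexp,
        hCoord_of_odd (by simp; omega) (by simp; omega) (by
          rintro ⟨h1, h2⟩
          simp only [set_n] at h2
          exact hn0 (by omega)), sum_Iio_set_of_le le_rfl, smul_smul, Int.units_mul_self, one_smul,
        set_set, set_n, sub_add_cancel, ← h0, set_self]
    · rw [hCoord_of_even he h0, map_units_smul]
      have he' : dExp (m i) (b.n i + 1) = 1 := by rw [dExp, if_pos (by omega)]
      have h2 : dCoord k m i (Finsupp.single b (1 : k)) = 0 := by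
        exact dCoord_of_le (by omega)
      rw [h2, map_zero, add_zero, dCoord_of_lt (by simp [he']; omega) (by
        intro _; simp; omega), sum_Iio_set_of_le le_rfl, smul_smul, Int.units_mul_self, one_smul,
        set_set, set_n, set_a, he', add_sub_cancel_right, Nat.sub_add_cancel h0, set_self]
  · have hexp : dExp (m i) (b.n i) = 1 := by rw [dExp, if_pos he]
    rcases lt_or_ge (b.a i + 1) (m i) with h0 | h0
    · rw [hCoord_eq_zero (by omega) (by omega), map_zero, zero_add,
        dCoord_of_lt (by omega) (by omega), map_units_smul, hexp,
        hCoord_of_even (by simp; omega) (by simp), sum_Iio_set_of_le le_rfl, smul_smul,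
        Int.units_mul_self, one_smul, set_set, set_n, set_a, sub_add_cancel,
        Nat.add_sub_cancel, set_self]
    · have h1 : ¬ (b.pos = false ∧ b.n i = -1) := by
        rintro ⟨-, h⟩
        apply hw'
        rw [h]
        norm_num
        omega
      have he' : dExp (m i) (b.n i + 1) = m i - 1 := by rw [dExp, if_neg (by omega)]
      rw [hCoord_of_odd he (by omega) h1, map_units_smul,
        dCoord_of_le (b := b) (by omega), map_zero, add_zero,
        dCoord_of_lt (by simp [he']; omega) (by
          intro h2
          have := hn h2 i
          simp
          omega), sum_Iio_set_of_le le_rfl, smul_smul, Int.units_mul_self, one_smul, set_set,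
        set_n, set_a, he', add_sub_cancel_right, zero_add, show m i - 1 = b.a i by omega, set_self]

end TateSpan

/-! ### Gradings and exactness of the spliced complex -/

namespace TateSpan

open TateMonomial

variable {k : Type u} [Field k] {r : ℕ} {m : Fin r → ℕ}

theorem map_mem_supported {V : Type*} [AddCommGroup V] [Module k V] {f : TateSpan k r →ₗ[k] V}
    {s : Set (TateMonomial r)} {N : Submodule k V} (h : ∀ b ∈ s, f (Finsupp.single b 1) ∈ N)
    {x : TateSpan k r} (hx : x ∈ Finsupp.supported k k s) : f x ∈ N := by
  rw [Finsupp.supported_eq_span_single] at hx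
  have : Submodule.span k ((fun i => Finsupp.single i (1 : k)) '' s) ≤ N.comap f := by
    rw [Submodule.span_le]
    rintro _ ⟨b, hb, rfl⟩
    exact h b hb
  exact this hx

theorem eqOn_supported {V : Type*} [AddCommGroup V] [Module k V] {f g : TateSpan k r →ₗ[k] V}
    {s : Set (TateMonomial r)} (h : ∀ b ∈ s, f (Finsupp.single b 1) = g (Finsupp.single b 1))
    {x : TateSpan k r} (hx : x ∈ Finsupp.supported k k s) : f x = g x := by
  have := map_mem_supported (f := f - g) (N := ⊥) (fun b hb => by simp [h b hb]) hx
  simpa [sub_eq_zero] using this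

theorem units_smul_single_mem {s : Set (TateMonomial r)} (e : ℤˣ) {b : TateMonomial r}
    (h : b ∈ s) : e • Finsupp.single b (1 : k) ∈ Finsupp.supported k k s := by
  have := Finsupp.single_mem_supported k (1 : k) h
  rcases Int.units_eq_one_or e with rfl | rfl
  · simpa using this
  · simpa using neg_mem this

/-! #### Weights -/

variable (k m) in
/-- The elements of weight `w`. -/
def wtSpace (w : Fin r → ℤ) : Submodule k (TateSpan k r) :=
  Finsupp.supported k k {b | b.wt m = w}

theorem single_mem_wtSpace (b : TateMonomial r) : Finsupp.single b (1 : k) ∈ wtSpace k m (b.wt m) :=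
  Finsupp.single_mem_supported k (1 : k) (by rfl)

theorem t_mem_wtSpace (i : Fin r) {w : Fin r → ℤ} {x : TateSpan k r} (hx : x ∈ wtSpace k m w) :
    t k m i x ∈ wtSpace k m (w + Pi.single i 1) := by
  refine map_mem_supported ?_ hx
  rintro b rfl
  rcases lt_or_ge (b.a i + 1) (m i) with h | h
  · rw [t_of_lt h]
    refine Finsupp.single_mem_supported k (1 : k) ?_
    change (b.set i _ _).wt m = _
    rw [wt_set]
    funext j
    by_cases hj : j = i
    · subst hj; simp [wt]; ring
    · simp [hj]
  · rw [t_of_le h]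
    exact zero_mem _

theorem wt_set_of_eq {b : TateMonomial r} {i : Fin r} {x : ℤ} {c : ℕ}
    (h : (c : ℤ) + m i * (x / 2) + x % 2 = b.a i + m i * (b.n i / 2) + b.n i % 2) :
    (b.set i x c).wt m = b.wt m := by
  rw [wt_set, h]
  exact Function.update_eq_self i (b.wt m)

theorem hCoord_mem_wtSpace (i : Fin r) {w : Fin r → ℤ} {x : TateSpan k r}
    (hx : x ∈ wtSpace k m w) : hCoord k m i x ∈ wtSpace k m w := by
  refine map_mem_supported ?_ hx
  rintro b rfl
  by_cases h1 : b.n i % 2 = 0 ∧ 1 ≤ b.a i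
  · rw [hCoord_of_even h1.1 h1.2]
    refine units_smul_single_mem _ (wt_set_of_eq ?_)
    rw [show (b.n i + 1) / 2 = b.n i / 2 by omega]
    omega
  · by_cases h2 : b.n i % 2 = 1 ∧ b.a i + 1 = m i ∧ ¬ (b.pos = false ∧ b.n i = -1)
    · rw [hCoord_of_odd h2.1 h2.2.1 h2.2.2]
      refine units_smul_single_mem _ (wt_set_of_eq ?_)
      rw [show (b.n i + 1) / 2 = b.n i / 2 + 1 by omega, mul_add]
      omega
    · rw [hCoord_eq_zero (fun h => by omega) (fun h h' => by
        by_contra h''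
        exact h2 ⟨h, h', h''⟩)]
      exact zero_mem _

variable (hm : ∀ i, 2 ≤ m i)
include hm

theorem dCoord_mem_wtSpace (i : Fin r) {w : Fin r → ℤ} {x : TateSpan k r}
    (hx : x ∈ wtSpace k m w) : dCoord k m i x ∈ wtSpace k m w := by
  refine map_mem_supported ?_ hx
  rintro b rfl
  by_cases h0 : b.pos = true ∧ b.n i = 0
  · rw [dCoord_of_eq_zero h0.1 h0.2]
    exact zero_mem _
  rcases lt_or_ge (b.a i + dExp (m i) (b.n i)) (m i) with h | h
  · rw [dCoord_of_lt h (fun h h' => h0 ⟨h, h'⟩)]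
    refine units_smul_single_mem _ (wt_set_of_eq ?_)
    have := hm i
    rcases Int.emod_two_eq_zero_or_one (b.n i) with he | he
    · rw [dExp, if_neg (by omega), show (b.n i - 1) / 2 = b.n i / 2 - 1 by omega, mul_sub]
      omega
    · rw [dExp, if_pos (by omega), show (b.n i - 1) / 2 = b.n i / 2 by omega]
      omega
  · rw [dCoord_of_le h]
    exact zero_mem _

theorem splice_mem_wtSpace {w : Fin r → ℤ} {x : TateSpan k r}
    (hx : x ∈ wtSpace k m w) : splice k m x ∈ wtSpace k m w := by
  refine map_mem_supported ?_ hx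
  rintro b rfl
  by_cases h : b = bot r
  · rw [h, splice_bot, wt_bot, ← wt_top m hm]
    exact single_mem_wtSpace _
  · rw [splice_of_ne h]
    exact zero_mem _

theorem d_mem_wtSpace {w : Fin r → ℤ} {x : TateSpan k r}
    (hx : x ∈ wtSpace k m w) : d k m x ∈ wtSpace k m w := by
  rw [d_apply]
  exact add_mem (sum_mem fun i _ => dCoord_mem_wtSpace hm i hx) (splice_mem_wtSpace hm hx)

omit hm

theorem splice_eq_zero {w : Fin r → ℤ} (hw : w ≠ 0) {x : TateSpan k r} (hx : x ∈ wtSpace k m w) :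
    splice k m x = 0 := by
  refine eqOn_supported (g := 0) ?_ hx
  rintro b rfl
  rw [splice_of_ne]
  · rfl
  · rintro rfl
    exact hw (wt_bot m)

/-! #### Degrees -/

variable (k m) in
/-- The part of the complete resolution of cohomological degree `n`. -/
def degSpace (n : ℤ) : Submodule k (TateSpan k r) :=
  Finsupp.supported k k {b | b.Valid m ∧ b.deg = n}

theorem single_mem_degSpace {b : TateMonomial r} {n : ℤ} (hb : b.Valid m) (hn : b.deg = n) :
    Finsupp.single b (1 : k) ∈ degSpace k m n :=
  Finsupp.single_mem_supported k (1 : k) ⟨hb, hn⟩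

theorem t_mem_degSpace (i : Fin r) {n : ℤ} {x : TateSpan k r} (hx : x ∈ degSpace k m n) :
    t k m i x ∈ degSpace k m n := by
  refine map_mem_supported ?_ hx
  rintro b ⟨hb, rfl⟩
  rcases lt_or_ge (b.a i + 1) (m i) with h | h
  · rw [t_of_lt h]
    exact single_mem_degSpace (hb.set i _ _ h (fun h => hb.2.1 h i) (fun h => hb.2.2 h i))
      (by rw [deg_set]; ring)
  · rw [t_of_le h]
    exact zero_mem _

theorem hCoord_mem_degSpace (i : Fin r) {n : ℤ} {x : TateSpan k r}
    (hx : x ∈ degSpace k m n) : hCoord k m i x ∈ degSpace k m (n - 1) := by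
  refine map_mem_supported ?_ hx
  rintro b ⟨hb, rfl⟩
  have ha := hb.1 i
  have hn := hb.2.1
  have hn' := hb.2.2
  by_cases h1 : b.n i % 2 = 0 ∧ 1 ≤ b.a i
  · rw [hCoord_of_even h1.1 h1.2]
    refine units_smul_single_mem _ ⟨hb.set i _ _ (by omega) (fun h => ?_) (fun h => ?_), ?_⟩
    · have := hn h i; omega
    · have := hn' h i; omega
    · rw [deg_set]; ring
  · by_cases h2 : b.n i % 2 = 1 ∧ b.a i + 1 = m i ∧ ¬ (b.pos = false ∧ b.n i = -1)
    · rw [hCoord_of_odd h2.1 h2.2.1 h2.2.2]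
      refine units_smul_single_mem _ ⟨hb.set i _ _ (by omega) (fun h => ?_) (fun h => ?_), ?_⟩
      · have := hn h i; omega
      · have h3 := hn' h i
        have h4 : b.n i ≠ -1 := fun h' => h2.2.2 ⟨h, h'⟩
        omega
      · rw [deg_set]; ring
    · rw [hCoord_eq_zero (fun h => by omega) (fun h h' => by
        by_contra h''
        exact h2 ⟨h, h', h''⟩)]
      exact zero_mem _

theorem dCoord_mem_degSpace (i : Fin r) {n : ℤ} {x : TateSpan k r}
    (hx : x ∈ degSpace k m n) : dCoord k m i x ∈ degSpace k m (n + 1) := by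
  refine map_mem_supported ?_ hx
  rintro b ⟨hb, rfl⟩
  by_cases h0 : b.pos = true ∧ b.n i = 0
  · rw [dCoord_of_eq_zero h0.1 h0.2]
    exact zero_mem _
  rcases lt_or_ge (b.a i + dExp (m i) (b.n i)) (m i) with h | h
  · have h0' : b.pos = true → b.n i ≠ 0 := fun h h' => h0 ⟨h, h'⟩
    rw [dCoord_of_lt h h0']
    refine units_smul_single_mem _ ⟨hb.set i _ _ h (fun h => ?_) (fun h => ?_), ?_⟩
    · have := hb.2.1 h i
      have := h0' h
      omega
    · have := hb.2.2 h i; omega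
    · rw [deg_set]; ring
  · rw [dCoord_of_le h]
    exact zero_mem _

include hm in
theorem splice_mem_degSpace {n : ℤ} {x : TateSpan k r}
    (hx : x ∈ degSpace k m n) : splice k m x ∈ degSpace k m (n + 1) := by
  refine map_mem_supported ?_ hx
  rintro b ⟨hb, rfl⟩
  by_cases h : b = bot r
  · subst h
    rw [splice_bot]
    exact single_mem_degSpace (valid_top m hm) (by rw [deg_top, deg_bot]; rfl)
  · rw [splice_of_ne h]
    exact zero_mem _

include hm in
theorem d_mem_degSpace {n : ℤ} {x : TateSpan k r}
    (hx : x ∈ degSpace k m n) : d k m x ∈ degSpace k m (n + 1) := by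
  rw [d_apply]
  exact add_mem (sum_mem fun i _ => dCoord_mem_degSpace i hx) (splice_mem_degSpace hm hx)

/-! #### Exactness -/

open Classical in
variable (k m) in
/-- The contracting homotopy. -/
noncomputable def contraction : TateSpan k r →ₗ[k] TateSpan k r :=
  lift fun b => if h : ∃ i, b.wt m i ≠ 0 then hCoord k m h.choose (Finsupp.single b 1)
    else if b = top m then Finsupp.single (bot r) 1 else 0

theorem contraction_eq {w : Fin r → ℤ} (hw : ∃ i, w i ≠ 0) {x : TateSpan k r}
    (hx : x ∈ wtSpace k m w) : contraction k m x = hCoord k m hw.choose x := by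
  refine eqOn_supported ?_ hx
  rintro b rfl
  rw [contraction, lift_single, dif_pos hw]

include hm

theorem contraction_top :
    contraction k m (Finsupp.single (top m) 1) = Finsupp.single (bot r) 1 := by
  rw [contraction, lift_single, dif_neg, if_pos rfl]
  rintro ⟨i, hi⟩
  exact hi (congrFun (wt_top m hm) i)

omit hm in
theorem contraction_bot : contraction k m (Finsupp.single (bot r) 1) = 0 := by
  rw [contraction, lift_single, dif_neg, if_neg (bot_ne_top m)]
  rintro ⟨i, hi⟩
  exact hi (congrFun (wt_bot m) i)

theorem d_top : d k m (Finsupp.single (top m) 1) = 0 := by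
  rw [← splice_bot, d_apply, splice_splice, add_zero]
  exact Finset.sum_eq_zero fun i _ => dCoord_splice hm i _

omit hm in
theorem d_bot : d k m (Finsupp.single (bot r) 1) = Finsupp.single (top m) 1 := by
  rw [d_apply, splice_bot, Finset.sum_eq_zero, zero_add]
  exact fun i _ => dCoord_of_eq_zero rfl rfl

theorem contraction_mem_degSpace {n : ℤ} {x : TateSpan k r} (hx : x ∈ degSpace k m n) :
    contraction k m x ∈ degSpace k m (n - 1) := by
  refine map_mem_supported ?_ hx
  rintro b ⟨hb, rfl⟩
  by_cases h : ∃ i, b.wt m i ≠ 0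
  · rw [contraction_eq h (single_mem_wtSpace b)]
    exact hCoord_mem_degSpace _ (single_mem_degSpace hb rfl)
  · have hw : b.wt m = 0 := by
      push Not at h
      exact funext h
    rcases hb.wt_eq_zero hw with rfl | rfl
    · rw [contraction_bot]
      exact zero_mem _
    · rw [contraction_top hm]
      exact single_mem_degSpace (valid_bot m hm) (by rw [deg_bot, deg_top]; rfl)

/-- In non-zero weight the contraction is the homotopy of one coordinate, chosen from the weight
alone. The choice is stable under `d`, which preserves weights; the other coordinates drop out by
anticommutation. In weight zero only `bot` and `top` occur, and the splice is inverted directly. -/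
theorem d_contraction_add {n : ℤ} {x : TateSpan k r} (hx : x ∈ degSpace k m n) :
    d k m (contraction k m x) + contraction k m (d k m x) = x := by
  refine eqOn_supported (f := d k m ∘ₗ contraction k m + contraction k m ∘ₗ d k m)
    (g := LinearMap.id) ?_ hx
  rintro b ⟨hb, -⟩
  simp only [LinearMap.add_apply, LinearMap.comp_apply, LinearMap.id_apply]
  by_cases h : ∃ i, b.wt m i ≠ 0
  · have hb' := single_mem_wtSpace (k := k) (m := m) b
    have hw : b.wt m ≠ 0 := fun h0 => by
      obtain ⟨i, hi⟩ := h
      exact hi (congrFun h0 i)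
    rw [contraction_eq h hb', contraction_eq h (d_mem_wtSpace hm hb'), d_apply, d_apply,
      splice_eq_zero hw hb', splice_eq_zero hw (hCoord_mem_wtSpace _ hb'), add_zero, add_zero,
      map_sum, ← Finset.sum_add_distrib, Finset.sum_eq_single h.choose]
    · exact dCoord_hCoord_add hm hb h.choose_spec
    · intro j _ hj
      rw [dCoord_hCoord_anticomm hj, neg_add_cancel]
    · simp
  · have hw : b.wt m = 0 := by
      push Not at h
      exact funext h
    rcases hb.wt_eq_zero hw with rfl | rfl
    · rw [contraction_bot, d_bot, contraction_top hm, map_zero, zero_add]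
    · rw [contraction_top hm, d_top hm, d_bot, map_zero, add_zero]

theorem exists_d_eq {n : ℤ} {x : TateSpan k r} (hx : x ∈ degSpace k m n) (hd : d k m x = 0) :
    ∃ y ∈ degSpace k m (n - 1), d k m y = x := by
  refine ⟨contraction k m x, contraction_mem_degSpace hm hx, ?_⟩
  have := d_contraction_add hm hx
  rwa [hd, map_zero, add_zero] at this

omit hm

/-! #### Coefficients of generators -/

theorem t_apply_eq_zero (i : Fin r) (x : TateSpan k r) {b : TateMonomial r} (hb : b.a i = 0) :
    t k m i x b = 0 := by
  suffices h : Finsupp.lapply b ∘ₗ t k m i = (0 : _ →ₗ[k] k) from LinearMap.congr_fun h x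
  refine hom_ext fun b' => ?_
  rw [LinearMap.comp_apply]
  rcases lt_or_ge (b'.a i + 1) (m i) with h | h
  · rw [t_of_lt h, Finsupp.lapply_apply, Finsupp.single_eq_of_ne]
    · rfl
    · rintro rfl
      simp at hb
  · rw [t_of_le h, map_zero]; rfl

include hm in
theorem dCoord_apply_eq_zero (i : Fin r) (x : TateSpan k r) {b : TateMonomial r}
    (hb : b.a i = 0) : dCoord k m i x b = 0 := by
  suffices h : Finsupp.lapply b ∘ₗ dCoord k m i = (0 : _ →ₗ[k] k) from LinearMap.congr_fun h x
  refine hom_ext fun b' => ?_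
  rw [LinearMap.comp_apply]
  by_cases h0 : b'.pos = true ∧ b'.n i = 0
  · rw [dCoord_of_eq_zero h0.1 h0.2, map_zero]; rfl
  rcases lt_or_ge (b'.a i + dExp (m i) (b'.n i)) (m i) with h | h
  · rw [dCoord_of_lt h (fun h h' => h0 ⟨h, h'⟩), map_units_smul, Finsupp.lapply_apply,
      Finsupp.single_eq_of_ne, smul_zero]
    · rfl
    · rintro rfl
      have := dExp_pos (hm i) (b'.n i)
      simp only [set_a] at hb
      omega
  · rw [dCoord_of_le h, map_zero]; rfl

theorem splice_apply_of_ne (x : TateSpan k r) {b : TateMonomial r} (hb : b ≠ top m) :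
    splice k m x b = 0 := by
  suffices h : Finsupp.lapply b ∘ₗ splice k m = (0 : _ →ₗ[k] k) from LinearMap.congr_fun h x
  refine hom_ext fun b' => ?_
  rw [LinearMap.comp_apply]
  by_cases h : b' = bot r
  · rw [h, splice_bot, Finsupp.lapply_apply, Finsupp.single_eq_of_ne hb]; rfl
  · rw [splice_of_ne h, map_zero]; rfl

include hm in
/-- Coefficients of generators vanish on boundaries. -/
theorem d_apply_eq_zero (x : TateSpan k r) {b : TateMonomial r} (hb : ∀ i, b.a i = 0)
    (hb' : b ≠ top m) : d k m x b = 0 := by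
  rw [d_apply, Finsupp.add_apply, Finsupp.finsetSum_apply, splice_apply_of_ne x hb', add_zero]
  exact Finset.sum_eq_zero fun i _ => dCoord_apply_eq_zero hm i x (hb i)

theorem ne_top_of_a_eq_zero (hm : ∀ i, 2 ≤ m i) (hr : 0 < r) {b : TateMonomial r}
    (hb : ∀ i, b.a i = 0) : b ≠ top m := by
  rintro rfl
  have := hb ⟨0, hr⟩
  have := hm ⟨0, hr⟩
  simp [top] at *
  omega

/-- In degree zero, the kernel of the differential is the kernel of the augmentation. -/
theorem d_eq_zero_of_apply_bot_eq_zero {x : TateSpan k r} (hx : x ∈ degSpace k m 0)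
    (h : x (bot r) = 0) : d k m x = 0 := by
  have key : d k m x = x (bot r) • Finsupp.single (top m) 1 := by
    refine eqOn_supported (f := d k m)
      (g := (LinearMap.toSpanSingleton k _ (Finsupp.single (top m) 1)) ∘ₗ Finsupp.lapply (bot r))
      ?_ hx
    rintro b ⟨hb, hdeg⟩
    have hpos : b.pos = true := by
      by_contra hp
      rw [Bool.not_eq_true] at hp
      have h1 : ∑ i, b.n i ≤ ∑ i : Fin r, (-1 : ℤ) :=
        Finset.sum_le_sum fun i _ => by have := hb.2.2 hp i; omega
      simp [deg, hp] at hdeg h1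
      omega
    have hn : ∀ i, b.n i = 0 := by
      have h1 : ∑ i, b.n i = 0 := by simpa [deg, hpos] using hdeg
      intro i
      exact (Finset.sum_eq_zero_iff_of_nonneg (fun i _ => hb.2.1 hpos i)).1 h1 i (Finset.mem_univ i)
    rw [d_apply, Finset.sum_eq_zero (fun i _ => dCoord_of_eq_zero hpos (hn i)), zero_add]
    by_cases hbb : b = bot r
    · subst hbb
      rw [splice_bot]
      simp
    · rw [splice_of_ne hbb]
      simp [Finsupp.single_eq_of_ne (Ne.symm hbb)]
  rw [key, h, zero_smul]

end TateSpan

/-! ### The explicit complete resolution -/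

/-- All `m i` are positive powers of the characteristic of `k`. -/
class IsCharPowers (k : Type u) [Field k] {r : ℕ} (m : Fin r → ℕ) : Prop where
  exists_eq_pow : ∃ p : ℕ, p.Prime ∧ CharP k p ∧ ∀ i, ∃ e, 1 ≤ e ∧ m i = p ^ e

namespace IsCharPowers

theorem two_le (k : Type u) [Field k] {r : ℕ} (m : Fin r → ℕ) [IsCharPowers k m]
    (i : Fin r) : 2 ≤ m i := by
  obtain ⟨p, hp, -, h⟩ := ‹IsCharPowers k m›.exists_eq_pow
  obtain ⟨e, he, hi⟩ := h i
  rw [hi]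
  exact hp.two_le.trans (Nat.le_self_pow (by omega) p)

theorem neZero (k : Type u) [Field k] {r : ℕ} (m : Fin r → ℕ) [IsCharPowers k m]
    (i : Fin r) : NeZero (m i) := ⟨by have := two_le k m i; omega⟩

theorem one_add_pow (k : Type u) [Field k] {r : ℕ} (m : Fin r → ℕ) [IsCharPowers k m]
    {A : Type*} [Ring A] [Algebra k A] (i : Fin r) (x : A) :
    (1 + x) ^ m i = 1 + x ^ m i := by
  obtain ⟨p, hp, hk, h⟩ := ‹IsCharPowers k m›.exists_eq_pow
  obtain ⟨e, he, hi⟩ := h i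
  rcases subsingleton_or_nontrivial A with hA | hA
  · exact Subsingleton.elim _ _
  have : CharP A p := charP_of_injective_algebraMap (algebraMap k A).injective p
  have : Fact p.Prime := ⟨hp⟩
  rw [hi, add_pow_char_pow_of_commute p (h := Commute.one_left x), one_pow]

end IsCharPowers

namespace ProdCyclic

variable {r : ℕ} {m : Fin r → ℕ}

/-- The generator of the `i`-th factor. -/
def gen (m : Fin r → ℕ) (i : Fin r) : ProdCyclic m := Pi.mulSingle i (Multiplicative.ofAdd 1)

theorem mulSingle_eq_pow [∀ i, NeZero (m i)] (i : Fin r) (x : Multiplicative (ZMod (m i))) :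
    (Pi.mulSingle i x : ProdCyclic m) = gen m i ^ (Multiplicative.toAdd x).val := by
  rw [gen, ← Pi.mulSingle_pow, ← ofAdd_nsmul, nsmul_eq_mul, mul_one, ZMod.natCast_zmod_val]
  rfl

theorem mem_of_gen_mem [∀ i, NeZero (m i)] (N : Submonoid (ProdCyclic m))
    (h : ∀ i, gen m i ∈ N) (g : ProdCyclic m) : g ∈ N :=
  Submonoid.pi_mem_of_mulSingle_mem g fun i => by
    rw [mulSingle_eq_pow]
    exact pow_mem (h i) _

theorem gen_pow (i : Fin r) : gen m i ^ m i = 1 := by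
  rw [gen, ← Pi.mulSingle_pow, ← ofAdd_nsmul, nsmul_eq_mul, mul_one, ZMod.natCast_self, ofAdd_zero,
    Pi.mulSingle_one]

end ProdCyclic

open ProdCyclic

/-! ### The action of the group on monomials -/

namespace TateSpan

open TateMonomial

variable {k : Type u} [Field k] {r : ℕ} {m : Fin r → ℕ}

/-- The span also contains monomials with `a_i ≥ m_i`, on which `t_i ^ 0` is still the identity;
this explains the alternative `c = 0`. -/
theorem t_pow_single (i : Fin r) (c : ℕ) (b : TateMonomial r) :
    (t k m i ^ c) (Finsupp.single b 1) =
      if b.a i + c < m i ∨ c = 0 then Finsupp.single (b.set i (b.n i) (b.a i + c)) 1 else 0 := by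
  induction c with
  | zero => simp
  | succ c ih =>
    rw [pow_succ', Module.End.mul_apply, ih]
    by_cases h1 : b.a i + c < m i ∨ c = 0
    · rw [if_pos h1]
      by_cases h2 : b.a i + (c + 1) < m i
      · rw [if_pos (Or.inl h2), t_of_lt (b := b.set i (b.n i) (b.a i + c)) (by rw [set_a]; omega)]
        simp [add_assoc]
      · rw [if_neg (by omega), t_of_le (b := b.set i (b.n i) (b.a i + c)) (by rw [set_a]; omega)]
    · rw [if_neg h1, if_neg (by omega), map_zero]

theorem t_pow_eq_zero (i : Fin r) (hi : m i ≠ 0) : t k m i ^ m i = 0 := by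
  refine hom_ext fun b => ?_
  rw [t_pow_single, if_neg (by omega)]
  rfl

variable (k m) in
/-- The action of a factor of the group. -/
noncomputable def actionCoord [IsCharPowers k m] (i : Fin r) :
    Multiplicative (ZMod (m i)) →* Module.End k (TateSpan k r) where
  toFun x := (1 + t k m i) ^ (Multiplicative.toAdd x).val
  map_one' := by simp
  map_mul' x y := by
    have := IsCharPowers.neZero k m
    have h1 : (1 + t k m i) ^ m i = 1 := by
      refine (IsCharPowers.one_add_pow k m i (t k m i)).trans ?_
      rw [t_pow_eq_zero i (NeZero.ne _), add_zero]
    rw [toAdd_mul, ZMod.val_add, ← pow_add]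
    conv_rhs => rw [← Nat.mod_add_div (ZMod.val _ + ZMod.val _) (m i), pow_add, pow_mul, h1,
      one_pow, mul_one]

variable [IsCharPowers k m]

variable (k m) in
theorem commute_actionCoord : Pairwise fun i j => ∀ x y,
    Commute (actionCoord k m i x) (actionCoord k m j y) := by
  intro i j _ x y
  have h : Commute (t k m i) (t k m j) := LinearMap.ext fun x => t_comm i j x
  have h' : Commute (1 + t k m i) (1 + t k m j) :=
    (Commute.one_left _).add_left ((Commute.one_right _).add_right h)
  exact h'.pow_pow _ _

variable (k m) in
/-- The action of the group on the span of the monomials. -/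
noncomputable def action : ProdCyclic m →* Module.End k (TateSpan k r) :=
  MonoidHom.noncommPiCoprod (actionCoord k m) (commute_actionCoord k m)

theorem action_gen (i : Fin r) : action k m (gen m i) = 1 + t k m i := by
  rw [action, gen, MonoidHom.noncommPiCoprod_mulSingle]
  change (1 + t k m i) ^ (1 : ZMod (m i)).val = _
  have := IsCharPowers.two_le k m i
  rw [ZMod.val_one'' (by omega), pow_one]

theorem action_mem_degSpace (g : ProdCyclic m) (n : ℤ) : ∀ x ∈ degSpace k m n,
    action k m g x ∈ degSpace k m n := by
  have := IsCharPowers.neZero k m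
  let N : Submonoid (ProdCyclic m) :=
    { carrier := {g | ∀ x ∈ degSpace k m n, action k m g x ∈ degSpace k m n}
      mul_mem' := fun {g h} hg hh x hx => by
        rw [map_mul]
        exact hg _ (hh x hx)
      one_mem' := fun x hx => by rwa [map_one] }
  refine mem_of_gen_mem N (fun i x hx => ?_) g
  rw [action_gen]
  exact add_mem hx (t_mem_degSpace i hx)

variable (k m) in
/-- The terms of the complete resolution. -/
noncomputable def obj (n : ℤ) : Rep.{u} k (ProdCyclic m) :=
  Rep.of (X := degSpace k m n)
    { toFun := fun g => (action k m g).restrict (action_mem_degSpace g n)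
      map_one' := by ext x : 2; simp
      map_mul' := fun g h => by ext x : 2; simp }

/-- An element of a term of the complete resolution. -/
def objMk {n : ℤ} (x : TateSpan k r) (hx : x ∈ degSpace k m n) : obj k m n := ⟨x, hx⟩

variable (k m) in
/-- The underlying element of an element of a term of the complete resolution. -/
noncomputable def coe (n : ℤ) : obj k m n →ₗ[k] TateSpan k r := (degSpace k m n).subtype

theorem coe_mem {n : ℤ} (x : obj k m n) : coe k m n x ∈ degSpace k m n := x.2

@[simp] theorem coe_objMk {n : ℤ} (x : TateSpan k r) (hx : x ∈ degSpace k m n) :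
    coe k m n (objMk x hx) = x := rfl

theorem coe_injective {n : ℤ} {x y : obj k m n} (h : coe k m n x = coe k m n y) : x = y :=
  Subtype.ext h

theorem coe_ρ {n : ℤ} (g : ProdCyclic m) (x : obj k m n) :
    coe k m n ((obj k m n).ρ g x) = action k m g (coe k m n x) := rfl

end TateSpan

/-! ### Representations in terms of the operators `g_i - 1` -/

namespace Rep

variable {k : Type u} [Field k] {r : ℕ} {m : Fin r → ℕ}

/-- The action of `g_i - 1`, for the generator `g_i` of the `i`-th factor. -/
def tau (B : Rep.{u} k (ProdCyclic m)) (i : Fin r) : B →ₗ[k] B := B.ρ (gen m i) - 1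

theorem tau_apply (B : Rep.{u} k (ProdCyclic m)) (i : Fin r) (x : B) :
    B.tau i x = B.ρ (gen m i) x - x := rfl

theorem hom_tau {A B : Rep.{u} k (ProdCyclic m)} (f : A ⟶ B) (i : Fin r) (x : A) :
    f.hom (A.tau i x) = B.tau i (f.hom x) := by
  rw [tau_apply, tau_apply, map_sub, Rep.hom_comm_apply]

@[simp] theorem tau_trivial (i : Fin r) (x : Rep.trivial k (ProdCyclic m) k) :
    (Rep.trivial k (ProdCyclic m) k).tau i x = 0 := sub_self x

theorem tau_eq_asAlgebraHom (B : Rep.{u} k (ProdCyclic m)) (i : Fin r) :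
    B.tau i = B.ρ.asAlgebraHom (MonoidAlgebra.single (gen m i) 1 - 1) := by
  rw [map_sub, map_one, Representation.asAlgebraHom_single_one]
  rfl

variable [IsCharPowers k m]

/-- A linear map commuting with all `g_i - 1` is equivariant. -/
def homOfTau {A B : Rep.{u} k (ProdCyclic m)} (f : A →ₗ[k] B)
    (hf : ∀ i x, f (A.tau i x) = B.tau i (f x)) : A ⟶ B :=
  homMk f (by
    have := IsCharPowers.neZero k m
    let N : Submonoid (ProdCyclic m) :=
      { carrier := {g | ∀ x, f (A.ρ g x) = B.ρ g (f x)}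
        mul_mem' := fun {g h} hg hh x => by
          rw [map_mul, map_mul, Module.End.mul_apply, Module.End.mul_apply, hg, hh]
        one_mem' := fun x => by simp }
    refine fun g => mem_of_gen_mem N (fun i x => ?_) g
    have := hf i x
    rw [tau_apply, tau_apply, map_sub] at this
    exact sub_left_injective this)

@[simp] theorem homOfTau_apply {A B : Rep.{u} k (ProdCyclic m)} (f : A →ₗ[k] B)
    (hf : ∀ i x, f (A.tau i x) = B.tau i (f x)) (x : A) : (homOfTau f hf).hom x = f x := rfl

end Rep

/-! ### Freeness of the terms, and assembly of the resolution -/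

namespace TateSpan

open TateMonomial

variable {k : Type u} [Field k] {r : ℕ} {m : Fin r → ℕ} [IsCharPowers k m]

@[simp] theorem coe_tau {n : ℤ} (i : Fin r) (x : obj k m n) :
    coe k m n ((obj k m n).tau i x) = t k m i (coe k m n x) := by
  rw [Rep.tau_apply, map_sub, coe_ρ, action_gen]
  simp

/-- The element of the complete resolution given by a monomial. -/
noncomputable def mono {n : ℤ} (b : TateMonomial r) (hb : b.Valid m) (hn : b.deg = n) :
    obj k m n := objMk (Finsupp.single b 1) (single_mem_degSpace hb hn)

@[simp] theorem coe_mono {n : ℤ} (b : TateMonomial r) (hb : b.Valid m) (hn : b.deg = n) :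
    coe k m n (mono b hb hn) = Finsupp.single b 1 := rfl

theorem mono_congr {n : ℤ} {b b' : TateMonomial r} (h : b = b') (hb : b.Valid m) (hn : b.deg = n) :
    (mono b hb hn : obj k m n) = mono b' (h ▸ hb) (h ▸ hn) := by
  subst h; rfl

theorem map_mono_ext {n : ℤ} {V : Type*} [AddCommGroup V] [Module k V] {f g : obj k m n →ₗ[k] V}
    (h : ∀ b hb hn, f (mono b hb hn) = g (mono b hb hn)) : f = g := by
  classical
  let π : TateSpan k r →ₗ[k] obj k m n :=
    lift fun b => if h : b.Valid m ∧ b.deg = n then mono b h.1 h.2 else 0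
  have hπ : ∀ x : obj k m n, π (coe k m n x) = x := by
    intro x
    apply coe_injective
    refine eqOn_supported (f := coe k m n ∘ₗ π) (g := LinearMap.id) ?_ (coe_mem x)
    rintro b ⟨hb, hn⟩
    simp [π, dif_pos (⟨hb, hn⟩ : b.Valid m ∧ b.deg = n)]
  have : f ∘ₗ π = g ∘ₗ π := by
    refine hom_ext fun b => ?_
    simp only [LinearMap.comp_apply, π, lift_single]
    split_ifs with h'
    · exact h b _ _
    · simp
  ext x
  have := LinearMap.congr_fun this (coe k m n x)
  simpa [hπ] using this

theorem tau_mono {n : ℤ} (i : Fin r) {b : TateMonomial r} (hb : b.Valid m) (hn : b.deg = n)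
    (h : b.a i + 1 < m i) : (obj k m n).tau i (mono b hb hn) =
      mono (b.set i (b.n i) (b.a i + 1))
        (hb.set i _ _ h (fun h => hb.2.1 h i) (fun h => hb.2.2 h i)) (by rw [deg_set, hn]; ring) := by
  apply coe_injective
  rw [coe_tau, coe_mono, coe_mono, t_of_lt h]

/-- A property of monomials holds if it holds for the generators and is preserved under
multiplication by `t_i`. -/
theorem valid_induction {P : TateMonomial r → Prop} {n : ℤ}
    (h0 : ∀ b, b.Valid m → b.deg = n → (∀ i, b.a i = 0) → P b)
    (h1 : ∀ b i, b.Valid m → b.deg = n → b.a i + 1 < m i → P b → P (b.set i (b.n i) (b.a i + 1)))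
    (b : TateMonomial r) (hb : b.Valid m) (hn : b.deg = n) : P b := by
  induction hs : ∑ i, b.a i using Nat.strong_induction_on generalizing b with
  | _ s ih =>
    subst hs
    by_cases h : ∀ i, b.a i = 0
    · exact h0 b hb hn h
    · push Not at h
      obtain ⟨i, hi⟩ := h
      let b' := b.set i (b.n i) (b.a i - 1)
      have hb' : b'.Valid m := hb.set i _ _ (by have := hb.1 i; omega) (fun h => hb.2.1 h i)
        (fun h => hb.2.2 h i)
      have hn' : b'.deg = n := by rw [deg_set, hn]; ring
      have hlt : ∑ j, b'.a j < ∑ j, b.a j := by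
        refine Finset.sum_lt_sum (fun j _ => ?_) ⟨i, Finset.mem_univ i, ?_⟩
        · by_cases hj : j = i
          · subst hj; simp [b']
          · simp [b', set_a_ne _ hj]
        · simp only [b', set_a]
          omega
      have := h1 b' i hb' hn' (by have := hb.1 i; simp [b']; omega) (ih _ hlt b' hb' hn' rfl)
      have e : b'.set i (b'.n i) (b'.a i + 1) = b := by
        simp [b', Nat.sub_add_cancel (Nat.pos_of_ne_zero hi)]
      rwa [e] at this

/-- Morphisms out of the terms of the complete resolution are determined by their values on
generators. -/
theorem obj_hom_ext {n : ℤ} {B : Rep.{u} k (ProdCyclic m)} {f g : obj k m n ⟶ B}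
    (h : ∀ b hb hn, (∀ i, b.a i = 0) → f.hom (mono b hb hn) = g.hom (mono b hb hn)) : f = g := by
  have key : ∀ b hb hn, f.hom (mono b hb hn : obj k m n) = g.hom (mono b hb hn) := by
    intro b hb hn
    refine valid_induction (m := m) (n := n) (P := fun b => ∀ hb hn,
      f.hom (mono b hb hn : obj k m n) = g.hom (mono b hb hn)) (fun b hb hn h0 _ _ => h b hb hn h0)
      (fun b i hb hn h1 ih _ _ => ?_) b hb hn hb hn
    rw [← tau_mono i hb hn h1, Rep.hom_tau, Rep.hom_tau, ih]
  have := map_mono_ext (f := f.hom.toLinearMap) (g := g.hom.toLinearMap) key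
  exact Rep.hom_ext_apply fun x => LinearMap.congr_fun this x

/-- Morphisms out of the terms of the complete resolution with given values on monomials. -/
theorem exists_hom {n : ℤ} {B : Rep.{u} k (ProdCyclic m)} (y : TateMonomial r → B) :
    ∃ f : obj k m n ⟶ B, ∀ b hb hn, (∀ i, b.a i = 0) → f.hom (mono b hb hn) = y b := by
  -- The elements `g_i - 1` of the group algebra satisfy the relations of the `t_i`, so `t^a e_n`
  -- can be sent to the corresponding monomial in them applied to the value prescribed on `e_n`.
  let T : Fin r → MonoidAlgebra k (ProdCyclic m) := fun i => MonoidAlgebra.single (gen m i) 1 - 1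
  have hT : ∀ i, T i ^ m i = 0 := by
    intro i
    have h1 := IsCharPowers.one_add_pow k m i (T i)
    rw [add_sub_cancel, MonoidAlgebra.single_pow, gen_pow, one_pow] at h1
    exact left_eq_add.1 h1
  let F : TateSpan k r →ₗ[k] B :=
    lift fun b => B.ρ.asAlgebraHom (∏ i, T i ^ b.a i) (y ⟨b.pos, b.n, 0⟩)
  have hF : ∀ i x, F (t k m i x) = B.tau i (F x) := by
    intro i x
    suffices h : F ∘ₗ t k m i = B.tau i ∘ₗ F from LinearMap.congr_fun h x
    refine hom_ext fun b => ?_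
    have h1 : ∀ c, (∏ j, T j ^ (b.set i (b.n i) c).a j) =
        T i ^ c * ∏ j ∈ Finset.univ.erase i, T j ^ b.a j := by
      intro c
      rw [← Finset.mul_prod_erase _ _ (Finset.mem_univ i), set_a]
      congr 1
      exact Finset.prod_congr rfl fun j hj => by rw [set_a_ne _ (Finset.ne_of_mem_erase hj)]
    have h2 := h1 (b.a i)
    rw [set_self] at h2
    rw [LinearMap.comp_apply, LinearMap.comp_apply, Rep.tau_eq_asAlgebraHom]
    simp only [F, lift_single]
    rw [← Module.End.mul_apply, ← map_mul, h2, ← mul_assoc, ← pow_succ']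
    rcases lt_or_ge (b.a i + 1) (m i) with h | h
    · rw [t_of_lt h, lift_single, h1, set_pos, show (b.set i (b.n i) (b.a i + 1)).n = b.n by simp [TateMonomial.set]]
    · rw [t_of_le h, pow_eq_zero_of_le h (hT i), zero_mul, map_zero, map_zero]
      rfl
  refine ⟨Rep.homOfTau (F ∘ₗ coe k m n) (fun i x => ?_), fun b hb hn h0 => ?_⟩
  · rw [LinearMap.comp_apply, coe_tau, hF, LinearMap.comp_apply]
  · rw [Rep.homOfTau_apply, LinearMap.comp_apply, coe_mono, lift_single]
    have : (⟨b.pos, b.n, 0⟩ : TateMonomial r) = b := by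
      ext i
      · rfl
      · rfl
      · exact (h0 i).symm
    rw [this]
    simp [h0]

/-- The terms are free on the monomials with `a = 0`, so it is enough to lift the values there. -/
instance obj_projective (n : ℤ) : Projective (obj k m n) := by
  refine ⟨fun {E B} f π hπ => ?_⟩
  rw [Rep.epi_iff_surjective] at hπ
  classical
  choose y hy using fun b : TateMonomial r =>
    hπ (if h : b.Valid m ∧ b.deg = n then f.hom (mono b h.1 h.2) else 0)
  obtain ⟨g, hg⟩ := exists_hom (n := n) y
  refine ⟨g, obj_hom_ext fun b hb hn h0 => ?_⟩
  change π.hom (g.hom _) = _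
  rw [hg b hb hn h0, hy, dif_pos ⟨hb, hn⟩]

/-- The restriction of an operator to terms of the complete resolution. -/
noncomputable def restrictObj (f : TateSpan k r →ₗ[k] TateSpan k r) {i j : ℤ}
    (hf : ∀ x ∈ degSpace k m i, f x ∈ degSpace k m j) : obj k m i →ₗ[k] obj k m j :=
  (f.restrict hf : degSpace k m i →ₗ[k] degSpace k m j)

@[simp] theorem coe_restrictObj (f : TateSpan k r →ₗ[k] TateSpan k r) {i j : ℤ}
    (hf : ∀ x ∈ degSpace k m i, f x ∈ degSpace k m j) (x : obj k m i) :
    coe k m j (restrictObj f hf x) = f (coe k m i x) := rfl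

variable (k m) in
/-- The differential of the complete resolution, in degrees `i` and `i + 1`. -/
noncomputable def dHomAux {i j : ℤ} (h : i + 1 = j) : obj k m i ⟶ obj k m j :=
  Rep.homOfTau (restrictObj (d k m) fun x hx => by
    subst h
    exact d_mem_degSpace (IsCharPowers.two_le k m) hx) (fun l x => by
      apply coe_injective
      rw [coe_tau, coe_restrictObj, coe_restrictObj, coe_tau, t_d (IsCharPowers.two_le k m)])

variable (k m) in
/-- The differential of the complete resolution. -/
noncomputable def dHom (i j : ℤ) : obj k m i ⟶ obj k m j :=
  if h : i + 1 = j then dHomAux k m h else 0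

theorem coe_dHom {i j : ℤ} (h : i + 1 = j) (x : obj k m i) :
    coe k m j ((dHom k m i j).hom x) = d k m (coe k m i x) := by
  rw [dHom, dif_pos h]
  rfl

variable (k m) in
/-- The explicit complete resolution, as a complex. -/
noncomputable def complex : CochainComplex (Rep.{u} k (ProdCyclic m)) ℤ where
  X := obj k m
  d := dHom k m
  shape i j h := dif_neg h
  d_comp_d' i j l hij hjl := Rep.hom_ext_apply fun x => by
    apply coe_injective
    change coe k m l ((dHom k m j l).hom ((dHom k m i j).hom x)) = _
    rw [coe_dHom hjl, coe_dHom hij, d_d (IsCharPowers.two_le k m)]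
    rfl

variable (k m) in
/-- The augmentation of the complete resolution. -/
noncomputable def augmentation : obj k m 0 ⟶ Rep.trivial k (ProdCyclic m) k :=
  Rep.homOfTau (B := Rep.trivial k (ProdCyclic m) k) (Finsupp.lapply (bot r) ∘ₗ coe k m 0)
    (fun i x => by
      rw [LinearMap.comp_apply, coe_tau, Finsupp.lapply_apply, t_apply_eq_zero i _ rfl,
        Rep.tau_trivial])

theorem augmentation_apply (x : obj k m 0) :
    (augmentation k m).hom x = coe k m 0 x (bot r) := rfl

variable (k m) in
/-- The explicit complete resolution. -/
noncomputable def resolution : CompleteResolution k (ProdCyclic m) where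
  complex := complex k m
  projective n := obj_projective n
  acyclic n := by
    rw [HomologicalComplex.exactAt_iff' _ (n - 1) n (n + 1) (by simp) (by simp),
      Rep.exact_iff_forall]
    intro x hx
    have hx' : (dHom k m n (n + 1)).hom x = 0 := hx
    have hd : d k m (coe k m n x) = 0 := by
      rw [← coe_dHom rfl x, hx', map_zero]
    obtain ⟨y, hy, hdy⟩ := exists_d_eq (IsCharPowers.two_le k m) (coe_mem x) hd
    refine ⟨objMk y hy, coe_injective ?_⟩
    exact (coe_dHom (sub_add_cancel n 1) (objMk y hy)).trans hdy
  ε := augmentation k m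
  epi_ε := by
    refine (Rep.epi_iff_surjective (augmentation k m)).2 fun c => ?_
    refine ⟨(c : k) • mono (bot r) (valid_bot m (IsCharPowers.two_le k m)) deg_bot, ?_⟩
    rw [augmentation_apply, map_smul, coe_mono]
    simp
  d_comp_ε := Rep.hom_ext_apply fun x => by
    refine (congrArg (fun y => y (bot r)) (coe_dHom (show (-1 : ℤ) + 1 = 0 by norm_num) x)).trans ?_
    exact d_apply_eq_zero (IsCharPowers.two_le k m) _ (fun _ => rfl) (bot_ne_top m)
  exact := by
    rw [Rep.exact_iff_forall]
    intro x hx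
    have hd : d k m (coe k m 0 x) = 0 := d_eq_zero_of_apply_bot_eq_zero (coe_mem x) hx
    obtain ⟨y, hy, hdy⟩ := exists_d_eq (IsCharPowers.two_le k m) (coe_mem x) hd
    refine ⟨objMk y hy, coe_injective ?_⟩
    exact (coe_dHom (by norm_num) (objMk y hy)).trans hdy

end TateSpan

/-! ### Weights on the endomorphism algebra of the explicit complete resolution -/

open ProdCyclic

namespace TateSpan

open TateMonomial HomCohomology

variable {k : Type u} [Field k] {r : ℕ} {m : Fin r → ℕ}

open Classical in
variable (k m) in
/-- The projection to the elements of a given weight. -/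
noncomputable def wtProj (w : Fin r → ℤ) : TateSpan k r →ₗ[k] TateSpan k r :=
  lift fun b => if b.wt m = w then Finsupp.single b 1 else 0

theorem wtProj_mem (w : Fin r → ℤ) (x : TateSpan k r) : wtProj k m w x ∈ wtSpace k m w := by
  refine map_mem_supported (s := Set.univ) (fun b _ => ?_) (by simp)
  rw [wtProj, lift_single]
  split_ifs with h
  · rw [← h]
    exact single_mem_wtSpace b
  · exact zero_mem _

theorem wtProj_of_mem {w : Fin r → ℤ} {x : TateSpan k r} (hx : x ∈ wtSpace k m w) :
    wtProj k m w x = x := by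
  refine eqOn_supported (g := LinearMap.id) (fun b hb => ?_) hx
  rw [wtProj, lift_single, if_pos (show b.wt m = w from hb)]
  rfl

theorem wtProj_of_mem_of_ne {w w' : Fin r → ℤ} (h : w' ≠ w) {x : TateSpan k r}
    (hx : x ∈ wtSpace k m w') : wtProj k m w x = 0 := by
  refine eqOn_supported (g := 0) (fun b hb => ?_) hx
  rw [wtProj, lift_single, if_neg]
  · rfl
  · rintro rfl
    exact h hb.symm

theorem wtProj_map {f : TateSpan k r →ₗ[k] TateSpan k r} {u : Fin r → ℤ}
    (hf : ∀ v x, x ∈ wtSpace k m v → f x ∈ wtSpace k m (v + u)) (v : Fin r → ℤ)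
    (x : TateSpan k r) : wtProj k m (v + u) (f x) = f (wtProj k m v x) := by
  suffices h : wtProj k m (v + u) ∘ₗ f = f ∘ₗ wtProj k m v from LinearMap.congr_fun h x
  refine hom_ext fun b => ?_
  have hb := single_mem_wtSpace (k := k) (m := m) b
  rw [LinearMap.comp_apply, LinearMap.comp_apply]
  by_cases h : b.wt m = v
  · subst h
    rw [wtProj_of_mem hb, wtProj_of_mem (hf _ _ hb)]
  · rw [wtProj_of_mem_of_ne h hb, map_zero,
      wtProj_of_mem_of_ne (w' := b.wt m + u) (by simpa using h) (hf _ _ hb)]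

theorem wtProj_t (i : Fin r) (v : Fin r → ℤ) (x : TateSpan k r) :
    wtProj k m (v + Pi.single i 1) (t k m i x) = t k m i (wtProj k m v x) :=
  wtProj_map (fun _ _ => t_mem_wtSpace i) v x

theorem wtProj_apply {b : TateMonomial r} {w : Fin r → ℤ} (hw : b.wt m = w) (x : TateSpan k r) :
    wtProj k m w x b = x b := by
  suffices h : Finsupp.lapply b ∘ₗ wtProj k m w = (Finsupp.lapply b : _ →ₗ[k] k) from
    LinearMap.congr_fun h x
  refine hom_ext fun b' => ?_
  rw [LinearMap.comp_apply, wtProj, lift_single]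
  split_ifs with h
  · rfl
  · rw [map_zero, Finsupp.lapply_apply, Finsupp.single_eq_of_ne]
    rintro rfl
    exact h hw

theorem apply_eq_zero_of_mem_wtSpace {w : Fin r → ℤ} {x : TateSpan k r} (hx : x ∈ wtSpace k m w)
    {b : TateMonomial r} (hb : b.wt m ≠ w) : x b = 0 := by
  by_contra h
  exact hb (hx (by simpa using h))

theorem wtProj_mem_degSpace (w : Fin r → ℤ) {n : ℤ} {x : TateSpan k r}
    (hx : x ∈ degSpace k m n) : wtProj k m w x ∈ degSpace k m n := by
  refine map_mem_supported ?_ hx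
  rintro b ⟨hb, hn⟩
  rw [wtProj, lift_single]
  split_ifs with h
  · exact single_mem_degSpace hb hn
  · exact zero_mem _

variable [IsCharPowers k m]

theorem wtProj_d (v : Fin r → ℤ) (x : TateSpan k r) :
    wtProj k m v (d k m x) = d k m (wtProj k m v x) := by
  have := wtProj_map (f := d k m) (u := 0)
    (fun v x hx => by rw [add_zero]; exact d_mem_wtSpace (IsCharPowers.two_le k m) hx) v x
  rwa [add_zero] at this

/-- A morphism between terms of the complete resolution is homogeneous of weight `w`. -/
def IsHomog (w : Fin r → ℤ) {p q : ℤ} (f : obj k m p ⟶ obj k m q) : Prop :=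
  ∀ (v : Fin r → ℤ) (x : obj k m p), coe k m p x ∈ wtSpace k m v →
    coe k m q (f.hom x) ∈ wtSpace k m (v + w)

theorem IsHomog.comp {w w' v : Fin r → ℤ} {p q l : ℤ} {f : obj k m p ⟶ obj k m q}
    {g : obj k m q ⟶ obj k m l} (hf : IsHomog w f) (hg : IsHomog w' g) (h : w' + w = v) :
    IsHomog v (f ≫ g) := fun u x hx => by
  have := hg _ _ (hf u x hx)
  rw [add_assoc, add_comm w, h] at this
  exact this

/-- On each monomial the value is projected to the weight of the monomial plus `w`. Multiplication
by `t_i` raises the weights of source and target alike by one, so the projection commutes with `t_i`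
and stays equivariant. -/
theorem exists_component (w : Fin r → ℤ) {p q : ℤ} (f : obj k m p ⟶ obj k m q) :
    ∃ g : obj k m p ⟶ obj k m q, ∀ b hb hn, coe k m q (g.hom (mono b hb hn)) =
      wtProj k m (b.wt m + w) (coe k m q (f.hom (mono b hb hn))) := by
  classical
  let G : TateSpan k r →ₗ[k] obj k m q := lift fun b =>
    if h : b.Valid m ∧ b.deg = p then objMk (wtProj k m (b.wt m + w)
      (coe k m q (f.hom (mono b h.1 h.2)))) (wtProj_mem_degSpace _ (coe_mem _)) else 0
  have hG : ∀ b (hb : b.Valid m) (hn : b.deg = p), coe k m q (G (Finsupp.single b 1)) =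
      wtProj k m (b.wt m + w) (coe k m q (f.hom (mono b hb hn))) := by
    intro b hb hn
    simp only [G, lift_single]
    rw [dif_pos ⟨hb, hn⟩, coe_objMk]
  refine ⟨Rep.homOfTau (G ∘ₗ coe k m p) fun i => ?_, hG⟩
  suffices h : G ∘ₗ coe k m p ∘ₗ (obj k m p).tau i = (obj k m q).tau i ∘ₗ G ∘ₗ coe k m p from
    fun x => LinearMap.congr_fun h x
  refine map_mono_ext fun b hb hn => ?_
  apply coe_injective
  simp only [LinearMap.comp_apply, coe_tau, coe_mono]
  rw [hG b hb hn, ← wtProj_t, ← coe_tau, ← Rep.hom_tau]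
  rcases lt_or_ge (b.a i + 1) (m i) with h | h
  · rw [t_of_lt h, tau_mono i hb hn h, hG _
      (hb.set i _ _ h (fun h => hb.2.1 h i) (fun h => hb.2.2 h i)) (by rw [deg_set, hn]; ring)]
    have h1 : (b.set i (b.n i) (b.a i + 1)).wt m = b.wt m + Pi.single i 1 := by
      -- If the weight were different, the coefficient `1` of the shifted monomial would have to
      -- vanish by `t_mem_wtSpace`.
      by_contra hne
      have h2 := apply_eq_zero_of_mem_wtSpace
        (t_mem_wtSpace i (single_mem_wtSpace (k := k) (m := m) b)) hne
      rw [t_of_lt h] at h2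
      simp at h2
    rw [h1]
    congr 2
    ring
  · have h1 : (obj k m p).tau i (mono b hb hn) = 0 := by
      apply coe_injective
      rw [coe_tau, coe_mono, t_of_le h, map_zero]
    rw [t_of_le h, h1]
    simp

/-- The component of weight `w` of a morphism. -/
noncomputable def component (w : Fin r → ℤ) {p q : ℤ} (f : obj k m p ⟶ obj k m q) :
    obj k m p ⟶ obj k m q := (exists_component w f).choose

theorem component_mono (w : Fin r → ℤ) {p q : ℤ} (f : obj k m p ⟶ obj k m q)
    (b : TateMonomial r) (hb : b.Valid m) (hn : b.deg = p) :
    coe k m q ((component w f).hom (mono b hb hn)) =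
      wtProj k m (b.wt m + w) (coe k m q (f.hom (mono b hb hn))) :=
  (exists_component w f).choose_spec b hb hn

theorem hom_ext_mono {p q : ℤ} {f g : obj k m p ⟶ obj k m q}
    (h : ∀ b hb hn, coe k m q (f.hom (mono b hb hn)) = coe k m q (g.hom (mono b hb hn))) :
    f = g := by
  have := map_mono_ext (f := f.hom.toLinearMap) (g := g.hom.toLinearMap)
    fun b hb hn => coe_injective (h b hb hn)
  exact Rep.hom_ext_apply fun x => LinearMap.congr_fun this x

/-- To check an identity on elements of given weight, it suffices to consider monomials. -/
theorem eqOn_wtSpace {p : ℤ} {V : Type*} [AddCommGroup V] [Module k V] {f g : obj k m p →ₗ[k] V}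
    {v : Fin r → ℤ} (h : ∀ b hb hn, b.wt m = v → f (mono b hb hn) = g (mono b hb hn))
    {x : obj k m p} (hx : coe k m p x ∈ wtSpace k m v) : f x = g x := by
  classical
  let π : TateSpan k r →ₗ[k] obj k m p :=
    lift fun b => if h : b.Valid m ∧ b.deg = p then mono b h.1 h.2 else 0
  have hπ : ∀ x : obj k m p, π (coe k m p x) = x := by
    intro x
    suffices h : π ∘ₗ coe k m p = LinearMap.id from LinearMap.congr_fun h x
    refine map_mono_ext fun b hb hn => ?_
    rw [LinearMap.comp_apply, coe_mono]
    simp only [π, lift_single]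
    rw [dif_pos ⟨hb, hn⟩]
    rfl
  have := eqOn_supported (f := f ∘ₗ π) (g := g ∘ₗ π) (s := {b | b.wt m = v}) (fun b hb => by
    simp only [LinearMap.comp_apply, π, lift_single]
    split_ifs with h'
    · exact h b _ _ hb
    · simp) hx
  simpa [hπ] using this

theorem component_apply (w : Fin r → ℤ) {p q : ℤ} (f : obj k m p ⟶ obj k m q) {v : Fin r → ℤ}
    {x : obj k m p} (hx : coe k m p x ∈ wtSpace k m v) :
    coe k m q ((component w f).hom x) = wtProj k m (v + w) (coe k m q (f.hom x)) := by
  refine eqOn_wtSpace (f := coe k m q ∘ₗ (component w f).hom.toLinearMap)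
    (g := wtProj k m (v + w) ∘ₗ coe k m q ∘ₗ f.hom.toLinearMap) (fun b hb hn hv => ?_) hx
  subst hv
  exact component_mono w f b hb hn

theorem isHomog_component (w : Fin r → ℤ) {p q : ℤ} (f : obj k m p ⟶ obj k m q) :
    IsHomog w (component w f) := fun v x hx => by
  rw [component_apply w f hx]
  exact wtProj_mem _ _

theorem component_of_isHomog {w : Fin r → ℤ} {p q : ℤ} {f : obj k m p ⟶ obj k m q}
    (hf : IsHomog w f) : component w f = f :=
  hom_ext_mono fun b hb hn => by
    rw [component_mono, wtProj_of_mem (hf _ _ (by rw [coe_mono]; exact single_mem_wtSpace b))]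

theorem component_add (w : Fin r → ℤ) {p q : ℤ} (f g : obj k m p ⟶ obj k m q) :
    component w (f + g) = component w f + component w g :=
  hom_ext_mono fun b hb hn => by
    rw [component_mono]
    change wtProj k m _ (coe k m q (f.hom _ + g.hom _)) =
      coe k m q ((component w f).hom _ + (component w g).hom _)
    rw [map_add, map_add, map_add, component_mono, component_mono]

theorem component_units_smul (w : Fin r → ℤ) {p q : ℤ} (e : ℤˣ) (f : obj k m p ⟶ obj k m q) :
    component w (e • f) = e • component w f := by
  rcases Int.units_eq_one_or e with rfl | rfl
  · simp
  · rw [Units.neg_smul, Units.neg_smul, one_smul, one_smul, eq_neg_iff_add_eq_zero,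
      ← component_add, neg_add_cancel]
    exact hom_ext_mono fun b hb hn => by
      rw [component_mono]
      simp

theorem component_comp_d (w : Fin r → ℤ) {p q l : ℤ} (h : q + 1 = l) (f : obj k m p ⟶ obj k m q) :
    component w f ≫ dHom k m q l = component w (f ≫ dHom k m q l) :=
  hom_ext_mono fun b hb hn => by
    rw [component_mono]
    refine (coe_dHom h _).trans (Eq.trans ?_ (congrArg _ (coe_dHom h _).symm))
    rw [wtProj_d]
    exact congrArg _ (component_mono w f b hb hn)

theorem d_comp_component (w : Fin r → ℤ) {p q l : ℤ} (h : p + 1 = q) (f : obj k m q ⟶ obj k m l) :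
    dHom k m p q ≫ component w f = component w (dHom k m p q ≫ f) :=
  hom_ext_mono fun b hb hn => by
    rw [component_mono]
    refine component_apply w f (v := b.wt m) ?_
    refine (congrArg (· ∈ wtSpace k m (b.wt m)) (coe_dHom h (mono b hb hn))).mpr ?_
    exact d_mem_wtSpace (IsCharPowers.two_le k m) (single_mem_wtSpace b)

/-! #### Homogeneous cochains -/

theorem IsHomog.zero (w : Fin r → ℤ) {p q : ℤ} : IsHomog w (0 : obj k m p ⟶ obj k m q) :=
  fun v x _ => by
    change coe k m q 0 ∈ _
    rw [map_zero]
    exact zero_mem _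

theorem IsHomog.add {w : Fin r → ℤ} {p q : ℤ} {f g : obj k m p ⟶ obj k m q} (hf : IsHomog w f)
    (hg : IsHomog w g) : IsHomog w (f + g) := fun v x hx => by
  change coe k m q (f.hom x + g.hom x) ∈ _
  rw [map_add]
  exact add_mem (hf v x hx) (hg v x hx)

theorem IsHomog.smul {w : Fin r → ℤ} {p q : ℤ} {f : obj k m p ⟶ obj k m q} (c : k)
    (hf : IsHomog w f) : IsHomog w (c • f) := fun v x hx => by
  change coe k m q (c • f.hom x) ∈ _
  rw [map_smul]
  exact Submodule.smul_mem _ _ (hf v x hx)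

variable (k m) in
/-- The homogeneous cochains of weight `w`. -/
noncomputable def wtCochain (w : Fin r → ℤ) (n : ℤ) :
    Submodule k (Cochain (complex k m) (complex k m) n) where
  carrier := {z | ∀ (p q : ℤ) (hpq : p + n = q), IsHomog w (p := p) (q := q) (z.v p q hpq)}
  zero_mem' _ _ _ := IsHomog.zero w
  add_mem' hz hz' p q hpq := IsHomog.add (hz p q hpq) (hz' p q hpq)
  smul_mem' c _ hz p q hpq := IsHomog.smul c (hz p q hpq)

theorem units_smul_mem_wtCochain {w : Fin r → ℤ} {n : ℤ}
    {z : Cochain (complex k m) (complex k m) n} (e : ℤˣ) (hz : z ∈ wtCochain k m w n) :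
    e • z ∈ wtCochain k m w n := by
  rcases Int.units_eq_one_or e with rfl | rfl
  · simpa using hz
  · simpa using neg_mem hz

theorem prod_mem_wtCochain {w w' v : Fin r → ℤ} {i j n : ℤ} (h : i + j = n) (hv : w + w' = v)
    {f : Cochain (complex k m) (complex k m) i} {g : Cochain (complex k m) (complex k m) j}
    (hf : f ∈ wtCochain k m w i) (hg : g ∈ wtCochain k m w' j) :
    prod k h f g ∈ wtCochain k m v n := by
  intro p q hpq
  rw [prod_apply, Cochain.comp_v _ _ _ p (p + j) q rfl (by omega)]
  exact IsHomog.comp (hg p (p + j) rfl) (hf (p + j) q (by omega)) hv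

/-- The components of a cochain, as morphisms between the terms of the resolution. -/
noncomputable def toHom {n : ℤ} (z : Cochain (complex k m) (complex k m) n) (p q : ℤ) (hpq : p + n = q) :
    obj k m p ⟶ obj k m q := z.v p q hpq

/-- The component of weight `w` of a cochain. -/
noncomputable def cochainComponent (w : Fin r → ℤ) {n : ℤ}
    (z : Cochain (complex k m) (complex k m) n) : Cochain (complex k m) (complex k m) n :=
  Cochain.mk fun p q hpq => component (k := k) (m := m) (p := p) (q := q) w (z.v p q hpq)

theorem cochainComponent_mem (w : Fin r → ℤ) {n : ℤ}
    (z : Cochain (complex k m) (complex k m) n) : cochainComponent w z ∈ wtCochain k m w n :=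
  fun _ _ _ => isHomog_component w _

theorem cochainComponent_of_mem {w : Fin r → ℤ} {n : ℤ}
    {z : Cochain (complex k m) (complex k m) n} (hz : z ∈ wtCochain k m w n) :
    cochainComponent w z = z := by
  ext p q hpq : 1
  exact component_of_isHomog (hz p q hpq)

theorem δ_cochainComponent (w : Fin r → ℤ) (n n' : ℤ) (z : Cochain (complex k m) (complex k m) n) :
    δ n n' (cochainComponent w z) = cochainComponent w (δ n n' z) := by
  by_cases h : n + 1 = n'
  · ext p q hpq : 1
    have h1 : ∀ y : Cochain (complex k m) (complex k m) n, toHom (δ n n' y) p q hpq =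
        toHom y p (q - 1) (by omega) ≫ dHom k m (q - 1) q +
          n'.negOnePow • dHom k m p (p + 1) ≫ toHom y (p + 1) q (by omega) :=
      fun y => δ_v n n' h _ p q hpq (q - 1) (p + 1) rfl rfl
    refine (h1 _).trans (Eq.trans ?_ (congrArg (component w) (h1 z).symm))
    rw [component_add, component_units_smul, ← component_comp_d w (by omega),
      ← d_comp_component w rfl]
    rfl
  · rw [δ_shape _ _ h, δ_shape _ _ h]
    exact (cochainComponent_of_mem (zero_mem _)).symm

/-- Homogeneous coboundaries have homogeneous primitives. -/
theorem exists_homogeneous_primitive {w : Fin r → ℤ} {n n' : ℤ}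
    {z : Cochain (complex k m) (complex k m) n'} (hz : z ∈ wtCochain k m w n')
    {y : Cochain (complex k m) (complex k m) n} (hy : δ n n' y = z) :
    ∃ y' ∈ wtCochain k m w n, δ n n' y' = z :=
  ⟨cochainComponent w y, cochainComponent_mem w y, by
    rw [δ_cochainComponent, hy, cochainComponent_of_mem hz]⟩

end TateSpan

/-! ### A homogeneous basis of the cohomology of the explicit complete resolution -/

open ProdCyclic

namespace TateSpan

open TateMonomial HomCohomology

variable {k : Type u} [Field k] {r : ℕ} {m : Fin r → ℕ}

variable (m) in
/-- The generators of cohomological degree `-n`. -/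
def Gen (n : ℤ) : Type := {b : TateMonomial r // b.Valid m ∧ b.deg = -n ∧ ∀ i, b.a i = 0}

/-- The degree fixes `∑ n_i`, and all `n_i` have the same sign, so each of them is bounded by the
sum. -/
instance (n : ℤ) : Finite (Gen m n) := by
  let B : Fin r → ℤ := fun _ => |n| + r + 1
  let f : Gen m n → Bool × Set.Icc (-B) B := fun b => (b.1.pos, ⟨b.1.n, by
    obtain ⟨b, hb, hn, -⟩ := b
    have hs : |∑ i, b.n i| ≤ |n| + r + 1 := by
      unfold deg at hn
      split_ifs at hn
      · have : ∑ i, b.n i = n := by linarith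
        rw [this]
        linarith
      · have : ∑ i, b.n i = n - r + 1 := by linarith
        rw [this, abs_le]
        have := abs_le.1 (le_refl |n|)
        constructor <;> linarith
    rw [abs_le] at hs
    rw [Set.mem_Icc, Pi.le_def, Pi.le_def]
    rcases hp : b.pos with _ | _
    · have h1 : ∀ i, b.n i < 0 := hb.2.2 hp
      have h2 : ∀ i, ∑ j, b.n j ≤ b.n i := fun i => by
        rw [← Finset.add_sum_erase _ _ (Finset.mem_univ i)]
        have := Finset.sum_nonpos (s := Finset.univ.erase i) (fun j _ => (h1 j).le)
        linarith
      exact ⟨fun i => by simp only [Pi.neg_apply, B]; linarith [h2 i], fun i => by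
        have := abs_nonneg n
        have := h1 i
        simp only [B]; omega⟩
    · have h1 : ∀ i, 0 ≤ b.n i := hb.2.1 hp
      have h2 : ∀ i, b.n i ≤ ∑ j, b.n j := fun i =>
        Finset.single_le_sum (fun j _ => h1 j) (Finset.mem_univ i)
      exact ⟨fun i => by
        have := abs_nonneg n
        have := h1 i
        simp only [Pi.neg_apply, B]; omega, fun i => by simp only [B]; linarith [h2 i]⟩⟩)
  refine Finite.of_injective f fun b b' h => ?_
  simp only [f, Prod.mk.injEq, Subtype.mk.injEq] at h
  refine Subtype.ext (TateMonomial.ext h.1 h.2 (funext fun i => ?_))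
  rw [b.2.2.2 i, b'.2.2.2 i]

variable [IsCharPowers k m]

/-- The generator of the resolution, as an element. -/
noncomputable def genMono {n : ℤ} (b : Gen m n) : obj k m (-n) := mono b.1 b.2.1 b.2.2.1

/-- Morphisms to the trivial module vanish on elements without generator coefficients. -/
theorem hom_trivial_eq_zero {p : ℤ} (ψ : obj k m p ⟶ Rep.trivial k (ProdCyclic m) k)
    {x : obj k m p} (hx : ∀ b : TateMonomial r, (∀ i, b.a i = 0) → coe k m p x b = 0) :
    ψ.hom x = 0 := by
  classical
  let π : TateSpan k r →ₗ[k] obj k m p :=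
    lift fun b => if h : b.Valid m ∧ b.deg = p then mono b h.1 h.2 else 0
  have hπ : ∀ x : obj k m p, π (coe k m p x) = x := by
    intro x
    suffices h : π ∘ₗ coe k m p = LinearMap.id from LinearMap.congr_fun h x
    refine map_mono_ext fun b hb hn => ?_
    rw [LinearMap.comp_apply, coe_mono]
    simp only [π, lift_single]
    rw [dif_pos ⟨hb, hn⟩]
    rfl
  have hx' : coe k m p x ∈ Finsupp.supported k k {b | ¬ ∀ i, b.a i = 0} := by
    intro b hb h
    exact (Finsupp.mem_support_iff.1 hb) (hx b h)
  have := eqOn_supported (f := ψ.hom.toLinearMap ∘ₗ π) (g := 0) (fun b hb => ?_) hx'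
  · simpa [hπ] using this
  · simp only [LinearMap.comp_apply, π, lift_single]
    split_ifs with h
    · have hb' : ¬ ∀ i, b.a i = 0 := hb
      push Not at hb'
      obtain ⟨i, hi⟩ := hb'
      have hai := h.1.1 i
      have hv : (b.set i (b.n i) (b.a i - 1)).Valid m := h.1.set i _ _ (by omega)
        (fun h' => h.1.2.1 h' i) (fun h' => h.1.2.2 h' i)
      have hd : (b.set i (b.n i) (b.a i - 1)).deg = p := by rw [deg_set, h.2]; ring
      -- A monomial which is not a generator is `t_i` times another one, and `g_i - 1` is zero on
      -- the trivial module.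
      have h2 := tau_mono (k := k) (m := m) i hv hd (by rw [set_a]; omega)
      have h3 : (b.set i (b.n i) (b.a i - 1)).set i ((b.set i (b.n i) (b.a i - 1)).n i)
          ((b.set i (b.n i) (b.a i - 1)).a i + 1) = b := by
        simp [Nat.sub_add_cancel (Nat.pos_of_ne_zero hi)]
      rw [mono_congr h3] at h2
      change ψ.hom (mono b h.1 h.2) = 0
      rw [← h2, Rep.hom_tau, Rep.tau_trivial]
    · simp

/-- Minimality: boundaries have no coefficients at generators. For `r = 0` the condition on
exponents is vacuous and `top` itself counts as a generator, whence the hypothesis `0 < r`. -/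
theorem hom_trivial_d_eq_zero (hr : 0 < r) {p q : ℤ} (h : p + 1 = q)
    (ψ : obj k m q ⟶ Rep.trivial k (ProdCyclic m) k) : dHom k m p q ≫ ψ = 0 :=
  Rep.hom_ext_apply fun x => hom_trivial_eq_zero ψ (x := (dHom k m p q).hom x) fun b hb => by
    rw [coe_dHom h, d_apply_eq_zero (IsCharPowers.two_le k m) _ hb
      (ne_top_of_a_eq_zero (IsCharPowers.two_le k m) hr hb)]

/-- The value of a cochain on a generator, under the augmentation. -/
noncomputable def cochainCoeff {n : ℤ} (b : Gen m n) :
    Cochain (complex k m) (complex k m) n →ₗ[k] k where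
  toFun z := coe k m 0 ((toHom z (-n) 0 (neg_add_cancel n)).hom (genMono b)) (bot r)
  map_add' z z' := by
    change coe k m 0 ((toHom z (-n) 0 _).hom (genMono b) + (toHom z' (-n) 0 _).hom (genMono b)) _
      = _
    rw [map_add]
    rfl
  map_smul' c z := by
    change coe k m 0 (c • (toHom z (-n) 0 _).hom (genMono b)) _ = _
    rw [map_smul]
    rfl

theorem cochainCoeff_apply {n : ℤ} (b : Gen m n) (z : Cochain (complex k m) (complex k m) n) :
    cochainCoeff b z =
      (augmentation k m).hom ((toHom z (-n) 0 (neg_add_cancel n)).hom (genMono b)) := rfl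

theorem toHom_δ {n n' : ℤ} (h : n + 1 = n') (y : Cochain (complex k m) (complex k m) n) (p q q' p' : ℤ)
    (hpq : p + n' = q) (hq' : q' = q - 1) (hp' : p' = p + 1) : toHom (δ n n' y) p q hpq =
      toHom y p q' (by omega) ≫ dHom k m q' q +
        n'.negOnePow • dHom k m p p' ≫ toHom y p' q (by omega) :=
  δ_v n n' h _ p q hpq q' p' hq' hp'.symm

theorem cochainCoeff_δ (hr : 0 < r) {n n' : ℤ} (h : n + 1 = n') (b : Gen m n')
    (y : Cochain (complex k m) (complex k m) n) : cochainCoeff b (δ n n' y) = 0 := by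
  have h1 : toHom (δ n n' y) (-n') 0 (neg_add_cancel n') ≫ augmentation k m = 0 := by
    rw [toHom_δ h y (-n') 0 (-1) (-n' + 1) _ (by norm_num) rfl, Preadditive.add_comp,
      Linear.units_smul_comp, Category.assoc, Category.assoc,
      hom_trivial_d_eq_zero hr (by norm_num), hom_trivial_d_eq_zero hr rfl, Limits.comp_zero,
      smul_zero, add_zero]
  rw [cochainCoeff_apply]
  exact congrArg (fun f => f.hom (genMono b)) h1

/-- The coefficient of a cohomology class at a generator. -/
noncomputable def coeff (hr : 0 < r) {n : ℤ} (b : Gen m n) :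
    H k (complex k m) (complex k m) n →ₗ[k] k :=
  Submodule.liftQ _ ((cochainCoeff b).comp (coeLinear n)) (by
    rintro z ⟨y, hy⟩
    rw [LinearMap.mem_ker, LinearMap.comp_apply, coeLinear_apply, ← hy]
    exact cochainCoeff_δ hr (sub_add_cancel n 1) b y)

theorem coeff_mk (hr : 0 < r) {n : ℤ} (b : Gen m n) (z : Cocycle (complex k m) (complex k m) n) :
    coeff (k := k) hr b (Submodule.Quotient.mk z) =
      cochainCoeff b (z : Cochain (complex k m) (complex k m) n) := rfl

theorem finite_prodCyclic (k : Type u) [Field k] (m : Fin r → ℕ) [IsCharPowers k m] :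
    Finite (ProdCyclic m) := by
  have := IsCharPowers.neZero k m
  have : ∀ i, Finite (Multiplicative (ZMod (m i))) := fun i => Finite.of_equiv _ Multiplicative.ofAdd
  infer_instance

end TateSpan

/-! ### Homogeneous classes, and a pure choice of representatives -/

open ProdCyclic

namespace TateSpan

open TateMonomial HomCohomology

variable {k : Type u} [Field k] {r : ℕ} {m : Fin r → ℕ} [IsCharPowers k m]

theorem eq_zero_of_coeff_eq_zero (hr : 0 < r) {n : ℤ} (x : H k (complex k m) (complex k m) n)
    (hx : ∀ b : Gen m n, coeff hr b x = 0) : x = 0 := by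
  obtain ⟨z, rfl⟩ := Submodule.Quotient.mk_surjective _ x
  have := finite_prodCyclic k m
  refine (CompleteResolution.mk_eq_of_v_comp_eq (resolution k m) (resolution k m) (-n)
    (neg_add_cancel n) z 0 ?_).trans (Submodule.Quotient.mk_zero _)
  have h : toHom (z : Cochain (complex k m) (complex k m) n) (-n) 0 (neg_add_cancel n) ≫
      augmentation k m = 0 :=
    obj_hom_ext fun b hb hn h0 => hx ⟨b, hb, hn, h0⟩
  exact h.trans Limits.zero_comp.symm

/-- By minimality, arbitrary values on the generators define a map to `k` that vanishes on
boundaries, and such a map lifts to a cocycle. -/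
theorem exists_coeff_eq (hr : 0 < r) {n : ℤ} (c : Gen m n → k) :
    ∃ x : H k (complex k m) (complex k m) n, ∀ b : Gen m n, coeff hr b x = c b := by
  classical
  have := finite_prodCyclic k m
  obtain ⟨f, hf⟩ := exists_hom (k := k) (m := m) (n := -n)
    (B := Rep.trivial k (ProdCyclic m) k) (fun b =>
      if h : b.Valid m ∧ b.deg = -n ∧ ∀ i, b.a i = 0 then c ⟨b, h⟩ else 0)
  have := (resolution k m).projective
  have := (resolution k m).injective
  have := (resolution k m).epi_ε
  obtain ⟨z, hz⟩ := exists_cocycle_v_comp_eq (K := (resolution k m).complex) (resolution k m).ε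
    (resolution k m).acyclic (resolution k m).acyclic (resolution k m).d_comp_ε
    (resolution k m).exact (-n) (neg_add_cancel n) f (hom_trivial_d_eq_zero hr (by ring) f)
  change Cocycle (complex k m) (complex k m) n at z
  refine ⟨Submodule.Quotient.mk z, fun b => ?_⟩
  have h1 : toHom (z : Cochain (complex k m) (complex k m) n) (-n) 0 (neg_add_cancel n) ≫
      augmentation k m = f := hz
  rw [coeff_mk, cochainCoeff_apply]
  refine (congrArg (fun f => f.hom (genMono b)) h1).trans ?_
  exact (hf b.1 b.2.1 b.2.2.1 b.2.2.2).trans (dif_pos b.2)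

variable (k m) in
/-- The basis of the cohomology dual to the generators. -/
noncomputable def basis (hr : 0 < r) (n : ℤ) :
    Module.Basis (Gen m n) k (H k (complex k m) (complex k m) n) :=
  Module.Basis.ofEquivFun <| LinearEquiv.ofBijective (LinearMap.pi (coeff hr))
    ⟨(injective_iff_map_eq_zero _).2 fun x hx =>
      eq_zero_of_coeff_eq_zero hr x fun b => congrFun hx b, fun c => by
      obtain ⟨x, hx⟩ := exists_coeff_eq (k := k) hr c
      exact ⟨x, funext hx⟩⟩

theorem basis_repr (hr : 0 < r) {n : ℤ} (x : H k (complex k m) (complex k m) n) (b : Gen m n) :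
    (basis k m hr n).repr x b = coeff hr b x := rfl

open Classical in
theorem coeff_basis (hr : 0 < r) {n : ℤ} (b b' : Gen m n) :
    coeff hr b (basis k m hr n b') = if b' = b then 1 else 0 := by
  rw [← basis_repr, Module.Basis.repr_self, Finsupp.single_apply]

variable (k m) in
/-- The homogeneous classes of weight `w`. -/
noncomputable def wtClass (w : Fin r → ℤ) (n : ℤ) :
    Submodule k (H k (complex k m) (complex k m) n) :=
  ((wtCochain k m w n).comap (coeLinear n)).map (Submodule.mkQ _)

theorem mk_mem_wtClass {w : Fin r → ℤ} {n : ℤ} {z : Cocycle (complex k m) (complex k m) n}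
    (hz : (z : Cochain (complex k m) (complex k m) n) ∈ wtCochain k m w n) :
    (Submodule.Quotient.mk z : H k (complex k m) (complex k m) n) ∈ wtClass k m w n :=
  ⟨z, hz, rfl⟩

theorem exists_mem_wtCochain {w : Fin r → ℤ} {n : ℤ} {x : H k (complex k m) (complex k m) n}
    (hx : x ∈ wtClass k m w n) : ∃ z : Cocycle (complex k m) (complex k m) n,
      (z : Cochain (complex k m) (complex k m) n) ∈ wtCochain k m w n ∧
        Submodule.Quotient.mk z = x := hx

theorem mul_mem_wtClass {w w' v : Fin r → ℤ} {i j n : ℤ} (h : i + j = n) (hv : w + w' = v)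
    {x : H k (complex k m) (complex k m) i} {y : H k (complex k m) (complex k m) j}
    (hx : x ∈ wtClass k m w i) (hy : y ∈ wtClass k m w' j) :
    cohProd k h x y ∈ wtClass k m v n := by
  obtain ⟨z, hz, rfl⟩ := exists_mem_wtCochain hx
  obtain ⟨z', hz', rfl⟩ := exists_mem_wtCochain hy
  rw [cohProd_mk]
  exact mk_mem_wtClass (prod_mem_wtCochain h hv hz hz')

theorem cochainCoeff_eq_zero_of_mem {w : Fin r → ℤ} {n : ℤ}
    {z : Cochain (complex k m) (complex k m) n} (hz : z ∈ wtCochain k m w n) (b : Gen m n)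
    (hb : b.1.wt m + w ≠ 0) : cochainCoeff b z = 0 := by
  refine apply_eq_zero_of_mem_wtSpace (hz (-n) 0 (neg_add_cancel n) (b.1.wt m) (genMono b) ?_) ?_
  · exact single_mem_wtSpace b.1
  · rw [wt_bot]
    exact hb.symm

theorem coeff_eq_zero_of_mem_wtClass (hr : 0 < r) {w : Fin r → ℤ} {n : ℤ}
    {x : H k (complex k m) (complex k m) n} (hx : x ∈ wtClass k m w n) (b : Gen m n)
    (hb : b.1.wt m + w ≠ 0) : coeff hr b x = 0 := by
  obtain ⟨z, hz, rfl⟩ := exists_mem_wtCochain hx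
  exact cochainCoeff_eq_zero_of_mem hz b hb

theorem eq_zero_of_mem_wtClass (hr : 0 < r) {w : Fin r → ℤ} {n : ℤ}
    {x : H k (complex k m) (complex k m) n} (hx : x ∈ wtClass k m w n)
    (hw : ∀ b : Gen m n, b.1.wt m + w ≠ 0) : x = 0 :=
  eq_zero_of_coeff_eq_zero hr x fun b => coeff_eq_zero_of_mem_wtClass hr hx b (hw b)

/-- The component of weight `-wt b` of any representative is again a cocycle. It has the same
coefficients: those at generators of the weight of `b` are unchanged, and the others are zero on
both sides. -/
theorem basis_mem_wtClass (hr : 0 < r) {n : ℤ} (b : Gen m n) :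
    basis k m hr n b ∈ wtClass k m (-b.1.wt m) n := by
  classical
  obtain ⟨z, hz⟩ := Submodule.Quotient.mk_surjective _ (basis k m hr n b)
  let z' : Cocycle (complex k m) (complex k m) n :=
    Cocycle.mk (cochainComponent (-b.1.wt m) (z : Cochain _ _ n)) (n + 1) rfl (by
      rw [δ_cochainComponent, Cocycle.δ_eq_zero]
      exact cochainComponent_of_mem (zero_mem _))
  have h : Submodule.Quotient.mk z' = basis k m hr n b := by
    rw [← sub_eq_zero]
    refine eq_zero_of_coeff_eq_zero hr _ fun b' => ?_
    rw [map_sub, coeff_mk, sub_eq_zero]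
    by_cases hb : b'.1.wt m = b.1.wt m
    · rw [← hz, coeff_mk]
      have h1 := component_mono (-b.1.wt m) (toHom (z : Cochain (complex k m) (complex k m) n)
        (-n) 0 (neg_add_cancel n)) b'.1 b'.2.1 b'.2.2.1
      refine (congrArg (fun y => y (bot r)) h1).trans (wtProj_apply ?_ _)
      rw [wt_bot, hb, add_neg_cancel]
    · rw [coeff_basis, if_neg (fun h => hb (by rw [h]))]
      exact cochainCoeff_eq_zero_of_mem (cochainComponent_mem _ _) _
        (by rwa [← sub_eq_add_neg, sub_ne_zero])
  rw [← h]
  exact mk_mem_wtClass (cochainComponent_mem _ _)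

/-- If a linear map sends basis elements to homogeneous elements, then it preserves weights. -/
theorem map_mem_of_mem_wtClass (hr : 0 < r) {n : ℤ} {V : Type*} [AddCommGroup V] [Module k V]
    {f : H k (complex k m) (complex k m) n →ₗ[k] V} {w : Fin r → ℤ} {S : Submodule k V}
    (hf : ∀ b : Gen m n, -b.1.wt m = w → f (basis k m hr n b) ∈ S)
    {x : H k (complex k m) (complex k m) n} (hx : x ∈ wtClass k m w n) : f x ∈ S := by
  classical
  have := Fintype.ofFinite (Gen m n)
  rw [← (basis k m hr n).sum_repr x, map_sum]
  refine Submodule.sum_mem _ fun b _ => ?_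
  rw [map_smul, basis_repr]
  by_cases h : -b.1.wt m = w
  · exact S.smul_mem _ (hf b h)
  · rw [coeff_eq_zero_of_mem_wtClass hr hx b, zero_smul]
    · exact S.zero_mem
    · intro h'
      exact h (by rw [neg_eq_iff_add_eq_zero, h'])

/-- A choice of representatives and primitives preserving weights. -/
theorem exists_homogeneous_choice (hr : 0 < r) : ∃ s : Choice k (complex k m),
    (∀ (n : ℤ) (w : Fin r → ℤ) (x : H k (complex k m) (complex k m) n), x ∈ wtClass k m w n →
      (s.rep n x : Cochain (complex k m) (complex k m) n) ∈ wtCochain k m w n) ∧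
    ∀ (i j l : ℤ) (h : i + j + (-1) = l) (w w' : Fin r → ℤ)
      (x : H k (complex k m) (complex k m) i) (y : H k (complex k m) (complex k m) j),
      x ∈ wtClass k m w i → y ∈ wtClass k m w' j → s.htpy h x y ∈ wtCochain k m (w + w') l := by
  choose z hz hzx using fun (n : ℤ) (b : Gen m n) =>
    exists_mem_wtCochain (basis_mem_wtClass (k := k) hr b)
  let f₁ : ∀ n : ℤ, H k (complex k m) (complex k m) n →ₗ[k] Cocycle (complex k m) (complex k m) n :=
    fun n => (basis k m hr n).constr k (z n)
  have hf₁b : ∀ n b, f₁ n (basis k m hr n b) = z n b := fun n b => Module.Basis.constr_basis _ _ _ _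
  have hf₁ : ∀ n x, (Submodule.Quotient.mk (f₁ n x) : H k (complex k m) (complex k m) n) = x := by
    intro n x
    suffices h : Submodule.mkQ _ ∘ₗ f₁ n = LinearMap.id from LinearMap.congr_fun h x
    refine (basis k m hr n).ext fun b => ?_
    rw [LinearMap.comp_apply, hf₁b]
    exact hzx n b
  have hf₁w : ∀ (n : ℤ) (w : Fin r → ℤ) (x : H k (complex k m) (complex k m) n),
      x ∈ wtClass k m w n →
      (f₁ n x : Cochain (complex k m) (complex k m) n) ∈ wtCochain k m w n := by
    intro n w x hx
    refine map_mem_of_mem_wtClass (f := coeLinear n ∘ₗ f₁ n) hr (fun b hb => ?_) hx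
    rw [LinearMap.comp_apply, hf₁b, ← hb]
    exact hz n b
  have hy : ∀ (i j l : ℤ) (_ : i + j + (-1) = l) (b : Gen m i) (b' : Gen m j),
      ∃ y ∈ wtCochain k m (-b.1.wt m + -b'.1.wt m) l, δ l (i + j) y =
        (f₁ (i + j) (cohProd k rfl (basis k m hr i b) (basis k m hr j b')) :
          Cochain (complex k m) (complex k m) (i + j)) -
        prod k rfl (f₁ i (basis k m hr i b) : Cochain (complex k m) (complex k m) i)
          (f₁ j (basis k m hr j b') : Cochain (complex k m) (complex k m) j) := by
    intro i j l h b b'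
    have hb := basis_mem_wtClass (k := k) hr b
    have hb' := basis_mem_wtClass (k := k) hr b'
    obtain ⟨y, hy⟩ := exists_δ_eq_sub (k := k) (show l + 1 = i + j by omega)
      (x := f₁ (i + j) (cohProd k rfl (basis k m hr i b) (basis k m hr j b')))
      (y := cocycleProd k rfl (f₁ i (basis k m hr i b)) (f₁ j (basis k m hr j b'))) (by
        rw [hf₁, ← cohProd_mk, hf₁, hf₁])
    -- The prescribed coboundary of `f₂` is homogeneous, and `δ` commutes with taking components, so
    -- a component of any primitive will do.
    exact exists_homogeneous_primitive (sub_mem (hf₁w _ _ _ (mul_mem_wtClass rfl rfl hb hb'))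
      (prod_mem_wtCochain rfl rfl (hf₁w _ _ _ hb) (hf₁w _ _ _ hb'))) hy
  choose y hyw hδy using hy
  let f₂ : ∀ i j l : ℤ, i + j + (-1) = l → (H k (complex k m) (complex k m) i →ₗ[k]
      H k (complex k m) (complex k m) j →ₗ[k] Cochain (complex k m) (complex k m) l) :=
    fun i j l h => (basis k m hr i).constr k fun b => (basis k m hr j).constr k fun b' => y i j l h b b'
  have hf₂b : ∀ i j l h b b', f₂ i j l h (basis k m hr i b) (basis k m hr j b') = y i j l h b b' := by
    intro i j l h b b'
    simp only [f₂, Module.Basis.constr_basis]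
  refine ⟨Choice.ofH f₁ hf₁ f₂ ?_, hf₁w, ?_⟩
  · rintro i j l n h rfl a c
    suffices hs : (f₂ i j l h).compr₂ (δ_hom k (complex k m) (complex k m) l (i + j)) =
        (cohProd k rfl).compr₂ (coeLinear (i + j) ∘ₗ f₁ (i + j)) -
        (prod k rfl).compl₁₂ (coeLinear i ∘ₗ f₁ i) (coeLinear j ∘ₗ f₁ j) from
      LinearMap.congr_fun (LinearMap.congr_fun hs a) c
    refine (basis k m hr i).ext fun b => (basis k m hr j).ext fun b' => ?_
    rw [LinearMap.compr₂_apply, hf₂b]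
    exact hδy i j l h b b'
  · intro i j l h w w' a c ha hc
    refine map_mem_of_mem_wtClass (f := f₂ i j l h a) hr (fun b' hb' => ?_) hc
    refine map_mem_of_mem_wtClass (f := (f₂ i j l h).flip (basis k m hr j b')) hr
      (fun b hb => ?_) ha
    rw [LinearMap.flip_apply, hf₂b, ← hb, ← hb']
    exact hyw i j l h b b'

/-- If weights force triple Massey products to vanish, then there is a choice whose Massey
cochains are coboundaries. -/
theorem exists_trivial_choice (hr : 0 < r) (hpure : ∀ (i j l n : ℤ), i + j + l + (-1) = n →
    ∀ (a : Gen m i) (b : Gen m j) (c : Gen m l) (e : Gen m n),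
      e.1.wt m ≠ a.1.wt m + b.1.wt m + c.1.wt m) :
    ∃ s : Choice k (complex k m), s.Trivial := by
  obtain ⟨s, h1, h2⟩ := exists_homogeneous_choice (k := k) (m := m) hr
  refine ⟨s, s.m_eq_zero_iff.1 ?_⟩
  funext ⟨i, j, l, n, h⟩
  refine (basis k m hr i).ext fun a => (basis k m hr j).ext fun b => (basis k m hr l).ext
    fun c => ?_
  -- The Massey class is homogeneous of weight minus the sum of the weights of `a`, `b` and `c`; by
  -- `hpure` no generator of its degree can pair with it.
  refine eq_zero_of_mem_wtClass hr (w := -a.1.wt m + -b.1.wt m + -c.1.wt m) (x :=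
    Submodule.Quotient.mk (s.massey h (basis k m hr i a) (basis k m hr j b) (basis k m hr l c)))
    (mk_mem_wtClass ?_) ?_
  · have ha := basis_mem_wtClass (k := k) hr a
    have hb := basis_mem_wtClass (k := k) hr b
    have hc := basis_mem_wtClass (k := k) hr c
    rw [Choice.coe_massey]
    refine sub_mem (add_mem (sub_mem ?_ ?_) ?_) (units_smul_mem_wtCochain _ ?_)
    · exact prod_mem_wtCochain _ rfl (h2 _ _ _ _ _ _ _ _ ha hb) (h1 _ _ _ hc)
    · rw [add_assoc]
      exact h2 _ _ _ _ _ _ _ _ ha (mul_mem_wtClass rfl rfl hb hc)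
    · exact h2 _ _ _ _ _ _ _ _ (mul_mem_wtClass rfl rfl ha hb) hc
    · rw [add_assoc]
      exact prod_mem_wtCochain _ rfl (h1 _ _ _ ha) (h2 _ _ _ _ _ _ _ _ hb hc)
  · intro e he
    refine hpure i j l n h a b c e ?_
    rw [← sub_eq_zero, ← he]
    abel

end TateSpan

/-! ### Weights of triple products -/

open ProdCyclic

namespace TateSpan

open TateMonomial HomCohomology

/-- The difference of the quotients by `2`, multiplied by `m`, equals the difference of the
remainders, which lies between `-1` and `3`. So it is zero, unless `m = 2`, where the weight is the
number itself. For `m = 3` the statement fails: `1, 1, 1` and `2` have weights `1, 1, 1` and `3`. -/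
theorem eq_add_add_of_weight {m : ℕ} (hm : 2 ≤ m) (hm3 : m ≠ 3) {a b c e : ℤ}
    (h : (m : ℤ) * (e / 2) + e % 2 =
      (m * (a / 2) + a % 2) + (m * (b / 2) + b % 2) + (m * (c / 2) + c % 2)) : e = a + b + c := by
  have h1 : (m : ℤ) * (e / 2 - a / 2 - b / 2 - c / 2) = a % 2 + b % 2 + c % 2 - e % 2 := by
    linarith
  have hm' : (2 : ℤ) ≤ m := by exact_mod_cast hm
  have hm3' : (m : ℤ) ≠ 3 := by exact_mod_cast hm3
  have key : (e / 2 - a / 2 - b / 2 - c / 2 = 0) ∨ ((m : ℤ) = 2 ∧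
      e / 2 - a / 2 - b / 2 - c / 2 = 1) := by
    set q := e / 2 - a / 2 - b / 2 - c / 2
    have h2 : -1 ≤ (m : ℤ) * q := by omega
    have h3 : (m : ℤ) * q ≤ 3 := by omega
    have h4 : 0 ≤ q := by nlinarith
    have h5 : q ≤ 1 := by nlinarith
    rcases (by omega : q = 0 ∨ q = 1) with hq | hq
    · exact Or.inl hq
    · rw [hq, mul_one] at h3
      exact Or.inr ⟨by omega, hq⟩
  rcases key with hq | ⟨h2, hq⟩
  · rw [hq, mul_zero] at h1
    omega
  · rw [hq, h2] at h1
    omega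

/-- `τ` is `0` for the resolution and `1` for the coresolution, whose degrees are shifted by `r -
1`; only its integrality matters later. -/
theorem sum_n_eq {r : ℕ} {m : Fin r → ℕ} {n : ℤ} (b : Gen m n) :
    ∃ τ : ℤ, ∑ i, b.1.n i = n - τ * (r - 1) := by
  obtain ⟨b, hb, hn, -⟩ := b
  unfold deg at hn
  split_ifs at hn
  · exact ⟨0, by linarith⟩
  · exact ⟨1, by linarith⟩

/-- Equal weights would make the exponents additive. Comparing `∑ n_i` with the degrees exhibits
`-1`, the degree of the Massey product, as a multiple of `r - 1`. -/
theorem wt_ne_add {k : Type u} [Field k] {r : ℕ} {m : Fin r → ℕ} [IsCharPowers k m]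
    (hr : r = 1 ∨ 3 ≤ r) (hm : ∀ i, m i ≠ 3)
    (i j l n : ℤ) (h : i + j + l + (-1) = n) (a : Gen m i) (b : Gen m j) (c : Gen m l)
    (e : Gen m n) : e.1.wt m ≠ a.1.wt m + b.1.wt m + c.1.wt m := by
  intro hw
  have h1 : ∀ t, e.1.n t = a.1.n t + b.1.n t + c.1.n t := fun t => by
    refine eq_add_add_of_weight (IsCharPowers.two_le k m t) (hm t) ?_
    have := congrFun hw t
    simp only [Pi.add_apply, wt, a.2.2.2 t, b.2.2.2 t, c.2.2.2 t, e.2.2.2 t] at this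
    push_cast at this
    linarith
  have h2 : ∑ t, e.1.n t = ∑ t, a.1.n t + ∑ t, b.1.n t + ∑ t, c.1.n t := by
    simp only [h1, Finset.sum_add_distrib]
  obtain ⟨τ₁, h3⟩ := sum_n_eq a
  obtain ⟨τ₂, h4⟩ := sum_n_eq b
  obtain ⟨τ₃, h5⟩ := sum_n_eq c
  obtain ⟨τ₄, h6⟩ := sum_n_eq e
  have h7 : (τ₄ - τ₁ - τ₂ - τ₃) * ((r : ℤ) - 1) = -1 := by
    rw [h3, h4, h5, h6] at h2
    linarith
  have h8 : ((r : ℤ) - 1) ∣ 1 := by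
    rw [← dvd_neg]
    exact ⟨_, by rw [← h7, mul_comm]⟩
  rcases hr with rfl | hr
  · norm_num at h8
  · have := Int.le_of_dvd one_pos h8
    omega

theorem exists_trivial_choice_of_ne {k : Type u} [Field k] {r : ℕ} {m : Fin r → ℕ}
    [IsCharPowers k m] (hr : r = 1 ∨ 3 ≤ r) (hm : ∀ i, m i ≠ 3) :
    ∃ s : Choice k (complex k m), s.Trivial :=
  exists_trivial_choice (by omega) (wt_ne_add (k := k) hr hm)

end TateSpan

/-! ### Sums of shifts of a complex -/

namespace HomCohomology

variable {k : Type u} [Field k] {C : Type w} [Category.{v} C] [Abelian C] [Linear k C]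
  [Limits.HasCoproducts.{v} C]

open Classical in
/-- Every morphism from `A` to a coproduct is the sum of finitely many of its components. -/
def IsSmallObject (A : C) : Prop :=
  ∀ {I : Type v} (M : I → C) (f : A ⟶ ∐ M),
    ∃ s : Finset I, f = ∑ i ∈ s, f ≫ Limits.Sigma.π M i ≫ Limits.Sigma.ι M i

variable (K L : CochainComplex C ℤ) {I : Type v} (deg : I → ℤ)

/-- The sum of the shifts of `K` by `deg i`, to the right. -/
noncomputable def sumShift : CochainComplex C ℤ where
  X n := ∐ fun i => K.X (n - deg i)
  d n n' := Limits.Sigma.map fun i => (deg i).negOnePow • K.d (n - deg i) (n' - deg i)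
  shape n n' h := by
    refine Limits.Sigma.hom_ext _ _ fun i => ?_
    rw [Limits.Sigma.ι_map, K.shape _ _ (by simp at h ⊢; omega)]
    simp
  d_comp_d' n n' n'' _ _ := by
    refine Limits.Sigma.hom_ext _ _ fun i => ?_
    rw [Limits.Sigma.ι_map_assoc, Limits.Sigma.ι_map]
    simp

variable {K L deg}

/-- The inclusion of a summand. -/
noncomputable def inj (n : ℤ) (i : I) : K.X (n - deg i) ⟶ (sumShift K deg).X n :=
  Limits.Sigma.ι (fun i => K.X (n - deg i)) i

open Classical in
/-- The projection to a summand. -/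
noncomputable def proj (n : ℤ) (i : I) : (sumShift K deg).X n ⟶ K.X (n - deg i) :=
  Limits.Sigma.π (fun i => K.X (n - deg i)) i

theorem sumShift_hom_ext {n : ℤ} {A : C} {f g : (sumShift K deg).X n ⟶ A}
    (h : ∀ i, inj n i ≫ f = inj n i ≫ g) : f = g := Limits.Sigma.hom_ext _ _ h

theorem inj_d (n n' : ℤ) (i : I) : inj n i ≫ (sumShift K deg).d n n' =
    (deg i).negOnePow • K.d (n - deg i) (n' - deg i) ≫ inj n' i := by
  refine (Limits.Sigma.ι_map (f := fun i => K.X (n - deg i)) (g := fun i => K.X (n' - deg i))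
    (fun i => (deg i).negOnePow • K.d (n - deg i) (n' - deg i)) i).trans ?_
  rw [Linear.units_smul_comp]
  rfl

theorem inj_proj (n : ℤ) (i : I) : inj (K := K) (deg := deg) n i ≫ proj n i = 𝟙 _ :=
  by classical exact Limits.Sigma.ι_π_eq_id (fun i => K.X (n - deg i)) i

theorem inj_proj_of_ne (n : ℤ) {i j : I} (h : i ≠ j) :
    inj (K := K) (deg := deg) n i ≫ proj n j = 0 := by
  classical exact Limits.Sigma.ι_π_of_ne (fun i => K.X (n - deg i)) h

theorem proj_d (n n' : ℤ) (i : I) : (sumShift K deg).d n n' ≫ proj n' i =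
    (deg i).negOnePow • proj n i ≫ K.d (n - deg i) (n' - deg i) := by
  refine sumShift_hom_ext fun j => ?_
  rw [← Category.assoc, inj_d, Linear.units_smul_comp, Category.assoc, Linear.comp_units_smul]
  by_cases h : j = i
  · subst h
    rw [inj_proj, Category.comp_id, ← Category.assoc, inj_proj, Category.id_comp]
  · rw [inj_proj_of_ne n' h, ← Category.assoc, inj_proj_of_ne n h, Limits.comp_zero,
      Limits.zero_comp, smul_zero, smul_zero]

variable (K deg) in
/-- The inclusion of a summand, as a cocycle. -/
noncomputable def incl (i : I) : Cocycle K (sumShift K deg) (deg i) :=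
  Cocycle.mk (Cochain.mk fun p q hpq => (K.XIsoOfEq (show p = q - deg i by omega)).hom ≫ inj q i)
    (deg i + 1) rfl (by
      ext p q hpq
      rw [δ_v (deg i) (deg i + 1) rfl _ p q hpq (q - 1) (p + 1) rfl rfl]
      simp only [Cochain.mk_v, Category.assoc, inj_d, Linear.comp_units_smul, Int.negOnePow_succ,
        HomologicalComplex.XIsoOfEq_hom_comp_d_assoc, HomologicalComplex.d_comp_XIsoOfEq_hom_assoc]
      simp)

theorem incl_v (i : I) (p q : ℤ) (hpq : p + deg i = q) :
    (incl K deg i : Cochain K (sumShift K deg) (deg i)).v p q hpq =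
      (K.XIsoOfEq (show p = q - deg i by omega)).hom ≫ inj q i := rfl

variable (K deg) in
/-- The projection to a summand, as a cocycle. -/
noncomputable def coord (i : I) : Cocycle (sumShift K deg) K (-deg i) :=
  Cocycle.mk (Cochain.mk fun p q hpq => proj p i ≫ (K.XIsoOfEq (show p - deg i = q by omega)).hom)
    (-deg i + 1) rfl (by
      ext p q hpq
      rw [δ_v (-deg i) (-deg i + 1) rfl _ p q hpq (q - 1) (p + 1) rfl rfl]
      simp only [Cochain.mk_v, Category.assoc, Int.negOnePow_succ,
        HomologicalComplex.XIsoOfEq_hom_comp_d]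
      rw [← Category.assoc ((sumShift K deg).d _ _), proj_d, Linear.units_smul_comp, Category.assoc,
        HomologicalComplex.d_comp_XIsoOfEq_hom, Int.negOnePow_neg, smul_smul, neg_mul,
        Int.units_mul_self, Units.neg_smul, one_smul, add_neg_cancel]
      rfl)

theorem coord_v (i : I) (p q : ℤ) (hpq : p + -deg i = q) :
    (coord K deg i : Cochain (sumShift K deg) K (-deg i)).v p q hpq =
      proj p i ≫ (K.XIsoOfEq (show p - deg i = q by omega)).hom := rfl

/-- The components of the morphism out of a sum of shifts given by a family of cocycles. -/
noncomputable def descX (γ : ∀ i, Cocycle K L (deg i)) (n : ℤ) :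
    (sumShift K deg).X n ⟶ L.X n :=
  Limits.Sigma.desc fun i => (γ i : Cochain K L (deg i)).v (n - deg i) n (by omega)

theorem inj_descX (γ : ∀ i, Cocycle K L (deg i)) (n : ℤ) (i : I) :
    inj n i ≫ descX γ n = (γ i : Cochain K L (deg i)).v (n - deg i) n (by omega) :=
  Limits.Sigma.ι_desc _ _

/-- The morphism out of a sum of shifts given by a family of cocycles. -/
noncomputable def sumDesc (γ : ∀ i, Cocycle K L (deg i)) : sumShift K deg ⟶ L where
  f := descX γ
  comm' n n' h := by
    change n + 1 = n' at h
    refine sumShift_hom_ext fun i => ?_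
    have h1 := Cochain.congr_v ((γ i).δ_eq_zero (deg i + 1)) (n - deg i) n' (by omega)
    rw [δ_v (deg i) (deg i + 1) rfl _ (n - deg i) n' _ n (n' - deg i) (by omega) (by omega),
      Cochain.zero_v, Int.negOnePow_succ, Units.neg_smul, ← sub_eq_add_neg, sub_eq_zero] at h1
    rw [← Category.assoc (inj n i), inj_descX, ← Category.assoc (inj n i), inj_d,
      Linear.units_smul_comp, Category.assoc, inj_descX, h1]

theorem inj_sumDesc (γ : ∀ i, Cocycle K L (deg i)) (n : ℤ) (i : I) :
    inj n i ≫ (sumDesc γ).f n = (γ i : Cochain K L (deg i)).v (n - deg i) n (by omega) :=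
  inj_descX γ n i

theorem prod_sumDesc_incl (γ : ∀ i, Cocycle K L (deg i)) (i : I) :
    prod k (zero_add (deg i)) (Cochain.ofHom (sumDesc γ)) (incl K deg i : Cochain K _ (deg i)) =
      (γ i : Cochain K L (deg i)) := by
  ext p q hpq
  obtain rfl : p = q - deg i := by omega
  rw [prod_apply, Cochain.comp_v _ _ _ (q - deg i) q q (by omega) (by omega), incl_v,
    Cochain.ofHom_v, Category.assoc, inj_sumDesc]
  simp

theorem coord_incl (i : I) : cohProd k (neg_add_cancel (deg i))
    (Submodule.Quotient.mk (coord K deg i)) (Submodule.Quotient.mk (incl K deg i)) =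
      Submodule.Quotient.mk (Cocycle.ofHom (𝟙 K)) := by
  rw [cohProd_mk]
  congr 1
  ext q
  rw [coe_cocycleProd, prod_apply, Cochain.comp_v _ _ _ q (q + deg i) q (by omega) (by omega),
    incl_v, coord_v, Category.assoc, ← Category.assoc (inj _ _), inj_proj]
  simp

theorem coord_incl_of_ne {i j : I} (h : i ≠ j) {n : ℤ} (hn : -deg j + deg i = n) :
    cohProd k hn (Submodule.Quotient.mk (coord K deg j)) (Submodule.Quotient.mk (incl K deg i)) =
      0 := by
  rw [cohProd_mk, Submodule.Quotient.mk_eq_zero]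
  convert Submodule.zero_mem _
  ext p q hpq
  rw [coe_cocycleProd, prod_apply, Cochain.comp_v _ _ _ p (p + deg i) q (by omega) (by omega),
    incl_v, coord_v, Category.assoc, ← Category.assoc (inj _ _), inj_proj_of_ne _ h]
  simp

/-- Classes in the cohomology of maps from a complex of small objects to a sum of shifts are
finite sums of their components. -/
theorem exists_eq_sum (hK : K.Acyclic) (hS : (sumShift K deg).Acyclic) [∀ i, Projective (K.X i)]
    [∀ i, Injective ((sumShift K deg).X i)] (hsm : IsSmallObject (K.X 0)) {n : ℤ}
    (x : H k K (sumShift K deg) n) : ∃ s : Finset I, x = ∑ i ∈ s,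
      cohProd k (add_sub_cancel (deg i) n) (Submodule.Quotient.mk (incl K deg i))
        (cohProd k (neg_add_eq_sub (deg i) n) (Submodule.Quotient.mk (coord K deg i)) x) := by
  obtain ⟨z, rfl⟩ := Submodule.Quotient.mk_surjective _ x
  -- A cocycle vanishing in one degree is a coboundary, so finiteness is needed only for the
  -- component out of `K.X 0`.
  obtain ⟨s, hs⟩ := hsm (fun i => K.X (n - deg i))
    ((z : Cochain K (sumShift K deg) n).v 0 n (by omega))
  refine ⟨s, ?_⟩
  let c : I → Cocycle K (sumShift K deg) n := fun i =>
    cocycleProd k (add_sub_cancel (deg i) n) (incl K deg i)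
      (cocycleProd k (neg_add_eq_sub (deg i) n) (coord K deg i) z)
  have hc : (Submodule.Quotient.mk (∑ i ∈ s, c i) : H k K (sumShift K deg) n) = ∑ i ∈ s,
      cohProd k (add_sub_cancel (deg i) n) (Submodule.Quotient.mk (incl K deg i))
        (cohProd k (neg_add_eq_sub (deg i) n) (Submodule.Quotient.mk (coord K deg i))
          (Submodule.Quotient.mk z)) :=
    map_sum (Submodule.mkQ (boundaries k K (sumShift K deg) n)) c s
  have hcv : ∀ i, (c i : Cochain K (sumShift K deg) n).v 0 n (by omega) =
      (z : Cochain K (sumShift K deg) n).v 0 n (by omega) ≫ proj n i ≫ inj n i := by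
    intro i
    simp only [c, coe_cocycleProd, prod_apply]
    rw [Cochain.comp_v _ _ _ 0 (n - deg i) n (by omega) (by omega),
      Cochain.comp_v _ _ _ 0 n (n - deg i) (by omega) (by omega), incl_v, coord_v]
    simp
  obtain ⟨y, hy⟩ := exists_δ_eq_of_v_eq_zero (n := n - 1) (by omega) hK hS (z - ∑ i ∈ s, c i) 0 n
    (by omega) (by
      have : ∀ (t : Finset I), ((∑ i ∈ t, c i : Cocycle K (sumShift K deg) n) :
          Cochain K (sumShift K deg) n).v 0 n (by omega) =
          ∑ i ∈ t, (z : Cochain K (sumShift K deg) n).v 0 n (by omega) ≫ proj n i ≫ inj n i := by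
        intro t
        classical
        induction t using Finset.induction_on with
        | empty => simp
        | insert a t ha ih =>
          rw [Finset.sum_insert ha, Finset.sum_insert ha, Cocycle.coe_add, Cochain.add_v, ih, hcv]
      rw [Cocycle.coe_sub, Cochain.sub_v, this, sub_eq_zero]
      exact hs)
  rw [← hc]
  exact mk_eq_mk_of_δ_eq y hy

end HomCohomology

/-! ### Cohomology of maps to a mapping cone -/

namespace HomCohomology

open CochainComplex

variable {k : Type u} [Field k] {C : Type w} [Category.{v} C] [Abelian C] [Linear k C]
  {K F G : CochainComplex C ℤ} (φ : F ⟶ G)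

variable (k) in
/-- The class of a morphism. -/
def ofHom {F G : CochainComplex C ℤ} (f : F ⟶ G) : H k F G 0 :=
  Submodule.Quotient.mk (Cocycle.ofHom f)

variable (k) in
/-- The class of the first projection of a mapping cone. -/
noncomputable def coneFst : H k (mappingCone φ) F 1 :=
  Submodule.Quotient.mk (mappingCone.fst φ)

theorem δ_prod_inl {n N : ℤ} (h : -1 + n = N) (z : Cochain K F n) (n' : ℤ) (hn' : n + 1 = n') :
    δ N n (prod k h (mappingCone.inl φ) z) =
      prod k (zero_add n) (Cochain.ofHom (mappingCone.inr φ))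
        (prod k (zero_add n) (Cochain.ofHom φ) z) -
      prod k (by omega) (mappingCone.inl φ) (δ n n' z) := by
  rw [δ_prod k h (neg_add_cancel 1) hn' (by omega), mappingCone.δ_inl, Int.negOnePow_neg,
    Int.negOnePow_one, Units.neg_smul, one_smul, ← sub_eq_add_neg, ← prod_assoc k (zero_add 0)
      (zero_add n) (zero_add n) (zero_add n)]
  congr 3
  simp [prod_apply]

theorem prod_snd_inr : prod k (zero_add 0) (mappingCone.snd φ)
    (Cochain.ofHom (mappingCone.inr φ)) = Cochain.ofHom (𝟙 G) := mappingCone.inr_snd φ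

theorem prod_fst_inr : prod k (add_zero 1) (mappingCone.fst φ : Cochain (mappingCone φ) F 1)
    (Cochain.ofHom (mappingCone.inr φ)) = 0 := mappingCone.inr_fst φ

theorem prod_fst_inl : prod k (add_neg_cancel 1) (mappingCone.fst φ : Cochain (mappingCone φ) F 1)
    (mappingCone.inl φ) = Cochain.ofHom (𝟙 F) := mappingCone.inl_fst φ

theorem id_prod {n : ℤ} (z : Cochain K F n) :
    prod k (zero_add n) (Cochain.ofHom (𝟙 F)) z = z := by
  rw [prod_apply]
  simp

theorem cone_decomposition {n N : ℤ} (h : -1 + n = N) (z : Cochain K (mappingCone φ) N) :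
    z = prod k h (mappingCone.inl φ)
        (prod k (by omega) (mappingCone.fst φ : Cochain (mappingCone φ) F 1) z) +
      prod k (zero_add N) (Cochain.ofHom (mappingCone.inr φ))
        (prod k (zero_add N) (mappingCone.snd φ) z) := by
  rw [← prod_assoc k (neg_add_cancel 1) (by omega) (zero_add N) h,
    ← prod_assoc k (add_zero 0) (zero_add N) (zero_add N) (zero_add N),
    ← LinearMap.add_apply, ← map_add]
  have : prod k (neg_add_cancel 1) (mappingCone.inl φ)
      (mappingCone.fst φ : Cochain (mappingCone φ) F 1) +
      prod k (add_zero 0) (Cochain.ofHom (mappingCone.inr φ)) (mappingCone.snd φ) =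
      Cochain.ofHom (𝟙 (mappingCone φ)) := (mappingCone.id φ)
  rw [this, id_prod]

/-- The second component of a cocycle in the cone is, up to sign, a null-homotopy of `φ` times its
first component. Together with the next two lemmas this provides the exactness of the cone sequence.
-/
theorem φ_mul_coneFst_mul {n N : ℤ} (h : 1 + N = n) (y : H k K (mappingCone φ) N) :
    cohProd k (zero_add n) (ofHom k φ) (cohProd k h (coneFst k φ) y) = 0 := by
  obtain ⟨y, rfl⟩ := Submodule.Quotient.mk_surjective _ y
  refine mk_eq_zero_of_δ_eq (x := cocycleProd k (zero_add n) (Cocycle.ofHom φ)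
    (cocycleProd k h (mappingCone.fst φ) y))
    (-prod k (zero_add N) (mappingCone.snd φ) (y : Cochain K (mappingCone φ) N)) ?_
  rw [δ_neg, δ_prod k _ (zero_add 1) rfl (by omega), mappingCone.δ_snd, Cocycle.δ_eq_zero,
    map_zero, smul_zero, add_zero, map_neg, LinearMap.neg_apply, neg_neg, coe_cocycleProd,
    coe_cocycleProd]
  exact prod_assoc k (zero_add 1) h h (zero_add n) _ _ _

/-- If `δ w` is the first component of `y`, then changing `y` by the boundary of `inl w` leaves a
cocycle that comes from `G`. -/
theorem exists_eq_inr_mul {n N : ℤ} (h : 1 + N = n) (y : H k K (mappingCone φ) N)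
    (hy : cohProd k h (coneFst k φ) y = 0) :
    ∃ c : H k K G N, y = cohProd k (zero_add N) (ofHom k (mappingCone.inr φ)) c := by
  obtain ⟨y, rfl⟩ := Submodule.Quotient.mk_surjective _ y
  obtain ⟨w, hw⟩ := exists_δ_eq_of_mk_eq_zero (k := k) (show N + 1 = n by omega)
    (x := cocycleProd k h (mappingCone.fst φ) y) hy
  rw [coe_cocycleProd] at hw
  let c : Cocycle K G N := Cocycle.mk (prod k (zero_add N) (mappingCone.snd φ)
    (y : Cochain K (mappingCone φ) N) + prod k (zero_add N) (Cochain.ofHom φ) w) n (by omega) (by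
      rw [δ_add, δ_prod k _ (zero_add 1) rfl (by omega), mappingCone.δ_snd, Cocycle.δ_eq_zero,
        δ_prod k _ (zero_add 1) (show N + 1 = n by omega) (by omega), hw, δ_ofHom, map_zero,
        smul_zero, add_zero, map_neg, LinearMap.neg_apply, map_zero, LinearMap.zero_apply,
        zero_add, Int.negOnePow_zero, one_smul, neg_add_eq_zero]
      exact prod_assoc k (zero_add 1) h h (zero_add n) _ _ _)
  refine ⟨Submodule.Quotient.mk c, ?_⟩
  refine mk_eq_mk_of_δ_eq (y := cocycleProd k (zero_add N) (Cocycle.ofHom (mappingCone.inr φ)) c)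
    (-prod k (show -1 + N = N - 1 by omega) (mappingCone.inl φ) w) ?_
  have h1 := cone_decomposition (k := k) φ (show -1 + n = N by omega)
    (y : Cochain K (mappingCone φ) N)
  have h2 : (cocycleProd k (zero_add N) (Cocycle.ofHom (mappingCone.inr φ)) c :
      Cochain K (mappingCone φ) N) = prod k (zero_add N) (Cochain.ofHom (mappingCone.inr φ))
        (prod k (zero_add N) (mappingCone.snd φ)
    (y : Cochain K (mappingCone φ) N) + prod k (zero_add N) (Cochain.ofHom φ) w) := rfl
  rw [δ_neg, δ_prod_inl φ _ w n (by omega), hw, h2, map_add]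
  rw [eq_sub_iff_add_eq]
  refine Eq.trans ?_ h1.symm
  abel

/-- For a null-homotopy `w` of the image of `c` in the cone, the first component of `w` is the
cocycle `z`, and the second one is a homotopy between `φ z` and `c`. -/
theorem exists_eq_φ_mul {n : ℤ} (c : H k K G n)
    (hc : cohProd k (zero_add n) (ofHom k (mappingCone.inr φ)) c = 0) :
    ∃ z : H k K F n, c = cohProd k (zero_add n) (ofHom k φ) z := by
  obtain ⟨c, rfl⟩ := Submodule.Quotient.mk_surjective _ c
  obtain ⟨w, hw⟩ := exists_δ_eq_of_mk_eq_zero (k := k) (sub_add_cancel n 1)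
    (x := cocycleProd k (zero_add n) (Cocycle.ofHom (mappingCone.inr φ)) c) hc
  have hw' : δ (n - 1) n w = prod k (zero_add n) (Cochain.ofHom (mappingCone.inr φ))
    (c : Cochain K G n) := hw
  let z : Cocycle K F n := Cocycle.mk (prod k (add_sub_cancel 1 n)
    (mappingCone.fst φ : Cochain (mappingCone φ) F 1) w) (n + 1) rfl (by
      rw [δ_prod k _ rfl (sub_add_cancel n 1) rfl, hw', Cocycle.δ_eq_zero,
        ← prod_assoc k (add_zero 1) _ (add_comm 1 n), prod_fst_inr]
      simp)
  refine ⟨Submodule.Quotient.mk z, mk_eq_mk_of_δ_eq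
    (y := cocycleProd k (zero_add n) (Cocycle.ofHom φ) z)
    (prod k (zero_add (n - 1)) (mappingCone.snd φ) w) ?_⟩
  have h2 : (cocycleProd k (zero_add n) (Cocycle.ofHom φ) z : Cochain K G n) =
    prod k (zero_add n) (Cochain.ofHom φ) (prod k (add_sub_cancel 1 n)
    (mappingCone.fst φ : Cochain (mappingCone φ) F 1) w) := rfl
  rw [δ_prod k _ (zero_add 1) (sub_add_cancel n 1) (sub_add_cancel n 1), hw', mappingCone.δ_snd,
    h2, ← prod_assoc k (zero_add 0) (zero_add n) (zero_add n) (zero_add n), prod_snd_inr, id_prod,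
    Int.negOnePow_zero, one_smul, map_neg, LinearMap.neg_apply, ← prod_assoc k (zero_add 1)
    (add_sub_cancel 1 n) (add_sub_cancel 1 n) (zero_add n)]
  exact neg_add_eq_sub _ _

theorem coneFst_inr : cohProd k (add_zero 1) (coneFst k φ) (ofHom k (mappingCone.inr φ)) = 0 := by
  refine mk_eq_zero_of_δ_eq (x := cocycleProd k (add_zero 1) (mappingCone.fst φ)
    (Cocycle.ofHom (mappingCone.inr φ))) (0 : Cochain G F 0) ?_
  rw [δ_zero]
  exact (prod_fst_inr φ).symm

theorem inr_φ : cohProd k (add_zero 0) (ofHom k (mappingCone.inr φ)) (ofHom k φ) = 0 := by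
  refine mk_eq_zero_of_δ_eq (x := cocycleProd k (add_zero 0) (Cocycle.ofHom (mappingCone.inr φ))
    (Cocycle.ofHom φ)) (mappingCone.inl φ) ?_
  rw [mappingCone.δ_inl, coe_cocycleProd, prod_apply]
  simp

theorem acyclic_mappingCone (hF : F.Acyclic) (hG : G.Acyclic) : (mappingCone φ).Acyclic := by
  rw [← HomotopyCategory.quotient_obj_mem_subcategoryAcyclic_iff_acyclic] at hF hG ⊢
  exact (HomotopyCategory.subcategoryAcyclic C).ext_of_isTriangulatedClosed₃ _
    (HomotopyCategory.mappingCone_triangleh_distinguished φ) hF hG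

theorem projective_mappingCone (hF : ∀ i, Projective (F.X i)) (hG : ∀ i, Projective (G.X i))
    (i : ℤ) : Projective ((mappingCone φ).X i) := by
  have := HomologicalComplex.HasHomotopyCofiber.hasBinaryBiproduct φ i (i + 1) rfl
  exact Projective.of_iso (HomologicalComplex.homotopyCofiber.XIsoBiprod φ i (i + 1) rfl).symm
    inferInstance

end HomCohomology

/-! ### Realisation of graded modules when Massey cochains are coboundaries -/

namespace HomCohomology

open CochainComplex

open scoped Classical

variable {k : Type u} [Field k] {C : Type w} [Category.{v} C] [Abelian C] [Linear k C]
  {K : CochainComplex C ℤ}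

section

variable {I : Type v} (deg : I → ℤ)

variable (k K) in
/-- Finitely supported families of classes, indexed by the summands of a sum of shifts. -/
abbrev Coeffs (n : ℤ) : Type v := DirectSum I fun i => H k K K (n - deg i)

variable (k K) in
/-- A family supported in one index. -/
noncomputable def Coeffs.single (n : ℤ) (i : I) : H k K K (n - deg i) →ₗ[k] Coeffs k K deg n :=
  DirectSum.lof k I (fun i => H k K K (n - deg i)) i

variable {deg}

/-- The linear map on families given by linear maps on the components. -/
noncomputable def Coeffs.lift {n : ℤ} {V : Type*} [AddCommGroup V] [Module k V]
    (f : ∀ i, H k K K (n - deg i) →ₗ[k] V) : Coeffs k K deg n →ₗ[k] V :=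
  DirectSum.toModule k I V f

@[simp] theorem Coeffs.lift_single {n : ℤ} {V : Type*} [AddCommGroup V] [Module k V]
    (f : ∀ i, H k K K (n - deg i) →ₗ[k] V) (i : I) (x : H k K K (n - deg i)) :
    Coeffs.lift f (Coeffs.single k K deg n i x) = f i x :=
  DirectSum.toModule_lof (M := fun i => H k K K (n - deg i)) (φ := f) k i x

theorem Coeffs.induction {n : ℤ} {P : Coeffs k K deg n → Prop} (h0 : P 0)
    (h1 : ∀ i x, P (Coeffs.single k K deg n i x)) (h2 : ∀ x y, P x → P y → P (x + y))
    (x : Coeffs k K deg n) : P x :=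
  DirectSum.induction_on x h0 h1 h2

theorem Coeffs.hom_ext {n : ℤ} {V : Type*} [AddCommGroup V] [Module k V]
    {f g : Coeffs k K deg n →ₗ[k] V}
    (h : ∀ i x, f (Coeffs.single k K deg n i x) = g (Coeffs.single k K deg n i x)) : f = g :=
  DirectSum.linearMap_ext k fun i => LinearMap.ext fun x => h i x

variable (deg) in
/-- The action of a class on families of classes, from the right. -/
noncomputable def Coeffs.act {n l n' : ℤ} (h : n + l = n') (c : H k K K l) :
    Coeffs k K deg n →ₗ[k] Coeffs k K deg n' :=
  Coeffs.lift fun i => (Coeffs.single k K deg n' i).comp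
    ((cohProd k (show n - deg i + l = n' - deg i by omega)).flip c)

@[simp] theorem Coeffs.act_single {n l n' : ℤ} (h : n + l = n') (c : H k K K l) (i : I)
    (x : H k K K (n - deg i)) : Coeffs.act deg h c (Coeffs.single k K deg n i x) =
      Coeffs.single k K deg n' i (cohProd k (show n - deg i + l = n' - deg i by omega) x c) :=
  Coeffs.lift_single _ _ _

variable [Limits.HasCoproducts.{v} C] (s : Choice k K)

/-- The cocycle given by a family of classes. -/
noncomputable def expand (n : ℤ) : Coeffs k K deg n →ₗ[k] Cocycle K (sumShift K deg) n :=
  Coeffs.lift fun i =>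
    (cocycleProd k (add_sub_cancel (deg i) n) (incl K deg i)).comp (s.rep (n - deg i))

theorem expand_single (n : ℤ) (i : I) (x : H k K K (n - deg i)) :
    expand s n (Coeffs.single k K deg n i x) =
      cocycleProd k (add_sub_cancel (deg i) n) (incl K deg i) (s.rep (n - deg i) x) :=
  Coeffs.lift_single _ _ _

/-- The class given by a family of classes. -/
noncomputable def expandH (n : ℤ) : Coeffs k K deg n →ₗ[k] H k K (sumShift K deg) n :=
  (Submodule.mkQ _).comp (expand s n)

theorem expandH_apply (n : ℤ) (b : Coeffs k K deg n) :
    expandH s n b = Submodule.Quotient.mk (expand s n b) := rfl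

theorem expandH_single (n : ℤ) (i : I) (x : H k K K (n - deg i)) :
    expandH s n (Coeffs.single k K deg n i x) =
      cohProd k (add_sub_cancel (deg i) n) (Submodule.Quotient.mk (incl K deg i)) x := by
  rw [expandH_apply, expand_single, ← cohProd_mk, s.mk_rep]

theorem expandH_act {n l n' : ℤ} (h : n + l = n') (c : H k K K l) (b : Coeffs k K deg n) :
    expandH s n' (Coeffs.act deg h c b) = cohProd k h (expandH s n b) c := by
  suffices hs : (expandH s n').comp (Coeffs.act deg h c) =
      ((cohProd k h).flip c).comp (expandH s n) from LinearMap.congr_fun hs b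
  refine Coeffs.hom_ext fun i x => ?_
  rw [LinearMap.comp_apply, LinearMap.comp_apply, LinearMap.flip_apply, Coeffs.act_single,
    expandH_single, expandH_single, cohProd_assoc]

/-- The classes `coord` recover the components of a family, which gives injectivity. Surjectivity is
the finiteness of the decomposition in `exists_eq_sum`, a consequence of smallness. -/
theorem expandH_bijective (hK : K.Acyclic) (hS : (sumShift K deg).Acyclic)
    [∀ i, Projective (K.X i)] [∀ i, Injective ((sumShift K deg).X i)]
    (hsm : IsSmallObject (K.X 0)) (n : ℤ) :
    Function.Bijective (expandH (deg := deg) s n) := by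
  constructor
  · refine (injective_iff_map_eq_zero _).2 fun b hb => ?_
    have h : ∀ i, (cohProd k (neg_add_eq_sub (deg i) n)
        (Submodule.Quotient.mk (coord K deg i))).comp (expandH s n) =
        DirectSum.component k I (fun i => H k K K (n - deg i)) i := by
      intro i
      refine Coeffs.hom_ext fun j x => ?_
      rw [LinearMap.comp_apply, expandH_single]
      by_cases hij : j = i
      · subst hij
        rw [← cohProd_assoc k (neg_add_cancel (deg j)) _ (zero_add _), coord_incl, id_cohProd]
        exact (DirectSum.component.lof_self (M := fun i => H k K K (n - deg i)) k j x).symm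
      · rw [← cohProd_assoc k rfl _ (show -deg i + deg j + (n - deg j) = n - deg i by omega),
          coord_incl_of_ne hij, map_zero, LinearMap.zero_apply]
        refine Eq.symm ((DirectSum.component.of (M := fun i => H k K K (n - deg i)) k i j x).trans ?_)
        rw [dif_neg hij]
    refine DirectSum.ext_component k fun i => ?_
    rw [← h, LinearMap.comp_apply, hb]
    simp
  · intro x
    obtain ⟨t, ht⟩ := exists_eq_sum hK hS hsm x
    refine ⟨∑ i ∈ t, Coeffs.single k K deg n i (cohProd k (neg_add_eq_sub (deg i) n)
      (Submodule.Quotient.mk (coord K deg i)) x), ?_⟩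
    rw [map_sum]
    simp only [expandH_single]
    exact ht.symm

end

variable (s : Choice k K) {X : ℤ → Type v} [∀ n, AddCommGroup (X n)] [∀ n, Module k (X n)]

variable (k X) in
/-- The index set of a homogeneous basis of a graded module. -/
structure BasisIndex where
  deg : ℤ
  idx : Module.Free.ChooseBasisIndex k (X deg)

variable (k K X) in
/-- Pairs of a homogeneous element of a module and a homogeneous scalar. -/
structure RelIndex where
  deg : ℤ
  elt : X deg
  scalarDeg : ℤ
  scalar : H k K K scalarDeg

variable (k X) in
/-- The degree of a basis element. -/
abbrev basisDeg (i : BasisIndex k X) : ℤ := i.deg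

variable (k K X) in
/-- The degree of a product. -/
abbrev relDeg (j : RelIndex k K X) : ℤ := j.deg + j.scalarDeg

variable (k K) in
/-- Tensors of a module and the cohomology algebra, as families of classes. -/
noncomputable def tens (d n : ℤ) :
    X d →ₗ[k] H k K K (n - d) →ₗ[k] Coeffs k K (basisDeg k X) n :=
  (Module.Free.chooseBasis k (X d)).constr k
    fun a => Coeffs.single k K (basisDeg k X) n ⟨d, a⟩

/-- To check an identity on tensors, it suffices to consider basis elements. -/
theorem tens_ext {d n : ℤ} {V : Type*} [AddCommGroup V] [Module k V]
    {f : Coeffs k K (basisDeg k X) n →ₗ[k] V} {g : X d →ₗ[k] H k K K (n - d) →ₗ[k] V}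
    (h : ∀ (a : Module.Free.ChooseBasisIndex k (X d)) b,
      f (Coeffs.single k K (basisDeg k X) n ⟨d, a⟩ b) = g (Module.Free.chooseBasis k (X d) a) b)
    (y : X d) (b : H k K K (n - d)) : f (tens k K d n y b) = g y b := by
  suffices hs : (tens k K d n).compr₂ f = g from LinearMap.congr_fun (LinearMap.congr_fun hs y) b
  refine (Module.Free.chooseBasis k (X d)).ext fun a => LinearMap.ext fun b => ?_
  rw [LinearMap.compr₂_apply, tens, Module.Basis.constr_basis, h]

variable [Limits.HasCoproducts.{v} C]

variable (k K) in
/-- The cocycle given by a homogeneous element of a module. -/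
noncomputable def elt (d : ℤ) : X d →ₗ[k] Cocycle K (sumShift K (basisDeg k X)) d :=
  (Module.Free.chooseBasis k (X d)).constr k fun a => incl K (basisDeg k X) ⟨d, a⟩

theorem expand_tens {d n : ℤ} (y : X d) (b : H k K K (n - d)) :
    expand s n (tens k K d n y b) =
      cocycleProd k (add_sub_cancel d n) (elt k K d y) (s.rep (n - d) b) :=
  tens_ext (g := (cocycleProd k (add_sub_cancel d n)).compl₁₂ (elt k K d) (s.rep (n - d)))
    (fun a b => by
      rw [expand_single, LinearMap.compl₁₂_apply, elt, Module.Basis.constr_basis]) y b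

/-- The family `x ⊗ f₂(b, c)`, up to sign. -/
noncomputable def htpyRight {n l N : ℤ} (h : n + l + (-1) = N) (c : H k K K l) :
    Coeffs k K (basisDeg k X) n →ₗ[k] Cochain K (sumShift K (basisDeg k X)) N :=
  Coeffs.lift fun i => i.deg.negOnePow •
    (prod k (show i.deg + (N - i.deg) = N by omega)
      (incl K (basisDeg k X) i : Cochain K (sumShift K (basisDeg k X)) i.deg)).comp
      ((s.htpy (show n - i.deg + l + (-1) = N - i.deg by omega)).flip c)

theorem htpyRight_tens {d n l N : ℤ} (h : n + l + (-1) = N) (c : H k K K l) (y : X d)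
    (b : H k K K (n - d)) : htpyRight s h c (tens k K d n y b) = d.negOnePow •
      prod k (show d + (N - d) = N by omega)
        (elt k K d y : Cochain K (sumShift K (basisDeg k X)) d)
        (s.htpy (show n - d + l + (-1) = N - d by omega) b c) := by
  refine tens_ext (g := d.negOnePow • (prod k (show d + (N - d) = N by omega)).compl₁₂
    ((coeLinear d).comp (elt k K d)) ((s.htpy (show n - d + l + (-1) = N - d by omega)).flip c))
    (fun a b => ?_) y b
  rw [htpyRight, Coeffs.lift_single]
  simp only [LinearMap.smul_apply, LinearMap.compl₁₂_apply, LinearMap.comp_apply,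
    LinearMap.flip_apply, elt, Module.Basis.constr_basis, coeLinear_apply]

variable (act : ∀ {i j l : ℤ}, i + j = l → (X i →ₗ[k] H k K K j →ₗ[k] X l))

/-- The action map on tensors. -/
noncomputable def tensAct (n : ℤ) : Coeffs k K (basisDeg k X) n →ₗ[k] X n :=
  Coeffs.lift fun i => act (add_sub_cancel i.deg n) (Module.Free.chooseBasis k (X i.deg) i.idx)

omit [Limits.HasCoproducts C] in
theorem tensAct_tens {d n : ℤ} (y : X d) (b : H k K K (n - d)) :
    tensAct act n (tens k K d n y b) = act (add_sub_cancel d n) y b :=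
  tens_ext (g := act (add_sub_cancel d n)) (fun a b => by rw [tensAct, Coeffs.lift_single]) y b

/-- The bar differential, sending `x ⊗ h ⊗ b` to `x h ⊗ b - x ⊗ h b`. -/
noncomputable def bar (n : ℤ) :
    Coeffs k K (relDeg k K X) n →ₗ[k] Coeffs k K (basisDeg k X) n :=
  Coeffs.lift fun j => tens k K (j.deg + j.scalarDeg) n (act rfl j.elt j.scalar) -
    (tens k K j.deg n j.elt).comp
      (cohProd k (show j.scalarDeg + (n - (j.deg + j.scalarDeg)) = n - j.deg by omega) j.scalar)

omit [Limits.HasCoproducts C] in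
theorem bar_single (n : ℤ) (j : RelIndex k K X) (b : H k K K (n - (j.deg + j.scalarDeg))) :
    bar act n (Coeffs.single k K (relDeg k K X) n j b) =
      tens k K (j.deg + j.scalarDeg) n (act rfl j.elt j.scalar) b - tens k K j.deg n j.elt
        (cohProd k (show j.scalarDeg + (n - (j.deg + j.scalarDeg)) = n - j.deg by omega) j.scalar b) :=
  Coeffs.lift_single _ _ _

omit [Limits.HasCoproducts C] in
theorem tensAct_bar (act_mul : ∀ {i j l ij jl n : ℤ} (hij : i + j = ij) (hjl : j + l = jl)
    (h : ij + l = n) (h' : i + jl = n) (x : X i) (b : H k K K j) (c : H k K K l),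
    act h (act hij x b) c = act h' x (cohProd k hjl b c)) (n : ℤ)
    (b : Coeffs k K (relDeg k K X) n) : tensAct act n (bar act n b) = 0 := by
  suffices hs : (tensAct act n).comp (bar act n) = 0 from LinearMap.congr_fun hs b
  refine Coeffs.hom_ext fun j b => ?_
  rw [LinearMap.comp_apply, bar_single, map_sub, tensAct_tens, tensAct_tens,
    act_mul rfl (show j.scalarDeg + (n - (j.deg + j.scalarDeg)) = n - j.deg by omega) _
      (add_sub_cancel j.deg n), sub_self, LinearMap.zero_apply]

/-- The relations between the cocycles given by the elements of a module. -/
noncomputable def relMap : sumShift K (relDeg k K X) ⟶ sumShift K (basisDeg k X) :=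
  sumDesc fun j => elt k K (j.deg + j.scalarDeg) (act rfl j.elt j.scalar) -
    cocycleProd k rfl (elt k K j.deg j.elt) (s.rep j.scalarDeg j.scalar)

theorem prod_relMap_incl (j : RelIndex k K X) :
    prod k (zero_add (j.deg + j.scalarDeg)) (Cochain.ofHom (relMap s act))
      (incl K (relDeg k K X) j : Cochain K _ (j.deg + j.scalarDeg)) =
      (elt k K (j.deg + j.scalarDeg) (act rfl j.elt j.scalar) : Cochain K _ (j.deg + j.scalarDeg)) -
      prod k rfl (elt k K j.deg j.elt : Cochain K _ j.deg)
        (s.rep j.scalarDeg j.scalar : Cochain K K j.scalarDeg) :=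
  prod_sumDesc_incl _ j

/-- The family `x ⊗ f₂(h, b)`, up to sign. -/
noncomputable def htpyLeft {n N : ℤ} (h : n + (-1) = N) :
    Coeffs k K (relDeg k K X) n →ₗ[k] Cochain K (sumShift K (basisDeg k X)) N :=
  Coeffs.lift fun j => j.deg.negOnePow • (prod k (show j.deg + (N - j.deg) = N by omega)
    (elt k K j.deg j.elt : Cochain K (sumShift K (basisDeg k X)) j.deg)).comp
      (s.htpy (show j.scalarDeg + (n - (j.deg + j.scalarDeg)) + (-1) = N - j.deg by omega) j.scalar)

theorem htpyLeft_single {n N : ℤ} (h : n + (-1) = N) (j : RelIndex k K X)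
    (b : H k K K (n - (j.deg + j.scalarDeg))) :
    htpyLeft s h (Coeffs.single k K (relDeg k K X) n j b) =
      j.deg.negOnePow • prod k (show j.deg + (N - j.deg) = N by omega)
    (elt k K j.deg j.elt : Cochain K (sumShift K (basisDeg k X)) j.deg)
      (s.htpy (show j.scalarDeg + (n - (j.deg + j.scalarDeg)) + (-1) = N - j.deg by omega) j.scalar b) :=
  Coeffs.lift_single _ _ _

/-- On cocycles, `relMap` sends `x ⊗ h ⊗ b` to `x h ⊗ b - x f₁(h) f₁(b)`, whereas `bar` involves
`f₁(h b)`. The difference is bounded by `x f₂(h, b)`, so `relMap` induces `bar` on cohomology. -/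
theorem δ_htpyLeft {n N : ℤ} (h : n + (-1) = N) (b : Coeffs k K (relDeg k K X) n) :
    δ N n (htpyLeft s h b) = prod k (zero_add n) (Cochain.ofHom (relMap s act))
      (expand s n b : Cochain K (sumShift K (relDeg k K X)) n) -
      (expand s n (bar act n b) : Cochain K (sumShift K (basisDeg k X)) n) := by
  suffices hs : (δ_hom k K (sumShift K (basisDeg k X)) N n).comp (htpyLeft s h) =
      (prod k (zero_add n) (Cochain.ofHom (relMap s act))).comp ((coeLinear n).comp (expand s n)) -
      ((coeLinear n).comp (expand s n)).comp (bar act n) from LinearMap.congr_fun hs b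
  refine Coeffs.hom_ext fun j b => ?_
  change δ N n (htpyLeft s h (Coeffs.single k K (relDeg k K X) n j b)) =
    prod k (zero_add n) (Cochain.ofHom (relMap s act))
      (expand s n (Coeffs.single k K (relDeg k K X) n j b) :
        Cochain K (sumShift K (relDeg k K X)) n) -
      (expand s n (bar act n (Coeffs.single k K (relDeg k K X) n j b)) :
        Cochain K (sumShift K (basisDeg k X)) n)
  rw [htpyLeft_single, δ_units_smul, δ_prod k _ rfl (show N - j.deg + 1 = n - j.deg by omega)
      (by omega), Cocycle.δ_eq_zero, map_zero, LinearMap.zero_apply, zero_add, smul_smul,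
    Int.units_mul_self, one_smul, s.δ_htpy _ (show j.scalarDeg + (n - (j.deg + j.scalarDeg)) = n - j.deg by omega),
    bar_single, map_sub (expand s n), expand_tens, expand_tens, expand_single, Cocycle.coe_sub,
    coe_cocycleProd, coe_cocycleProd, coe_cocycleProd]
  rw [← prod_assoc k (zero_add (relDeg k K X j)) (add_sub_cancel (relDeg k K X j) n)
    (add_sub_cancel (relDeg k K X j) n) (zero_add n)]
  have h1 : prod k (zero_add (relDeg k K X j)) (Cochain.ofHom (relMap s act))
      (incl K (relDeg k K X) j : Cochain K _ (relDeg k K X j)) = _ := prod_relMap_incl s act j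
  rw [h1]
  simp only [map_sub, LinearMap.sub_apply]
  rw [← prod_assoc k rfl (show j.scalarDeg + (n - (j.deg + j.scalarDeg)) = n - j.deg by omega)
    (show j.deg + j.scalarDeg + (n - (j.deg + j.scalarDeg)) = n by omega) (show j.deg + (n - j.deg) = n by omega)]
  abel

end HomCohomology

/-! ### Compatibility of the homotopies with the right action -/

namespace HomCohomology

open CochainComplex

open scoped Classical

variable {k : Type u} [Field k] {C : Type w} [Category.{v} C] [Abelian C] [Linear k C]
  [Limits.HasCoproducts.{v} C] {K : CochainComplex C ℤ} (s : Choice k K)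

/-- The family `f₂(b, c)`, up to sign. -/
noncomputable def htpyAct {I : Type v} (deg : I → ℤ) {n l N : ℤ} (h : n + l + (-1) = N)
    (c : H k K K l) : Coeffs k K deg n →ₗ[k] Cochain K (sumShift K deg) N :=
  Coeffs.lift fun i => (deg i).negOnePow •
    (prod k (show deg i + (N - deg i) = N by omega)
      (incl K deg i : Cochain K (sumShift K deg) (deg i))).comp
      ((s.htpy (show n - deg i + l + (-1) = N - deg i by omega)).flip c)

theorem htpyAct_single {I : Type v} (deg : I → ℤ) {n l N : ℤ} (h : n + l + (-1) = N)
    (c : H k K K l) (i : I) (b : H k K K (n - deg i)) :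
    htpyAct s deg h c (Coeffs.single k K deg n i b) = (deg i).negOnePow •
      prod k (show deg i + (N - deg i) = N by omega)
        (incl K deg i : Cochain K (sumShift K deg) (deg i))
        (s.htpy (show n - deg i + l + (-1) = N - deg i by omega) b c) :=
  Coeffs.lift_single _ _ _

theorem δ_htpyAct {I : Type v} (deg : I → ℤ) {n l n' N : ℤ} (h : n + l + (-1) = N)
    (hn : n + l = n') (c : H k K K l) (b : Coeffs k K deg n) :
    δ N n' (htpyAct s deg h c b) =
      (expand s n' (Coeffs.act deg hn c b) : Cochain K (sumShift K deg) n') -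
        prod k hn (expand s n b : Cochain K (sumShift K deg) n) (s.rep l c : Cochain K K l) := by
  suffices hs : (δ_hom k K (sumShift K deg) N n').comp (htpyAct s deg h c) =
      ((coeLinear n').comp (expand s n')).comp (Coeffs.act deg hn c) -
      ((prod k hn).flip (s.rep l c : Cochain K K l)).comp ((coeLinear n).comp (expand s n)) from
    LinearMap.congr_fun hs b
  refine Coeffs.hom_ext fun i b => ?_
  change δ N n' (htpyAct s deg h c (Coeffs.single k K deg n i b)) =
    (expand s n' (Coeffs.act deg hn c (Coeffs.single k K deg n i b)) :
      Cochain K (sumShift K deg) n') -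
    prod k hn (expand s n (Coeffs.single k K deg n i b) : Cochain K (sumShift K deg) n)
      (s.rep l c : Cochain K K l)
  rw [htpyAct_single, δ_units_smul, δ_prod k _ rfl (show N - deg i + 1 = n' - deg i by omega)
      (by omega), Cocycle.δ_eq_zero, map_zero, LinearMap.zero_apply, zero_add, smul_smul,
    Int.units_mul_self, one_smul, s.δ_htpy _ (show n - deg i + l = n' - deg i by omega),
    Coeffs.act_single, expand_single, expand_single, coe_cocycleProd, coe_cocycleProd, map_sub,
    prod_assoc k _ (show n - deg i + l = n' - deg i by omega) _ (add_sub_cancel (deg i) n')]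

variable {X : ℤ → Type v} [∀ n, AddCommGroup (X n)] [∀ n, Module k (X n)]
  (act : ∀ {i j l : ℤ}, i + j = l → (X i →ₗ[k] H k K K j →ₗ[k] X l))

/-- For a family with one entry `b` at the index `(x, h)`, the four terms add up, up to sign, to `x`
times the Massey cochain of `h`, `b` and `c`. This is where triviality of Massey products enters the
realisation. -/
theorem exists_δ_eq_htpy (hs : s.Trivial) {n l n' N N' M : ℤ} (hn : n + l = n')
    (hN : n + (-1) = N) (hN' : n' + (-1) = N') (hM : M + 1 = N') (c : H k K K l)
    (b : Coeffs k K (relDeg k K X) n) : ∃ z : Cochain K (sumShift K (basisDeg k X)) M,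
      δ M N' z = prod k (zero_add N') (Cochain.ofHom (relMap s act))
          (htpyAct s (relDeg k K X) (show n + l + (-1) = N' by omega) c b) +
        prod k (show N + l = N' by omega) (htpyLeft s hN b) (s.rep l c : Cochain K K l) -
        htpyLeft s hN' (Coeffs.act (relDeg k K X) hn c b) -
        htpyRight s (show n + l + (-1) = N' by omega) c (bar act n b) := by
  induction b using Coeffs.induction with
  | h0 => exact ⟨0, by simp⟩
  | h1 j b =>
    obtain ⟨z, hz⟩ := hs (show j.scalarDeg + (n - (j.deg + j.scalarDeg)) = n - j.deg by omega)
      (show n - (j.deg + j.scalarDeg) + l = n' - (j.deg + j.scalarDeg) by omega)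
      (show j.scalarDeg + (n - (j.deg + j.scalarDeg)) + (-1) = N - j.deg by omega)
      (show n - (j.deg + j.scalarDeg) + l + (-1) = N' - (j.deg + j.scalarDeg) by omega)
      (show n - j.deg + l + (-1) = N' - j.deg by omega)
      (show M - j.deg + 1 = N' - j.deg by omega) j.scalar b c
    refine ⟨prod k (add_sub_cancel j.deg M) (elt k K j.deg j.elt :
      Cochain K (sumShift K (basisDeg k X)) j.deg) z, ?_⟩
    rw [δ_prod k _ rfl (show M - j.deg + 1 = N' - j.deg by omega) hM, Cocycle.δ_eq_zero, map_zero,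
      LinearMap.zero_apply, zero_add, hz, htpyAct_single, htpyLeft_single, Coeffs.act_single,
      bar_single, map_sub (htpyRight s _ c), htpyRight_tens, htpyRight_tens]
    have h1 := htpyLeft_single (X := X) s hN' j
      (cohProd k (show n - (j.deg + j.scalarDeg) + l = n' - (j.deg + j.scalarDeg) by omega) b c)
    rw [Choice.prod_units_smul,
      ← prod_assoc k (zero_add (relDeg k K X j)) _ (show relDeg k K X j + (N' - relDeg k K X j) = N'
        by omega) (zero_add N')]
    have h2 : prod k (zero_add (relDeg k K X j)) (Cochain.ofHom (relMap s act))
      (incl K (relDeg k K X) j : Cochain K _ (relDeg k K X j)) = _ := prod_relMap_incl s act j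
    rw [h2]
    refine Eq.trans ?_ (congrArg (fun t => _ - t - _) h1.symm)
    simp only [map_sub, map_add, LinearMap.sub_apply, smul_sub, smul_add, Choice.units_smul_prod,
      Choice.prod_units_smul, Int.negOnePow_add, smul_smul]
    rw [prod_assoc k (show j.deg + (N - j.deg) = N by omega)
        (show N - j.deg + l = N' - j.deg by omega) _ (show j.deg + (N' - j.deg) = N' by omega),
      prod_assoc k (show j.deg + j.scalarDeg = j.deg + j.scalarDeg from rfl)
        (show j.scalarDeg + (N' - (j.deg + j.scalarDeg)) = N' - j.deg by omega) _
        (show j.deg + (N' - j.deg) = N' by omega)]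
    abel
  | h2 x y hx hy =>
    obtain ⟨z, hz⟩ := hx
    obtain ⟨z', hz'⟩ := hy
    refine ⟨z + z', ?_⟩
    simp only [δ_add, hz, hz', map_add, LinearMap.add_apply]
    abel

end HomCohomology

/-! ### The cone of the relations, and the splitting of its cohomology -/

namespace HomCohomology

open CochainComplex

open scoped Classical

section

variable {k : Type u} [Field k] {C : Type w} [Category.{v} C] [Abelian C] [Linear k C]
  [Limits.HasCoproducts.{v} C] {K : CochainComplex C ℤ} (s : Choice k K)
  {X : ℤ → Type v} [∀ n, AddCommGroup (X n)] [∀ n, Module k (X n)]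
  (act : ∀ {i j l : ℤ}, i + j = l → (X i →ₗ[k] H k K K j →ₗ[k] X l))

theorem expandH_bar (n : ℤ) (b : Coeffs k K (relDeg k K X) n) :
    expandH s n (bar act n b) =
      cohProd k (zero_add n) (ofHom k (relMap s act)) (expandH s n b) :=
  (mk_eq_mk_of_δ_eq (x := cocycleProd k (zero_add n) (Cocycle.ofHom (relMap s act)) (expand s n b))
    (y := expand s n (bar act n b)) (htpyLeft s (show n + (-1) = n - 1 by omega) b)
    (δ_htpyLeft s act _ b)).symm

/-- The cochain to the cone of the relations given by a family of classes. -/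
noncomputable def coneCochain {n N : ℤ} (h : n + (-1) = N) :
    Coeffs k K (relDeg k K X) n →ₗ[k] Cochain K (mappingCone (relMap s act)) N :=
  (prod k (by omega) (mappingCone.inl (relMap s act))).comp ((coeLinear n).comp (expand s n)) -
    (prod k (zero_add N) (Cochain.ofHom (mappingCone.inr (relMap s act)))).comp (htpyLeft s h)

theorem coneCochain_apply {n N : ℤ} (h : n + (-1) = N) (b : Coeffs k K (relDeg k K X) n) :
    coneCochain s act h b = prod k (by omega) (mappingCone.inl (relMap s act))
        (expand s n b : Cochain K (sumShift K (relDeg k K X)) n) -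
      prod k (zero_add N) (Cochain.ofHom (mappingCone.inr (relMap s act))) (htpyLeft s h b) := rfl

/-- The correction by `htpyLeft` replaces `relMap` by `bar` in the boundary, so the cochain is
closed on the kernel of `bar`. -/
theorem δ_coneCochain {n N : ℤ} (h : n + (-1) = N) (b : Coeffs k K (relDeg k K X) n) :
    δ N n (coneCochain s act h b) = prod k (zero_add n)
      (Cochain.ofHom (mappingCone.inr (relMap s act)))
      (expand s n (bar act n b) : Cochain K (sumShift K (basisDeg k X)) n) := by
  rw [coneCochain_apply, δ_sub, δ_prod_inl _ _ _ (n + 1) rfl,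
    δ_prod k _ (zero_add 1) (show N + 1 = n by omega) (by omega), δ_ofHom, δ_htpyLeft s act,
    Cocycle.δ_eq_zero]
  simp

theorem prod_fst_coneCochain {n N : ℤ} (h : n + (-1) = N) (b : Coeffs k K (relDeg k K X) n) :
    prod k (by omega) (mappingCone.fst (relMap s act) : Cochain (mappingCone (relMap s act)) _ 1)
      (coneCochain s act h b) = (expand s n b : Cochain K (sumShift K (relDeg k K X)) n) := by
  rw [coneCochain_apply, map_sub, ← prod_assoc k (add_neg_cancel 1) _ (zero_add n),
    ← prod_assoc k (add_zero 1) _ (show 1 + N = n by omega), prod_fst_inl, prod_fst_inr, id_prod]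
  simp

/-- On the kernel of `bar` the term `htpyRight` of `exists_δ_eq_htpy` disappears, and what remains
says that the lift to the cone is right linear up to coboundaries. -/
theorem exists_δ_eq_coneCochain_act (hs : s.Trivial) {n l n' N N' : ℤ} (hn : n + l = n')
    (hN : n + (-1) = N) (hN' : n' + (-1) = N') (c : H k K K l)
    (b : Coeffs k K (relDeg k K X) n) (hb : bar act n b = 0) :
    ∃ z : Cochain K (mappingCone (relMap s act)) (N' - 1), δ (N' - 1) N' z =
      prod k (show N + l = N' by omega) (coneCochain s act hN b) (s.rep l c : Cochain K K l) -
        coneCochain s act hN' (Coeffs.act (relDeg k K X) hn c b) := by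
  obtain ⟨z, hz⟩ := exists_δ_eq_htpy s act hs hn hN hN' (sub_add_cancel N' 1) c b
  rw [hb, map_zero, sub_zero] at hz
  refine ⟨prod k (by omega) (mappingCone.inl (relMap s act))
      (htpyAct s (relDeg k K X) (show n + l + (-1) = N' by omega) c b) -
    prod k (zero_add (N' - 1)) (Cochain.ofHom (mappingCone.inr (relMap s act))) z, ?_⟩
  rw [δ_sub, δ_prod_inl _ _ _ n' (by omega), δ_htpyAct s _ _ hn,
    δ_prod k _ (zero_add 1) (sub_add_cancel N' 1) (by omega), δ_ofHom, hz, coneCochain_apply,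
    coneCochain_apply, map_sub (prod k _), LinearMap.sub_apply,
    prod_assoc k (show -1 + n = N by omega) hn _ (show -1 + n' = N' by omega),
    prod_assoc k (zero_add N) (show N + l = N' by omega) (show N + l = N' by omega) (zero_add N')]
  simp only [map_sub, map_add, map_zero, LinearMap.zero_apply, zero_add, Int.negOnePow_zero,
    one_smul]
  abel

/-- The cocycle to the cone given by a family of classes on which `bar` vanishes. -/
noncomputable def coneCocycle {n N : ℤ} (h : n + (-1) = N) :
    LinearMap.ker (bar (k := k) (K := K) act n) →ₗ[k] Cocycle K (mappingCone (relMap s act)) N where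
  toFun := fun b => Cocycle.mk (coneCochain s act h b) n (by omega) (by
    rw [δ_coneCochain, LinearMap.mem_ker.1 b.2]
    simp)
  map_add' := fun b b' => by ext1; simp
  map_smul' := fun c b => by ext1; exact map_smul (coneCochain s act h) c b.1

/-- The class of maps to the cone given by a family of classes on which `bar` vanishes. -/
noncomputable def coneClass {n N : ℤ} (h : n + (-1) = N) :
    LinearMap.ker (bar (k := k) (K := K) act n) →ₗ[k] H k K (mappingCone (relMap s act)) N :=
  (Submodule.mkQ _).comp (coneCocycle s act h)

theorem coneClass_apply {n N : ℤ} (h : n + (-1) = N)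
    (b : LinearMap.ker (bar (k := k) (K := K) act n)) :
    coneClass s act h b = Submodule.Quotient.mk (coneCocycle s act h b) := rfl

theorem coneFst_coneClass {n N : ℤ} (h : n + (-1) = N)
    (b : LinearMap.ker (bar (k := k) (K := K) act n)) :
    cohProd k (by omega) (coneFst k (relMap s act)) (coneClass s act h b) =
      expandH s n b.1 := by
  rw [coneClass_apply, coneFst, cohProd_mk, expandH_apply]
  congr 1
  ext1
  exact prod_fst_coneCochain s act h b.1

theorem coneClass_act (hs : s.Trivial) {n l n' N N' : ℤ} (hn : n + l = n')
    (hN : n + (-1) = N) (hN' : n' + (-1) = N') (c : H k K K l)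
    (b : LinearMap.ker (bar (k := k) (K := K) act n)) (hb : bar act n' (Coeffs.act _ hn c b.1) = 0) :
    coneClass s act hN' ⟨Coeffs.act _ hn c b.1, hb⟩ =
      cohProd k (show N + l = N' by omega) (coneClass s act hN b) c := by
  obtain ⟨z, hz⟩ := exists_δ_eq_coneCochain_act s act hs hn hN hN' c b.1 b.2
  conv_rhs => rw [← s.mk_rep c]
  exact (mk_eq_mk_of_δ_eq (x := cocycleProd k (show N + l = N' by omega)
    (coneCocycle s act hN b) (s.rep l c)) (y := coneCocycle s act hN' ⟨_, hb⟩) z hz).symm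

/-- The class of maps to the cone given by a homogeneous element of a module. -/
noncomputable def coneElt (d : ℤ) : X d →ₗ[k] H k K (mappingCone (relMap s act)) d :=
  (cohProd k (zero_add d) (ofHom k (mappingCone.inr (relMap s act)))).comp
    ((Submodule.mkQ _).comp (elt k K d))

/-- The difference of the two sides is the image of the relation indexed by `(x, c)`, which dies in
the cone. -/
theorem coneElt_act {d l n : ℤ} (h : d + l = n) (x : X d) (c : H k K K l) :
    coneElt s act n (act h x c) = cohProd k h (coneElt s act d x) c := by
  subst h
  have h1 : cohProd k (zero_add (d + l)) (ofHom k (relMap s act)) (Submodule.Quotient.mk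
      (incl K (relDeg k K X) ⟨d, x, l, c⟩)) = Submodule.Quotient.mk (elt k K (d + l) (act rfl x c)) -
        cohProd k rfl (Submodule.Quotient.mk (elt k K d x)) c := by
    conv_rhs => rw [← s.mk_rep c]
    refine congrArg (Submodule.Quotient.mk : Cocycle K _ (d + l) → H k K _ (d + l)) ?_
    ext1
    rw [s.mk_rep]
    exact prod_relMap_incl s act ⟨d, x, l, c⟩
  have h2 := congrArg (cohProd k (zero_add (d + l))
    (ofHom k (mappingCone.inr (relMap s act)))) h1
  rw [← cohProd_assoc k (add_zero 0) _ (zero_add (d + l)), inr_φ, map_zero, LinearMap.zero_apply,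
    map_sub, ← cohProd_assoc k (zero_add d) _ rfl] at h2
  exact sub_eq_zero.1 h2.symm

theorem inr_expandH (n : ℤ) (b : Coeffs k K (basisDeg k X) n) :
    cohProd k (zero_add n) (ofHom k (mappingCone.inr (relMap s act))) (expandH s n b) =
      coneElt s act n (tensAct act n b) := by
  suffices hs : (cohProd k (zero_add n) (ofHom k (mappingCone.inr (relMap s act)))).comp
      (expandH s n) = (coneElt s act n).comp (tensAct act n) from LinearMap.congr_fun hs b
  refine Coeffs.hom_ext fun i b => ?_
  have h : Submodule.Quotient.mk (elt k K i.deg (Module.Free.chooseBasis k (X i.deg) i.idx)) =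
      (Submodule.Quotient.mk (incl K (basisDeg k X) i) : H k K _ i.deg) := by
    rw [elt, Module.Basis.constr_basis]
  rw [LinearMap.comp_apply, LinearMap.comp_apply, expandH_single, tensAct, Coeffs.lift_single,
    coneElt_act, ← cohProd_assoc k (zero_add i.deg) _ (add_sub_cancel i.deg n)]
  rw [coneElt, LinearMap.comp_apply, LinearMap.comp_apply, Submodule.mkQ_apply, h]

/-- Under `expandH`, `bar` becomes left multiplication by the class of `relMap`, which commutes with
the action from the right. -/
theorem bar_act (s : Choice k K) (hK : K.Acyclic)
    (hS : ∀ {I : Type v} (deg : I → ℤ), (sumShift K deg).Acyclic)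
    [∀ i, Projective (K.X i)]
    (hI : ∀ {I : Type v} (deg : I → ℤ) (i : ℤ), Injective ((sumShift K deg).X i))
    (hsm : IsSmallObject (K.X 0)) {n l n' : ℤ} (h : n + l = n') (c : H k K K l)
    (b : Coeffs k K (relDeg k K X) n) (hb : bar act n b = 0) :
    bar act n' (Coeffs.act _ h c b) = 0 := by
  have := hI (basisDeg k X)
  refine (expandH_bijective s hK (hS _) hsm n').1 ?_
  rw [expandH_bar, expandH_act, ← cohProd_assoc k (zero_add n) _ h, ← expandH_bar, hb]
  simp

/-- If `x` dies in the cone, then `x ⊗ 1` is in the image of `bar`. The action map kills that image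
and sends `x ⊗ 1` to `x`. -/
theorem coneElt_injective (act_one : ∀ {i : ℤ} (x : X i),
      act (add_zero i) x (Submodule.Quotient.mk (Cocycle.ofHom (𝟙 K))) = x)
    (act_mul : ∀ {i j l ij jl n : ℤ} (hij : i + j = ij) (hjl : j + l = jl)
    (h : ij + l = n) (h' : i + jl = n) (x : X i) (b : H k K K j) (c : H k K K l),
    act h (act hij x b) c = act h' x (cohProd k hjl b c)) (hK : K.Acyclic)
    (hS : ∀ {I : Type v} (deg : I → ℤ), (sumShift K deg).Acyclic)
    [∀ i, Projective (K.X i)]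
    (hI : ∀ {I : Type v} (deg : I → ℤ) (i : ℤ), Injective ((sumShift K deg).X i))
    (hsm : IsSmallObject (K.X 0)) (d : ℤ) : Function.Injective (coneElt s act d) := by
  refine (injective_iff_map_eq_zero _).2 fun x hx => ?_
  have h1 := hI (basisDeg k X)
  have h2 := hI (relDeg k K X)
  obtain ⟨z, hz⟩ := exists_eq_φ_mul (relMap s act) (Submodule.Quotient.mk (elt k K d x)) hx
  obtain ⟨b, rfl⟩ := (expandH_bijective s hK (hS _) hsm d).2 z
  rw [← expandH_bar] at hz
  -- The unit is needed in degree `d - d`, which is zero only propositionally.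
  obtain ⟨e, he, he'⟩ : ∃ e : H k K K (d - d), act (add_sub_cancel d d) x e = x ∧
      cohProd k (add_sub_cancel d d) (Submodule.Quotient.mk (elt k K d x)) e =
        Submodule.Quotient.mk (elt k K d x) := by
    have : ∀ (q : ℤ) (hq : d + q = d), ∃ e : H k K K q, act hq x e = x ∧
        cohProd k hq (Submodule.Quotient.mk (elt k K d x)) e =
          Submodule.Quotient.mk (elt k K d x) := by
      intro q hq
      obtain rfl : q = 0 := by omega
      exact ⟨_, act_one x, cohProd_id k _⟩
    exact this _ _
  have h3 : expandH s d (tens k K d d x e) = expandH s d (bar act d b) := by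
    rw [expandH_apply, expand_tens]
    refine Eq.trans ?_ hz
    rw [← cohProd_mk, s.mk_rep, he']
  have h4 := congrArg (tensAct act d) ((expandH_bijective s hK (hS _) hsm d).1 h3)
  rwa [tensAct_tens, tensAct_bar act act_mul, he] at h4

end

/-- If Massey cochains are coboundaries, then every graded module is a direct summand of the
cohomology of maps from `K` to a complex. -/
theorem isDirectSummand_mappingCone {k : Type u} [Field k] {C : Type w} [Category.{v} C] [Abelian C]
    [Linear k C] [Limits.HasCoproducts.{v} C] {K : CochainComplex C ℤ} (s : Choice k K)
    (hs : s.Trivial) (hK : K.Acyclic)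
    (hS : ∀ {I : Type v} (deg : I → ℤ), (sumShift K deg).Acyclic)
    [∀ i, Projective (K.X i)]
    (hI : ∀ {I : Type v} (deg : I → ℤ) (i : ℤ), Injective ((sumShift K deg).X i))
    (hsm : IsSmallObject (K.X 0)) (X : GradedMod (endAlg k K)) :
    X.IsDirectSummand (homMod k K (mappingCone (relMap s (X := X.carrier) (fun {_ _ _} h => X.act h)))) := by
  let act : ∀ {i j l : ℤ}, i + j = l → (X.carrier i →ₗ[k] H k K K j →ₗ[k] X.carrier l) :=
    fun {_ _ _} h => X.act h
  have act_mul : ∀ {i j l ij jl n : ℤ} (hij : i + j = ij) (hjl : j + l = jl)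
    (h : ij + l = n) (h' : i + jl = n) (x : X.carrier i) (b : H k K K j) (c : H k K K l),
    act h (act hij x b) c = act h' x (cohProd k hjl b c) := X.act_mul
  have act_one : ∀ {i : ℤ} (x : X.carrier i),
      act (add_zero i) x (Submodule.Quotient.mk (Cocycle.ofHom (𝟙 K))) = x := X.act_one
  have h1 := hI (basisDeg k X.carrier)
  have h2 := hI (relDeg k K X.carrier)
  let ι : ∀ n, X.carrier n →ₗ[k] H k K (mappingCone (relMap s act)) n := coneElt s act
  have hι : ∀ n, Function.Injective (ι n) :=
    coneElt_injective s act act_one act_mul hK hS hI hsm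
  let Ψ : ∀ n, Coeffs k K (relDeg k K X.carrier) n ≃ₗ[k] _ := fun n =>
    LinearEquiv.ofBijective (expandH s n) (expandH_bijective s hK (hS _) hsm n)
  -- The first component of a class in the cone is annihilated by `relMap`, hence comes from a
  -- unique family in the kernel of `bar`.
  let β : ∀ N, H k K (mappingCone (relMap s act)) N →ₗ[k]
      LinearMap.ker (bar (k := k) (K := K) act (1 + N)) := fun N =>
    LinearMap.codRestrict _ ((Ψ (1 + N)).symm.toLinearMap.comp
      (cohProd k rfl (coneFst k (relMap s act)))) fun y => by
        refine (expandH_bijective s hK (hS _) hsm _).1 ?_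
        rw [expandH_bar, LinearMap.comp_apply]
        refine Eq.trans (congrArg _ ((Ψ (1 + N)).apply_symm_apply _)) ?_
        rw [φ_mul_coneFst_mul, map_zero]
  have hΨβ : ∀ N y, expandH s (1 + N) (β N y).1 = cohProd k rfl (coneFst k (relMap s act)) y :=
    fun N y => (Ψ (1 + N)).apply_symm_apply _
  -- Projecting to the kernel of `bar` and lifting back by `coneClass` gives an operator which
  -- preserves the first component and vanishes on the image of `X`; `1 - ρ` will be the retraction
  -- onto `X`.
  let ρ : ∀ N, H k K (mappingCone (relMap s act)) N →ₗ[k] H k K (mappingCone (relMap s act)) N :=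
    fun N => (coneClass s act (show 1 + N + (-1) = N by omega)).comp (β N)
  have hfst : ∀ N y, cohProd k rfl (coneFst k (relMap s act)) (ρ N y) =
      cohProd k rfl (coneFst k (relMap s act)) y := fun N y => by
    exact (coneFst_coneClass s act _ (β N y)).trans (hΨβ N y)
  -- The first component of `y - ρ y` is zero, so it comes from `X ⊗ Λ`; in the cone `x ⊗ b` equals
  -- the class of `x b`.
  have hmem : ∀ N y, ∃ x : X.carrier N, ι N x = y - ρ N y := by
    intro N y
    obtain ⟨c, hc⟩ := exists_eq_inr_mul (relMap s act) rfl (y - ρ N y)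
      (by rw [map_sub, hfst, sub_self])
    obtain ⟨a, rfl⟩ := (expandH_bijective s hK (hS _) hsm N).2 c
    rw [inr_expandH] at hc
    exact ⟨_, hc.symm⟩
  have hρι : ∀ N x, ρ N (ι N x) = 0 := by
    intro N x
    have : β N (ι N x) = 0 := by
      refine Subtype.ext ((expandH_bijective s hK (hS _) hsm _).1 ?_)
      rw [hΨβ]
      change cohProd k rfl _ (cohProd k (zero_add N) (ofHom k (mappingCone.inr (relMap s act)))
        (Submodule.Quotient.mk (elt k K N x))) = expandH s (1 + N) 0
      rw [← cohProd_assoc k (add_zero 1) _ rfl, coneFst_inr, map_zero, map_zero,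
        LinearMap.zero_apply]
    change coneClass s act _ (β N (ι N x)) = 0
    rw [this, map_zero]
  -- Linearity of `ρ` is inherited from `coneClass_act`, so it rests on the triviality of the Massey
  -- cochains.
  have hρact : ∀ {i j l : ℤ} (h : i + j = l) (y : H k K (mappingCone (relMap s act)) i)
      (c : H k K K j), ρ l (cohProd k h y c) = cohProd k h (ρ i y) c := by
    intro i j l h y c
    have hb := bar_act act s hK hS hI hsm (show 1 + i + j = 1 + l by omega) c (β i y).1 (β i y).2
    have : β l (cohProd k h y c) = ⟨Coeffs.act _ (by omega) c (β i y).1, hb⟩ := by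
      refine Subtype.ext ((expandH_bijective s hK (hS _) hsm _).1 ?_)
      rw [hΨβ, expandH_act, hΨβ, cohProd_assoc]
    change coneClass s act _ (β l (cohProd k h y c)) = _
    rw [this]
    exact coneClass_act s act hs _ _ _ c (β i y) hb
  let e : ∀ n, X.carrier n ≃ₗ[k] LinearMap.range (ι n) := fun n =>
    LinearEquiv.ofInjective (ι n) (hι n)
  let π : ∀ n, H k K (mappingCone (relMap s act)) n →ₗ[k] X.carrier n := fun n =>
    (e n).symm.toLinearMap.comp (LinearMap.codRestrict _ (LinearMap.id - ρ n) (hmem n))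
  have hιπ : ∀ n y, ι n (π n y) = y - ρ n y := fun n y =>
    congrArg Subtype.val ((e n).apply_symm_apply ⟨y - ρ n y, hmem n y⟩)
  have hιact : ∀ {i j l : ℤ} (h : i + j = l) (x : X.carrier i) (c : H k K K j),
      ι l (act h x c) = cohProd k h (ι i x) c := coneElt_act s act
  refine ⟨⟨ι, hιact⟩, ⟨π, ?_⟩, fun n x => hι n ?_⟩
  · intro i j l h y c
    change H k K K j at c
    change H k K (mappingCone (relMap s act)) i at y
    change π l (cohProd k h y c) = act h (π i y) c
    refine hι l ?_
    rw [hιπ, hιact, hιπ, hρact, map_sub, LinearMap.sub_apply]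
  · change ι n (π n (ι n x)) = ι n x
    rw [hιπ, hρι, sub_zero]

end HomCohomology

/-! ### Coproducts of representations, and realisation over a finite group -/

namespace Rep

open scoped Classical

variable {k : Type u} [Field k] {G : Type} [Group G]

section

variable {I : Type u} (M : I → Rep.{u} k G)

/-- The identity of the categorical coproduct factors through the direct sum of the underlying
spaces with the componentwise action, where elements have finite support. -/
theorem exists_eq_sum_sigma_ι (x : (∐ M : Rep.{u} k G)) :
    ∃ (s : Finset I) (y : ∀ i, M i), x = ∑ i ∈ s, (Limits.Sigma.ι M i).hom (y i) := by
  let D : Rep.{u} k G := Rep.of (Representation.directSum fun i => (M i).ρ)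
  let f : (∐ M : Rep.{u} k G) ⟶ D := Limits.Sigma.desc fun i =>
    homMk (B := D) (DirectSum.lof k I (fun i => M i) i) fun g x =>
      (DirectSum.lmap_lof (R := k) (M := fun i => M i) (N := fun i => M i)
        (fun i => (M i).ρ g) i x).symm
  let g : (DirectSum I fun i => M i) →ₗ[k] (∐ M : Rep.{u} k G) :=
    DirectSum.toModule k I _ fun i => (Limits.Sigma.ι M i).hom.toLinearMap
  have hgl : ∀ i (y : M i), g (DirectSum.lof k I (fun i => M i) i y) =
      (Limits.Sigma.ι M i).hom y := fun i y =>
    DirectSum.toModule_lof (M := fun i => M i)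
      (φ := fun i => (Limits.Sigma.ι M i).hom.toLinearMap) k i y
  have hg : ∀ (a : G) (z : D), g (D.ρ a z) = (∐ M : Rep.{u} k G).ρ a (g z) := by
    intro a z
    suffices h : g ∘ₗ D.ρ a = (∐ M : Rep.{u} k G).ρ a ∘ₗ g from LinearMap.congr_fun h z
    refine DirectSum.linearMap_ext k fun i => LinearMap.ext fun y => ?_
    have h1 : D.ρ a (DirectSum.lof k I (fun i => M i) i y) =
        DirectSum.lof k I (fun i => M i) i ((M i).ρ a y) :=
      DirectSum.lmap_lof (R := k) (M := fun i => M i) (N := fun i => M i)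
        (fun i => (M i).ρ a) i y
    change g (D.ρ a (DirectSum.lof k I (fun i => M i) i y)) =
      (∐ M : Rep.{u} k G).ρ a (g (DirectSum.lof k I (fun i => M i) i y))
    rw [h1, hgl, hgl]
    exact Rep.hom_comm_apply (Limits.Sigma.ι M i) a y
  have hfg : f ≫ homMk g hg = 𝟙 _ := by
    refine Limits.Sigma.hom_ext _ _ fun i => ?_
    rw [Limits.Sigma.ι_desc_assoc, Category.comp_id]
    exact hom_ext_apply fun y => hgl i y
  have hx : g (f.hom x) = x := congrArg (fun h => h.hom x) hfg
  rw [← hx]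
  generalize (f.hom x : D) = z
  change DirectSum I fun i => M i at z
  refine ⟨DFinsupp.support z, fun i => z i, ?_⟩
  conv_lhs => rw [← DirectSum.sum_support_of z]
  rw [map_sum]
  refine Finset.sum_congr rfl fun i _ => ?_
  exact hgl i (z i)

theorem sigma_π_ι_apply (i : I) (y : M i) :
    (Limits.Sigma.π M i).hom ((Limits.Sigma.ι M i).hom y) = y :=
  congrArg (fun h => h.hom y) (Limits.Sigma.ι_π_eq_id M i)

theorem sigma_π_ι_apply_of_ne {i j : I} (h : i ≠ j) (y : M i) :
    (Limits.Sigma.π M j).hom ((Limits.Sigma.ι M i).hom y) = 0 :=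
  congrArg (fun h => h.hom y) (Limits.Sigma.ι_π_of_ne M h)

theorem sigma_π_sum (s : Finset I) (y : ∀ i, M i) (j : I) :
    (Limits.Sigma.π M j).hom (∑ i ∈ s, (Limits.Sigma.ι M i).hom (y i)) =
      if j ∈ s then y j else 0 := by
  rw [map_sum]
  split_ifs with h
  · rw [Finset.sum_eq_single_of_mem j h fun i _ hi => sigma_π_ι_apply_of_ne M hi _,
      sigma_π_ι_apply]
  · exact Finset.sum_eq_zero fun i hi => sigma_π_ι_apply_of_ne M (by rintro rfl; exact h hi) _

theorem sigma_eq_sum {x : (∐ M : Rep.{u} k G)} {s : Finset I}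
    (hs : ∀ i ∉ s, (Limits.Sigma.π M i).hom x = 0) :
    x = ∑ i ∈ s, (Limits.Sigma.ι M i).hom ((Limits.Sigma.π M i).hom x) := by
  obtain ⟨t, y, rfl⟩ := exists_eq_sum_sigma_ι M x
  simp only [sigma_π_sum] at hs ⊢
  have h1 : ∀ i ∈ t, i ∉ s → y i = 0 := fun i hi his => by
    have := hs i his
    rwa [if_pos hi] at this
  have h2 : ∀ i, (Limits.Sigma.ι M i).hom (if i ∈ t then y i else 0) =
      if i ∈ t then (Limits.Sigma.ι M i).hom (y i) else 0 := fun i => by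
    split_ifs <;> simp
  simp only [h2]
  rw [← Finset.sum_filter, Finset.filter_mem_eq_inter, Finset.inter_comm]
  refine (Finset.sum_subset Finset.inter_subset_left fun i hi his => ?_).symm
  rw [h1 i hi (fun h => his (Finset.mem_inter.2 ⟨hi, h⟩)), map_zero]

theorem exists_sigma_π_eq_zero (x : (∐ M : Rep.{u} k G)) :
    ∃ s : Finset I, ∀ i ∉ s, (Limits.Sigma.π M i).hom x = 0 := by
  obtain ⟨s, y, rfl⟩ := exists_eq_sum_sigma_ι M x
  exact ⟨s, fun i hi => by rw [sigma_π_sum, if_neg hi]⟩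

end

theorem sum_hom_apply {A B : Rep.{u} k G} {I : Type*} (s : Finset I) (f : I → (A ⟶ B)) (x : A) :
    (∑ i ∈ s, f i).hom x = ∑ i ∈ s, (f i).hom x := by
  let φ : (A ⟶ B) →+ B := ⟨⟨fun f => f.hom x, rfl⟩, fun _ _ => rfl⟩
  exact map_sum φ f s

open HomCohomology in
-- A finite spanning set has images with finitely many non-zero components altogether, and the
-- remaining components vanish on the whole space by linearity.
theorem isSmallObject (A : Rep.{u} k G) [Module.Finite k A] : IsSmallObject A := by
  intro I M f
  obtain ⟨S, hS⟩ := Module.Finite.fg_top (R := k) (M := A)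
  choose t ht using fun x : A => exists_sigma_π_eq_zero M (f.hom x)
  have h : ∀ i ∉ S.biUnion t, ∀ x : A, (Limits.Sigma.π M i).hom (f.hom x) = 0 := by
    intro i hi x
    have : (f ≫ Limits.Sigma.π M i).hom.toLinearMap = 0 := by
      refine LinearMap.ext_on (s := (S : Set A)) hS fun y hy => ?_
      refine ht y i fun h => hi ?_
      exact Finset.mem_biUnion.2 ⟨y, hy, h⟩
    exact LinearMap.congr_fun this x
  refine ⟨S.biUnion t, hom_ext_apply fun x => ?_⟩
  rw [sum_hom_apply]
  exact sigma_eq_sum M fun i hi => h i hi x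

end Rep

namespace HomCohomology

variable {k : Type u} [Field k] {G : Type} [Group G]

/-- A cycle has finitely many non-zero components. Each of them is a boundary in a shift of `K`, and
the finitely many primitives are added up. -/
theorem sumShift_acyclic {K : CochainComplex (Rep.{u} k G) ℤ} (hK : K.Acyclic) {I : Type u}
    (deg : I → ℤ) : (sumShift K deg).Acyclic := by
  intro n
  rw [HomologicalComplex.exactAt_iff' _ (n - 1) n (n + 1) (by simp) (by simp),
    Rep.exact_iff_forall]
  intro x hx
  change (sumShift K deg).X n at x
  change ((sumShift K deg).d n (n + 1)).hom x = 0 at hx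
  change ∃ y : (sumShift K deg).X (n - 1), ((sumShift K deg).d (n - 1) n).hom y = x
  have h1 : ∀ i, ∃ y : K.X (n - 1 - deg i),
      (K.d (n - 1 - deg i) (n - deg i)).hom y = (proj (K := K) (deg := deg) n i).hom x := by
    intro i
    have h2 := hK (n - deg i)
    rw [HomologicalComplex.exactAt_iff' _ (n - 1 - deg i) (n - deg i) (n + 1 - deg i)
      (by simp; omega) (by simp; omega), Rep.exact_iff_forall] at h2
    refine h2 ((proj (K := K) (deg := deg) n i).hom x) ?_
    have h3 := congrArg (fun f => f.hom x) (proj_d (K := K) (deg := deg) n (n + 1) i)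
    have h4 : ((sumShift K deg).d n (n + 1) ≫ proj (n + 1) i).hom x = 0 := by
      change (proj (K := K) (deg := deg) (n + 1) i).hom (((sumShift K deg).d n (n + 1)).hom x) = 0
      rw [hx, map_zero]
    rw [← Linear.units_smul_comp] at h3
    have h5 := h3.symm.trans h4
    rcases Int.units_eq_one_or (deg i).negOnePow with hu | hu
    · rw [hu, one_smul] at h5
      exact h5
    · rw [hu, Units.neg_smul, one_smul, Preadditive.neg_comp] at h5
      exact neg_eq_zero.1 h5
  choose y hy using h1
  obtain ⟨s, hs⟩ := Rep.exists_sigma_π_eq_zero (fun i => K.X (n - deg i)) x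
  -- The sign compensates for the one in the differential of the shifted copy of `K`.
  refine ⟨∑ i ∈ s, ((deg i).negOnePow • inj (K := K) (deg := deg) (n - 1) i).hom (y i), ?_⟩
  rw [map_sum]
  refine Eq.trans (Finset.sum_congr rfl fun i _ => ?_)
    (Rep.sigma_eq_sum (fun i => K.X (n - deg i)) hs).symm
  have h6 : ((deg i).negOnePow • inj (K := K) (deg := deg) (n - 1) i) ≫ (sumShift K deg).d (n - 1) n =
      K.d (n - 1 - deg i) (n - deg i) ≫ inj n i := by
    rw [Linear.units_smul_comp, inj_d, smul_smul, Int.units_mul_self, one_smul]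
  refine (congrArg (fun f => f.hom (y i)) h6).trans ?_
  exact congrArg (inj (K := K) (deg := deg) n i).hom (hy i)

end HomCohomology

namespace CompleteResolution

open HomCohomology

variable {k : Type u} [Field k] {G : Type} [Group G] [Finite G]

/-- The cone is built from sums of shifts of the resolution, so it is acyclic with projective, hence
injective, terms; this allows its replacement by a single module. Finite dimension in degree zero
provides smallness. -/
theorem isSummandOfRealisable_of_trivial (P : CompleteResolution k G)
    [Module.Finite k (P.complex.X 0)] (s : Choice k P.complex) (hs : s.Trivial)
    (X : GradedMod P.tateAlg) : P.IsSummandOfRealisable X := by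
  have := Fintype.ofFinite G
  have := P.projective
  have hproj : ∀ {I : Type u} (deg : I → ℤ) (i : ℤ),
      Projective ((sumShift P.complex deg).X i) := fun deg i =>
    inferInstanceAs (Projective (∐ fun j => P.complex.X (i - deg j)))
  have hS : ∀ {I : Type u} (deg : I → ℤ), (sumShift P.complex deg).Acyclic := fun deg =>
    sumShift_acyclic P.acyclic deg
  have h := isDirectSummand_mappingCone s hs P.acyclic hS
    (fun deg i => by
      have := hproj deg i
      exact Rep.injective_of_projective _) (Rep.isSmallObject _) X
  have : ∀ i, Injective ((CochainComplex.mappingCone (relMap s (X := X.carrier)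
      (fun {_ _ _} h => X.act h))).X i) := fun i => by
    have := projective_mappingCone (relMap s (X := X.carrier) (fun {_ _ _} h => X.act h))
      (hproj _) (hproj _) i
    exact Rep.injective_of_projective _
  exact exists_isDirectSummand_single P.acyclic (acyclic_mappingCone _ (hS _) (hS _)) h

/-- If some complete resolution has finite-dimensional terms and a choice whose Massey cochains
are coboundaries, then every module is a summand of a realisable one. -/
theorem isSummandOfRealisable (P Q : CompleteResolution k G) [Module.Finite k (Q.complex.X 0)]
    (s : Choice k Q.complex) (hs : s.Trivial) (X : GradedMod P.tateAlg) :
    P.IsSummandOfRealisable X := by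
  obtain ⟨-, -, E, -⟩ := exists_hEquiv P Q
  obtain ⟨M, hM⟩ := Q.isSummandOfRealisable_of_trivial s hs (E.pull X)
  exact ⟨M, E.isDirectSummand_of_pull hM⟩

end CompleteResolution

namespace TateSpan

open TateMonomial

variable {k : Type u} [Field k] {r : ℕ} {m : Fin r → ℕ} [IsCharPowers k m]

instance (n : ℤ) : Module.Finite k (obj k m n) := by
  have : Finite {b : TateMonomial r | b.Valid m ∧ b.deg = n} := by
    let f : {b : TateMonomial r | b.Valid m ∧ b.deg = n} → Gen m (-n) × (∀ i, Fin (m i)) :=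
      fun b => (⟨⟨b.1.pos, b.1.n, 0⟩, ⟨fun i => by
        have := IsCharPowers.two_le k m i
        simp; omega, b.2.1.2.1, b.2.1.2.2⟩, by rw [neg_neg]; exact b.2.2, fun _ => rfl⟩,
        fun i => ⟨b.1.a i, b.2.1.1 i⟩)
    refine Finite.of_injective f fun b b' h => ?_
    refine Subtype.ext (TateMonomial.ext (congrArg (fun q => q.1.1.pos) h)
      (congrArg (fun q => q.1.1.n) h) (funext fun i => ?_))
    exact congrArg (fun q => (q.2 i : ℕ)) h
  exact Module.Finite.equiv (Finsupp.supportedEquivFinsupp (M := k) (R := k)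
    {b : TateMonomial r | b.Valid m ∧ b.deg = n}).symm

instance : Module.Finite k ((resolution k m).complex.X 0) :=
  inferInstanceAs (Module.Finite k (obj k m 0))

end TateSpan

/-! ### Massey products as obstructions to realisability -/

namespace HomCohomology

variable {k : Type u} [Field k] {C : Type w} [Category.{v} C] [Preadditive C] [Linear k C]
  {K L : CochainComplex C ℤ}

/-- If `x ζ = 0`, then `x ⟨ζ, a, b⟩ = -⟨x, ζ, a⟩ b`, for every representative of `⟨ζ, a, b⟩`. -/
theorem exists_mul_massey_eq {d p q dp pq n : ℤ} (hdp : d + p = dp) (hpq : p + q = pq)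
    (hn : dp - 1 + q = n) (ζ : Cocycle K K d) (a : Cocycle K K p) (b : Cocycle K K q)
    (g : Cochain K K (dp - 1))
    (hg : δ (dp - 1) dp g = prod k hdp (ζ : Cochain K K d) (a : Cochain K K p))
    (h : Cochain K K (pq - 1))
    (hh : δ (pq - 1) pq h = prod k hpq (a : Cochain K K p) (b : Cochain K K q))
    (w : Cocycle K K n) (hw : (w : Cochain K K n) = prod k hn g (b : Cochain K K q) -
      d.negOnePow • prod k (by omega) (ζ : Cochain K K d) h)
    (x : H k K L 0) (hx : cohProd k (zero_add d) x (Submodule.Quotient.mk ζ) = 0) :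
    ∃ ν : H k K L (dp - 1), cohProd k (zero_add n) x (Submodule.Quotient.mk w) =
      cohProd k hn ν (Submodule.Quotient.mk b) := by
  obtain ⟨ξ, rfl⟩ := Submodule.Quotient.mk_surjective _ x
  obtain ⟨y, hy⟩ := exists_δ_eq_of_mk_eq_zero (k := k) (sub_add_cancel d 1)
    (x := cocycleProd k (zero_add d) ξ ζ) hx
  rw [coe_cocycleProd] at hy
  -- A representative of `⟨x, ζ, a⟩`, formed with the null-homotopy `y` of `x ζ` and the given
  -- null-homotopy `g` of `ζ a`.
  let ν : Cocycle K L (dp - 1) := Cocycle.mk (prod k (zero_add (dp - 1)) (ξ : Cochain K L 0) g -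
    prod k (show d - 1 + p = dp - 1 by omega) y (a : Cochain K K p)) dp (by omega) (by
      rw [δ_sub, δ_prod k _ (zero_add 1) (sub_add_cancel dp 1) (sub_add_cancel dp 1),
        δ_prod k _ (sub_add_cancel d 1) rfl (sub_add_cancel dp 1), hg, hy, Cocycle.δ_eq_zero,
        Cocycle.δ_eq_zero, prod_assoc k (zero_add d) hdp _ (zero_add dp)]
      simp)
  refine ⟨Submodule.Quotient.mk ν, ?_⟩
  refine mk_eq_mk_of_δ_eq (x := cocycleProd k (zero_add n) ξ w) (y := cocycleProd k hn ν b)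
    (-(d.negOnePow • prod k (show d - 1 + (pq - 1) = n - 1 by omega) y h)) ?_
  have hν : (cocycleProd k hn ν b : Cochain K L n) = prod k hn
    (prod k (zero_add (dp - 1)) (ξ : Cochain K L 0) g -
    prod k (show d - 1 + p = dp - 1 by omega) y (a : Cochain K K p)) (b : Cochain K K q) := rfl
  rw [δ_neg, δ_units_smul, δ_prod k _ (sub_add_cancel d 1) (sub_add_cancel pq 1) (sub_add_cancel n 1),
    hy, hh, hν, coe_cocycleProd, hw]
  simp only [map_sub, LinearMap.sub_apply, Choice.prod_units_smul]
  rw [prod_assoc k (zero_add (dp - 1)) hn hn (zero_add n),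
    prod_assoc k (show d - 1 + p = dp - 1 by omega) hpq hn (show d - 1 + pq = n by omega),
    prod_assoc k (zero_add d) (show d + (pq - 1) = n by omega) _ (zero_add n),
    smul_add, smul_smul, ← Int.negOnePow_add, show d + (d - 1) = 2 * (d - 1) + 1 by ring,
    Int.negOnePow_succ, Int.negOnePow_two_mul, Units.neg_smul, one_smul]
  abel

/-- If `Λ / ζ Λ` is a summand of `H(K, M)`, then `⟨ζ, a, b⟩` vanishes modulo its
indeterminacy. -/
theorem exists_massey_eq_of_isDirectSummand {M : CochainComplex C ℤ} (E : HEquiv k K L)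
    {d p q dp dp' pq pq' n : ℤ} (hdp : d + p = dp) (hpq : p + q = pq)
    (hdp' : dp' + 1 = dp) (hpq' : pq' + 1 = pq)
    (hn : dp' + q = n) (hn' : d + pq' = n)
    (ζ : Cocycle L L d) (a : Cocycle L L p) (b : Cocycle L L q)
    (g : Cochain L L dp')
    (hg : δ dp' dp g = prod k hdp (ζ : Cochain L L d) (a : Cochain L L p))
    (h : Cochain L L pq')
    (hh : δ pq' pq h = prod k hpq (a : Cochain L L p) (b : Cochain L L q))
    (w : Cocycle L L n) (hw : (w : Cochain L L n) = prod k hn g (b : Cochain L L q) -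
      d.negOnePow • prod k hn' (ζ : Cochain L L d) h)
    (hX : (GradedMod.cyclicQuotient (endAlg k K) (E.conj d (Submodule.Quotient.mk ζ))).IsDirectSummand
      (homMod k K M)) :
    ∃ (ν : H k L L dp') (l : H k L L pq'), (Submodule.Quotient.mk w : H k L L n) =
      cohProd k hn ν (Submodule.Quotient.mk b) + cohProd k hn' (Submodule.Quotient.mk ζ) l := by
  obtain rfl : dp' = dp - 1 := by omega
  obtain rfl : pq' = pq - 1 := by omega
  obtain ⟨⟨ι, hι⟩, ⟨π, hπ⟩, hπι⟩ := hX
  let ζ' : H k K K d := E.conj d (Submodule.Quotient.mk ζ)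
  let Q : ∀ m, H k K K m →ₗ[k] (GradedMod.cyclicQuotient (endAlg k K) ζ').carrier m :=
    fun m => Submodule.mkQ _
  let ι' : ∀ m, (GradedMod.cyclicQuotient (endAlg k K) ζ').carrier m →ₗ[k] H k K M m := ι
  let π' : ∀ m, H k K M m →ₗ[k] (GradedMod.cyclicQuotient (endAlg k K) ζ').carrier m := π
  let e : H k K K 0 := Submodule.Quotient.mk (Cocycle.ofHom (𝟙 K))
  -- By linearity the inclusion sends the class of `y` to `x y`, where `x` is the image of the class
  -- of `1`.
  have hι' : ∀ {m : ℤ} (y : H k K K m), ι' m (Q m y) = cohProd k (zero_add m) (ι' 0 (Q 0 e)) y := by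
    intro m y
    refine Eq.trans ?_ (hι (zero_add m) (Q 0 e) y)
    refine congrArg (ι' m) ?_
    change Q m y = Q m (cohProd k (zero_add m) e y)
    rw [id_cohProd]
  have hπ' : ∀ {i j l : ℤ} (h : i + j = l) (y : H k K M i) (c : H k K K j) (z : H k K K i),
      Q i z = π' i y → π' l (cohProd k h y c) = Q l (cohProd k h z c) := by
    intro i j l h y c z hz
    refine (hπ h y c).trans ?_
    change (GradedMod.cyclicQuotient (endAlg k K) ζ').act h (π' i y) c = _
    rw [← hz]
    rfl
  let x : H k K M 0 := ι' 0 (Q 0 e)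
  have hxζ : cohProd k (zero_add d) x ζ' = 0 := by
    rw [← hι']
    have : Q d ζ' = 0 := by
      refine (Submodule.Quotient.mk_eq_zero _).2 ?_
      have : ∀ (m : ℤ) (hm : d + m = d), ∃ c, (endAlg k K).mul hm ζ' c = ζ' := by
        intro m hm
        obtain rfl : m = 0 := by omega
        exact ⟨_, (endAlg k K).mul_one ζ'⟩
      exact this _ _
    rw [this, map_zero]
  obtain ⟨ν, hν⟩ := exists_mul_massey_eq hdp hpq hn ζ a b g hg h hh w hw
    (cohProd k (add_zero 0) x E.b) (by
      rw [cohProd_assoc k _ (zero_add d) _ (zero_add d), ← E.conj_b,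
        ← cohProd_assoc k (zero_add d) _ (add_zero d), hxζ, map_zero, LinearMap.zero_apply])
  have h1 : cohProd k (zero_add n) x (E.conj n (Submodule.Quotient.mk w)) =
      cohProd k hn (cohProd k (add_zero (dp - 1)) ν E.a) (E.conj q (Submodule.Quotient.mk b)) := by
    rw [E.conj_apply, ← cohProd_assoc k (add_zero 0) _ (zero_add n),
      ← cohProd_assoc k (zero_add n) _ (add_zero n), hν,
      cohProd_assoc k hn (add_zero q) _ hn,
      cohProd_assoc k (add_zero (dp - 1)) (zero_add q) _ hn, E.a_conj]
  -- Applying the retraction to `x w = ν b` gives `w ≡ μ b` modulo `ζ Λ`, for any lift `μ` of the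
  -- image of `ν`.
  obtain ⟨μ, hμ⟩ := Submodule.mkQ_surjective _ (π' (dp - 1) (cohProd k (add_zero (dp - 1)) ν E.a))
  change H k K K (dp - 1) at μ
  have h2 : Q n (E.conj n (Submodule.Quotient.mk w)) =
      Q n (cohProd k hn μ (E.conj q (Submodule.Quotient.mk b))) := by
    rw [← hπ' hn _ _ μ hμ, ← h1, ← hι']
    exact (hπι n _).symm
  obtain ⟨l, hl⟩ := (Submodule.Quotient.eq _).1 h2
  have hl' : ∀ (m : ℤ) (hm : d + m = n) (l : H k K K m), (cohProd k hm ζ' l =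
      E.conj n (Submodule.Quotient.mk w) - cohProd k hn μ (E.conj q (Submodule.Quotient.mk b))) →
      (Submodule.Quotient.mk w : H k L L n) =
        cohProd k hn (E.symm.conj _ μ) (Submodule.Quotient.mk b) +
        cohProd k hm (Submodule.Quotient.mk ζ) (E.symm.conj m l) := by
    intro m hm l hl
    have h3 := congrArg (E.symm.conj n) hl
    rw [E.symm.conj_mul, map_sub, E.conj_symm_conj, E.symm.conj_mul, E.conj_symm_conj,
      E.conj_symm_conj] at h3
    rw [h3, add_sub_cancel]
  obtain rfl : n = d + (pq - 1) := hn'.symm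
  -- The quotient yields a cofactor in degree `d + (pq - 1) - d`, equal to `pq - 1` only
  -- propositionally.
  have : ∀ (m : ℤ) (hm : d + m = d + (pq - 1)) (l : H k K K m), (cohProd k hm ζ' l =
      E.conj _ (Submodule.Quotient.mk w) - cohProd k hn μ (E.conj q (Submodule.Quotient.mk b))) →
      ∃ l : H k K K (pq - 1), (cohProd k rfl ζ' l =
      E.conj _ (Submodule.Quotient.mk w) - cohProd k hn μ (E.conj q (Submodule.Quotient.mk b))) := by
    intro m hm l hl
    obtain rfl : m = pq - 1 := by omega
    exact ⟨l, hl⟩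
  obtain ⟨l', hl''⟩ := this _ _ l hl
  exact ⟨_, _, hl' _ rfl l' hl''⟩

end HomCohomology

/-! ### Evaluation of cochains on the monomials of the explicit complete resolution -/

open ProdCyclic

namespace TateMonomial

variable {r : ℕ} {m : Fin r → ℕ}

theorem Valid.pos_of_deg_nonpos {b : TateMonomial r} (hb : b.Valid m) (h : b.deg ≤ 0) :
    b.pos = true := by
  by_contra hp
  rw [Bool.not_eq_true] at hp
  have h1 : ∑ i, b.n i ≤ ∑ _i : Fin r, (-1 : ℤ) :=
    Finset.sum_le_sum fun i _ => by have := hb.2.2 hp i; omega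
  rw [deg, hp] at h
  simp at h h1
  omega

theorem Valid.neg_of_deg_pos {b : TateMonomial r} (hb : b.Valid m) (h : 0 < b.deg) :
    b.pos = false := by
  by_contra hp
  rw [Bool.not_eq_false] at hp
  have h1 : 0 ≤ ∑ i, b.n i := Finset.sum_nonneg fun i _ => hb.2.1 hp i
  rw [deg, hp] at h
  simp at h
  omega

theorem wt_nonneg {b : TateMonomial r} (hb : b.Valid m) (hp : b.pos = true) (i : Fin r) :
    0 ≤ b.wt m i := by
  have h := hb.2.1 hp i
  have h1 : 0 ≤ (m i : ℤ) * (b.n i / 2) := mul_nonneg (by positivity) (by omega)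
  have h2 : 0 ≤ b.n i % 2 := by omega
  simp only [wt]
  positivity

/-- The monomials of degree zero are the `t^a`. -/
theorem Valid.n_eq_zero {b : TateMonomial r} (hb : b.Valid m) (h : b.deg = 0) : b.n = 0 := by
  have hp := hb.pos_of_deg_nonpos h.le
  rw [deg, hp] at h
  funext i
  exact (Finset.sum_eq_zero_iff_of_nonneg fun i _ => hb.2.1 hp i).1 (by simpa using h) i
    (Finset.mem_univ i)

theorem Valid.eq_bot {b : TateMonomial r} (hb : b.Valid m) (h : b.deg = 0) (hw : b.wt m = 0) :
    b = bot r := by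
  have h0 := hb.n_eq_zero h
  refine TateMonomial.ext (hb.pos_of_deg_nonpos h.le) h0 (funext fun i => ?_)
  have := congrFun hw i
  simpa [wt, h0, bot] using this

end TateMonomial

namespace TateSpan

open TateMonomial HomCohomology

variable {k : Type u} [Field k] {r : ℕ} {m : Fin r → ℕ}

theorem eq_smul_single {n : ℤ} {w : Fin r → ℤ} {x : TateSpan k r} (hx : x ∈ degSpace k m n)
    (hw : x ∈ wtSpace k m w) {b : TateMonomial r}
    (h : ∀ b' : TateMonomial r, b'.Valid m → b'.deg = n → b'.wt m = w → b' = b) :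
    x = x b • Finsupp.single b 1 := by
  rw [Finsupp.smul_single, smul_eq_mul, mul_one]
  ext b'
  by_cases hb : b' = b
  · rw [hb, Finsupp.single_eq_same]
  · rw [Finsupp.single_eq_of_ne hb]
    by_contra h0
    have h1 : b' ∈ (x.support : Set (TateMonomial r)) := by simpa using h0
    exact hb (h b' (hx h1).1 (hx h1).2 (hw h1))

theorem eq_zero_of_forall {n : ℤ} {w : Fin r → ℤ} {x : TateSpan k r} (hx : x ∈ degSpace k m n)
    (hw : x ∈ wtSpace k m w)
    (h : ∀ b : TateMonomial r, b.Valid m → b.deg = n → b.wt m = w → False) : x = 0 := by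
  ext b
  by_contra h0
  have h1 : b ∈ (x.support : Set (TateMonomial r)) := by simpa using h0
  exact h b (hx h1).1 (hx h1).2 (hw h1)

variable [IsCharPowers k m]

/-- A cochain, as an endomorphism of the span of all monomials. -/
noncomputable def ev {n : ℤ} (z : Cochain (complex k m) (complex k m) n) :
    TateSpan k r →ₗ[k] TateSpan k r := by
  classical
  exact lift fun b => if h : b.Valid m then
    coe k m (b.deg + n) ((toHom z b.deg (b.deg + n) rfl).hom (mono b h rfl)) else 0

theorem ev_coe {n : ℤ} (z : Cochain (complex k m) (complex k m) n) {p q : ℤ} (h : p + n = q)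
    (x : obj k m p) : ev z (coe k m p x) = coe k m q ((toHom z p q h).hom x) := by
  suffices hs : ev z ∘ₗ coe k m p = coe k m q ∘ₗ (toHom z p q h).hom.toLinearMap from
    LinearMap.congr_fun hs x
  refine map_mono_ext fun b hb hn => ?_
  subst hn h
  rw [LinearMap.comp_apply, coe_mono, ev, lift_single, dif_pos hb]
  rfl

theorem exists_coe_eq {p : ℤ} {x : TateSpan k r} (hx : x ∈ degSpace k m p) :
    ∃ y : obj k m p, coe k m p y = x := ⟨objMk x hx, rfl⟩

theorem ev_mem_degSpace {n : ℤ} (z : Cochain (complex k m) (complex k m) n) {p : ℤ}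
    {x : TateSpan k r} (hx : x ∈ degSpace k m p) : ev z x ∈ degSpace k m (p + n) := by
  obtain ⟨y, rfl⟩ := exists_coe_eq hx
  rw [ev_coe z rfl]
  exact coe_mem _

theorem ev_mem_wtSpace {n : ℤ} {w : Fin r → ℤ} {z : Cochain (complex k m) (complex k m) n}
    (hz : z ∈ wtCochain k m w n) {p : ℤ} {v : Fin r → ℤ} {x : TateSpan k r}
    (hx : x ∈ degSpace k m p) (hv : x ∈ wtSpace k m v) : ev z x ∈ wtSpace k m (v + w) := by
  obtain ⟨y, rfl⟩ := exists_coe_eq hx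
  rw [ev_coe z rfl]
  exact hz _ _ rfl _ _ hv

theorem ev_t {n : ℤ} (z : Cochain (complex k m) (complex k m) n) (i : Fin r) {p : ℤ}
    {x : TateSpan k r} (hx : x ∈ degSpace k m p) : ev z (t k m i x) = t k m i (ev z x) := by
  obtain ⟨y, rfl⟩ := exists_coe_eq hx
  rw [← coe_tau, ev_coe z rfl, ev_coe z rfl, ← coe_tau, Rep.hom_tau]

theorem ev_prod {i j n : ℤ} (h : i + j = n) (f : Cochain (complex k m) (complex k m) i)
    (g : Cochain (complex k m) (complex k m) j) {p : ℤ} {x : TateSpan k r}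
    (hx : x ∈ degSpace k m p) : ev (prod k h f g) x = ev f (ev g x) := by
  obtain ⟨y, rfl⟩ := exists_coe_eq hx
  rw [ev_coe g rfl, ev_coe f rfl, ev_coe _ (show p + n = p + j + i by omega)]
  have : toHom (prod k h f g) p (p + j + i) (by omega) =
      toHom g p (p + j) rfl ≫ toHom f (p + j) (p + j + i) rfl := by
    rw [toHom, prod_apply, Cochain.comp_v _ _ _ p (p + j) _ rfl rfl]
    rfl
  rw [this]
  rfl

theorem ev_sub {n : ℤ} (f g : Cochain (complex k m) (complex k m) n) {p : ℤ} {x : TateSpan k r}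
    (hx : x ∈ degSpace k m p) : ev (f - g) x = ev f x - ev g x := by
  obtain ⟨y, rfl⟩ := exists_coe_eq hx
  rw [ev_coe _ rfl, ev_coe _ rfl, ev_coe _ rfl]
  change coe k m _ ((toHom f _ _ rfl).hom y - (toHom g _ _ rfl).hom y) = _
  rw [map_sub]

theorem ev_zero {n : ℤ} {p : ℤ} {x : TateSpan k r}
    (hx : x ∈ degSpace k m p) : ev (0 : Cochain (complex k m) (complex k m) n) x = 0 := by
  have := ev_sub (0 : Cochain (complex k m) (complex k m) n) 0 hx
  rwa [sub_zero, sub_self] at this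

theorem ev_units_smul {n : ℤ} (e : ℤˣ) (f : Cochain (complex k m) (complex k m) n) {p : ℤ}
    {x : TateSpan k r} (hx : x ∈ degSpace k m p) : ev (e • f) x = e • ev f x := by
  rcases Int.units_eq_one_or e with rfl | rfl
  · simp
  · rw [Units.neg_smul, Units.neg_smul, one_smul, one_smul, ← zero_sub, ev_sub 0 f hx, ev_zero hx,
      zero_sub]

theorem ev_δ {n n' : ℤ} (h : n + 1 = n') (z : Cochain (complex k m) (complex k m) n) {p : ℤ}
    {x : TateSpan k r} (hx : x ∈ degSpace k m p) :
    ev (δ n n' z) x = d k m (ev z x) + n'.negOnePow • ev z (d k m x) := by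
  obtain ⟨y, rfl⟩ := exists_coe_eq hx
  rw [ev_coe _ (show p + n' = p + n' from rfl), toHom_δ h z p (p + n') (p + n) (p + 1) rfl
    (by omega) rfl, ev_coe z rfl, ← coe_dHom (show p + n + 1 = p + n' by omega),
    ← coe_dHom (show p + 1 = p + 1 from rfl),
    ev_coe z (show p + 1 + n = p + n' by omega)]
  have h1 : ∀ e : ℤˣ, ∀ x y : obj k m (p + n'),
      coe k m (p + n') (x + e • y) = coe k m _ x + e • coe k m _ y := by
    intro e x y
    rw [map_add]
    exact congrArg _ (map_units_smul _ _ _)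
  have h2 : ∀ e : ℤˣ, ∀ f g : obj k m p ⟶ obj k m (p + n'), ∀ y,
      (f + e • g).hom y = f.hom y + e • g.hom y := by
    intro e f g y
    rcases Int.units_eq_one_or e with rfl | rfl
    · simp only [one_smul]; rfl
    · simp only [Units.neg_smul, one_smul]; rfl
  rw [h2, h1]
  rfl

theorem d_ev {n : ℤ} (z : Cocycle (complex k m) (complex k m) n) {p : ℤ}
    {x : TateSpan k r} (hx : x ∈ degSpace k m p) :
    d k m (ev (z : Cochain (complex k m) (complex k m) n) x) =
      n.negOnePow • ev (z : Cochain (complex k m) (complex k m) n) (d k m x) := by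
  have h := ev_δ rfl (z : Cochain (complex k m) (complex k m) n) hx
  rw [Cocycle.δ_eq_zero, ev_zero hx, Int.negOnePow_succ, Units.neg_smul, ← sub_eq_add_neg,
    eq_comm, sub_eq_zero] at h
  exact h

theorem cochainCoeff_eq {n : ℤ} (b : Gen m n) (z : Cochain (complex k m) (complex k m) n) :
    cochainCoeff b z = ev z (Finsupp.single b.1 1) (bot r) := by
  have := ev_coe z (neg_add_cancel n) (genMono b)
  exact congrArg (fun x => x (bot r)) this.symm

/-- The value of a homogeneous cochain on a monomial vanishes for lack of monomials. -/
theorem ev_single_eq_zero {n : ℤ} {w : Fin r → ℤ} {z : Cochain (complex k m) (complex k m) n}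
    (hz : z ∈ wtCochain k m w n) {b : TateMonomial r} (hb : b.Valid m)
    (h : ∀ b' : TateMonomial r, b'.Valid m → b'.deg = b.deg + n → b'.wt m = b.wt m + w → False) :
    ev z (Finsupp.single b 1) = 0 :=
  eq_zero_of_forall (ev_mem_degSpace z (single_mem_degSpace hb rfl))
    (ev_mem_wtSpace hz (single_mem_degSpace hb rfl) (single_mem_wtSpace b)) h

/-- The value of a homogeneous cochain on a monomial is a multiple of the only monomial of its
degree and weight. -/
theorem exists_ev_single_eq {n : ℤ} {w : Fin r → ℤ} {z : Cochain (complex k m) (complex k m) n}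
    (hz : z ∈ wtCochain k m w n) {b : TateMonomial r} (hb : b.Valid m) (b₀ : TateMonomial r)
    (h : ∀ b' : TateMonomial r, b'.Valid m → b'.deg = b.deg + n → b'.wt m = b.wt m + w → b' = b₀) :
    ∃ c : k, ev z (Finsupp.single b 1) = c • Finsupp.single b₀ 1 :=
  ⟨_, eq_smul_single (ev_mem_degSpace z (single_mem_degSpace hb rfl))
    (ev_mem_wtSpace hz (single_mem_degSpace hb rfl) (single_mem_wtSpace b)) h⟩

/-- A homogeneous cocycle dual to a generator. -/
theorem exists_dual_cocycle (hr : 0 < r) {n : ℤ} (b : Gen m n) :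
    ∃ z : Cocycle (complex k m) (complex k m) n,
      (z : Cochain (complex k m) (complex k m) n) ∈ wtCochain k m (-b.1.wt m) n ∧
      Submodule.Quotient.mk z = basis k m hr n b ∧
      ev (z : Cochain (complex k m) (complex k m) n) (Finsupp.single b.1 1) =
        Finsupp.single (bot r) 1 := by
  obtain ⟨z, hz, hb⟩ := exists_mem_wtCochain (basis_mem_wtClass (k := k) hr b)
  refine ⟨z, hz, hb, ?_⟩
  obtain ⟨c, hc⟩ := exists_ev_single_eq hz b.2.1 (bot r) fun b' hb' hd hw =>
    hb'.eq_bot (by rw [hd, b.2.2.1, neg_add_cancel]) (by rw [hw, add_neg_cancel])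
  have h1 := coeff_basis (k := k) hr b b
  rw [if_pos rfl, ← hb, coeff_mk, cochainCoeff_eq, hc] at h1
  rw [hc, show c = 1 by simpa using h1, one_smul]

/-- Products whose weight does not match have vanishing coefficients. -/
theorem coeff_mul_eq_zero (hr : 0 < r) {i j n : ℤ} (h : i + j = n) (b : Gen m n)
    (x : H k (complex k m) (complex k m) i) {w : Fin r → ℤ} {y : H k (complex k m) (complex k m) j}
    (hy : y ∈ wtClass k m w j) (hb : ∀ b' : Gen m i, b'.1.wt m ≠ b.1.wt m + w) :
    coeff hr b (cohProd k h x y) = 0 := by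
  suffices hs : coeff hr b ∘ₗ (cohProd k h).flip y = 0 from LinearMap.congr_fun hs x
  refine (basis k m hr i).ext fun b' => ?_
  refine coeff_eq_zero_of_mem_wtClass hr (mul_mem_wtClass h rfl (basis_mem_wtClass hr b') hy) b ?_
  intro h'
  refine hb b' ?_
  rw [← sub_eq_zero, ← neg_eq_zero, ← h']
  abel

theorem coeff_mul_eq_zero' (hr : 0 < r) {i j n : ℤ} (h : i + j = n) (b : Gen m n) {w : Fin r → ℤ}
    {x : H k (complex k m) (complex k m) i} (hx : x ∈ wtClass k m w i)
    (y : H k (complex k m) (complex k m) j) (hb : ∀ b' : Gen m j, b'.1.wt m ≠ b.1.wt m + w) :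
    coeff hr b (cohProd k h x y) = 0 := by
  suffices hs : coeff hr b ∘ₗ cohProd k h x = 0 from LinearMap.congr_fun hs y
  refine (basis k m hr j).ext fun b' => ?_
  refine coeff_eq_zero_of_mem_wtClass hr (mul_mem_wtClass h rfl hx (basis_mem_wtClass hr b')) b ?_
  intro h'
  refine hb b' ?_
  rw [← sub_eq_zero, ← neg_eq_zero, ← h']
  abel

/-- Products of homogeneous cocycles for whose weight there is no class are homogeneously
null-homotopic. -/
theorem exists_homogeneous_nullhomotopy (hr : 0 < r) {i j n l : ℤ} (h : i + j = n)
    {w w' : Fin r → ℤ} {f : Cocycle (complex k m) (complex k m) i}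
    {g : Cocycle (complex k m) (complex k m) j}
    (hf : (f : Cochain (complex k m) (complex k m) i) ∈ wtCochain k m w i)
    (hg : (g : Cochain (complex k m) (complex k m) j) ∈ wtCochain k m w' j)
    (hw : ∀ b : Gen m n, b.1.wt m + (w + w') ≠ 0) (hl : l + 1 = n) :
    ∃ y ∈ wtCochain k m (w + w') l, δ l n y =
      prod k h (f : Cochain (complex k m) (complex k m) i) (g : Cochain (complex k m) (complex k m) j) := by
  have h0 : (Submodule.Quotient.mk (cocycleProd k h f g) : H k (complex k m) (complex k m) n) = 0 :=
    eq_zero_of_mem_wtClass hr (mul_mem_wtClass h rfl (mk_mem_wtClass hf) (mk_mem_wtClass hg)) hw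
  obtain ⟨y, hy⟩ := exists_δ_eq_sub (k := k) hl (x := cocycleProd k h f g) (y := 0) h0
  rw [Cocycle.coe_zero, sub_zero] at hy
  exact exists_homogeneous_primitive (prod_mem_wtCochain h rfl hf hg) hy

end TateSpan

/-! ### A module which is not a summand of a realisable one, for a factor of order three -/

open ProdCyclic

namespace TateMonomial

variable {r : ℕ} {m : Fin r → ℕ}

theorem wt_bot_set (i : Fin r) (x : ℤ) (c : ℕ) :
    ((bot r).set i x c).wt m = Pi.single i (c + m i * (x / 2) + x % 2) := by
  rw [wt_set, wt_bot]
  rfl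

theorem valid_bot_set (hm : ∀ i, 2 ≤ m i) (i : Fin r) {x : ℤ} {c : ℕ} (hx : 0 ≤ x) (hc : c < m i) :
    ((bot r).set i x c).Valid m :=
  (valid_bot m hm).set i x c hc (fun _ => hx) (fun h => by simp [bot] at h)

theorem deg_bot_set (i : Fin r) (x : ℤ) (c : ℕ) : ((bot r).set i x c).deg = -x := by
  rw [deg_set, deg_bot]
  simp [bot]

/-- The monomials of degree `-1` are the `t^a e_j`. -/
theorem Valid.eq_set_of_deg_eq {b : TateMonomial r} (hb : b.Valid m) (h : b.deg = -1) :
    b.pos = true ∧ ∃ j, b.n = Pi.single j 1 := by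
  have hp := hb.pos_of_deg_nonpos (by omega)
  refine ⟨hp, ?_⟩
  have hs : ∑ i, b.n i = 1 := by
    rw [deg, hp] at h
    simp at h
    exact h
  obtain ⟨j, -, hj⟩ : ∃ j ∈ Finset.univ, b.n j ≠ 0 := by
    by_contra! h0
    rw [Finset.sum_eq_zero h0] at hs
    omega
  have h0 : ∀ i, 0 ≤ b.n i := fun i => hb.2.1 hp i
  refine ⟨j, funext fun l => ?_⟩
  rw [← Finset.add_sum_erase _ _ (Finset.mem_univ j)] at hs
  have h1 : 0 ≤ ∑ i ∈ Finset.univ.erase j, b.n i := Finset.sum_nonneg fun i _ => h0 i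
  have h2 := h0 j
  by_cases hl : l = j
  · subst hl
    rw [Pi.single_eq_same]
    omega
  · rw [Pi.single_eq_of_ne hl]
    exact (Finset.sum_eq_zero_iff_of_nonneg fun i _ => h0 i).1
      (show ∑ i ∈ Finset.univ.erase j, b.n i = 0 by omega) l (by simpa using hl)

end TateMonomial

namespace TateSpan

open TateMonomial HomCohomology

variable {k : Type u} [Field k] {r : ℕ} {m : Fin r → ℕ}

/-- The other exponents `n_j` are zero, so only the coordinate `i` contributes, and its sign is
`+1`. -/
theorem d_bot_set_of_lt (i : Fin r) {x : ℤ} {c : ℕ} (hx : x ≠ 0) (h : c + dExp (m i) x < m i) :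
    d k m (Finsupp.single ((bot r).set i x c) 1) =
      Finsupp.single ((bot r).set i (x - 1) (c + dExp (m i) x)) 1 := by
  rw [d_apply, splice_of_ne (fun h => hx (by simpa [bot] using congrArg (fun b => b.n i) h)),
    add_zero, Finset.sum_eq_single i]
  · rw [dCoord_of_lt (by simpa using h) (by simp [hx]), set_a, set_n, set_set,
      Finset.sum_eq_zero, zpow_zero, one_smul]
    intro j hj
    rw [set_n_ne _ (Finset.mem_Iio.1 hj).ne]
    rfl
  · intro j _ hj
    exact dCoord_of_eq_zero rfl (by rw [set_n_ne _ hj]; rfl)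
  · intro h
    exact absurd (Finset.mem_univ i) h

variable [IsCharPowers k m]

theorem ev_t_pow {n : ℤ} (z : Cochain (complex k m) (complex k m) n) (i : Fin r) (c : ℕ) {p : ℤ}
    {x : TateSpan k r} (hx : x ∈ degSpace k m p) :
    ev z ((t k m i ^ c) x) = (t k m i ^ c) (ev z x) := by
  have key : (t k m i ^ c) x ∈ degSpace k m p ∧ ev z ((t k m i ^ c) x) = (t k m i ^ c) (ev z x) := by
    induction c with
    | zero => exact ⟨hx, rfl⟩
    | succ c ih =>
      rw [pow_succ', Module.End.mul_apply, Module.End.mul_apply, ev_t z i ih.1, ih.2]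
      exact ⟨t_mem_degSpace i ih.1, rfl⟩
  exact key.2

omit [IsCharPowers k m] in
theorem t_pow_bot_set (i : Fin r) {x : ℤ} {c c' : ℕ} (h : c + c' < m i) :
    (t k m i ^ c') (Finsupp.single ((bot r).set i x c) 1) =
      Finsupp.single ((bot r).set i x (c + c')) 1 := by
  rw [t_pow_single, if_pos (Or.inl (by simpa using h))]
  simp

variable (k m) in
/-- The generator in degree `x` of the `i`-th factor. -/
def coordGen (i : Fin r) (x : ℤ) (hx : 0 ≤ x) : Gen m x :=
  ⟨(bot r).set i x 0, valid_bot_set (IsCharPowers.two_le k m) i hx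
    (by have := IsCharPowers.two_le k m i; omega), deg_bot_set i _ _, fun j => by
      by_cases h : j = i
      · subst h; simp
      · rw [set_a_ne _ h]; rfl⟩

theorem coordGen_val (i : Fin r) (x : ℤ) (hx : 0 ≤ x) : (coordGen k m i x hx).1 = (bot r).set i x 0 := rfl

/-- The class in degree `1` of a factor of order `3` generates an ideal whose quotient is not a
direct summand of a realisable module. -/
theorem not_isDirectSummand_of_eq_three {K M : CochainComplex (Rep.{u} k (ProdCyclic m)) ℤ}
    (E : HEquiv k K (complex k m)) (hr : 0 < r) (i : Fin r) (hi : m i = 3) :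
    ¬ (GradedMod.cyclicQuotient (endAlg k K)
      (E.conj 1 (basis k m hr 1 (coordGen k m i 1 zero_le_one)))).IsDirectSummand (homMod k K M) := by
  intro hX
  have hm := IsCharPowers.two_le k m
  -- The obstruction is `⟨u, u, u⟩`; the values of `u` and of a null-homotopy `g` of `u ^ 2` are
  -- computed on the monomials of the `i`-th factor.
  obtain ⟨u, hu, hub, hu1⟩ := exists_dual_cocycle (k := k) hr (coordGen k m i 1 zero_le_one)
  generalize basis k m hr 1 (coordGen k m i 1 zero_le_one) = ζ at hX hub
  subst hub
  have hw1 : (coordGen k m i 1 zero_le_one).1.wt m = Pi.single i 1 := by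
    rw [coordGen_val, wt_bot_set]
    norm_num
  rw [coordGen_val] at hu1
  rw [hw1] at hu
  -- For `m i = 3` the generators of the resolution have `i`-weight `0` or `1` modulo `3`. This
  -- makes `u ^ 2` null-homotopic and later excludes the indeterminacy.
  have hno : ∀ b : TateMonomial r, b.Valid m → b.pos = true → (∀ j, b.a j = 0) →
      b.wt m i ≠ 2 := by
    intro b hb hp ha h
    have h1 := hb.2.1 hp i
    simp only [wt, ha i, hi] at h
    push_cast at h
    omega
  obtain ⟨g, hg, hgδ⟩ := exists_homogeneous_nullhomotopy (k := k) hr (show (1 : ℤ) + 1 = 2 by norm_num)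
    hu hu (fun b hb => hno b.1 b.2.1 (b.2.1.pos_of_deg_nonpos (by rw [b.2.2.1]; norm_num)) b.2.2.2 (by
      have := congrFun hb i
      simp at this
      omega)) (show (1 : ℤ) + 1 = 2 by norm_num)
  let e : ℕ → ℕ → TateMonomial r := fun x c => (bot r).set i x c
  have he : ∀ x c, c < 3 → (e x c).Valid m := fun x c hc =>
    valid_bot_set hm i (by omega) (by rw [hi]; exact hc)
  have hewt : ∀ x c, (e x c).wt m = Pi.single i (c + 3 * ((x : ℤ) / 2) + (x : ℤ) % 2) := by
    intro x c
    simp only [e]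
    rw [wt_bot_set, hi]
    rfl
  have hemem : ∀ x c : ℕ, c < 3 → Finsupp.single (e x c) (1 : k) ∈ degSpace k m (-(x : ℤ)) := fun x c hc =>
    single_mem_degSpace (he x c hc) (deg_bot_set i _ _)
  have hd2 : d k m (Finsupp.single (e 2 0) 1) = Finsupp.single (e 1 2) 1 := by
    have h := d_bot_set_of_lt (k := k) (m := m) (x := 2) (c := 0) i (by norm_num)
      (by simp [dExp, hi])
    simpa [e, dExp, hi] using h
  have hd1 : ∀ c, c < 2 → d k m (Finsupp.single (e 1 c) 1) = Finsupp.single (e 0 (c + 1)) 1 := by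
    intro c hc
    have h := d_bot_set_of_lt (k := k) (m := m) (x := 1) (c := c) i (by norm_num)
      (by simp [dExp, hi]; omega)
    simpa [e, dExp, hi] using h
  have ht : ∀ x c, c < 3 → (t k m i ^ c) (Finsupp.single (e x 0) 1) = Finsupp.single (e x c) 1 := by
    intro x c hc
    have := t_pow_bot_set (k := k) (m := m) i (x := x) (c := 0) (c' := c) (by omega)
    rwa [zero_add] at this
  have hcls : ∀ (b : TateMonomial r) (c : ℕ), b.Valid m → b.deg = -1 → b.wt m = Pi.single i ((c : ℤ) + 1) →
      b = e 1 c := by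
    intro b c hb hd hw
    obtain ⟨hp, j, hj⟩ := hb.eq_set_of_deg_eq hd
    have hji : j = i := by
      by_contra h
      have := congrFun hw j
      simp [wt, hj, h] at this
      omega
    subst hji
    refine TateMonomial.ext hp ?_ (funext fun l => ?_)
    · rw [hj]
      simp [e, TateMonomial.set, Pi.single, bot]
    · have h1 := congrFun hw l
      by_cases hl : l = j
      · subst hl
        simp [wt, hj] at h1
        simpa [e] using h1
      · simp [wt, hj, hl] at h1
        simp [e, set_a_ne _ hl, h1, bot]
  have hbot : e 0 0 = bot r := set_self (bot r) i
  have hu1' : ∀ c, c < 3 → ev (u : Cochain (complex k m) (complex k m) 1) (Finsupp.single (e 1 c) 1) =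
      Finsupp.single (e 0 c) 1 := by
    intro c hc
    rw [← ht 1 c hc, ev_t_pow _ i c (hemem 1 0 (by norm_num)), ← ht 0 c hc, hbot]
    exact congrArg _ hu1
  obtain ⟨c, hc⟩ := exists_ev_single_eq hu (he 2 0 (by norm_num)) (e 1 1) (fun b hb hd hw =>
    hcls b 1 hb (by rw [hd]; exact (congrArg (· + 1) (deg_bot_set i _ _)).trans (by norm_num)) (by
      rw [hw, hewt, ← Pi.single_neg, ← Pi.single_add]
      norm_num))
  -- Anticommutation of `u` with `d` on `e_2`, where `d e_2 = t² e_1` and `d (t e_1) = t² e_0`.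
  have hc1 : c = -1 := by
    have h := d_ev u (hemem 2 0 (by norm_num))
    rw [hd2, hu1' 2 (by norm_num), hc, map_smul, hd1 1 (by norm_num)] at h
    have h1 := congrArg (fun x => x (e 0 2)) h
    simpa using h1
  -- The value would have degree `0`, hence lie in the resolution, and negative weight.
  have hg1 : ev g (Finsupp.single (e 1 0) 1) = 0 :=
    ev_single_eq_zero hg (he 1 0 (by norm_num)) fun b hb hd hw => by
      have h0 : b.deg = 0 := hd.trans ((congrArg (· + 1) (deg_bot_set i _ _)).trans (by norm_num))
      have h1 := wt_nonneg hb (hb.pos_of_deg_nonpos h0.le) i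
      rw [hw, hewt] at h1
      simp at h1
  obtain ⟨x, hx⟩ := exists_ev_single_eq hg (he 2 0 (by norm_num)) (e 1 0) (fun b hb hd hw =>
    hcls b 0 hb (by rw [hd]; exact (congrArg (· + 1) (deg_bot_set i _ _)).trans (by norm_num)) (by
      rw [hw, hewt, ← Pi.single_neg, ← Pi.single_add, ← Pi.single_add]
      norm_num))
  -- On `e_2` the equation `δ g = u ^ 2` reads `x t e_0 = c t e_0`, because `g` vanishes on `e_1`.
  have hx1 : x = -1 := by
    have h := ev_δ (show (1 : ℤ) + 1 = 2 by norm_num) g (hemem 2 0 (by norm_num))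
    rw [hgδ, ev_prod _ _ _ (hemem 2 0 (by norm_num)), hc, map_smul, hu1' 1 (by norm_num), hd2,
      ← ht 1 2 (by norm_num), ev_t_pow _ i 2 (hemem 1 0 (by norm_num)), hg1, map_zero, smul_zero,
      add_zero, hx, map_smul, hd1 0 (by norm_num)] at h
    have h1 := congrArg (fun x => x (e 0 1)) h
    simp at h1
    rw [← h1, hc1]
  obtain ⟨w, hw⟩ : ∃ w : Cocycle (complex k m) (complex k m) 2,
      (w : Cochain (complex k m) (complex k m) 2) =
        prod k (show (1 : ℤ) + 1 = 2 by norm_num) g (u : Cochain (complex k m) (complex k m) 1) -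
        (1 : ℤ).negOnePow • prod k (show (1 : ℤ) + 1 = 2 by norm_num)
          (u : Cochain (complex k m) (complex k m) 1) g := by
    refine ⟨Cocycle.mk _ 3 (by norm_num) ?_, rfl⟩
    rw [δ_sub, δ_units_smul, δ_prod k _ (show (1 : ℤ) + 1 = 2 by norm_num)
      (show (1 : ℤ) + 1 = 2 by norm_num) (by norm_num), δ_prod k _ (show (1 : ℤ) + 1 = 2 by norm_num)
      (show (1 : ℤ) + 1 = 2 by norm_num) (by norm_num), hgδ, Cocycle.δ_eq_zero, map_zero, map_zero,
      LinearMap.zero_apply, smul_zero, add_zero, zero_add, smul_smul, Int.units_mul_self, one_smul,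
      prod_assoc k _ (show (1 : ℤ) + 1 = 2 by norm_num) _ (show (1 : ℤ) + 2 = 3 by norm_num),
      sub_self]
  obtain ⟨ν, l, hνl⟩ := exists_massey_eq_of_isDirectSummand E (dp := 2) (pq := 2)
    (by norm_num) (by norm_num) (by norm_num) (by norm_num) (by norm_num) (by norm_num) u u u g hgδ g hgδ w hw hX
  -- A product with `u` having a coefficient at `e_2` would require a generator of degree `1` and
  -- `i`-weight `3 - 1 = 2`.
  have hcl : ∀ b : Gen m 1, b.1.wt m ≠ (coordGen k m i 2 zero_le_two).1.wt m + -Pi.single i 1 := by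
    intro b hb
    refine hno b.1 b.2.1 (b.2.1.pos_of_deg_nonpos (by rw [b.2.2.1]; norm_num)) b.2.2.2 ?_
    rw [hb, coordGen_val, wt_bot_set, hi]
    norm_num
  have h1 := congrArg (coeff hr (coordGen k m i 2 zero_le_two)) hνl
  rw [map_add] at h1
  have h2 : coeff (k := k) hr (coordGen k m i 2 zero_le_two) (Submodule.Quotient.mk w) = 0 := by
    rw [h1]
    refine (congrArg₂ (· + ·) ?_ ?_).trans (add_zero 0)
    · exact coeff_mul_eq_zero hr _ (coordGen k m i 2 zero_le_two) ν (mk_mem_wtClass hu) hcl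
    · exact coeff_mul_eq_zero' hr _ (coordGen k m i 2 zero_le_two) (mk_mem_wtClass hu) l hcl
  rw [coeff_mk, cochainCoeff_eq, hw, coordGen_val] at h2
  have h3 := hemem 2 0 (by norm_num)
  have h4 : ev (prod k (show (1 : ℤ) + 1 = 2 by norm_num) g
      (u : Cochain (complex k m) (complex k m) 1) - (1 : ℤ).negOnePow •
        prod k (show (1 : ℤ) + 1 = 2 by norm_num) (u : Cochain (complex k m) (complex k m) 1) g)
      (Finsupp.single (e 2 0) 1) (bot r) = 0 := h2
  -- On `e_2`, `g u` gives `-t g(e_1) = 0` and `u g` gives `-u(e_1) = -e_0`, so the coefficient is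
  -- `-1`.
  rw [ev_sub _ _ h3, ev_units_smul _ _ h3, ev_prod _ _ _ h3, ev_prod _ _ _ h3, hc, hx, map_smul,
    map_smul, hu1' 0 (by norm_num), ← ht 1 1 (by norm_num), ev_t_pow _ i 1 (hemem 1 0 (by norm_num)),
    hg1, map_zero, hbot, hx1] at h4
  simp at h4

end TateSpan

/-! ### A module which is not a summand of a realisable one, for two factors -/

open ProdCyclic

namespace TateMonomial

/-- The monomial with two factors, with given exponents in the coordinate `i` and in the other
coordinate. -/
def mon (i : Fin 2) (s : Bool) (x y : ℤ) (a b : ℕ) : TateMonomial 2 :=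
  ⟨s, fun l => if l = i then x else y, fun l => if l = i then a else b⟩

/-- The weight with given values in the coordinate `i` and in the other coordinate. -/
def wt₂ (i : Fin 2) (x y : ℤ) : Fin 2 → ℤ := fun l => if l = i then x else y

variable {m : Fin 2 → ℕ} {i j : Fin 2}

theorem mon_n_left (s : Bool) (x y : ℤ) (a b : ℕ) : (mon i s x y a b).n i = x := if_pos rfl
theorem mon_a_left (s : Bool) (x y : ℤ) (a b : ℕ) : (mon i s x y a b).a i = a := if_pos rfl
theorem mon_n_right (hij : i ≠ j) (s : Bool) (x y : ℤ) (a b : ℕ) : (mon i s x y a b).n j = y :=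
  if_neg hij.symm
theorem mon_a_right (hij : i ≠ j) (s : Bool) (x y : ℤ) (a b : ℕ) : (mon i s x y a b).a j = b :=
  if_neg hij.symm

theorem forall_two_iff (hij : i ≠ j) {P : Fin 2 → Prop} : (∀ l, P l) ↔ P i ∧ P j := by
  refine ⟨fun h => ⟨h i, h j⟩, fun h l => ?_⟩
  rcases (show l = i ∨ l = j by omega) with rfl | rfl
  exacts [h.1, h.2]

theorem sum_two (hij : i ≠ j) {A : Type*} [AddCommMonoid A] (f : Fin 2 → A) :
    ∑ l, f l = f i + f j := by
  rw [← Finset.sum_pair hij]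
  refine Finset.sum_congr (Finset.ext fun l => ?_) fun _ _ => rfl
  simp only [Finset.mem_univ, Finset.mem_insert, Finset.mem_singleton, true_iff]
  omega

theorem funext_two (hij : i ≠ j) {A : Type*} {f g : Fin 2 → A} (hi : f i = g i) (hj : f j = g j) :
    f = g := funext ((forall_two_iff hij).2 ⟨hi, hj⟩)

theorem eq_mon (hij : i ≠ j) (b : TateMonomial 2) :
    b = mon i b.pos (b.n i) (b.n j) (b.a i) (b.a j) :=
  TateMonomial.ext rfl (funext_two hij (by simp [mon]) (by simp [mon, hij.symm]))
    (funext_two hij (by simp [mon]) (by simp [mon, hij.symm]))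

theorem mon_set_left (hij : i ≠ j) (s : Bool) (x y x' : ℤ) (a b a' : ℕ) :
    (mon i s x y a b).set i x' a' = mon i s x' y a' b :=
  TateMonomial.ext rfl (funext_two hij (by simp [mon]) (by simp [mon, hij.symm, set]))
    (funext_two hij (by simp [mon]) (by simp [mon, hij.symm, set]))

theorem mon_set_right (hij : i ≠ j) (s : Bool) (x y y' : ℤ) (a b b' : ℕ) :
    (mon i s x y a b).set j y' b' = mon i s x y' a b' :=
  TateMonomial.ext rfl (funext_two hij (by simp [mon, set, hij]) (by simp [mon, hij.symm]))
    (funext_two hij (by simp [mon, set, hij]) (by simp [mon, hij.symm]))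

theorem bot_eq_mon : bot 2 = mon i true 0 0 0 0 := by
  refine TateMonomial.ext rfl ?_ ?_ <;> funext l <;> simp [bot, mon]

theorem top_eq_mon (hij : i ≠ j) : top m = mon i false (-1) (-1) (m i - 1) (m j - 1) :=
  TateMonomial.ext rfl (funext_two hij (by simp [mon, top]) (by simp [mon, top]))
    (funext_two hij (by simp [mon, top]) (by simp [mon, top, hij.symm]))

theorem deg_two (hij : i ≠ j) (b : TateMonomial 2) :
    b.deg = -(b.n i + b.n j) - if b.pos then 0 else 1 := by
  rw [deg, sum_two hij]
  norm_num

theorem deg_mon (hij : i ≠ j) (s : Bool) (x y : ℤ) (a b : ℕ) :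
    (mon i s x y a b).deg = -(x + y) - if s then 0 else 1 := by
  rw [deg_two hij, mon_n_left, mon_n_right hij]
  rfl

theorem valid_two (hij : i ≠ j) (b : TateMonomial 2) : b.Valid m ↔ b.a i < m i ∧ b.a j < m j ∧
    (b.pos = true → 0 ≤ b.n i ∧ 0 ≤ b.n j) ∧ (b.pos = false → b.n i < 0 ∧ b.n j < 0) := by
  rw [Valid, forall_two_iff hij, forall_two_iff hij, forall_two_iff hij, and_assoc]

theorem wt_mon (hij : i ≠ j) (s : Bool) (x y : ℤ) (a b : ℕ) : (mon i s x y a b).wt m =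
    wt₂ i (a + m i * (x / 2) + x % 2) (b + m j * (y / 2) + y % 2) :=
  funext_two hij (by simp [mon, wt, wt₂]) (by simp [mon, wt, wt₂, hij.symm])

theorem wt₂_add (x y x' y' : ℤ) : wt₂ i x y + wt₂ i x' y' = wt₂ i (x + x') (y + y') := by
  funext l
  simp only [wt₂, Pi.add_apply]
  split_ifs <;> rfl

theorem wt₂_neg (x y : ℤ) : -wt₂ i x y = wt₂ i (-x) (-y) := by
  funext l
  simp only [wt₂, Pi.neg_apply]
  split_ifs <;> rfl

theorem wt_eq_wt₂_iff (hij : i ≠ j) (b : TateMonomial 2) (x y : ℤ) : b.wt m = wt₂ i x y ↔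
    b.a i + m i * (b.n i / 2) + b.n i % 2 = x ∧ b.a j + m j * (b.n j / 2) + b.n j % 2 = y := by
  rw [funext_iff, forall_two_iff hij]
  simp [wt, wt₂, hij.symm]

end TateMonomial

/-! ### The differential and homogeneous cochains for two factors -/

namespace TateSpan

open TateMonomial HomCohomology

variable {k : Type u} [Field k] {m : Fin 2 → ℕ} {i j : Fin 2}

theorem dCoord_left (hij : i ≠ j) {s : Bool} {x y : ℤ} {a b : ℕ} (h : a + dExp (m i) x < m i)
    (hs : s = true → x ≠ 0) : ∃ ε : ℤˣ, dCoord k m i (Finsupp.single (mon i s x y a b) 1) =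
      ε • Finsupp.single (mon i s (x - 1) y (a + dExp (m i) x) b) 1 := by
  rw [dCoord_of_lt (by simpa [mon] using h) (by simpa [mon] using hs), mon_set_left hij, mon_n_left, mon_a_left]
  exact ⟨_, rfl⟩

theorem dCoord_right (hij : i ≠ j) {s : Bool} {x y : ℤ} {a b : ℕ} (h : b + dExp (m j) y < m j)
    (hs : s = true → y ≠ 0) : ∃ ε : ℤˣ, dCoord k m j (Finsupp.single (mon i s x y a b) 1) =
      ε • Finsupp.single (mon i s x (y - 1) a (b + dExp (m j) y)) 1 := by
  rw [dCoord_of_lt (by simpa [mon, hij.symm] using h) (by simpa [mon, hij.symm] using hs),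
    mon_set_right hij, mon_n_right hij, mon_a_right hij]
  exact ⟨_, rfl⟩

theorem dCoord_left_eq_zero {s : Bool} {x y : ℤ} {a b : ℕ}
    (h : m i ≤ a + dExp (m i) x ∨ (s = true ∧ x = 0)) :
    dCoord k m i (Finsupp.single (mon i s x y a b) 1) = 0 := by
  rcases h with h | h
  · exact dCoord_of_le (by simpa [mon] using h)
  · exact dCoord_of_eq_zero h.1 (by simpa [mon] using h.2)

theorem dCoord_right_eq_zero (hij : i ≠ j) {s : Bool} {x y : ℤ} {a b : ℕ}
    (h : m j ≤ b + dExp (m j) y ∨ (s = true ∧ y = 0)) :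
    dCoord k m j (Finsupp.single (mon i s x y a b) 1) = 0 := by
  rcases h with h | h
  · exact dCoord_of_le (by simpa [mon, hij.symm] using h)
  · exact dCoord_of_eq_zero h.1 (by simpa [mon, hij.symm] using h.2)

theorem d_two (hij : i ≠ j) {b : TateMonomial 2} (hb : b ≠ bot 2) : d k m (Finsupp.single b 1) =
    dCoord k m i (Finsupp.single b 1) + dCoord k m j (Finsupp.single b 1) := by
  rw [d_apply, sum_two hij, splice_of_ne hb, add_zero]

theorem t_pow_left (hij : i ≠ j) (s : Bool) (x y : ℤ) (a b c : ℕ) (h : a + c < m i) :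
    (t k m i ^ c) (Finsupp.single (mon i s x y a b) 1) =
      Finsupp.single (mon i s x y (a + c) b) 1 := by
  rw [t_pow_single, if_pos (Or.inl (by simpa [mon] using h)), mon_set_left hij]
  simp [mon]

theorem t_pow_right (hij : i ≠ j) (s : Bool) (x y : ℤ) (a b c : ℕ) (h : b + c < m j) :
    (t k m j ^ c) (Finsupp.single (mon i s x y a b) 1) =
      Finsupp.single (mon i s x y a (b + c)) 1 := by
  rw [t_pow_single, if_pos (Or.inl (by simpa [mon, hij.symm] using h)), mon_set_right hij]
  simp [mon, hij.symm]

variable [IsCharPowers k m]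

theorem ev_mon_eq_zero (hij : i ≠ j) {n u v : ℤ} {z : Cochain (complex k m) (complex k m) n}
    (hz : z ∈ wtCochain k m (wt₂ i u v) n) {s : Bool} {x y : ℤ} {a b : ℕ}
    (hb : (mon i s x y a b).Valid m)
    (h : ∀ b' : TateMonomial 2, b'.Valid m →
      b'.deg = -(x + y) - (if s then 0 else 1) + n →
      b'.a i + m i * (b'.n i / 2) + b'.n i % 2 = a + m i * (x / 2) + x % 2 + u →
      b'.a j + m j * (b'.n j / 2) + b'.n j % 2 = b + m j * (y / 2) + y % 2 + v → False) :
    ev z (Finsupp.single (mon i s x y a b) 1) = 0 := by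
  refine ev_single_eq_zero hz hb fun b' hb' hd hw => ?_
  rw [deg_mon hij] at hd
  rw [wt_mon hij, wt₂_add, wt_eq_wt₂_iff hij] at hw
  exact h b' hb' hd hw.1 hw.2

theorem exists_ev_mon_eq (hij : i ≠ j) {n u v : ℤ} {z : Cochain (complex k m) (complex k m) n}
    (hz : z ∈ wtCochain k m (wt₂ i u v) n) {s : Bool} {x y : ℤ} {a b : ℕ}
    (hb : (mon i s x y a b).Valid m) (s' : Bool) (x' y' : ℤ) (a' b' : ℕ)
    (h : ∀ b₀ : TateMonomial 2, b₀.Valid m →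
      b₀.deg = -(x + y) - (if s then 0 else 1) + n →
      b₀.a i + m i * (b₀.n i / 2) + b₀.n i % 2 = a + m i * (x / 2) + x % 2 + u →
      b₀.a j + m j * (b₀.n j / 2) + b₀.n j % 2 = b + m j * (y / 2) + y % 2 + v →
      b₀.pos = s' ∧ b₀.n i = x' ∧ b₀.n j = y' ∧ b₀.a i = a' ∧ b₀.a j = b') :
    ∃ c : k, ev z (Finsupp.single (mon i s x y a b) 1) =
      c • Finsupp.single (mon i s' x' y' a' b') 1 := by
  refine exists_ev_single_eq hz hb _ fun b₀ hb₀ hd hw => ?_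
  rw [deg_mon hij] at hd
  rw [wt_mon hij, wt₂_add, wt_eq_wt₂_iff hij] at hw
  obtain ⟨h1, h2, h3, h4, h5⟩ := h b₀ hb₀ hd hw.1 hw.2
  rw [eq_mon hij b₀, h1, h2, h3, h4, h5]

end TateSpan

open ProdCyclic

/-! ### The Massey product for two factors -/

namespace TateSpan

open TateMonomial HomCohomology

variable {k : Type u} [Field k] {m : Fin 2 → ℕ} {i j : Fin 2}

theorem units_smul_single_ne_zero {r : ℕ} (e : ℤˣ) (b : TateMonomial r) :
    e • Finsupp.single b (1 : k) ≠ 0 := by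
  rw [Ne, smul_eq_zero_iff_eq, Finsupp.single_eq_zero]
  exact one_ne_zero

variable [IsCharPowers k m]

variable (k m) in
/-- The generator with given exponents. -/
def monGen (hij : i ≠ j) (s : Bool) (x y n : ℤ)
    (hs : s = true → 0 ≤ x ∧ 0 ≤ y) (hs' : s = false → x < 0 ∧ y < 0)
    (hn : -(x + y) - (if s then 0 else 1) = -n) : Gen m n :=
  ⟨mon i s x y 0 0, (valid_two hij _).2 ⟨by
      have := IsCharPowers.two_le k m i
      rw [mon_a_left]; omega, by
      have := IsCharPowers.two_le k m j
      rw [mon_a_right hij]; omega, by rwa [mon_n_left, mon_n_right hij], by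
      rwa [mon_n_left, mon_n_right hij]⟩, by rwa [deg_mon hij], fun l => by simp [mon]⟩

/-- Generators of positive degree have negative weights. -/
theorem wt_gen_neg {r : ℕ} {m : Fin r → ℕ} (hm : ∀ i, 2 ≤ m i) {n : ℤ} (hn : n < 0) (b : Gen m n)
    (i : Fin r) : b.1.wt m i < 0 := by
  have h0 := b.2.1.2.2 (b.2.1.neg_of_deg_pos (by rw [b.2.2.1]; omega)) i
  have h1 := hm i
  have h2 : (m i : ℤ) * (b.1.n i / 2) ≤ m i * (-1) :=
    mul_le_mul_of_nonneg_left (by omega) (by positivity)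
  simp only [wt, b.2.2.2 i]
  push_cast
  omega

set_option maxHeartbeats 1000000 in
/-- The class in degree `2` of one of two factors generates an ideal whose quotient is not a
direct summand of a realisable module. -/
theorem not_isDirectSummand_of_two {K M : CochainComplex (Rep.{u} k (ProdCyclic m)) ℤ}
    (E : HEquiv k K (complex k m)) (i : Fin 2) :
    ¬ (GradedMod.cyclicQuotient (endAlg k K)
      (E.conj 2 (basis k m two_pos 2 (coordGen k m i 2 zero_le_two)))).IsDirectSummand
        (homMod k K M) := by
  intro hX
  obtain ⟨j, hij⟩ : ∃ j, i ≠ j := ⟨i + 1, by omega⟩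
  have hm := IsCharPowers.two_le k m
  have hmi := hm i
  have hmj := hm j
  have hval : ∀ {s : Bool} {x y : ℤ} {a b : ℕ}, a < m i → b < m j →
      (s = true → 0 ≤ x ∧ 0 ≤ y) → (s = false → x < 0 ∧ y < 0) → (mon i s x y a b).Valid m :=
    fun ha hb hs hs' => (valid_two hij _).2 (by
      rw [mon_a_left, mon_a_right hij, mon_n_left, mon_n_right hij]
      exact ⟨ha, hb, hs, hs'⟩)
  have hmem : ∀ {s : Bool} {x y : ℤ} {a b : ℕ}, (mon i s x y a b).Valid m →
      Finsupp.single (mon i s x y a b) (1 : k) ∈ degSpace k m _ :=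
    fun h => single_mem_degSpace h rfl
  -- the cocycles
  have hζg : (coordGen k m i 2 zero_le_two).1 = mon i true 2 0 0 0 := by
    rw [coordGen_val, bot_eq_mon (i := i), mon_set_left hij]
  -- `ζ` and `b` are the degree-two classes of the two factors, and `a` has degree `-3` and is dual
  -- to `e_{-2,-2}`. Their Massey product has degree and weight zero, as has the unit.
  obtain ⟨ζ, hζ, hζb, hζ1⟩ := exists_dual_cocycle (k := k) two_pos (coordGen k m i 2 zero_le_two)
  obtain ⟨b, hb, -, hb1⟩ := exists_dual_cocycle (k := k) two_pos
    (monGen k m hij true 0 2 2 (by simp) (by simp) (by norm_num))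
  obtain ⟨a, ha, -, ha1⟩ := exists_dual_cocycle (k := k) two_pos
    (monGen k m hij false (-2) (-2) (-3) (by simp) (by simp) (by norm_num))
  change (b : Cochain (complex k m) (complex k m) 2) ∈ wtCochain k m (-(mon i true 0 2 0 0).wt m) 2
    at hb
  change (a : Cochain (complex k m) (complex k m) (-3)) ∈
    wtCochain k m (-(mon i false (-2) (-2) 0 0).wt m) (-3) at ha
  change ev (b : Cochain (complex k m) (complex k m) 2) (Finsupp.single (mon i true 0 2 0 0) 1) = _
    at hb1
  change ev (a : Cochain (complex k m) (complex k m) (-3))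
    (Finsupp.single (mon i false (-2) (-2) 0 0) 1) = _ at ha1
  rw [hζg] at hζ hζ1
  generalize basis k m two_pos 2 (coordGen k m i 2 zero_le_two) = ζ' at hX hζb
  subst hζb
  rw [wt_mon hij, wt₂_neg] at hζ hb ha
  norm_num at hζ hb ha
  -- the null-homotopies
  obtain ⟨g, hg, hgδ⟩ := exists_homogeneous_nullhomotopy (k := k) two_pos
    (show (2 : ℤ) + -3 = -1 by norm_num) hζ ha (fun b hb => by
      -- The product has degree `-1`, where generators have negative weight in every coordinate, but
      -- a non-zero class would need `i`-weight zero.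
      have h1 := wt_gen_neg hm (by norm_num) b i
      have h2 := congrFun hb i
      simp [wt₂] at h2
      omega) (show (-2 : ℤ) + 1 = -1 by norm_num)
  obtain ⟨h, hh, hhδ⟩ := exists_homogeneous_nullhomotopy (k := k) two_pos
    (show (-3 : ℤ) + 2 = -1 by norm_num) ha hb (fun b hb => by
      have h1 := wt_gen_neg hm (by norm_num) b j
      have h2 := congrFun hb j
      simp [wt₂, hij.symm] at h2
      omega) (show (-2 : ℤ) + 1 = -1 by norm_num)
  rw [wt₂_add] at hg hh
  norm_num at hg hh
  -- the values of the cochains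
  have v00 : (mon i true 0 0 0 0).Valid m := hval (by omega) (by omega) (by simp) (by simp)
  have v01 : (mon i true 0 1 0 0).Valid m := hval (by omega) (by omega) (by simp) (by simp)
  have v02 : (mon i true 0 2 0 0).Valid m := hval (by omega) (by omega) (by simp) (by simp)
  have v11 : (mon i false (-1) (-1) 0 0).Valid m := hval (by omega) (by omega) (by simp) (by simp)
  have v12 : (mon i false (-1) (-2) 0 0).Valid m := hval (by omega) (by omega) (by simp) (by simp)
  have v13 : (mon i false (-1) (-3) 0 0).Valid m := hval (by omega) (by omega) (by simp) (by simp)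
  have v22 : (mon i false (-2) (-2) 0 0).Valid m := hval (by omega) (by omega) (by simp) (by simp)
  -- `b` moves `e_{0,0}` across the splice into the coresolution, where degree and weight leave a
  -- single monomial.
  obtain ⟨c, hc⟩ := exists_ev_mon_eq hij hb v00 false (-1) (-2) (m i - 1) 0 (by
    intro b₀ hb₀ hd h1 h2
    have hp := hb₀.neg_of_deg_pos (by rw [hd]; norm_num)
    have hv := (valid_two hij _).1 hb₀
    rw [deg_two hij, hp] at hd
    simp [hp] at hd hv
    obtain ⟨hx, hy⟩ | ⟨hx, hy⟩ : (b₀.n i = -1 ∧ b₀.n j = -2) ∨ (b₀.n i = -2 ∧ b₀.n j = -1) := by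
      omega
    all_goals
      rw [hx] at h1
      rw [hy] at h2
      norm_num at h1 h2
      refine ⟨hp, ?_, ?_, ?_, ?_⟩ <;> omega)
  obtain ⟨c₁, hc₁⟩ := exists_ev_mon_eq hij hb v01 false (-1) (-1) (m i - 1) 0 (by
    intro b₀ hb₀ hd h1 h2
    have hp := hb₀.neg_of_deg_pos (by rw [hd]; norm_num)
    have hv := (valid_two hij _).1 hb₀
    rw [deg_two hij, hp] at hd
    simp [hp] at hd hv
    obtain ⟨hx, hy⟩ : b₀.n i = -1 ∧ b₀.n j = -1 := by omega
    rw [hx] at h1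
    rw [hy] at h2
    norm_num at h1 h2
    refine ⟨hp, ?_, ?_, ?_, ?_⟩ <;> omega)
  -- This value and the next two have non-positive degree, so they lie in the resolution; a
  -- coordinate of their weight is `1 - m i` or `1 - m j`, which is negative.
  have hg0 := ev_mon_eq_zero hij hg v12 (by
    intro b₀ hb₀ hd h1 h2
    norm_num at hd
    have h3 := wt_nonneg hb₀ (hb₀.pos_of_deg_nonpos (by rw [hd])) i
    simp only [wt] at h3
    norm_num at h1
    omega)
  have hh0 := ev_mon_eq_zero hij hh v11 (by
    intro b₀ hb₀ hd h1 h2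
    norm_num at hd
    have h3 := wt_nonneg hb₀ (hb₀.pos_of_deg_nonpos (by rw [hd]; norm_num)) j
    simp only [wt] at h3
    norm_num at h2
    omega)
  have ha0 := ev_mon_eq_zero hij ha v13 (by
    intro b₀ hb₀ hd h1 h2
    norm_num at hd
    have h3 := wt_nonneg hb₀ (hb₀.pos_of_deg_nonpos (by rw [hd])) j
    simp only [wt] at h3
    norm_num at h2
    omega)
  obtain ⟨x, hx⟩ := exists_ev_mon_eq hij hh v00 true 2 0 0 0 (by
    intro b₀ hb₀ hd h1 h2
    have hp := hb₀.pos_of_deg_nonpos (by rw [hd]; norm_num)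
    have hv := (valid_two hij _).1 hb₀
    rw [deg_two hij, hp] at hd
    simp [hp] at hd hv
    obtain ⟨hx, hy⟩ | ⟨hx, hy⟩ | ⟨hx, hy⟩ : (b₀.n i = 2 ∧ b₀.n j = 0) ∨
        (b₀.n i = 1 ∧ b₀.n j = 1) ∨ (b₀.n i = 0 ∧ b₀.n j = 2) := by omega
    all_goals
      rw [hx] at h1
      rw [hy] at h2
      norm_num at h1 h2
      refine ⟨hp, ?_, ?_, ?_, ?_⟩ <;> omega)
  obtain ⟨y, hy⟩ := exists_ev_mon_eq hij ha v12 true 1 0 0 0 (by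
    intro b₀ hb₀ hd h1 h2
    have hp := hb₀.pos_of_deg_nonpos (by rw [hd]; norm_num)
    have hv := (valid_two hij _).1 hb₀
    rw [deg_two hij, hp] at hd
    simp [hp] at hd hv
    obtain ⟨hx, hy⟩ | ⟨hx, hy⟩ : (b₀.n i = 1 ∧ b₀.n j = 0) ∨ (b₀.n i = 0 ∧ b₀.n j = 1) := by
      omega
    all_goals
      rw [hx] at h1
      rw [hy] at h2
      norm_num at h1 h2
      refine ⟨hp, ?_, ?_, ?_, ?_⟩ <;> omega)
  -- the differentials
  have hodd : ∀ l (n : ℤ), n % 2 = 1 → dExp (m l) n = 1 := fun l n h => if_pos h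
  have heven : ∀ l (n : ℤ), n % 2 = 0 → dExp (m l) n = m l - 1 := fun l n h => if_neg (by omega)
  have hne : ∀ {s : Bool} {x y : ℤ} {a b : ℕ}, (s = true → x ≠ 0 ∨ y ≠ 0) →
      mon i s x y a b ≠ bot 2 := by
    intro s x y a b hs hb
    rw [bot_eq_mon (i := i)] at hb
    have h1 := congrArg TateMonomial.pos hb
    have h2 := congrArg (fun b => b.n i) hb
    have h3 := congrArg (fun b => b.n j) hb
    simp only [mon_n_left, mon_n_right hij] at h2 h3
    exact (hs h1).elim (· h2) (· h3)
  obtain ⟨ε₁, d02⟩ : ∃ ε : ℤˣ, d k m (Finsupp.single (mon i true 0 2 0 0) 1) =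
      ε • Finsupp.single (mon i true 0 1 0 (m j - 1)) 1 := by
    obtain ⟨ε, hε⟩ := dCoord_right (k := k) hij (s := true) (x := 0) (y := 2) (a := 0) (b := 0)
      (by rw [heven _ _ (by norm_num)]; omega) (by simp)
    rw [d_two hij (hne (by simp)), hε, dCoord_left_eq_zero (Or.inr ⟨rfl, rfl⟩), zero_add,
      heven _ _ (by norm_num), zero_add]
    exact ⟨ε, rfl⟩
  obtain ⟨ε₂, d01⟩ : ∃ ε : ℤˣ, d k m (Finsupp.single (mon i true 0 1 0 0) 1) =
      ε • Finsupp.single (mon i true 0 0 0 1) 1 := by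
    obtain ⟨ε, hε⟩ := dCoord_right (k := k) hij (s := true) (x := 0) (y := 1) (a := 0) (b := 0)
      (by rw [hodd _ _ (by norm_num)]; omega) (by simp)
    rw [d_two hij (hne (by simp)), hε, dCoord_left_eq_zero (Or.inr ⟨rfl, rfl⟩), zero_add,
      hodd _ _ (by norm_num), zero_add]
    exact ⟨ε, rfl⟩
  obtain ⟨ε₃, d11⟩ : ∃ ε : ℤˣ, d k m (Finsupp.single (mon i false (-1) (-1) (m i - 1) 0) 1) =
      ε • Finsupp.single (mon i false (-1) (-2) (m i - 1) 1) 1 := by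
    obtain ⟨ε, hε⟩ := dCoord_right (k := k) hij (s := false) (x := -1) (y := -1) (a := m i - 1)
      (b := 0) (by rw [hodd _ _ (by norm_num)]; omega) (by simp)
    rw [d_two hij (hne (by simp)), hε, dCoord_left_eq_zero (Or.inl
      (by rw [hodd _ _ (by norm_num)]; omega)), zero_add, hodd _ _ (by norm_num), zero_add]
    exact ⟨ε, rfl⟩
  obtain ⟨ε₄, ε₅, d12⟩ : ∃ ε ε' : ℤˣ, d k m (Finsupp.single (mon i false (-1) (-2) 0 0) 1) =
      ε • Finsupp.single (mon i false (-2) (-2) 1 0) 1 +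
      ε' • Finsupp.single (mon i false (-1) (-3) 0 (m j - 1)) 1 := by
    obtain ⟨ε, hε⟩ := dCoord_left (k := k) hij (s := false) (x := -1) (y := -2) (a := 0)
      (b := 0) (by rw [hodd _ _ (by norm_num)]; omega) (by simp)
    obtain ⟨ε', hε'⟩ := dCoord_right (k := k) hij (s := false) (x := -1) (y := -2) (a := 0)
      (b := 0) (by rw [heven _ _ (by norm_num)]; omega) (by simp)
    rw [d_two hij (hne (by simp)), hε, hε', heven j (-2) (by norm_num), hodd i (-1) (by norm_num),
      zero_add, zero_add]
    exact ⟨ε, ε', rfl⟩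
  obtain ⟨ε₆, d10⟩ : ∃ ε : ℤˣ, d k m (Finsupp.single (mon i true 1 0 0 0) 1) =
      ε • Finsupp.single (mon i true 0 0 1 0) 1 := by
    obtain ⟨ε, hε⟩ := dCoord_left (k := k) hij (s := true) (x := 1) (y := 0) (a := 0) (b := 0)
      (by rw [hodd _ _ (by norm_num)]; omega) (by simp)
    rw [d_two hij (hne (by simp)), hε, dCoord_right_eq_zero hij (Or.inr ⟨rfl, rfl⟩), add_zero,
      hodd _ _ (by norm_num), zero_add]
    exact ⟨ε, rfl⟩
  have d00 : d k m (Finsupp.single (mon i true 0 0 0 0) 1) =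
      Finsupp.single (mon i false (-1) (-1) (m i - 1) (m j - 1)) 1 := by
    rw [← bot_eq_mon, d_bot, top_eq_mon hij]
  -- multiples of generators
  have hL : ∀ {s : Bool} {x y : ℤ} (c : ℕ), c < m i →
      Finsupp.single (mon i s x y c 0) (1 : k) =
        (t k m i ^ c) (Finsupp.single (mon i s x y 0 0) 1) := by
    intro s x y c hc
    rw [t_pow_left hij _ _ _ _ _ _ (by omega), zero_add]
  have hR : ∀ {s : Bool} {x y : ℤ} {a : ℕ} (c : ℕ), c < m j →
      Finsupp.single (mon i s x y a c) (1 : k) =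
        (t k m j ^ c) (Finsupp.single (mon i s x y a 0) 1) := by
    intro s x y a c hc
    rw [t_pow_right hij _ _ _ _ _ _ (by omega), zero_add]
  have evL : ∀ {n : ℤ} (z : Cochain (complex k m) (complex k m) n) {s : Bool} {x y : ℤ} (c : ℕ),
      (mon i s x y 0 0).Valid m → c < m i → ev z (Finsupp.single (mon i s x y c 0) 1) =
        (t k m i ^ c) (ev z (Finsupp.single (mon i s x y 0 0) 1)) := by
    intro n z s x y c hv hc
    rw [hL c hc, ev_t_pow _ i c (hmem hv)]
  have evR : ∀ {n : ℤ} (z : Cochain (complex k m) (complex k m) n) {s : Bool} {x y : ℤ} (c : ℕ),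
      (mon i s x y 0 0).Valid m → c < m j → ev z (Finsupp.single (mon i s x y 0 c) 1) =
        (t k m j ^ c) (ev z (Finsupp.single (mon i s x y 0 0) 1)) := by
    intro n z s x y c hv hc
    rw [hR c hc, ev_t_pow _ j c (hmem hv)]
  rw [bot_eq_mon (i := i)] at ha1 hb1 hζ1
  -- non-vanishing of the values
  have hy0 : y ≠ 0 := by
    rintro rfl
    -- In `d a = ± a d` on `e_{-1,-2}`, the right side is `± t_i e_{0,0}`, since `a` vanishes on
    -- `e_{-1,-3}`; the left side is `y` times a boundary.
    have h1 := d_ev a (hmem v12)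
    rw [hy, zero_smul, map_zero, d12, map_add, map_units_smul, map_units_smul, evL _ 1 v22 (by omega),
      ha1, evR _ _ v13 (by omega), ha0, map_zero, smul_zero, add_zero, ← hL 1 (by omega),
      smul_smul] at h1
    exact units_smul_single_ne_zero _ _ h1.symm
  have hc₁0 : c₁ ≠ 0 := by
    rintro rfl
    -- `b` sends `e_{0,2}` to `e_{0,0}`, whose differential is the socle element of the coresolution
    -- and hence non-zero. The splice enters here.
    have h1 := d_ev b (hmem v02)
    rw [hb1, d00, d02, map_units_smul, evR _ _ v01 (by omega), hc₁, zero_smul, map_zero, smul_zero,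
      smul_zero, Finsupp.single_eq_zero] at h1
    exact one_ne_zero h1
  have hc0 : c ≠ 0 := by
    rintro rfl
    -- On `e_{0,1}`, the coefficient `c₁` is propagated to `c` along `t_j e_{0,0}`.
    have h1 := d_ev b (hmem v01)
    rw [hc₁, map_smul, d11, d01, map_units_smul, evR _ _ v00 (by omega), hc, zero_smul, map_zero,
      smul_zero, smul_zero] at h1
    exact units_smul_single_ne_zero _ _ ((smul_eq_zero_iff_right hc₁0).1 h1)
  have hbot : ev (a : Cochain (complex k m) (complex k m) (-3)) (c • Finsupp.single (mon i false (-1) (-2) (m i - 1) 0) (1 : k)) =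
      (c * y) • Finsupp.single (mon i true 1 0 (m i - 1) 0) 1 := by
    rw [map_smul, evL _ _ v12 (by omega), hy, map_smul, ← hL _ (by omega), smul_smul]
  have hx0 : x ≠ 0 := by
    rintro rfl
    -- On `e_{0,0}` the product `a b` is `c y t_i^(m_i-1) e_{1,0} ≠ 0`. Since `h` vanishes on the
    -- socle element, this equals `d h(e_{0,0})`, which forces `x ≠ 0`.
    have h1 := ev_δ (show (-2 : ℤ) + 1 = -1 by norm_num) h (hmem v00)
    have h2 : ev h (Finsupp.single (mon i false (-1) (-1) (m i - 1) (m j - 1)) (1 : k)) = 0 := by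
      rw [hR _ (by omega), ev_t_pow _ j _ (hmem (hval (by omega) (by omega) (by simp) (by simp))),
        evL _ _ v11 (by omega), hh0, map_zero, map_zero]
    rw [hhδ, ev_prod _ _ _ (hmem v00), hc, hbot, hx, zero_smul, map_zero, d00, h2, smul_zero,
      add_zero, smul_eq_zero_iff_right (mul_ne_zero hc0 hy0), Finsupp.single_eq_zero] at h1
    exact one_ne_zero h1
  -- the Massey product
  obtain ⟨w, hw⟩ : ∃ w : Cocycle (complex k m) (complex k m) 0,
      (w : Cochain (complex k m) (complex k m) 0) =
        prod k (show (-2 : ℤ) + 2 = 0 by norm_num) g (b : Cochain (complex k m) (complex k m) 2) -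
        (2 : ℤ).negOnePow • prod k (show (2 : ℤ) + -2 = 0 by norm_num)
          (ζ : Cochain (complex k m) (complex k m) 2) h := by
    refine ⟨Cocycle.mk _ 1 (by norm_num) ?_, rfl⟩
    rw [δ_sub, δ_units_smul, δ_prod k _ (show (-2 : ℤ) + 1 = -1 by norm_num)
      (show (2 : ℤ) + 1 = 3 by norm_num) (by norm_num), δ_prod k _ (show (2 : ℤ) + 1 = 3 by norm_num)
      (show (-2 : ℤ) + 1 = -1 by norm_num) (by norm_num), hgδ, hhδ, Cocycle.δ_eq_zero,
      Cocycle.δ_eq_zero, map_zero, map_zero,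
      LinearMap.zero_apply, smul_zero, add_zero, zero_add (_ • _), smul_smul, Int.units_mul_self,
      one_smul,
      prod_assoc k _ (show (-3 : ℤ) + 2 = -1 by norm_num) _ (show (2 : ℤ) + -1 = 1 by norm_num),
      sub_self]
  obtain ⟨ν, l, hνl⟩ := exists_massey_eq_of_isDirectSummand E (dp := -1) (pq := -1)
    (by norm_num) (by norm_num) (by norm_num) (by norm_num) (by norm_num) (by norm_num) ζ a b g hgδ h hhδ w hw hX
  let e : Gen m 0 := monGen k m hij true 0 0 0 (by simp) (by simp) (by norm_num)
  have he : e.1 = mon i true 0 0 0 0 := rfl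
  have hew : e.1.wt m = 0 := by rw [he, ← bot_eq_mon, wt_bot]
  have h1 := congrArg (coeff two_pos e) hνl
  rw [map_add] at h1
  have h2 : coeff (k := k) two_pos e (Submodule.Quotient.mk w) = 0 := by
    rw [h1]
    refine (congrArg₂ (· + ·) ?_ ?_).trans (add_zero 0)
    -- A cofactor producing the unit would have degree `-2`, where all coordinates of the weights of
    -- generators are negative; the weight required is zero in one coordinate.
    · refine coeff_mul_eq_zero two_pos _ e ν (mk_mem_wtClass hb) fun b' hb' => ?_
      have h3 := wt_gen_neg hm (by norm_num) b' i
      rw [hb', hew] at h3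
      simp [wt₂] at h3
    · refine coeff_mul_eq_zero' two_pos _ e (mk_mem_wtClass hζ) l fun b' hb' => ?_
      have h3 := wt_gen_neg hm (by norm_num) b' j
      rw [hb', hew] at h3
      simp [wt₂, hij.symm] at h3
  -- On `e_{0,0}`, `g b` is a multiple of `t_i^(m_i-1) g(e_{-1,-2}) = 0`, and `ζ h` is `x e_{0,0}`.
  rw [coeff_mk, cochainCoeff_eq, hw, he, ev_sub _ _ (hmem v00), ev_units_smul _ _ (hmem v00),
    ev_prod _ _ _ (hmem v00), ev_prod _ _ _ (hmem v00), hc, hx, map_smul, map_smul, hζ1,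
    evL _ _ v12 (by omega), hg0, map_zero, smul_zero, zero_sub, bot_eq_mon (i := i)] at h2
  simp at h2
  exact hx0 ((smul_eq_zero_iff_eq _).1 h2)

end TateSpan

/-! ### Coefficients in the explicit complete resolution -/

open ProdCyclic

namespace IsCharPowers

/-- The reduction of a binomial coefficient is the carry. -/
theorem choose_add_eq (k : Type u) [Field k] {r : ℕ} (m : Fin r → ℕ) [IsCharPowers k m] (i : Fin r)
    {a b : ℕ} (ha : a < m i) (hb : b < m i) :
    ((a + b).choose (m i) : k) = if m i ≤ a + b then 1 else 0 := by
  split_ifs with h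
  · obtain ⟨c, hc⟩ := Nat.exists_eq_add_of_le h
    -- The coefficients of `X ^ m i` are compared in `(1 + X)^(a+b) = (1 + X ^ m i) (1 + X)^c`, with
    -- `c < m i`.
    have h1 := one_add_pow k m i (Polynomial.X : Polynomial k)
    have h2 : (1 + Polynomial.X : Polynomial k) ^ (a + b) =
        (1 + Polynomial.X) ^ c + Polynomial.X ^ m i * (1 + Polynomial.X) ^ c := by
      rw [hc, pow_add, h1]
      ring
    have h3 := congrArg (fun q => Polynomial.coeff q (m i)) h2
    simp only [Polynomial.coeff_add, Polynomial.coeff_X_pow_mul', Polynomial.coeff_one_add_X_pow,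
      le_refl, if_true, Nat.sub_self, Nat.choose_zero_right] at h3
    rw [h3, Nat.choose_eq_zero_of_lt (by omega)]
    simp
  · rw [Nat.choose_eq_zero_of_lt (by omega), Nat.cast_zero]

end IsCharPowers

namespace TateSpan

open TateMonomial HomCohomology

variable {k : Type u} [Field k] {r : ℕ} {m : Fin r → ℕ}

/-- At a monomial in the `i`-th factor alone, the other `d_j` contribute nothing, since their values
involve `t_j`. Among all monomials, `d_i` sends only `t_i^c e_x` there. -/
theorem d_apply_bot_set (hm : ∀ i, 2 ≤ m i) (i : Fin r) {x : ℤ} {c c' : ℕ} (hx : x ≠ 0)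
    (hc' : c + dExp (m i) x = c') (hc : c' < m i) (y : TateSpan k r) :
    d k m y ((bot r).set i (x - 1) c') = y ((bot r).set i x c) := by
  subst hc'
  suffices h : Finsupp.lapply ((bot r).set i (x - 1) (c + dExp (m i) x)) ∘ₗ d k m =
      (Finsupp.lapply ((bot r).set i x c) : _ →ₗ[k] k) from LinearMap.congr_fun h y
  refine hom_ext fun b => ?_
  rw [LinearMap.comp_apply, Finsupp.lapply_apply, Finsupp.lapply_apply]
  by_cases hb : b = (bot r).set i x c
  · subst hb
    rw [d_bot_set_of_lt i hx hc, Finsupp.single_eq_same, Finsupp.single_eq_same]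
  · rw [Finsupp.single_eq_of_ne (Ne.symm hb), d_apply, Finsupp.add_apply, Finsupp.finsetSum_apply,
      splice_apply_of_ne _ (fun h => by simpa [bot, top] using congrArg pos h), add_zero,
      Finset.sum_eq_single i (fun j _ hj => dCoord_apply_eq_zero hm j _ (by
        rw [set_a_ne _ hj]; rfl)) (fun h => absurd (Finset.mem_univ i) h)]
    by_cases h0 : b.pos = true ∧ b.n i = 0
    · rw [dCoord_of_eq_zero h0.1 h0.2]
      rfl
    rcases lt_or_ge (b.a i + dExp (m i) (b.n i)) (m i) with h1 | h1
    · rw [dCoord_of_lt h1 (fun h2 h3 => h0 ⟨h2, h3⟩)]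
      have h2 : (Finsupp.single (b.set i (b.n i - 1) (b.a i + dExp (m i) (b.n i))) (1 : k))
          ((bot r).set i (x - 1) (c + dExp (m i) x)) = 0 := by
        rw [Finsupp.single_eq_of_ne]
        intro h
        apply hb
        have h3 := congrArg (fun b => b.n i) h
        have h4 := congrArg (fun b => b.a i) h
        simp only [set_n, set_a] at h3 h4
        have h5 : b.n i = x := by omega
        rw [h5] at h4
        have h6 := congrArg (fun b => b.set i x c) h
        simp only [set_set] at h6
        rw [h6, ← h5, show c = b.a i by omega, set_self]
      rcases Int.units_eq_one_or ((-1) ^ (∑ j ∈ Finset.Iio i, b.n j) : ℤˣ) with h3 | h3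
      · rw [h3, one_smul, h2]
      · rw [h3, Units.neg_smul, one_smul, Finsupp.neg_apply, h2, neg_zero]
    · rw [dCoord_of_le h1]
      rfl

theorem t_pow_apply_bot_set (i : Fin r) (x : ℤ) (c j : ℕ) (hc : c < m i) (y : TateSpan k r) :
    (t k m i ^ j) y ((bot r).set i x c) = if j ≤ c then y ((bot r).set i x (c - j)) else 0 := by
  suffices h : Finsupp.lapply ((bot r).set i x c) ∘ₗ (t k m i ^ j) =
      (if j ≤ c then Finsupp.lapply ((bot r).set i x (c - j)) else 0 : _ →ₗ[k] k) by
    have := LinearMap.congr_fun h y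
    split_ifs at this ⊢ <;> exact this
  refine hom_ext fun b => ?_
  rw [LinearMap.comp_apply, Finsupp.lapply_apply, t_pow_single]
  have key : b.set i (b.n i) (b.a i + j) = (bot r).set i x c ↔
      j ≤ c ∧ b = (bot r).set i x (c - j) := by
    constructor
    · intro h
      have h3 := congrArg (fun b => b.n i) h
      have h4 := congrArg (fun b => b.a i) h
      simp only [set_n, set_a] at h3 h4
      refine ⟨by omega, ?_⟩
      have h6 := congrArg (fun b => b.set i x (c - j)) h
      simp only [set_set] at h6
      rw [← h6, ← h3, show c - j = b.a i by omega, set_self]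
    · rintro ⟨h, rfl⟩
      rw [set_n, set_a, set_set, Nat.sub_add_cancel h]
  by_cases hb : b.set i (b.n i) (b.a i + j) = (bot r).set i x c
  · obtain ⟨h1, h2⟩ := key.1 hb
    have h3 : b.a i + j = c := by rw [h2, set_a]; omega
    rw [if_pos (Or.inl (by omega)), hb, if_pos h1, h2]
    simp
  · have h1 : (if b.a i + j < m i ∨ j = 0 then
        Finsupp.single (b.set i (b.n i) (b.a i + j)) (1 : k) else 0) ((bot r).set i x c) = 0 := by
      split_ifs
      · exact Finsupp.single_eq_of_ne (Ne.symm hb)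
      · rfl
    rw [h1]
    split_ifs with h2
    · rw [Finsupp.lapply_apply, Finsupp.single_eq_of_ne]
      rintro h3
      exact hb (key.2 ⟨h2, h3.symm⟩)
    · rfl

theorem one_add_t_pow_apply (i : Fin r) (x : ℤ) (c n : ℕ) (hc : c < m i) (y : TateSpan k r) :
    ((1 + t k m i) ^ n) y ((bot r).set i x c) =
      ∑ j ∈ Finset.range (c + 1), (n.choose j : k) * y ((bot r).set i x (c - j)) := by
  have h1 : (1 + t k m i) ^ n = ∑ j ∈ Finset.range (n + 1), (n.choose j : k) • t k m i ^ j := by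
    rw [add_comm, (Commute.one_right (t k m i)).add_pow]
    refine Finset.sum_congr rfl fun j _ => ?_
    rw [one_pow, mul_one, ← Nat.cast_comm, ← nsmul_eq_mul, Nat.cast_smul_eq_nsmul]
  rw [h1, LinearMap.sum_apply, Finsupp.finsetSum_apply]
  simp only [LinearMap.smul_apply, Finsupp.smul_apply, t_pow_apply_bot_set i x c _ hc, smul_eq_mul]
  -- Both sums are compared inside a common range: binomial coefficients vanish beyond `n`, and the
  -- other factor vanishes beyond `c`.
  have h2 : ∀ N, n ≤ N → c ≤ N → ∀ f : ℕ → k,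
      ∑ j ∈ Finset.range (n + 1), (n.choose j : k) * (if j ≤ c then f j else 0) =
        ∑ j ∈ Finset.range (c + 1), (n.choose j : k) * f j := by
    intro N hn hcN f
    trans ∑ j ∈ Finset.range (N + 1), (n.choose j : k) * (if j ≤ c then f j else 0)
    · refine Finset.sum_subset (Finset.range_mono (by omega)) fun j _ hj => ?_
      rw [Finset.mem_range] at hj
      rw [Nat.choose_eq_zero_of_lt (by omega), Nat.cast_zero, zero_mul]
    · symm
      refine (Finset.sum_congr rfl fun j hj => ?_).trans
        (Finset.sum_subset (Finset.range_mono (show c + 1 ≤ N + 1 by omega)) fun j _ hj => ?_)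
      · rw [Finset.mem_range] at hj
        rw [if_pos (by omega)]
      · rw [Finset.mem_range] at hj
        rw [if_neg (by omega), mul_zero]
  exact h2 (n + c) (by omega) (by omega) fun j => y ((bot r).set i x (c - j))

variable [IsCharPowers k m]

/-- A functional which vanishes on the multiples of `t_l` for `l ≠ i` only sees the action of the
`i`-th factor. -/
theorem functional_action (i : Fin r) (Λ : TateSpan k r →ₗ[k] k)
    (hΛ : ∀ l, l ≠ i → ∀ x, Λ (t k m l x) = 0) (g : ProdCyclic m) (x : TateSpan k r) :
    Λ (action k m g x) = Λ (((1 + t k m i) ^ coord i g) x) := by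
  have := IsCharPowers.neZero k m
  let N : Submonoid (ProdCyclic m) :=
    { carrier := {g | ∀ x, Λ (action k m g x) = Λ x}
      one_mem' := fun x => by rw [map_one]; rfl
      mul_mem' := fun {g h} hg hh x => by
        rw [map_mul, Module.End.mul_apply, hg, hh] }
  -- With its `i`-th coordinate removed, `g` is a product of powers of generators `g_l` with `l ≠
  -- i`, each of which preserves `Λ`.
  have hN : g * (Pi.mulSingle i (g i))⁻¹ ∈ N := by
    refine Submonoid.pi_mem_of_mulSingle_mem _ fun l => ?_
    by_cases hl : l = i
    · subst hl
      rw [Pi.mul_apply, Pi.inv_apply, Pi.mulSingle_eq_same, mul_inv_cancel, Pi.mulSingle_one]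
      exact one_mem N
    · rw [mulSingle_eq_pow]
      refine pow_mem (fun x => ?_) _
      rw [action_gen, LinearMap.add_apply, map_add, hΛ l hl, add_zero]
      rfl
  have h1 := hN (action k m (Pi.mulSingle i (g i)) x)
  rw [← Module.End.mul_apply, ← map_mul, inv_mul_cancel_right, mulSingle_eq_pow, map_pow,
    action_gen] at h1
  exact h1

theorem action_apply_bot_set (i : Fin r) (x : ℤ) (c : ℕ) (hc : c < m i) (g : ProdCyclic m)
    (y : TateSpan k r) : action k m g y ((bot r).set i x c) =
      ∑ j ∈ Finset.range (c + 1), ((coord i g).choose j : k) * y ((bot r).set i x (c - j)) := by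
  rw [← one_add_t_pow_apply i x c _ hc]
  exact functional_action i (Finsupp.lapply ((bot r).set i x c)) (fun l hl y =>
    t_apply_eq_zero l y (by rw [set_a_ne _ hl]; rfl)) g y

/-- Functionals dual to the generators of the factors are computed by the differential. -/
theorem augmentation_eq_apply (hr : 0 < r) (i : Fin r) {n : ℤ} (hn : 0 ≤ n)
    (f : Cocycle (complex k m) (complex k m) n)
    (hf : (Submodule.Quotient.mk f : H k (complex k m) (complex k m) n) =
      basis k m hr n (coordGen k m i n hn)) (y : obj k m (-n)) :
    (augmentation k m).hom ((toHom (f : Cochain (complex k m) (complex k m) n) (-n) 0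
      (neg_add_cancel n)).hom y) = coe k m (-n) y ((bot r).set i n 0) := by
  classical
  let ψ : obj k m (-n) ⟶ Rep.trivial k (ProdCyclic m) k :=
    toHom (f : Cochain (complex k m) (complex k m) n) (-n) 0 (neg_add_cancel n) ≫ augmentation k m
  suffices h : ψ.hom.toLinearMap = Finsupp.lapply ((bot r).set i n 0) ∘ₗ coe k m (-n) from
    LinearMap.congr_fun h y
  refine map_mono_ext fun b hb hd => ?_
  rw [LinearMap.comp_apply, coe_mono, Finsupp.lapply_apply]
  by_cases h0 : ∀ l, b.a l = 0
  · have h1 := coeff_basis (k := k) hr ⟨b, hb, hd, h0⟩ (coordGen k m i n hn)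
    rw [← hf] at h1
    refine Eq.trans (show _ = coeff (k := k) hr (⟨b, hb, hd, h0⟩ : Gen m n)
      (Submodule.Quotient.mk f) from rfl) (h1.trans ?_)
    rw [Finsupp.single_apply]
    refine if_congr ⟨fun h => ?_, fun h => Subtype.ext h.symm⟩ rfl rfl
    exact (congrArg Subtype.val h).symm
  · have h1 : ψ.hom (mono b hb hd) = 0 := hom_trivial_eq_zero ψ fun b' hb' => by
      rw [coe_mono, Finsupp.single_eq_of_ne]
      rintro rfl
      exact h0 hb'
    refine h1.trans (Finsupp.single_eq_of_ne ?_).symm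
    rintro rfl
    refine h0 fun l => ?_
    by_cases hl : l = i
    · subst hl; simp
    · rw [set_a_ne _ hl]; rfl

end TateSpan

/-! ### Inhomogeneous cocycles representing the classes of the factors -/

open ProdCyclic

namespace TateSpan

open TateMonomial HomCohomology

variable {k : Type u} [Field k] {r : ℕ} {m : Fin r → ℕ} [IsCharPowers k m]

theorem exists_dHom_eq {n' n : ℤ} (h : n' + 1 = n) (y : obj k m n) (hy : d k m (coe k m n y) = 0) :
    ∃ x : obj k m n', (dHom k m n' n).hom x = y := by
  obtain rfl : n' = n - 1 := by omega
  obtain ⟨x, hx, hdx⟩ := exists_d_eq (IsCharPowers.two_le k m) (coe_mem y) hy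
  exact ⟨objMk x hx, coe_injective ((coe_dHom h (objMk x hx)).trans hdx)⟩

variable (k m) in
/-- The generator in degree zero. -/
noncomputable def one : obj k m 0 := mono (bot r) (valid_bot m (IsCharPowers.two_le k m)) deg_bot

theorem coe_one : coe k m 0 (one k m) = Finsupp.single (bot r) 1 := rfl

theorem augmentation_one : (augmentation k m).hom (one k m) = (1 : k) := by
  rw [augmentation_apply, coe_one, Finsupp.single_eq_same]

theorem action_bot_apply (i : Fin r) {c : ℕ} (hc : c < m i) (g : ProdCyclic m) :
    action k m g (Finsupp.single (bot r) 1) ((bot r).set i 0 c) = ((coord i g).choose c : k) := by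
  rw [action_apply_bot_set i 0 c hc, Finset.sum_eq_single c]
  · rw [Nat.sub_self, show (bot r).set i 0 0 = bot r from set_self (bot r) i,
      Finsupp.single_eq_same, mul_one]
  · intro j hj hjc
    rw [Finset.mem_range] at hj
    rw [Finsupp.single_eq_of_ne, mul_zero]
    intro h
    have h1 := congrArg (fun b => b.a i) h
    simp only [set_a, bot, Pi.zero_apply] at h1
    omega
  · intro h
    exact absurd (Finset.mem_range.2 (Nat.lt_succ_self c)) h

theorem exists_dHom_eq_sub_one (g : ProdCyclic m) : ∃ s : obj k m (-1),
    (dHom k m (-1) 0).hom s = (obj k m 0).ρ g (one k m) - one k m := by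
  refine exists_dHom_eq (by norm_num) _ (d_eq_zero_of_apply_bot_eq_zero (coe_mem _) ?_)
  rw [← augmentation_apply]
  have h := Rep.hom_comm_apply (augmentation k m) g (one k m)
  rw [map_sub, h]
  exact sub_self _

/-- The low coefficients of a lift of `g e - e`. -/
theorem apply_set_one_eq {g : ProdCyclic m} {s : obj k m (-1)}
    (hs : (dHom k m (-1) 0).hom s = (obj k m 0).ρ g (one k m) - one k m) (i : Fin r) {c : ℕ}
    (hc : c + 1 < m i) :
    coe k m (-1) s ((bot r).set i 1 c) = ((coord i g).choose (c + 1) : k) := by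
  have h1 := d_apply_bot_set (IsCharPowers.two_le k m) i (x := 1) (c := c) one_ne_zero
    (by simp [dExp]) hc (coe k m (-1) s)
  rw [← h1, ← coe_dHom (show (-1 : ℤ) + 1 = 0 by norm_num), hs, map_sub, coe_ρ, coe_one,
    Finsupp.sub_apply, sub_self, action_bot_apply i hc, Finsupp.single_eq_of_ne, sub_zero]
  intro h
  simpa [bot] using congrArg (fun b => b.a i) h

/-- The lifts of `g e - e` may be chosen without socle coefficient. -/
theorem exists_dHom_eq_sub_one' (i : Fin r) (g : ProdCyclic m) : ∃ s : obj k m (-1),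
    (dHom k m (-1) 0).hom s = (obj k m 0).ρ g (one k m) - one k m ∧
    coe k m (-1) s ((bot r).set i 1 (m i - 1)) = 0 := by
  have hm := IsCharPowers.two_le k m i
  obtain ⟨s, hs⟩ := exists_dHom_eq_sub_one (k := k) g
  -- The differential of `e_2` is exactly `t_i^(m_i-1) e_1`, so a multiple of it removes the
  -- unwanted coefficient without changing the boundary.
  let y : obj k m (-2) := genMono (coordGen k m i 2 zero_le_two)
  have hdy : coe k m (-1) ((dHom k m (-2) (-1)).hom y) =
      Finsupp.single ((bot r).set i 1 (m i - 1)) 1 := by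
    rw [coe_dHom (by norm_num)]
    refine (d_bot_set_of_lt (x := 2) (c := 0) i (by norm_num) (by simp [dExp]; omega)).trans ?_
    simp [dExp]
  refine ⟨s - coe k m (-1) s ((bot r).set i 1 (m i - 1)) • (dHom k m (-2) (-1)).hom y, ?_, ?_⟩
  · rw [map_sub, map_smul, hs]
    have : (dHom k m (-1) 0).hom ((dHom k m (-2) (-1)).hom y) = 0 := by
      apply coe_injective
      rw [coe_dHom (by norm_num), coe_dHom (by norm_num), d_d (IsCharPowers.two_le k m), map_zero]
    rw [this, smul_zero, sub_zero]
  · rw [map_sub, map_smul, hdy]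
    simp

theorem exists_dHom_eq_coboundary (s : ProdCyclic m → obj k m (-1))
    (hs : ∀ g, (dHom k m (-1) 0).hom (s g) = (obj k m 0).ρ g (one k m) - one k m)
    (g h : ProdCyclic m) : ∃ t : obj k m (-2),
      (dHom k m (-2) (-1)).hom t = (obj k m (-1)).ρ g (s h) - s (g * h) + s g := by
  refine exists_dHom_eq (by norm_num) _ ?_
  rw [← coe_dHom (show (-1 : ℤ) + 1 = 0 by norm_num), map_add, map_sub, Rep.hom_comm_apply, hs, hs,
    hs, map_sub, map_mul, Module.End.mul_apply]
  rw [show ∀ a b c : obj k m 0, a - b - (a - c) + (b - c) = 0 from fun a b c => by abel, map_zero]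

/-- The cocycle dual to the generator in degree `1` of a factor is the projection. -/
theorem augmentation_apply_one (i : Fin r) (f : Cocycle (complex k m) (complex k m) 1)
    (hf : (Submodule.Quotient.mk f : H k (complex k m) (complex k m) 1) =
      basis k m i.pos 1 (coordGen k m i 1 zero_le_one)) {g : ProdCyclic m} {s : obj k m (-1)}
    (hs : (dHom k m (-1) 0).hom s = (obj k m 0).ρ g (one k m) - one k m) :
    (augmentation k m).hom ((toHom (f : Cochain (complex k m) (complex k m) 1) (-1) 0
      (neg_add_cancel 1)).hom s) = proj k i g := by
  have hm := IsCharPowers.two_le k m i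
  rw [augmentation_eq_apply i.pos i zero_le_one f hf, apply_set_one_eq hs i (by omega), zero_add,
    Nat.choose_one_right]
  rfl

/-- The cocycle dual to the generator in degree `2` of a factor is the carry. -/
theorem augmentation_apply_two (i : Fin r) (f : Cocycle (complex k m) (complex k m) 2)
    (hf : (Submodule.Quotient.mk f : H k (complex k m) (complex k m) 2) =
      basis k m i.pos 2 (coordGen k m i 2 zero_le_two)) {s : ProdCyclic m → obj k m (-1)}
    (hs : ∀ g, (dHom k m (-1) 0).hom (s g) = (obj k m 0).ρ g (one k m) - one k m)
    (hs' : ∀ g, coe k m (-1) (s g) ((bot r).set i 1 (m i - 1)) = 0) {g h : ProdCyclic m}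
    {t : obj k m (-2)}
    (ht : (dHom k m (-2) (-1)).hom t = (obj k m (-1)).ρ g (s h) - s (g * h) + s g) :
    (augmentation k m).hom ((toHom (f : Cochain (complex k m) (complex k m) 2) (-2) 0
      (neg_add_cancel 2)).hom t) = carry k i g h := by
  have hm := IsCharPowers.two_le k m i
  have := IsCharPowers.neZero k m
  have hlt : ∀ g : ProdCyclic m, coord i g < m i := fun g => ZMod.val_lt _
  have h1 := d_apply_bot_set (IsCharPowers.two_le k m) i (x := 2) (c := 0) two_ne_zero
    (c' := m i - 1) (by simp [dExp]) (by omega) (coe k m (-2) t)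
  rw [augmentation_eq_apply i.pos i zero_le_two f hf, ← h1,
    ← coe_dHom (show (-2 : ℤ) + 1 = -1 by norm_num), ht, map_add, map_sub, coe_ρ,
    Finsupp.add_apply, Finsupp.sub_apply, show (2 : ℤ) - 1 = 1 by norm_num, hs', hs', sub_zero,
    add_zero, action_apply_bot_set i 1 (m i - 1) (by omega)]
  -- In the last case the coefficient is zero by normalisation and the binomial coefficient is zero
  -- because the coordinate of `h` is less than `m i`.
  have h2 : ∀ c, c < m i → coe k m (-1) (s h) ((bot r).set i 1 c) =
      ((coord i h).choose (c + 1) : k) := by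
    intro c hc
    rcases (show c + 1 < m i ∨ c = m i - 1 by omega) with h3 | rfl
    · exact apply_set_one_eq (hs h) i h3
    · rw [hs', Nat.choose_eq_zero_of_lt (by have := hlt h; omega), Nat.cast_zero]
  refine Eq.trans ?_ (IsCharPowers.choose_add_eq k m i (hlt g) (hlt h))
  -- Vandermonde's identity; the extra term with index `m i` vanishes because the coordinate of `g`
  -- is less than `m i`.
  rw [Nat.add_choose_eq, Finset.Nat.sum_antidiagonal_eq_sum_range_succ
    (fun a b => (coord i g).choose a * (coord i h).choose b), Finset.sum_range_succ _ (m i),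
    Nat.choose_eq_zero_of_lt (hlt g), zero_mul, add_zero, Nat.sub_add_cancel (by omega),
    Nat.cast_sum]
  refine Finset.sum_congr rfl fun j hj => ?_
  rw [Finset.mem_range] at hj
  rw [h2 _ (by omega), Nat.cast_mul, show m i - 1 - j + 1 = m i - j by omega]

/-- Transport of cocycles to an arbitrary complete resolution. -/
theorem exists_transport (hr : 0 < r) (P : CompleteResolution k (ProdCyclic m)) :
    ∃ (E : HEquiv k P.complex (complex k m)) (β : complex k m ⟶ P.complex),
      (∀ x : obj k m 0, P.ε.hom ((β.f 0).hom x) = (augmentation k m).hom x) ∧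
      ∀ {n : ℤ} (f : Cocycle (complex k m) (complex k m) n), ∃ f' : Cocycle P.complex P.complex n,
        (Submodule.Quotient.mk f' : H k P.complex P.complex n) =
          E.conj n (Submodule.Quotient.mk f) ∧
        ∀ x : obj k m (-n), P.ε.hom (((f' : Cochain P.complex P.complex n).v (-n) 0
          (neg_add_cancel n)).hom ((β.f (-n)).hom x)) = (augmentation k m).hom
            ((toHom (f : Cochain (complex k m) (complex k m) n) (-n) 0 (neg_add_cancel n)).hom x) := by
  have := finite_prodCyclic k m
  obtain ⟨α, β, E, hα, hβ, -, hε⟩ := CompleteResolution.exists_hEquiv P (resolution k m)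
  change Cocycle P.complex (complex k m) 0 at α
  change Cocycle (complex k m) P.complex 0 at β
  change HEquiv k P.complex (complex k m) at E
  refine ⟨E, β.homOf, fun x => congrArg (fun f => f.hom x) hε, fun {n} f => ?_⟩
  refine ⟨cocycleProd k (zero_add n) β (cocycleProd k (add_zero n) f α), ?_, fun x => ?_⟩
  · rw [HEquiv.conj_apply, hα, hβ]
    rfl
  -- Evaluating `β f α` after `β` amounts to evaluating `f α β`. This has the class of `f`, and
  -- cohomologous cocycles agree under the augmentation by minimality.
  · let z : Cocycle (complex k m) (complex k m) n :=
      cocycleProd k (add_zero n) f (cocycleProd k (add_zero 0) α β)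
    have hz : (Submodule.Quotient.mk z : H k (complex k m) (complex k m) n) =
        Submodule.Quotient.mk f := by
      have h1 : cohProd k (add_zero 0) (Submodule.Quotient.mk α : H k P.complex (complex k m) 0)
          (Submodule.Quotient.mk β) = Submodule.Quotient.mk (Cocycle.ofHom (𝟙 (complex k m))) := by
        have h2 := E.ab
        rwa [hα, hβ] at h2
      have h3 := cohProd_id (k := k) (Submodule.Quotient.mk f : H k (complex k m) (complex k m) n)
      rw [← h1] at h3
      exact h3
    have hzf : toHom (z : Cochain (complex k m) (complex k m) n) (-n) 0 (neg_add_cancel n) ≫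
        augmentation k m = toHom (f : Cochain (complex k m) (complex k m) n) (-n) 0
          (neg_add_cancel n) ≫ augmentation k m :=
      obj_hom_ext fun b hb hn h0 =>
        congrArg (coeff hr (⟨b, hb, hn, h0⟩ : Gen m n)) hz
    have h4 : toHom (z : Cochain (complex k m) (complex k m) n) (-n) 0 (neg_add_cancel n) =
        (β : Cochain (complex k m) P.complex 0).v (-n) (-n) (add_zero _) ≫
          (α : Cochain P.complex (complex k m) 0).v (-n) (-n) (add_zero _) ≫
          (f : Cochain (complex k m) (complex k m) n).v (-n) 0 (neg_add_cancel n) := by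
      rw [toHom, coe_cocycleProd, coe_cocycleProd, prod_apply, prod_apply,
        Cochain.comp_v _ _ _ (-n) (-n) 0 (by omega) (by omega),
        Cochain.comp_v _ _ _ (-n) (-n) (-n) (by omega) (by omega), Category.assoc]
    have h5 : (cocycleProd k (zero_add n) β (cocycleProd k (add_zero n) f α) :
        Cochain P.complex P.complex n).v (-n) 0 (neg_add_cancel n) =
        ((α : Cochain P.complex (complex k m) 0).v (-n) (-n) (add_zero _) ≫
          (f : Cochain (complex k m) (complex k m) n).v (-n) 0 (neg_add_cancel n)) ≫
          (β : Cochain (complex k m) P.complex 0).v 0 0 (add_zero _) := by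
      rw [coe_cocycleProd, coe_cocycleProd, prod_apply, prod_apply,
        Cochain.comp_v _ _ _ (-n) 0 0 (by omega) (by omega),
        Cochain.comp_v _ _ _ (-n) (-n) 0 (by omega) (by omega)]
    rw [h5]
    refine Eq.trans ?_ (congrArg (fun f => f.hom x) hzf)
    rw [h4]
    exact congrArg (fun g => g.hom (((α : Cochain P.complex (complex k m) 0).v (-n) (-n)
      (add_zero _) ≫ (f : Cochain (complex k m) (complex k m) n).v (-n) 0
      (neg_add_cancel n)).hom (((β : Cochain (complex k m) P.complex 0).v (-n) (-n)
      (add_zero _)).hom x))) hε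

end TateSpan

open ProdCyclic

/-! ### The classes of the factors in an arbitrary resolution, and the theorem -/

namespace TateSpan

open TateMonomial HomCohomology

variable {k : Type u} [Field k] {r : ℕ} {m : Fin r → ℕ} [IsCharPowers k m]

/-- In every complete resolution, the classes of the factors in degrees `1` and `2` correspond to
basis elements of the cohomology of the explicit complete resolution. -/
theorem exists_represents (P : CompleteResolution k (ProdCyclic m)) (i : Fin r) :
    ∃ E : HEquiv k P.complex (complex k m),
      P.RepresentsOne (E.conj 1 (basis k m i.pos 1 (coordGen k m i 1 zero_le_one))) (proj k i) ∧
      P.RepresentsTwo (E.conj 2 (basis k m i.pos 2 (coordGen k m i 2 zero_le_two))) (carry k i) := by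
  obtain ⟨E, β, hβ, hf⟩ := exists_transport i.pos P
  have hone : P.ε.hom ((β.f 0).hom (one k m)) = (1 : k) := (hβ _).trans augmentation_one
  have hd : ∀ p q (x : obj k m p), (P.complex.d p q).hom ((β.f p).hom x) =
      (β.f q).hom ((dHom k m p q).hom x) := fun p q x =>
    congrArg (fun f => f.hom x) (β.comm p q)
  have hρ : ∀ (n : ℤ) (g : ProdCyclic m) (x : obj k m n), (β.f n).hom ((obj k m n).ρ g x) =
      (P.complex.X n).ρ g ((β.f n).hom x) := fun n g x => Rep.hom_comm_apply (β.f n) g x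
  have hsub : ∀ (n : ℤ) (x y : obj k m n), (β.f n).hom (x - y) = (β.f n).hom x - (β.f n).hom y :=
    fun n x y => map_sub (β.f n).hom.toLinearMap x y
  have hadd : ∀ (n : ℤ) (x y : obj k m n), (β.f n).hom (x + y) = (β.f n).hom x + (β.f n).hom y :=
    fun n x y => map_add (β.f n).hom.toLinearMap x y
  choose s hs hs' using exists_dHom_eq_sub_one' (k := k) (m := m) i
  have hds : ∀ g, (P.complex.d (-1) 0).hom ((β.f (-1)).hom (s g)) =
      (P.complex.X 0).ρ g ((β.f 0).hom (one k m)) - (β.f 0).hom (one k m) := fun g => by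
    rw [hd, hs, hsub, hρ]
  refine ⟨E, ?_, ?_⟩
  · obtain ⟨f, hfb⟩ := Submodule.Quotient.mk_surjective _
      (basis k m i.pos 1 (coordGen k m i 1 zero_le_one))
    obtain ⟨f', hf', hff'⟩ := hf f
    refine ⟨f', by rw [hf', hfb], (β.f 0).hom (one k m), fun g => (β.f (-1)).hom (s g), hone, hds,
      fun g => ?_⟩
    exact (hff' (s g)).trans (augmentation_apply_one i f hfb (hs g))
  · obtain ⟨f, hfb⟩ := Submodule.Quotient.mk_surjective _
      (basis k m i.pos 2 (coordGen k m i 2 zero_le_two))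
    obtain ⟨f', hf', hff'⟩ := hf f
    choose t ht using exists_dHom_eq_coboundary s hs
    refine ⟨f', by rw [hf', hfb], (β.f 0).hom (one k m), fun g => (β.f (-1)).hom (s g),
      fun g h => (β.f (-2)).hom (t g h), hone, hds, fun g h => ?_, fun g h => ?_⟩
    · rw [hd, ht, hadd, hsub, hρ]
    · exact (hff' (t g h)).trans (augmentation_apply_two i f hfb hs hs' (ht g h))

/-- The realisation needs a finite-dimensional term in degree zero, which an arbitrary `P` need not
have. Triviality is therefore transferred to the explicit resolution, and the summand back to `P`.
-/
theorem isSummandOfRealisable_of_canonicalClass_eq_zero (P : CompleteResolution k (ProdCyclic m))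
    (s : Choice k P.complex) (hs : s.canonicalClass = 0) (X : GradedMod P.tateAlg) :
    P.IsSummandOfRealisable X := by
  have := finite_prodCyclic k m
  obtain ⟨s', hs'⟩ := s.exists_trivial hs
  obtain ⟨-, -, E, -⟩ := CompleteResolution.exists_hEquiv P (resolution k m)
  obtain ⟨t⟩ := Choice.nonempty k (resolution k m).complex
  obtain ⟨t', ht'⟩ := t.exists_trivial (Choice.canonicalClass_eq_zero_of_trivial E.symm t s' hs')
  exact P.isSummandOfRealisable (resolution k m) t' ht' X

end TateSpan

theorem theorem3p1 {k : Type u} [Field k] (p : ℕ) (hp : p.Prime) [CharP k p]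
    (r : ℕ) (e : Fin r → ℕ) (he : ∀ i, 1 ≤ e i) :
    Nonempty (CompleteResolution k (ProdCyclic fun i => p ^ e i)) ∧
    ∀ P : CompleteResolution k (ProdCyclic fun i => p ^ e i),
      ((r = 1 ∨ 3 ≤ r) → (∀ i, p ^ e i ≠ 3) →
        (∀ s : HomCohomology.Choice k P.complex, s.canonicalClass = 0) ∧
        ∀ X : GradedMod P.tateAlg, P.IsSummandOfRealisable X) ∧
      ((r = 2 ∨ ∃ i, p ^ e i = 3) →
        (∀ s : HomCohomology.Choice k P.complex, s.canonicalClass ≠ 0) ∧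
        ∃ X : GradedMod P.tateAlg, ¬ P.IsSummandOfRealisable X) ∧
      (r = 2 → ∀ i, ∃ v : P.tateAlg.carrier 2,
        P.RepresentsTwo v (ProdCyclic.carry k i) ∧
        ¬ P.IsSummandOfRealisable (GradedMod.cyclicQuotient P.tateAlg v)) ∧
      (∀ i, p ^ e i = 3 → ∃ u : P.tateAlg.carrier 1,
        P.RepresentsOne u (ProdCyclic.proj k i) ∧
        ¬ P.IsSummandOfRealisable (GradedMod.cyclicQuotient P.tateAlg u)) := by
  have : IsCharPowers k (fun i => p ^ e i) := ⟨p, hp, inferInstance, fun i => ⟨e i, he i, rfl⟩⟩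
  have := TateSpan.finite_prodCyclic k fun i => p ^ e i
  refine ⟨⟨TateSpan.resolution k _⟩, fun P => ?_⟩
  have h2 : r = 2 → ∀ i, ∃ v : P.tateAlg.carrier 2, P.RepresentsTwo v (ProdCyclic.carry k i) ∧
      ¬ P.IsSummandOfRealisable (GradedMod.cyclicQuotient P.tateAlg v) := by
    rintro rfl i
    obtain ⟨E, -, hv⟩ := TateSpan.exists_represents P i
    exact ⟨_, hv, fun ⟨M, hM⟩ => TateSpan.not_isDirectSummand_of_two E i hM⟩
  have h3 : ∀ i, p ^ e i = 3 → ∃ u : P.tateAlg.carrier 1,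
      P.RepresentsOne u (ProdCyclic.proj k i) ∧
      ¬ P.IsSummandOfRealisable (GradedMod.cyclicQuotient P.tateAlg u) := by
    intro i hi
    obtain ⟨E, hu, -⟩ := TateSpan.exists_represents P i
    exact ⟨_, hu, fun ⟨M, hM⟩ => TateSpan.not_isDirectSummand_of_eq_three E i.pos i hi hM⟩
  refine ⟨fun hr hm => ?_, fun h => ?_, h2, h3⟩
  · obtain ⟨t, ht⟩ := TateSpan.exists_trivial_choice_of_ne (k := k) hr hm
    obtain ⟨-, -, E, -⟩ := CompleteResolution.exists_hEquiv P (TateSpan.resolution k _)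
    exact ⟨fun s => HomCohomology.Choice.canonicalClass_eq_zero_of_trivial E s t ht, fun X =>
      P.isSummandOfRealisable (TateSpan.resolution k _) t ht X⟩
  -- The canonical class is not computed: if it vanished, every module would be a summand of a
  -- realisable one, contrary to the quotient modules just obtained.
  · have hX : ∃ X : GradedMod P.tateAlg, ¬ P.IsSummandOfRealisable X := by
      rcases h with hr | ⟨i, hi⟩
      · obtain ⟨v, -, hv⟩ := h2 hr ⟨0, by omega⟩
        exact ⟨_, hv⟩
      · obtain ⟨u, -, hu⟩ := h3 i hi
        exact ⟨_, hu⟩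
    obtain ⟨X, hX⟩ := hX
    exact ⟨fun s hs => hX (TateSpan.isSummandOfRealisable_of_canonicalClass_eq_zero P s hs X),
      X, hX⟩
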